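/- **Local central limit theorem for lace-expansion recursions.** *Setting.* Let $d>4$ be an integer. For $n\ge 0$, $k\in[-\pi,\pi]^d$, $z>0$ let $f_n(k;z)$, $g_n(k;z)$, $e_n(k;z)$ be real-valued with $f_0=1$ and $$f_{n+1}(k;z)=\sum_{m=1}^{n+1}g_m(k;z)f_{n+1-m}(k;z)+e_{n+1}(k;z)\qquad(n\ge0).$$ For a function $D$ on $\mathbb Z^d$ put $\hat D(k)=\sum_x D(x)e^{ik\cdot x}$, $a(k)=1-\hat D(k)$, $\sigma^2=-\nabla^2\hat D(0)$; for $L\ge1$ put $\beta=L^{-d}$. Write $k^2=\sum_ik_i^2$ and $\|h\|_1=(2\pi)^{-d}\int_{[-\pi,\pi]^d}|h(k)|\,dk$. Fix $\delta,\gamma,\rho>0$ with $$0<\tfrac{d-4}2-\rho<\gamma<\gamma+\delta<1\wedge\tfrac{d-4}2,$$ and constants $\varepsilon>\delta$, $C$, $c_1,c_2,\eta>0$, $\alpha\in(0,1)$, and functions $C_e(K),C_g(K),L_1(K)$ of $K>1$. Assume: (S) For $n\ge1$, $z>0$, the functions $f_n,g_n,e_n$ of $k$ are invariant under $k_i\mapsto-k_i$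 and under permutations of the coordinates; $f_n(\cdot;z)$ is measurable and its second partial derivatives $\partial^2_{k_i}$ exist at $k=0$. For each $n$, $|f_n(k;z)|$ is bounded uniformly in $k$ and in $z$ in a neighbourhood of $1$ (which may depend on $n$). (D) $D\ge0$, $f_1(k;z)=z\hat D(k)$, $e_1=0$, $\sum_xD(x)=1$, $\sum_x|x|^{2+2\varepsilon}D(x)<\infty$, $\|D\|_\infty\le CL^{-d}$, $\sigma^2\le CL^2$; and for $k\in[-\pi,\pi]^d$: $c_1L^2k^2\le a(k)\le c_2L^2k^2$ if $\|k\|_\infty\le L^{-1}$, $a(k)>\eta$ if $\|k\|_\infty\ge L^{-1}$, and $a(k)<2-\eta$. (E), (G) Let $K>1$ with $L\ge L_1(K)$, let $I\subset[1-\alpha,1+\alpha]$ be an interval of positive length, let $n\ge0$, and suppose that for all $z\in I$ and $1\le m\le n$ $$\|\hat D^2f_m(\cdot;z)\|_1\le K\beta m^{-d/2},\quad |f_m(0;z)|\le K,\quad|\nabla^2f_m(0;z)|\le K\sigma^2m .$$ Then for all $z\in I$, $k\in[-\pi,\pi]^d$, $2\le m\le n+1$ and $\varepsilon'\in[0,\varepsilon]$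 (the derivatives that occur existing): * $|e_m(k;z)|\le C_e(K)\beta m^{-d/2}$, $\ |e_m(k;z)-e_m(0;z)|\le C_e(K)a(k)\beta m^{-(d-2)/2}$; * $|g_m(k;z)|\le C_g(K)\beta m^{-d/2}$, $\ |\nabla^2g_m(0;z)|\le C_g(K)\sigma^2\beta m^{-(d-2)/2}$, $\ |\partial_zg_m(0;z)|\le C_g(K)\beta m^{-(d-2)/2}$; * $|g_m(k;z)-g_m(0;z)-a(k)\sigma^{-2}\nabla^2g_m(0;z)|\le C_g(K)\beta a(k)^{1+\varepsilon'}m^{-(d-2-2\varepsilon')/2}$. *Conclusion.* There are $L_0\ge1$ and $c>0$, depending only on $d$, the exponents, constants and functions fixed above, such that for every $L\ge L_0$ and all $D,f,g,e$ as above there are $z_c,A,v>0$ with the following properties. First, $z_c=\lim_n z_n$, where $z_0=z_1=1$ and $z_{n+1}=1-\sum_{m=2}^{n+1}g_m(0;z_n)$, and, all series converging absolutely, $$1=\sum_{m\ge1}g_m(0;z_c),\qquad A=\frac{1+\sum_{m\ge1}e_m(0;z_c)}{\sum_{m\ge1}m\,g_m(0;z_c)},\qquad v=-\frac{\sum_{m\ge1}\nabla^2g_m(0;z_c)}{\sigma^2\sum_{m\ge1}m\,g_m(0;z_c)}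 .$$ Next let $p_n(x;z)=\int_{[-\pi,\pi]^d}e^{-ik\cdot x}f_n(k;z)\frac{dk}{(2\pi)^d}$, let $C_R(x)=\{y\in\mathbb Z^d:\|x-y\|_\infty\le R\}$, and let $\lfloor x\rfloor$ be a lattice point closest to $x\in\mathbb R^d$ (ties broken arbitrarily). (i) Let $R_n\to\infty$ with $R_n=o(n^{1/2})$, and let $x=x_n\in\mathbb R^d$ satisfy $x_n^2\le c\log R_n$ for all large $n$ and $R_n|x_n|=o(n^{1/2})$ (every fixed $x\in\mathbb R^d$ is allowed). Then, as $n\to\infty$, $$\frac1{(2R_n+1)^d}\sum_{y\in C_{R_n}(\lfloor x_n\sqrt{v\sigma^2n}\rfloor)}p_n(y;z_c)\;\sim\;A\Big(\frac d{2\pi nv\sigma^2}\Big)^{d/2}e^{-dx_n^2/2}.$$ (ii) For all $\kappa\in(0,1)$ with $\kappa<d-4-2\rho$ and all $\gamma^-\in(0,\gamma)$, the left side for radius $R$ and point $x$ equals $$A\Big(\frac d{2\pi nv\sigma^2}\Big)^{d/2}\Big[e^{-dx^2/2}+O(R^{-\kappa})+O(n^{-\gamma^-})+O(n^{-\delta})+O(R^2n^{-1})\Big]$$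 uniformly in $n\ge1$, real $R\ge1$ and $x\in\mathbb R^d$, where the constants in the error terms may depend on everything else (in particular on $L$). -/

import Mathlib

open Filter Topology MeasureTheory Asymptotics

namespace LaceLCLT

noncomputable section

/-- The cube `[-π, π]^d` of dual variables `k`. -/
def dualCube (d : ℕ) : Set (Fin d → ℝ) :=
  Set.Icc (fun _ => -Real.pi) (fun _ => Real.pi)

/-- `x² = ∑ xᵢ²`, the squared Euclidean norm (Mathlib's norm on `Fin d → ℝ` is the sup norm). -/
def sqNorm {d : ℕ} (x : Fin d → ℝ) : ℝ := ∑ i, x i ^ 2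

/-- A lattice point as a point of `ℝ^d`. -/
def toReal {d : ℕ} (x : Fin d → ℤ) : Fin d → ℝ := fun i => (x i : ℝ)

/-- `k · x`. -/
def dot {d : ℕ} (k : Fin d → ℝ) (x : Fin d → ℤ) : ℝ := ∑ i, k i * (x i : ℝ)

/-- The Fourier transform `∑ₓ h(x) e^{i k·x}` of a function on `ℤ^d`. -/
def fourier {d : ℕ} (h : (Fin d → ℤ) → ℝ) (k : Fin d → ℝ) : ℂ :=
  ∑' x, (h x : ℂ) * Complex.exp (Complex.I * (dot k x : ℂ))

/-- The restriction of `h` to the `i`-th coordinate axis. -/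
def onAxis {d : ℕ} (h : (Fin d → ℝ) → ℝ) (i : Fin d) : ℝ → ℝ :=
  fun t => h (Pi.single i t)

/-- The second partial derivatives `∂²h/∂kᵢ²` exist at the origin. -/
def HasSecondPartials {d : ℕ} (h : (Fin d → ℝ) → ℝ) : Prop :=
  ∀ i, (∀ᶠ t in 𝓝 (0 : ℝ), DifferentiableAt ℝ (onAxis h i) t) ∧
    DifferentiableAt ℝ (deriv (onAxis h i)) 0

/-- The Laplacian at the origin, `∇²h(0) = ∑ᵢ ∂²h/∂kᵢ² (0)`. -/
def lap0 {d : ℕ} (h : (Fin d → ℝ) → ℝ) : ℝ :=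
  ∑ i, deriv (deriv (onAxis h i)) 0

/-- `D̂(k)` as a real number; under the assumptions below `D̂` is real-valued on the dual cube. -/
def hatD {d : ℕ} (D : (Fin d → ℤ) → ℝ) (k : Fin d → ℝ) : ℝ := (fourier D k).re

/-- `a(k) = 1 - D̂(k)`. -/
def aFun {d : ℕ} (D : (Fin d → ℤ) → ℝ) (k : Fin d → ℝ) : ℝ := 1 - hatD D k

/-- `σ² = -∇² D̂(0)`. -/
def sigmaSq {d : ℕ} (D : (Fin d → ℤ) → ℝ) : ℝ := -lap0 (hatD D)

/-- `β = L^{-d}`. -/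
def beta (d : ℕ) (L : ℝ) : ℝ := (L ^ d)⁻¹

/-- Normalised Lebesgue measure `(2π)^{-d} dk` on the dual cube. -/
def dualMeasure (d : ℕ) : Measure (Fin d → ℝ) :=
  ENNReal.ofReal (((2 * Real.pi) ^ d)⁻¹) • volume.restrict (dualCube d)

/-- Invariance on the dual cube under sign changes and permutations of the coordinates. -/
def LatticeSymmetric {d : ℕ} (h : (Fin d → ℝ) → ℝ) : Prop :=
  (∀ k ∈ dualCube d, ∀ i, h (Function.update k i (-k i)) = h k) ∧
  (∀ k ∈ dualCube d, ∀ τ : Equiv.Perm (Fin d), h (fun i => k (τ i)) = h k)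

/-- The recursion relation, with `f₀ = 1`.  `f n k z` stands for `fₙ(k;z)`; only the values at
`k` in the dual cube and `z > 0` matter, and `g 0`, `e 0` play no role. -/
structure Recursion (d : ℕ) (f g e : ℕ → (Fin d → ℝ) → ℝ → ℝ) : Prop where
  zero : ∀ k ∈ dualCube d, ∀ z : ℝ, 0 < z → f 0 k z = 1
  succ : ∀ n : ℕ, ∀ k ∈ dualCube d, ∀ z : ℝ, 0 < z →
    f (n + 1) k z
      = ∑ m ∈ Finset.Icc 1 (n + 1), g m k z * f (n + 1 - m) k z + e (n + 1) k z

/-- Lattice symmetry and local boundedness, together with the regularity of `fₙ` without which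
`‖D̂² fₙ‖₁`, the inverse Fourier transform and `∇² fₙ(0;z)` make no sense. -/
structure AssumptionS (d : ℕ) (f g e : ℕ → (Fin d → ℝ) → ℝ → ℝ) : Prop where
  symm_f : ∀ n, 1 ≤ n → ∀ z : ℝ, 0 < z → LatticeSymmetric (fun k => f n k z)
  symm_g : ∀ n, 1 ≤ n → ∀ z : ℝ, 0 < z → LatticeSymmetric (fun k => g n k z)
  symm_e : ∀ n, 1 ≤ n → ∀ z : ℝ, 0 < z → LatticeSymmetric (fun k => e n k z)
  bdd : ∀ n, ∃ U ∈ 𝓝 (1 : ℝ), ∃ B : ℝ, ∀ z ∈ U, ∀ k ∈ dualCube d, |f n k z| ≤ B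
  meas : ∀ n, 1 ≤ n → ∀ z : ℝ, 0 < z →
    AEMeasurable (fun k => f n k z) (volume.restrict (dualCube d))
  diff : ∀ n, 1 ≤ n → ∀ z : ℝ, 0 < z → HasSecondPartials (fun k => f n k z)

/-- The assumption on the step distribution `D = D_L`, with exponent `ε` and with constants
`C, c₁, c₂, η`. -/
structure AssumptionD (d : ℕ) (ε C c₁ c₂ η L : ℝ) (D : (Fin d → ℤ) → ℝ)
    (f e : ℕ → (Fin d → ℝ) → ℝ → ℝ) : Prop where
  nonneg : ∀ x, 0 ≤ D x
  f_one : ∀ k ∈ dualCube d, ∀ z : ℝ, 0 < z → (f 1 k z : ℂ) = (z : ℂ) * fourier D k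
  e_one : ∀ k ∈ dualCube d, ∀ z : ℝ, 0 < z → e 1 k z = 0
  normalised : HasSum D 1
  moment : Summable fun x : Fin d → ℤ => Real.sqrt (sqNorm (toReal x)) ^ (2 + 2 * ε) * D x
  sup_le : ∀ x, D x ≤ C * beta d L
  sigma_le : sigmaSq D ≤ C * L ^ 2
  a_lower : ∀ k ∈ dualCube d, ‖k‖ ≤ L⁻¹ → c₁ * L ^ 2 * sqNorm k ≤ aFun D k
  a_upper : ∀ k ∈ dualCube d, ‖k‖ ≤ L⁻¹ → aFun D k ≤ c₂ * L ^ 2 * sqNorm k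
  a_away : ∀ k ∈ dualCube d, L⁻¹ ≤ ‖k‖ → η < aFun D k
  a_lt : ∀ k ∈ dualCube d, aFun D k < 2 - η

/-- The bounds on `f_m(·;z)`, which may or may not hold:
`‖D̂² f_m‖₁ ≤ K β m^{-d/2}`, `|f_m(0)| ≤ K`, `|∇² f_m(0)| ≤ K σ² m`. -/
def FBounds (d : ℕ) (L : ℝ) (D : (Fin d → ℤ) → ℝ) (f : ℕ → (Fin d → ℝ) → ℝ → ℝ)
    (K : ℝ) (m : ℕ) (z : ℝ) : Prop :=
  eLpNorm (fun k => hatD D k ^ 2 * f m k z) 1 (dualMeasure d)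
      ≤ ENNReal.ofReal (K * beta d L * (m : ℝ) ^ (-(d : ℝ) / 2)) ∧
  |f m 0 z| ≤ K ∧
  |lap0 (fun k => f m k z)| ≤ K * sigmaSq D * m

/-- Bounds on `f_m` for `m ≤ n`, on an interval `[s,t] ⊆ [1-α,1+α]`, imply bounds on `e_m` for
`m ≤ n+1` on the same interval; this is required for `L ≥ L₁(K)`, with a constant `C_e(K)`. -/
def AssumptionE (d : ℕ) (α : ℝ) (Ce L₁ : ℝ → ℝ) (L : ℝ) (D : (Fin d → ℤ) → ℝ)
    (f e : ℕ → (Fin d → ℝ) → ℝ → ℝ) : Prop :=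
  ∀ K : ℝ, 1 < K → L₁ K ≤ L → ∀ s t : ℝ, s < t → Set.Icc s t ⊆ Set.Icc (1 - α) (1 + α) →
    ∀ n : ℕ, (∀ z ∈ Set.Icc s t, ∀ m, 1 ≤ m → m ≤ n → FBounds d L D f K m z) →
    ∀ z ∈ Set.Icc s t, ∀ k ∈ dualCube d, ∀ m : ℕ, 2 ≤ m → m ≤ n + 1 →
      |e m k z| ≤ Ce K * beta d L * (m : ℝ) ^ (-(d : ℝ) / 2) ∧
      |e m k z - e m 0 z| ≤ Ce K * aFun D k * beta d L * (m : ℝ) ^ (-((d : ℝ) - 2) / 2)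

/-- Bounds on `f_m` for `m ≤ n`, on an interval `[s,t] ⊆ [1-α,1+α]`, imply bounds on `g_m` for
`m ≤ n+1` on the same interval (including the existence of the derivatives that are bounded);
this is required for `L ≥ L₁(K)`, with a constant `C_g(K)`. -/
def AssumptionG (d : ℕ) (ε α : ℝ) (Cg L₁ : ℝ → ℝ) (L : ℝ) (D : (Fin d → ℤ) → ℝ)
    (f g : ℕ → (Fin d → ℝ) → ℝ → ℝ) : Prop :=
  ∀ K : ℝ, 1 < K → L₁ K ≤ L → ∀ s t : ℝ, s < t → Set.Icc s t ⊆ Set.Icc (1 - α) (1 + α) →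
    ∀ n : ℕ, (∀ z ∈ Set.Icc s t, ∀ m, 1 ≤ m → m ≤ n → FBounds d L D f K m z) →
    ∀ z ∈ Set.Icc s t, ∀ m : ℕ, 2 ≤ m → m ≤ n + 1 →
      (∀ k ∈ dualCube d, |g m k z| ≤ Cg K * beta d L * (m : ℝ) ^ (-(d : ℝ) / 2)) ∧
      HasSecondPartials (fun k => g m k z) ∧
      |lap0 (fun k => g m k z)|
        ≤ Cg K * sigmaSq D * beta d L * (m : ℝ) ^ (-((d : ℝ) - 2) / 2) ∧
      DifferentiableAt ℝ (fun w => g m 0 w) z ∧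
      |deriv (fun w => g m 0 w) z| ≤ Cg K * beta d L * (m : ℝ) ^ (-((d : ℝ) - 2) / 2) ∧
      (∀ k ∈ dualCube d, ∀ ε' ∈ Set.Icc 0 ε,
        |g m k z - g m 0 z - aFun D k * (sigmaSq D)⁻¹ * lap0 (fun q => g m q z)|
          ≤ Cg K * beta d L * aFun D k ^ (1 + ε')
              * (m : ℝ) ^ (-((d : ℝ) - 2 - 2 * ε') / 2))

/-- `z₀ = z₁ = 1` and `z_{n+1} = 1 - ∑_{m=2}^{n+1} g_m(0;z_n)`. -/
def zSeq {d : ℕ} (g : ℕ → (Fin d → ℝ) → ℝ → ℝ) : ℕ → ℝ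
  | 0 => 1
  | n + 1 => 1 - ∑ m ∈ Finset.Icc 2 (n + 1), g m 0 (zSeq g n)

/-- The critical value `z_c = lim z_n`, which solves `∑_{m≥1} g_m(0;z_c) = 1`, and the amplitude
`A` and the diffusion parameter `v`, given by
`A = (1 + ∑ e_m(0;z_c)) / ∑ m g_m(0;z_c)` and
`v = -∑ ∇² g_m(0;z_c) / (σ² ∑ m g_m(0;z_c))`.  The sums over `m ≥ 1` are indexed by `m = j+1`. -/
structure IsCritical {d : ℕ} (D : (Fin d → ℤ) → ℝ) (g e : ℕ → (Fin d → ℝ) → ℝ → ℝ)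
    (zc A v : ℝ) : Prop where
  zc_pos : 0 < zc
  A_pos : 0 < A
  v_pos : 0 < v
  limit : Tendsto (zSeq g) atTop (𝓝 zc)
  sum_g : HasSum (fun j : ℕ => g (j + 1) 0 zc) 1
  summable_mg : Summable fun j : ℕ => ((j : ℝ) + 1) * g (j + 1) 0 zc
  summable_e : Summable fun j : ℕ => e (j + 1) 0 zc
  summable_lap : Summable fun j : ℕ => lap0 (fun k => g (j + 1) k zc)
  A_eq : A = (1 + ∑' j : ℕ, e (j + 1) 0 zc) / ∑' j : ℕ, ((j : ℝ) + 1) * g (j + 1) 0 zc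
  v_eq : v = -(∑' j : ℕ, lap0 (fun k => g (j + 1) k zc))
    / (sigmaSq D * ∑' j : ℕ, ((j : ℝ) + 1) * g (j + 1) 0 zc)

/-- `p_n(x;z) = ∫_{[-π,π]^d} e^{-i k·x} f_n(k;z) dk / (2π)^d`. -/
def pn {d : ℕ} (f : ℕ → (Fin d → ℝ) → ℝ → ℝ) (n : ℕ) (x : Fin d → ℤ) (z : ℝ) : ℂ :=
  ∫ k, Complex.exp (-(Complex.I * (dot k x : ℂ))) * (f n k z : ℂ) ∂(dualMeasure d)

/-- The cube `C_R(x) = {y ∈ ℤ^d : ‖x - y‖_∞ ≤ R}`. -/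
def latticeCube {d : ℕ} (x : Fin d → ℤ) (R : ℝ) : Set (Fin d → ℤ) :=
  {y | ‖toReal x - toReal y‖ ≤ R}

/-- The cube `C_R(x)` is finite, so that the sum below is a genuine finite sum. -/
theorem latticeCube_finite {d : ℕ} (x : Fin d → ℤ) (R : ℝ) : (latticeCube x R).Finite := by
  refine (Set.finite_Icc (fun i => x i - ⌈R⌉) (fun i => x i + ⌈R⌉)).subset fun y hy => ?_
  have key : ∀ i, |x i - y i| ≤ ⌈R⌉ := by
    intro i
    have h1 : |(x i : ℝ) - y i| ≤ R := (norm_le_pi_norm (toReal x - toReal y) i).trans hy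
    have h2 : ((|x i - y i| : ℤ) : ℝ) ≤ (⌈R⌉ : ℝ) := by
      push_cast
      exact h1.trans (Int.le_ceil R)
    exact_mod_cast h2
  constructor <;> intro i <;> have := abs_le.mp (key i) <;> simp only <;> omega

/-- `(2R+1)^{-d} ∑_{y ∈ C_R(x)} p_n(y;z)`. -/
def cubeAverage {d : ℕ} (f : ℕ → (Fin d → ℝ) → ℝ → ℝ) (n : ℕ) (z R : ℝ)
    (x : Fin d → ℤ) : ℂ :=
  (((2 * R + 1) ^ d : ℝ) : ℂ)⁻¹ * ∑ y ∈ (latticeCube_finite x R).toFinset, pn f n y z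

/-- `y` is a closest lattice point to `x` in Euclidean distance (ties are broken arbitrarily). -/
def IsClosest {d : ℕ} (x : Fin d → ℝ) (y : Fin d → ℤ) : Prop :=
  ∀ w : Fin d → ℤ, sqNorm (x - toReal y) ≤ sqNorm (x - toReal w)

/-- The prefactor `A (d / (2π n v σ²))^{d/2}`. -/
def prefactor (d n : ℕ) (A v σsq : ℝ) : ℝ :=
  A * ((d : ℝ) / (2 * Real.pi * n * v * σsq)) ^ ((d : ℝ) / 2)

end

end LaceLCLT

/-! Fix k and write a = a(k). The recursion is a renewal equation whose kernel is a small
perturbation of a single step: g_1 = z(1 - a), and the g_m with m ≥ 2 have total mass O(β). At z_c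
the kernel at k = 0 has mass 1, and f_n should behave like (E/c) s^{-n}, where s solves ∑ g_m(k) s^m
= 1, E = 1 + ∑ e_m and c = ∑ m g_m at k = 0. The kernel is only known to decay like m^{-d/2}, so the
series need not converge for s > 1. It is therefore truncated at N ≈ 1/a. The truncated equation has
a root s ≈ 1 + va (`NearCritical.exists_root`, `CriticalBounds.abs_root_sub_le`). The tilted kernel
g_m s^m then satisfies a renewal theorem with rate n^{-δ} (`abs_resolvent_sub_le`), which is a
contraction argument because the perturbation is small. The discarded tail, in effect one long step,
costs a^{-2} n^{-d/2} (`exists_perturbation_bound`). This gives f_n = A e^{-nva} up to the errors in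
`NearCritical.exists_asymptotics`, and away from criticality the bounds `NearCritical.exists_bound`
and `NearCritical.exists_diff_bound`.

The bounds on g and e are conditional on bounds on f. The circle is broken by the order of choices:
`exists_fBounds_constant` gives a K that does not involve C_e and C_g and that is valid as soon as
the kernel is small, and then L is taken so large that C_e(K)β and C_g(K)β are small. An induction
on n, on shrinking intervals around z_n, propagates the bounds (`exists_critical_point`), and z_c is
the common point of the intervals. The L¹ bound tolerates the factor a^{-2} because |k|^{-4} is
integrable for d > 4. The Laplacian bound follows from |f_n(k) - f_n(0)| ≤ C n a(k) by taking limits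
of difference quotients.

It remains to invert the Fourier transform. Near 0, a(k) = σ²k²/(2d) up to a higher order term,
which produces the Gaussian. The long-step error |k|^{-4} n^{-d/2} integrates to the order n^{-d/2}
of the main term, so no pointwise limit follows. Averaging over a cube of radius R inserts a
Dirichlet kernel, which gains R^{-κ} against |k|^{-4} (`exists_integral_cubeKernel_bound`). What is
left is to compare the cube average of a Gaussian with its value at the centre. -/

namespace LaceLCLT

/-! ### Truncated renewal equations -/

/-- The power series `∑_{m=1}^N g_m x^m`. -/
noncomputable def truncSeries (g : ℕ → ℝ) (N : ℕ) : PowerSeries ℝ :=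
  PowerSeries.mk fun m => if m ∈ Finset.Icc 1 N then g m else 0

/-- The coefficients of `(1 - ∑_{m=1}^N g_m x^m)⁻¹`. -/
noncomputable def resolvent (g : ℕ → ℝ) (N n : ℕ) : ℝ :=
  PowerSeries.coeff n (1 - truncSeries g N)⁻¹

theorem constantCoeff_one_sub_truncSeries (g : ℕ → ℝ) (N : ℕ) :
    PowerSeries.constantCoeff (1 - truncSeries g N) = 1 := by
  rw [map_sub, map_one, ← PowerSeries.coeff_zero_eq_constantCoeff_apply, truncSeries,
    PowerSeries.coeff_mk]
  simp

theorem one_sub_truncSeries_mul_inv (g : ℕ → ℝ) (N : ℕ) :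
    (1 - truncSeries g N) * (1 - truncSeries g N)⁻¹ = 1 :=
  PowerSeries.mul_inv_cancel _ (by rw [constantCoeff_one_sub_truncSeries]; exact one_ne_zero)

theorem coeff_truncSeries_mul (g f : ℕ → ℝ) (N n : ℕ) :
    PowerSeries.coeff n (truncSeries g N * PowerSeries.mk f)
      = ∑ m ∈ Finset.Icc 1 (min n N), g m * f (n - m) := by
  rw [PowerSeries.coeff_mul, Finset.Nat.sum_antidiagonal_eq_sum_range_succ_mk]
  simp only [truncSeries, PowerSeries.coeff_mk, ite_mul, zero_mul]
  rw [← Finset.sum_filter]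
  refine Finset.sum_congr ?_ fun _ _ => rfl
  ext m
  simp only [Finset.mem_filter, Finset.mem_range, Finset.mem_Icc]
  omega

/-- The solution of a convolution recursion, through the resolvent of the truncated kernel. -/
theorem eq_sum_resolvent {g e f : ℕ → ℝ}
    (hf : ∀ n, f n = ∑ m ∈ Finset.Icc 1 n, g m * f (n - m) + e n) (N n : ℕ) :
    f n = ∑ j ∈ Finset.range (n + 1), resolvent g N (n - j)
      * (e j + ∑ m ∈ Finset.Icc (N + 1) j, g m * f (j - m)) := by
  -- Only the terms m ≤ N of the recursion are moved to the left; the terms m > N remain as an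
  -- additional source, which still involves f.
  have key : (1 - truncSeries g N) * PowerSeries.mk f
      = PowerSeries.mk fun j => e j + ∑ m ∈ Finset.Icc (N + 1) j, g m * f (j - m) := by
    ext j
    rw [sub_mul, one_mul, map_sub, coeff_truncSeries_mul, PowerSeries.coeff_mk,
      PowerSeries.coeff_mk]
    have hsplit : ∑ m ∈ Finset.Icc 1 j, g m * f (j - m)
        = ∑ m ∈ Finset.Icc 1 (min j N), g m * f (j - m)
          + ∑ m ∈ Finset.Icc (N + 1) j, g m * f (j - m) := by
      rw [← Finset.sum_union]
      · refine Finset.sum_congr ?_ fun _ _ => rfl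
        ext m
        simp only [Finset.mem_union, Finset.mem_Icc]
        omega
      · rw [Finset.disjoint_left]
        intro m
        simp only [Finset.mem_Icc]
        omega
    have := hf j
    rw [hsplit] at this
    linarith
  have h2 : PowerSeries.mk f = (1 - truncSeries g N)⁻¹
      * PowerSeries.mk fun j => e j + ∑ m ∈ Finset.Icc (N + 1) j, g m * f (j - m) := by
    rw [← key, ← mul_assoc, mul_comm (1 - truncSeries g N)⁻¹, one_sub_truncSeries_mul_inv, one_mul]
  have h3 := congrArg (PowerSeries.coeff n) h2
  rw [PowerSeries.coeff_mk, mul_comm, PowerSeries.coeff_mul,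
    Finset.Nat.sum_antidiagonal_eq_sum_range_succ_mk] at h3
  rw [h3]
  refine Finset.sum_congr rfl fun j _ => ?_
  rw [PowerSeries.coeff_mk, mul_comm]
  rfl

theorem resolvent_rec (g : ℕ → ℝ) (N n : ℕ) :
    resolvent g N n = ∑ m ∈ Finset.Icc 1 (min n N), g m * resolvent g N (n - m)
      + if n = 0 then 1 else 0 := by
  have h := congrArg (PowerSeries.coeff n) (one_sub_truncSeries_mul_inv g N)
  have h1 : (1 - truncSeries g N)⁻¹ = PowerSeries.mk (resolvent g N) := by
    ext j; simp [resolvent]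
  rw [sub_mul, one_mul, map_sub, PowerSeries.coeff_one] at h
  nth_rewrite 2 [h1] at h
  rw [coeff_truncSeries_mul] at h
  have : resolvent g N n = PowerSeries.coeff n (1 - truncSeries g N)⁻¹ := rfl
  linarith

/-- A subcritical kernel has a bounded resolvent. -/
theorem abs_resolvent_le_one {g : ℕ → ℝ} {N : ℕ} (h : ∑ m ∈ Finset.Icc 1 N, |g m| ≤ 1) (n : ℕ) :
    |resolvent g N n| ≤ 1 := by
  induction n using Nat.strong_induction_on with
  | _ n ih =>
    rw [resolvent_rec]
    rcases Nat.eq_zero_or_pos n with rfl | hn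
    · simp
    · rw [if_neg hn.ne', add_zero]
      refine (Finset.abs_sum_le_sum_abs _ _).trans (le_trans ?_ h)
      refine le_trans (Finset.sum_le_sum (g := fun m => |g m|) fun m hm => ?_)
        (Finset.sum_le_sum_of_subset_of_nonneg ?_ fun _ _ _ => abs_nonneg _)
      · rw [Finset.mem_Icc] at hm
        rw [abs_mul]
        exact mul_le_of_le_one_right (abs_nonneg _) (ih _ (by omega))
      · exact Finset.Icc_subset_Icc le_rfl (min_le_right _ _)

/-- The tails `∑_{m=j+1}^N g_m` of a truncated kernel. -/
noncomputable def kernelTail (g : ℕ → ℝ) (N j : ℕ) : ℝ := ∑ m ∈ Finset.Icc (j + 1) N, g m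

/-- For G(1) = 1 the polynomial 1 - G(x) is divisible by 1 - x, and the quotient is the generating
function of the tails. Multiplied by 1/(1 - G) it gives 1/(1 - x). -/
theorem sum_kernelTail_mul_resolvent {g : ℕ → ℝ} {N : ℕ}
    (h : ∑ m ∈ Finset.Icc 1 N, g m = 1) (n : ℕ) :
    ∑ j ∈ Finset.range (n + 1), kernelTail g N j * resolvent g N (n - j) = 1 := by
  have h1 : (1 - PowerSeries.X) * PowerSeries.mk (kernelTail g N) = 1 - truncSeries g N := by
    ext j
    rw [sub_mul, one_mul, map_sub, map_sub, PowerSeries.coeff_mk, PowerSeries.coeff_one]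
    rcases j with _ | j
    · simp [kernelTail, truncSeries, h]
    · rw [PowerSeries.coeff_succ_X_mul, PowerSeries.coeff_mk, truncSeries, PowerSeries.coeff_mk]
      simp only [kernelTail, Finset.mem_Icc]
      by_cases hj : j + 1 ≤ N
      · rw [← Finset.insert_Icc_add_one_left_eq_Icc hj, Finset.sum_insert (by simp)]
        simp [hj]
      · rw [Finset.Icc_eq_empty (by omega), Finset.Icc_eq_empty (by omega)]
        simp [hj]
  have h2 : PowerSeries.mk (kernelTail g N) * (1 - truncSeries g N)⁻¹
      = PowerSeries.mk fun _ => (1 : ℝ) := by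
    have h3 : (1 - PowerSeries.X) * (PowerSeries.mk (kernelTail g N) * (1 - truncSeries g N)⁻¹)
        = 1 := by
      rw [← mul_assoc, h1, one_sub_truncSeries_mul_inv]
    have h4 : (PowerSeries.mk fun _ => (1 : ℝ)) * (1 - PowerSeries.X) = 1 :=
      PowerSeries.mk_one_mul_one_sub_eq_one ℝ
    calc _ = ((PowerSeries.mk fun _ => (1 : ℝ)) * (1 - PowerSeries.X))
          * (PowerSeries.mk (kernelTail g N) * (1 - truncSeries g N)⁻¹) := by rw [h4, one_mul]
      _ = _ := by rw [mul_assoc, h3, mul_one]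
  have h3 := congrArg (PowerSeries.coeff n) h2
  rw [PowerSeries.coeff_mul, Finset.Nat.sum_antidiagonal_eq_sum_range_succ_mk,
    PowerSeries.coeff_mk] at h3
  rw [← h3]
  exact Finset.sum_congr rfl fun j _ => by rw [PowerSeries.coeff_mk]; rfl

theorem sum_Icc_add_one_rpow_le {δ : ℝ} (hδ : 0 ≤ δ) {m J : ℕ} :
    ∑ j ∈ (Finset.Icc 1 J).filter (fun j => j + 1 ≤ m), ((j : ℝ) + 1) ^ δ
      ≤ (m : ℝ) ^ (1 + δ) := by
  rcases Nat.eq_zero_or_pos m with rfl | hm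
  · simp; positivity
  have hm' : (0 : ℝ) < m := by exact_mod_cast hm
  calc _ ≤ ∑ j ∈ (Finset.Icc 1 J).filter (fun j => j + 1 ≤ m), (m : ℝ) ^ δ := by
        refine Finset.sum_le_sum fun j hj => ?_
        rw [Finset.mem_filter] at hj
        exact Real.rpow_le_rpow (by positivity) (by exact_mod_cast hj.2) hδ
    _ = (((Finset.Icc 1 J).filter (fun j => j + 1 ≤ m)).card : ℝ) * (m : ℝ) ^ δ := by
        rw [Finset.sum_const, nsmul_eq_mul]
    _ ≤ m * (m : ℝ) ^ δ := by
        refine mul_le_mul_of_nonneg_right ?_ (by positivity)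
        have : ((Finset.Icc 1 J).filter (fun j => j + 1 ≤ m)).card ≤ (Finset.Icc 1 m).card := by
          refine Finset.card_le_card fun j hj => ?_
          simp only [Finset.mem_filter, Finset.mem_Icc] at hj ⊢
          omega
        rw [Nat.card_Icc, Nat.add_sub_cancel] at this
        exact_mod_cast this
    _ = (m : ℝ) ^ (1 + δ) := by rw [Real.rpow_add hm', Real.rpow_one]

/-- Exchanging the two sums trades a tail for one extra power of m, whence the exponent 1 + δ in the
moment conditions on the kernel. -/
theorem sum_abs_kernelTail_le {g : ℕ → ℝ} {δ : ℝ} (hδ : 0 ≤ δ) (N J : ℕ) :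
    ∑ j ∈ Finset.Icc 1 J, |kernelTail g N j| * ((j : ℝ) + 1) ^ δ
      ≤ ∑ m ∈ Finset.Icc 2 N, |g m| * (m : ℝ) ^ (1 + δ) := by
  calc _ ≤ ∑ j ∈ Finset.Icc 1 J, ∑ m ∈ Finset.Icc (j + 1) N, |g m| * ((j : ℝ) + 1) ^ δ := by
        refine Finset.sum_le_sum fun j _ => ?_
        rw [← Finset.sum_mul]
        exact mul_le_mul_of_nonneg_right (Finset.abs_sum_le_sum_abs _ _) (by positivity)
    _ = ∑ m ∈ Finset.Icc 2 N, ∑ j ∈ (Finset.Icc 1 J).filter (fun j => j + 1 ≤ m),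
          |g m| * ((j : ℝ) + 1) ^ δ := by
        refine Finset.sum_comm' fun j m => ?_
        simp only [Finset.mem_filter, Finset.mem_Icc]
        omega
    _ ≤ _ := by
        refine Finset.sum_le_sum fun m _ => ?_
        rw [← Finset.mul_sum]
        exact mul_le_mul_of_nonneg_left (sum_Icc_add_one_rpow_le hδ) (abs_nonneg _)

theorem sum_nat_mul_eq_sum_kernelTail (g : ℕ → ℝ) (N : ℕ) :
    ∑ m ∈ Finset.Icc 1 N, (m : ℝ) * g m = ∑ j ∈ Finset.range N, kernelTail g N j := by
  simp only [kernelTail]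
  rw [Finset.sum_comm' (t' := Finset.Icc 1 N) (s' := fun m => Finset.range m)]
  · refine Finset.sum_congr rfl fun m _ => ?_
    rw [Finset.sum_const, Finset.card_range, nsmul_eq_mul]
  · intro j m
    simp only [Finset.mem_range, Finset.mem_Icc]
    omega

/-- Submultiplicativity of the weight (n + 1)^δ lets a weighted bound survive a convolution, which
closes the induction in the renewal theorem. -/
theorem succ_rpow_le_mul {δ : ℝ} (hδ : 0 ≤ δ) {j n : ℕ} (h : j ≤ n) :
    ((n : ℝ) + 1) ^ δ ≤ ((j : ℝ) + 1) ^ δ * (((n - j : ℕ) : ℝ) + 1) ^ δ := by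
  rw [← Real.mul_rpow (by positivity) (by positivity)]
  refine Real.rpow_le_rpow (by positivity) ?_ hδ
  rw [Nat.cast_sub h]
  have : (0 : ℝ) ≤ j * ((n : ℝ) - j) :=
    mul_nonneg (by positivity) (sub_nonneg.2 (by exact_mod_cast h))
  nlinarith

/-- The mean is the sum of all tails; the tail at 0 is the total mass 1, and the remaining ones add
up to at most 1/2. -/
theorem abs_sum_nat_mul_sub_one_le {g : ℕ → ℝ} {N : ℕ} {δ : ℝ} (hδ : 0 ≤ δ) (hN : 1 ≤ N)
    (h : ∑ m ∈ Finset.Icc 1 N, g m = 1)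
    (hg : ∑ m ∈ Finset.Icc 2 N, |g m| * (m : ℝ) ^ (1 + δ) ≤ 1 / 2) :
    |∑ m ∈ Finset.Icc 1 N, (m : ℝ) * g m - 1| ≤ 1 / 2 := by
  obtain ⟨M, rfl⟩ : ∃ M, N = M + 1 := ⟨N - 1, by omega⟩
  have h0 : kernelTail g (M + 1) 0 = 1 := by simpa [kernelTail] using h
  rw [sum_nat_mul_eq_sum_kernelTail, Finset.sum_range_succ', h0, add_sub_cancel_right]
  refine (Finset.abs_sum_le_sum_abs _ _).trans (le_trans ?_
    ((sum_abs_kernelTail_le hδ (M + 1) M).trans hg))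
  rw [← Finset.sum_image (g := fun j => j + 1)
    (f := fun j => |kernelTail g (M + 1) j|) (fun _ _ _ _ hh => by simpa using hh)]
  have himg : (Finset.range M).image (fun j => j + 1) = Finset.Icc 1 M := by
    ext j
    simp only [Finset.mem_image, Finset.mem_range, Finset.mem_Icc]
    exact ⟨by rintro ⟨i, hi, rfl⟩; omega, fun hj => ⟨j - 1, by omega, by omega⟩⟩
  rw [himg]
  refine Finset.sum_le_sum fun j _ => le_mul_of_one_le_right (abs_nonneg _) ?_
  exact Real.one_le_rpow (by linarith [j.cast_nonneg (α := ℝ)]) hδ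

/-- The renewal theorem with a polynomial rate for a small perturbation of the deterministic
kernel. -/
theorem abs_resolvent_sub_le {g : ℕ → ℝ} {N : ℕ} {δ : ℝ} (hδ : 0 ≤ δ) (hN : 1 ≤ N)
    (h : ∑ m ∈ Finset.Icc 1 N, g m = 1)
    (hg : ∑ m ∈ Finset.Icc 2 N, |g m| * (m : ℝ) ^ (1 + δ) ≤ 1 / 2) (n : ℕ) :
    |resolvent g N n - (∑ m ∈ Finset.Icc 1 N, (m : ℝ) * g m)⁻¹| ≤ ((n : ℝ) + 1) ^ (-δ) := by
  set c := ∑ m ∈ Finset.Icc 1 N, (m : ℝ) * g m with hc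
  have hc1 := abs_le.1 (abs_sum_nat_mul_sub_one_le hδ hN h hg)
  rw [← hc] at hc1
  have hc0 : 0 < c := by linarith [hc1.1]
  have hcinv : c⁻¹ ≤ 2 := by
    rw [inv_le_comm₀ hc0 two_pos]; linarith [hc1.1]
  set Q := kernelTail g N
  have hQ0 : Q 0 = 1 := by simpa [Q, kernelTail] using h
  suffices H : |resolvent g N n - c⁻¹| * ((n : ℝ) + 1) ^ δ ≤ 1 by
    rw [Real.rpow_neg (by positivity)]
    exact (le_div_iff₀ (by positivity)).2 H |>.trans_eq (one_div _)
  induction n using Nat.strong_induction_on with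
  | _ n ih =>
    have h1 := sum_kernelTail_mul_resolvent h n
    rw [Finset.range_eq_Ico, Finset.sum_eq_sum_Ico_succ_bot (by omega)] at h1
    -- The range is extended beyond N, where the tails vanish, so that n < N and n ≥ N need no
    -- separate treatment.
    have hQsum : c = Q 0 + ∑ j ∈ Finset.Ico 1 (n + 1), Q j
        + ∑ j ∈ Finset.Ico (n + 1) (n + 1 + N), Q j := by
      rw [hc, sum_nat_mul_eq_sum_kernelTail,
        ← Finset.sum_eq_sum_Ico_succ_bot (by omega : 0 < n + 1),
        Finset.sum_Ico_consecutive _ (by omega) (by omega), ← Finset.range_eq_Ico]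
      refine Finset.sum_subset (Finset.range_mono (by omega)) fun j _ hj => ?_
      rw [Finset.mem_range] at hj
      exact Finset.sum_eq_zero fun m hm => by rw [Finset.mem_Icc] at hm; omega
    -- Subtracting 1 = c⁻¹ ∑ Q j from ∑ Q j * V (n - j) = 1 isolates the deviation at n, because Q 0
    -- = 1: it is the unused tail mass minus a convolution of earlier deviations.
    have h2 : resolvent g N n - c⁻¹ = c⁻¹ * ∑ j ∈ Finset.Ico (n + 1) (n + 1 + N), Q j
        - ∑ j ∈ Finset.Ico 1 (n + 1), Q j * (resolvent g N (n - j) - c⁻¹) := by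
      have h3 : ∑ j ∈ Finset.Ico 1 (n + 1), Q j * (resolvent g N (n - j) - c⁻¹)
          = ∑ j ∈ Finset.Ico 1 (n + 1), Q j * resolvent g N (n - j)
            - c⁻¹ * ∑ j ∈ Finset.Ico 1 (n + 1), Q j := by
        rw [Finset.mul_sum, ← Finset.sum_sub_distrib]
        exact Finset.sum_congr rfl fun j _ => by ring
      have h4 : ∑ j ∈ Finset.Ico (n + 1) (n + 1 + N), Q j
          = c - 1 - ∑ j ∈ Finset.Ico 1 (n + 1), Q j := by rw [hQsum, hQ0]; ring
      have h5 : kernelTail g N 0 * resolvent g N (n - 0) = resolvent g N n := by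
        rw [show kernelTail g N 0 = 1 from hQ0, one_mul, Nat.sub_zero]
      rw [h5, zero_add] at h1
      have h6 : c⁻¹ * c = 1 := inv_mul_cancel₀ hc0.ne'
      rw [h3, h4]
      linear_combination h1 - h6
    have hb1 : |c⁻¹ * ∑ j ∈ Finset.Ico (n + 1) (n + 1 + N), Q j| * ((n : ℝ) + 1) ^ δ
        ≤ 2 * ∑ j ∈ Finset.Ico (n + 1) (n + 1 + N), |Q j| * ((j : ℝ) + 1) ^ δ := by
      rw [abs_mul, abs_of_pos (inv_pos.2 hc0), mul_assoc]
      refine mul_le_mul hcinv ?_ (by positivity) two_pos.le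
      refine (mul_le_mul_of_nonneg_right (Finset.abs_sum_le_sum_abs _ _) (by positivity)).trans ?_
      rw [Finset.sum_mul]
      refine Finset.sum_le_sum fun j hj => mul_le_mul_of_nonneg_left ?_ (abs_nonneg _)
      rw [Finset.mem_Ico] at hj
      refine Real.rpow_le_rpow (by positivity) ?_ hδ
      have : n ≤ j := by omega
      exact_mod_cast Nat.succ_le_succ this
    have hb2 : |∑ j ∈ Finset.Ico 1 (n + 1), Q j * (resolvent g N (n - j) - c⁻¹)|
          * ((n : ℝ) + 1) ^ δ
        ≤ ∑ j ∈ Finset.Ico 1 (n + 1), |Q j| * ((j : ℝ) + 1) ^ δ := by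
      refine (mul_le_mul_of_nonneg_right (Finset.abs_sum_le_sum_abs _ _) (by positivity)).trans ?_
      rw [Finset.sum_mul]
      refine Finset.sum_le_sum fun j hj => ?_
      rw [Finset.mem_Ico] at hj
      rw [abs_mul, mul_assoc]
      refine mul_le_mul_of_nonneg_left ?_ (abs_nonneg _)
      calc _ ≤ |resolvent g N (n - j) - c⁻¹|
            * (((j : ℝ) + 1) ^ δ * (((n - j : ℕ) : ℝ) + 1) ^ δ) :=
            mul_le_mul_of_nonneg_left (succ_rpow_le_mul hδ (by omega)) (abs_nonneg _)
        _ = (|resolvent g N (n - j) - c⁻¹| * (((n - j : ℕ) : ℝ) + 1) ^ δ)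
            * ((j : ℝ) + 1) ^ δ := by ring
        _ ≤ 1 * ((j : ℝ) + 1) ^ δ :=
            mul_le_mul_of_nonneg_right (ih (n - j) (by omega)) (by positivity)
        _ = _ := one_mul _
    have hb3 := (sum_abs_kernelTail_le (g := g) hδ N (n + N)).trans hg
    have hsplit : ∑ j ∈ Finset.Icc 1 (n + N), |Q j| * ((j : ℝ) + 1) ^ δ
        = ∑ j ∈ Finset.Ico 1 (n + 1), |Q j| * ((j : ℝ) + 1) ^ δ
          + ∑ j ∈ Finset.Ico (n + 1) (n + 1 + N), |Q j| * ((j : ℝ) + 1) ^ δ := by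
      rw [Finset.sum_Ico_consecutive _ (by omega) (by omega)]
      refine Finset.sum_congr ?_ fun _ _ => rfl
      ext j
      simp only [Finset.mem_Icc, Finset.mem_Ico]
      omega
    rw [hsplit] at hb3
    have hn1 : 0 ≤ ∑ j ∈ Finset.Ico 1 (n + 1), |Q j| * ((j : ℝ) + 1) ^ δ :=
      Finset.sum_nonneg fun _ _ => by positivity
    rw [h2]
    -- The tail mass enters with factor 2 ≥ c⁻¹ and the convolution with factor 1, while the two
    -- weighted sums together are at most 1/2.
    calc _ ≤ (|c⁻¹ * ∑ j ∈ Finset.Ico (n + 1) (n + 1 + N), Q j|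
          + |∑ j ∈ Finset.Ico 1 (n + 1), Q j * (resolvent g N (n - j) - c⁻¹)|)
            * ((n : ℝ) + 1) ^ δ := mul_le_mul_of_nonneg_right (abs_sub _ _) (by positivity)
      _ ≤ 1 := by rw [add_mul]; linarith

/-! ### Elementary sums -/

/-- `∑_{m ≥ 1} m^{-p}`. -/
noncomputable def zetaSum (p : ℝ) : ℝ := ∑' m : ℕ, (m : ℝ) ^ (-p)

theorem summable_rpow_neg {p : ℝ} (hp : 1 < p) : Summable fun m : ℕ => (m : ℝ) ^ (-p) :=
  Real.summable_nat_rpow.2 (by linarith)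

theorem sum_rpow_neg_le {p : ℝ} (hp : 1 < p) (s : Finset ℕ) :
    ∑ m ∈ s, (m : ℝ) ^ (-p) ≤ zetaSum p :=
  (summable_rpow_neg hp).sum_le_tsum s fun _ _ => by positivity

theorem zetaSum_nonneg (p : ℝ) : 0 ≤ zetaSum p := tsum_nonneg fun _ => by positivity

/-- Telescoping: (1 + rx)^{-2} is dominated by 2/r times the decrement of 1/(1 + rx) over a unit
step. -/
theorem sum_range_one_add_mul_rpow_le {τ r : ℝ} (hτ : 2 ≤ τ) (hr : 0 < r) (hr1 : r ≤ 1) (n : ℕ) :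
    ∑ i ∈ Finset.range n, (1 + r * (i : ℝ)) ^ (-τ) ≤ 2 / r := by
  have h : ∀ n : ℕ, ∑ i ∈ Finset.range n, (1 + r * (i : ℝ)) ^ (-τ)
      ≤ 2 / r * (1 - 1 / (1 + r * (n : ℝ))) := by
    intro n
    induction n with
    | zero => simp
    | succ n ih =>
      rw [Finset.sum_range_succ]
      have hx : (1 : ℝ) ≤ 1 + r * n := by
        have : 0 ≤ r * (n : ℝ) := by positivity
        linarith
      have h1 : (1 + r * (n : ℝ)) ^ (-τ) ≤ 1 / (1 + r * (n : ℝ)) ^ 2 := by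
        calc _ ≤ (1 + r * (n : ℝ)) ^ (-(2 : ℝ)) :=
              Real.rpow_le_rpow_of_exponent_le hx (by linarith)
          _ = _ := by
              rw [Real.rpow_neg (by linarith), one_div]
              norm_cast
      have h2 : 1 / (1 + r * (n : ℝ)) ^ 2
          ≤ 2 / r * (1 / (1 + r * (n : ℝ)) - 1 / (1 + r * ((n + 1 : ℕ) : ℝ))) := by
        push_cast
        set x := 1 + r * (n : ℝ)
        have hy : 1 + r * ((n : ℝ) + 1) = x + r := by simp only [x]; ring
        have hx0 : 0 < x := by linarith
        rw [hy]
        have : 2 / r * (1 / x - 1 / (x + r)) = 2 / (x * (x + r)) := by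
          field_simp
          ring
        rw [this, div_le_div_iff₀ (by positivity) (by positivity)]
        nlinarith
      linarith
  refine (h n).trans ?_
  have : 0 ≤ 1 / (1 + r * (n : ℝ)) := by positivity
  have h2 : 0 < 2 / r := by positivity
  nlinarith

/-- Put i = j - m. If i ≤ m, then j ≤ 2m and m^{-τ} already supplies j^{-τ}. If m ≤ i, then j ≤ 2i,
and rm ≥ 1 gives j(1 + rm) ≤ 4m(1 + ri), so the two factors exchange roles. In both cases a sum of
order 1/r is left over. -/
theorem conv_rpow_le {τ r : ℝ} (hτ : 2 ≤ τ) (hr : 0 < r) (hr1 : r ≤ 1) {N : ℕ}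
    (hN : 1 ≤ r * ((N : ℝ) + 1)) (j : ℕ) :
    ∑ m ∈ Finset.Icc (N + 1) j, (m : ℝ) ^ (-τ) * (1 + r * ((j - m : ℕ) : ℝ)) ^ (-τ)
      ≤ 4 * 4 ^ τ * r⁻¹ * (j : ℝ) ^ (-τ) := by
  have hpt : ∀ m ∈ Finset.Icc (N + 1) j,
      (m : ℝ) ^ (-τ) * (1 + r * ((j - m : ℕ) : ℝ)) ^ (-τ)
        ≤ 4 ^ τ * (j : ℝ) ^ (-τ) * ((1 + r * ((j - m : ℕ) : ℝ)) ^ (-τ)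
          + (1 + r * (m : ℝ)) ^ (-τ)) := by
    intro m hm
    rw [Finset.mem_Icc] at hm
    have hmN : (N : ℝ) + 1 ≤ m := by exact_mod_cast hm.1
    have hm0 : (0 : ℝ) < m := by have := N.cast_nonneg (α := ℝ); linarith
    have hj0 : (0 : ℝ) < j := hm0.trans_le (by exact_mod_cast hm.2)
    set i := j - m with hi
    have hji : (j : ℝ) = m + i := by rw [hi, Nat.cast_sub hm.2]; ring
    have hi0 : (0 : ℝ) ≤ i := i.cast_nonneg
    have hrm : 1 ≤ r * (m : ℝ) := hN.trans (by gcongr)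
    set x := 1 + r * (i : ℝ) with hx
    set y := 1 + r * (m : ℝ) with hy
    have hx1 : 0 < x := by positivity
    have hy1 : 0 < y := by positivity
    have hconv : ∀ w : ℝ, 0 < w → (j : ℝ) * w ≤ 4 * (m * x) →
        (m : ℝ) ^ (-τ) * x ^ (-τ) ≤ 4 ^ τ * (j : ℝ) ^ (-τ) * w ^ (-τ) := by
      intro w hw hle
      rw [← Real.mul_rpow hm0.le hx1.le, mul_assoc, ← Real.mul_rpow hj0.le hw.le]
      calc ((m : ℝ) * x) ^ (-τ) = 4 ^ τ * (4 * (m * x)) ^ (-τ) := by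
            rw [Real.mul_rpow (x := 4) (by norm_num) (by positivity), ← mul_assoc,
              ← Real.rpow_add (by norm_num)]
            simp
        _ ≤ 4 ^ τ * (j * w) ^ (-τ) := by
            refine mul_le_mul_of_nonneg_left ?_ (by positivity)
            exact Real.rpow_le_rpow_of_nonpos (by positivity) hle (by linarith)
    rcases le_total (i : ℝ) m with him | him
    · refine (hconv x hx1 ?_).trans ?_
      · nlinarith
      · refine mul_le_mul_of_nonneg_left ?_ (by positivity)
        have : 0 ≤ y ^ (-τ) := by positivity
        linarith
    · refine (hconv y hy1 ?_).trans ?_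
      · have h1 : y ≤ 2 * (r * m) := by linarith
        have h2 : (j : ℝ) ≤ 2 * i := by linarith
        calc (j : ℝ) * y ≤ (2 * i) * (2 * (r * m)) := by gcongr
          _ = 4 * (m * (r * i)) := by ring
          _ ≤ 4 * (m * x) := by gcongr; simp [hx]
      · refine mul_le_mul_of_nonneg_left ?_ (by positivity)
        have : 0 ≤ x ^ (-τ) := by positivity
        linarith
  refine (Finset.sum_le_sum hpt).trans ?_
  rw [← Finset.mul_sum, Finset.sum_add_distrib]
  have hsub : Finset.Icc (N + 1) j ⊆ Finset.range (j + 1) := by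
    intro m hm
    rw [Finset.mem_Icc] at hm
    rw [Finset.mem_range]
    omega
  have h1 : ∑ m ∈ Finset.Icc (N + 1) j, (1 + r * ((j - m : ℕ) : ℝ)) ^ (-τ) ≤ 2 / r := by
    refine (Finset.sum_le_sum_of_subset_of_nonneg hsub fun _ _ _ => by positivity).trans ?_
    have := Finset.sum_flip (n := j) (f := fun i : ℕ => (1 + r * (i : ℝ)) ^ (-τ))
    rw [this]
    exact sum_range_one_add_mul_rpow_le hτ hr hr1 _
  have h2 : ∑ m ∈ Finset.Icc (N + 1) j, (1 + r * (m : ℝ)) ^ (-τ) ≤ 2 / r :=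
    (Finset.sum_le_sum_of_subset_of_nonneg hsub fun _ _ _ => by positivity).trans
      (sum_range_one_add_mul_rpow_le hτ hr hr1 _)
  calc _ ≤ 4 ^ τ * (j : ℝ) ^ (-τ) * (2 / r + 2 / r) := by gcongr
    _ = _ := by rw [div_eq_mul_inv]; ring

/-- Exponential decay beats every power. -/
theorem exists_exp_neg_le_rpow {c : ℝ} (hc : 0 < c) (p : ℝ) :
    ∃ C : ℝ, 0 < C ∧ ∀ x : ℝ, 0 ≤ x → Real.exp (-(c * x)) ≤ C * (1 + x) ^ (-p) := by
  set q := max p 1 with hq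
  have hq0 : 0 < q := lt_of_lt_of_le one_pos (le_max_right _ _)
  refine ⟨(q / c) ^ q * Real.exp c, by positivity, fun x hx => ?_⟩
  have h1 : (1 + x) ^ p ≤ (1 + x) ^ q :=
    Real.rpow_le_rpow_of_exponent_le (by linarith) (le_max_left _ _)
  have h2 : (1 + x) ^ q ≤ (q / c) ^ q * Real.exp (c * (1 + x)) := by
    have h3 : 1 + x ≤ q / c * Real.exp (c * (1 + x) / q) := by
      have := Real.add_one_le_exp (c * (1 + x) / q)
      calc 1 + x = q / c * (c * (1 + x) / q) := by field_simp
        _ ≤ q / c * Real.exp (c * (1 + x) / q) := by gcongr; linarith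
    calc (1 + x) ^ q ≤ (q / c * Real.exp (c * (1 + x) / q)) ^ q :=
          Real.rpow_le_rpow (by linarith) h3 hq0.le
      _ = _ := by
          rw [Real.mul_rpow (by positivity) (by positivity), ← Real.exp_mul]
          congr 2
          field_simp
  rw [Real.rpow_neg (by linarith), Real.exp_neg, ← div_eq_mul_inv, inv_eq_one_div,
    div_le_div_iff₀ (by positivity) (by positivity), one_mul]
  calc (1 + x) ^ p ≤ _ := h1.trans h2
    _ = _ := by rw [mul_assoc, ← Real.exp_add]; congr 2; ring

/-! ### Perturbation by the tail of the kernel -/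

/-- The exponential tilt f n * s^n solves a recursion with kernel g m * s^m. With s chosen to make
the truncated tilted kernel critical, the decay of f is carried by s^{-n}. -/
theorem scaled_eq_sum_resolvent {g e f : ℕ → ℝ} {s : ℝ}
    (hf : ∀ n, f n = ∑ m ∈ Finset.Icc 1 n, g m * f (n - m) + e n) (N n : ℕ) :
    f n * s ^ n = ∑ j ∈ Finset.range (n + 1), resolvent (fun m => g m * s ^ m) N (n - j)
      * (s ^ j * (e j + ∑ m ∈ Finset.Icc (N + 1) j, g m * f (j - m))) := by
  have h := eq_sum_resolvent (g := fun m => g m * s ^ m) (e := fun n => e n * s ^ n)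
    (f := fun n => f n * s ^ n) (fun n => ?_) N n
  · rw [h]
    refine Finset.sum_congr rfl fun j _ => ?_
    congr 1
    rw [mul_add, mul_comm (e j), Finset.mul_sum]
    congr 1
    refine Finset.sum_congr rfl fun m hm => ?_
    rw [Finset.mem_Icc] at hm
    rw [← pow_sub_mul_pow s hm.2]
    ring
  · rw [hf n, add_mul, Finset.sum_mul]
    congr 1
    refine Finset.sum_congr rfl fun m hm => ?_
    rw [Finset.mem_Icc] at hm
    rw [← pow_sub_mul_pow s hm.2]
    ring

/-- The part of the solution that is driven by the source terms up to `N`. -/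
noncomputable def mainPart (g e : ℕ → ℝ) (s : ℝ) (N n : ℕ) : ℝ :=
  ∑ j ∈ Finset.range (N + 1), resolvent (fun m => g m * s ^ m) N (n - j) * (s ^ j * e j)

theorem eq_mainPart_self {g e f : ℕ → ℝ} {s : ℝ}
    (hf : ∀ n, f n = ∑ m ∈ Finset.Icc 1 n, g m * f (n - m) + e n) (n : ℕ) :
    f n * s ^ n = mainPart g e s n n := by
  rw [scaled_eq_sum_resolvent hf n n, mainPart]
  refine Finset.sum_congr rfl fun j hj => ?_
  rw [Finset.mem_range] at hj
  rw [Finset.Icc_eq_empty (by omega), Finset.sum_empty, add_zero]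

theorem sum_source_le {τ b s : ℝ} (hτ : 1 < τ) (hb : 0 ≤ b) (hs0 : 0 ≤ s) {e : ℕ → ℝ} {N : ℕ}
    (he0 : e 0 = 1) (he1 : e 1 = 0) (hs : ∀ j ≤ N, s ^ j ≤ Real.exp 4)
    (he : ∀ m, 2 ≤ m → m ≤ N → |e m| ≤ b * (m : ℝ) ^ (-τ)) :
    ∑ j ∈ Finset.range (N + 1), |s ^ j * e j| ≤ 1 + b * (Real.exp 4 * zetaSum τ) := by
  rw [Finset.sum_range_succ', pow_zero, he0, one_mul, abs_one, add_comm]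
  refine add_le_add le_rfl ?_
  calc _ ≤ ∑ j ∈ Finset.range N, b * Real.exp 4 * ((j + 1 : ℕ) : ℝ) ^ (-τ) := by
        refine Finset.sum_le_sum fun j hj => ?_
        rw [Finset.mem_range] at hj
        rcases Nat.eq_zero_or_pos j with rfl | hj0
        · rw [he1, mul_zero, abs_zero]; positivity
        · rw [abs_mul, abs_of_nonneg (pow_nonneg hs0 _)]
          calc _ ≤ Real.exp 4 * (b * ((j + 1 : ℕ) : ℝ) ^ (-τ)) :=
                mul_le_mul (hs _ (by omega)) (he _ (by omega) (by omega)) (abs_nonneg _)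
                  (Real.exp_pos _).le
            _ = _ := by ring
    _ = b * Real.exp 4 * ∑ m ∈ (Finset.range N).map (addRightEmbedding 1),
          (m : ℝ) ^ (-τ) := by
        rw [Finset.sum_map, Finset.mul_sum]; rfl
    _ ≤ b * Real.exp 4 * zetaSum τ := by gcongr; exact sum_rpow_neg_le hτ _
    _ = _ := by ring

theorem abs_mainPart_le {τ b s B : ℝ} (hτ : 1 < τ) (hb : 0 ≤ b) (hs0 : 0 ≤ s) {g e : ℕ → ℝ}
    {N n : ℕ} (he0 : e 0 = 1) (he1 : e 1 = 0) (hs : ∀ j ≤ N, s ^ j ≤ Real.exp 4)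
    (he : ∀ m, 2 ≤ m → m ≤ N → |e m| ≤ b * (m : ℝ) ^ (-τ))
    (hV : ∀ n, |resolvent (fun m => g m * s ^ m) N n| ≤ B) :
    |mainPart g e s N n| ≤ B * (1 + b * (Real.exp 4 * zetaSum τ)) := by
  have hB : 0 ≤ B := (abs_nonneg _).trans (hV 0)
  refine (Finset.abs_sum_le_sum_abs _ _).trans ?_
  calc _ ≤ ∑ j ∈ Finset.range (N + 1), B * |s ^ j * e j| := by
        refine Finset.sum_le_sum fun j _ => ?_
        rw [abs_mul]
        exact mul_le_mul_of_nonneg_right (hV _) (abs_nonneg _)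
    _ ≤ _ := by
        rw [← Finset.mul_sum]
        exact mul_le_mul_of_nonneg_left (sum_source_le hτ hb hs0 he0 he1 hs he) hB

/-- Here r is the decay rate and N is at least of order 1/r. The tail of the kernel acts as a source
of size b m^{-τ}; convolving it with f costs one factor r⁻¹, and convolving the result with the
decay s^{-(n-j)} costs a second one. Both are instances of `conv_rpow_le`. Smallness of b closes the
induction for the crude bound on f. -/
theorem exists_perturbation_bound {τ : ℝ} (hτ : 2 ≤ τ) :
    ∃ C b₀ : ℝ, 1 ≤ C ∧ 0 < b₀ ∧ ∀ (r s b : ℝ) (N n₁ : ℕ) (g e f : ℕ → ℝ),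
      0 < r → r ≤ 1 → 1 ≤ N → 1 ≤ r * ((N : ℝ) + 1) → Real.exp (r / 4) ≤ s → s ^ N ≤ Real.exp 4 →
      0 ≤ b → b ≤ b₀ →
      (∀ n, f n = ∑ m ∈ Finset.Icc 1 n, g m * f (n - m) + e n) → e 0 = 1 → e 1 = 0 →
      (∀ m, 2 ≤ m → m ≤ n₁ → |g m| ≤ b * (m : ℝ) ^ (-τ) ∧ |e m| ≤ b * (m : ℝ) ^ (-τ)) →
      (∀ n, |resolvent (fun m => g m * s ^ m) N n| ≤ 3) →
      ∀ n ≤ n₁, |f n| ≤ C * (1 + r * (n : ℝ)) ^ (-τ) ∧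
        (N ≤ n → |f n - mainPart g e s N n / s ^ n| ≤ C * b * (r ^ 2)⁻¹ * (n : ℝ) ^ (-τ)
          ∧ |mainPart g e s N n| ≤ 4) := by
  obtain ⟨Ce, hCe0, hCe⟩ := exists_exp_neg_le_rpow (c := 1 / 4) (by norm_num) τ
  set Cc : ℝ := 4 * 4 ^ τ with hCc
  have hCc0 : 0 < Cc := by positivity
  -- 4 * Ce comes from the main part, which is at most 4 before the division by s^n; the additional
  -- 1 is the room for the tail contribution, b * (C₂ * 2^τ) ≤ 1.
  set M : ℝ := 4 * Ce + 1 with hM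
  have hM0 : 0 < M := by positivity
  set C₂ : ℝ := 3 * (1 + M * Cc) * Ce * Cc with hC₂
  have hC₂0 : 0 < C₂ := by positivity
  set Z := Real.exp 4 * zetaSum τ with hZ
  have hZ0 : 0 ≤ Z := mul_nonneg (Real.exp_pos _).le (zetaSum_nonneg _)
  refine ⟨max (max M C₂) 1, min (1 / (3 * Z + 1)) (1 / (C₂ * 2 ^ τ)), le_max_right _ _,
    lt_min (by positivity) (by positivity), ?_⟩
  intro r s b N n₁ g e f hr hr1 hN hrN hs hsN hb hbb hf he0 he1 hge hV
  have hb1 : b * (3 * Z + 1) ≤ 1 := by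
    have := hbb.trans (min_le_left _ _)
    rwa [le_div_iff₀ (by positivity)] at this
  have hb2 : b * (C₂ * 2 ^ τ) ≤ 1 := by
    have := hbb.trans (min_le_right _ _)
    rwa [le_div_iff₀ (by positivity)] at this
  have hs1 : 1 ≤ s := le_trans (Real.one_le_exp (by positivity)) hs
  have hs0 : 0 < s := by linarith
  have hspow : ∀ i : ℕ, (s ^ i)⁻¹ ≤ Ce * (1 + r * (i : ℝ)) ^ (-τ) := by
    intro i
    refine le_trans ?_ (hCe (r * i) (by positivity))
    rw [show -(1 / 4 * (r * (i : ℝ))) = -((i : ℝ) * (r / 4)) by ring, Real.exp_neg, Real.exp_nat_mul]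
    gcongr
  have hpart1 : ∀ n K : ℕ, K ≤ N → K ≤ n → K ≤ n₁ →
      ∑ j ∈ Finset.range (K + 1), |resolvent (fun m => g m * s ^ m) N (n - j)
        * (s ^ j * e j)| ≤ 4 := by
    intro n K hKN _ hK1
    calc _ ≤ ∑ j ∈ Finset.range (K + 1), 3 * |s ^ j * e j| := by
          refine Finset.sum_le_sum fun j _ => ?_
          rw [abs_mul]
          exact mul_le_mul_of_nonneg_right (hV _) (abs_nonneg _)
      _ ≤ 3 * (1 + b * Z) := by
          rw [← Finset.mul_sum]
          refine mul_le_mul_of_nonneg_left (sum_source_le (by linarith) hb hs0.le he0 he1 ?_ ?_)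
            (by norm_num)
          · exact fun j hj => (pow_le_pow_right₀ hs1 (by omega)).trans hsN
          · exact fun m h2 hm => (hge m h2 (by omega)).2
      _ ≤ 4 := by nlinarith
  have hsplit : ∀ n, f n * s ^ n = (∑ j ∈ Finset.range (min n N + 1),
        resolvent (fun m => g m * s ^ m) N (n - j) * (s ^ j * e j))
      + ∑ j ∈ Finset.Icc (N + 1) n, resolvent (fun m => g m * s ^ m) N (n - j)
        * (s ^ j * (e j + ∑ m ∈ Finset.Icc (N + 1) j, g m * f (j - m))) := by
    intro n
    rw [scaled_eq_sum_resolvent hf N n]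
    have : Finset.range (n + 1) = Finset.range (min n N + 1) ∪ Finset.Icc (N + 1) n := by
      ext j
      simp only [Finset.mem_union, Finset.mem_range, Finset.mem_Icc]
      omega
    rw [this, Finset.sum_union]
    · congr 1
      refine Finset.sum_congr rfl fun j hj => ?_
      rw [Finset.mem_range] at hj
      rw [Finset.Icc_eq_empty (by omega), Finset.sum_empty, add_zero]
    · rw [Finset.disjoint_left]
      intro j
      simp only [Finset.mem_range, Finset.mem_Icc]
      omega
  -- Every m in the tail is positive, so only f i with i < n occurs. The estimate can thus serve as
  -- the induction step for the crude bound and again for the refined one.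
  have hpart2 : ∀ n ≤ n₁, (∀ i < n, |f i| ≤ M * (1 + r * (i : ℝ)) ^ (-τ)) →
      |∑ j ∈ Finset.Icc (N + 1) n, resolvent (fun m => g m * s ^ m) N (n - j)
        * (s ^ j * (e j + ∑ m ∈ Finset.Icc (N + 1) j, g m * f (j - m)))| / s ^ n
      ≤ C₂ * b * (r ^ 2)⁻¹ * (n : ℝ) ^ (-τ) := by
    intro n hn ih
    have hsrc : ∀ j ∈ Finset.Icc (N + 1) n,
        |e j + ∑ m ∈ Finset.Icc (N + 1) j, g m * f (j - m)|
          ≤ b * (1 + M * Cc) * r⁻¹ * (j : ℝ) ^ (-τ) := by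
      intro j hj
      rw [Finset.mem_Icc] at hj
      have h1 : |∑ m ∈ Finset.Icc (N + 1) j, g m * f (j - m)|
          ≤ b * M * (Cc * r⁻¹ * (j : ℝ) ^ (-τ)) := by
        refine (Finset.abs_sum_le_sum_abs _ _).trans (le_trans ?_
          (mul_le_mul_of_nonneg_left (conv_rpow_le hτ hr hr1 hrN j) (by positivity)))
        rw [Finset.mul_sum]
        refine Finset.sum_le_sum fun m hm => ?_
        rw [Finset.mem_Icc] at hm
        rw [abs_mul]
        calc _ ≤ (b * (m : ℝ) ^ (-τ)) * (M * (1 + r * ((j - m : ℕ) : ℝ)) ^ (-τ)) :=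
              mul_le_mul (hge m (by omega) (by omega)).1 (ih _ (by omega)) (abs_nonneg _)
                (by positivity)
          _ = _ := by ring
      have h2 := (hge j (by omega) (by omega)).2
      have h3 : b * (j : ℝ) ^ (-τ) ≤ b * r⁻¹ * (j : ℝ) ^ (-τ) := by
        have : 1 ≤ r⁻¹ := (one_le_inv₀ hr).2 hr1
        have h0 : 0 ≤ b * (j : ℝ) ^ (-τ) := by positivity
        nlinarith
      calc _ ≤ _ := abs_add_le _ _
        _ ≤ b * r⁻¹ * (j : ℝ) ^ (-τ) + b * M * (Cc * r⁻¹ * (j : ℝ) ^ (-τ)) := by linarith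
        _ = _ := by ring
    rw [div_le_iff₀ (by positivity)]
    refine (Finset.abs_sum_le_sum_abs _ _).trans ?_
    have hterm : ∀ j ∈ Finset.Icc (N + 1) n, |resolvent (fun m => g m * s ^ m) N (n - j)
        * (s ^ j * (e j + ∑ m ∈ Finset.Icc (N + 1) j, g m * f (j - m)))|
        ≤ s ^ n * (3 * (b * (1 + M * Cc) * r⁻¹) * Ce)
          * ((j : ℝ) ^ (-τ) * (1 + r * ((n - j : ℕ) : ℝ)) ^ (-τ)) := by
      intro j hj
      have hj' := Finset.mem_Icc.1 hj
      rw [abs_mul, abs_mul, abs_of_pos (pow_pos hs0 j)]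
      have h1 : s ^ j = s ^ n * (s ^ (n - j))⁻¹ := by
        rw [← pow_sub_mul_pow s hj'.2]
        field_simp
      calc _ ≤ 3 * (s ^ j * (b * (1 + M * Cc) * r⁻¹ * (j : ℝ) ^ (-τ))) := by
            gcongr
            · exact hV _
            · exact hsrc j hj
        _ = s ^ n * 3 * (b * (1 + M * Cc) * r⁻¹ * (j : ℝ) ^ (-τ)) * (s ^ (n - j))⁻¹ := by
            rw [h1]; ring
        _ ≤ s ^ n * 3 * (b * (1 + M * Cc) * r⁻¹ * (j : ℝ) ^ (-τ))
              * (Ce * (1 + r * ((n - j : ℕ) : ℝ)) ^ (-τ)) := by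
            gcongr
            exact hspow _
        _ = _ := by ring
    refine (Finset.sum_le_sum hterm).trans ?_
    rw [← Finset.mul_sum]
    calc _ ≤ s ^ n * (3 * (b * (1 + M * Cc) * r⁻¹) * Ce) * (Cc * r⁻¹ * (n : ℝ) ^ (-τ)) := by
          gcongr
          exact conv_rpow_le hτ hr hr1 hrN n
      _ = _ := by rw [hC₂]; ring
  have hcrude : ∀ n ≤ n₁, |f n| ≤ M * (1 + r * (n : ℝ)) ^ (-τ) := by
    intro n
    induction n using Nat.strong_induction_on with
    | _ n ih =>
      intro hn
      have hsn : 0 < s ^ n := pow_pos hs0 n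
      have h1 : f n = f n * s ^ n / s ^ n := by field_simp
      rw [h1, hsplit n, add_div]
      have hA : |(∑ j ∈ Finset.range (min n N + 1),
          resolvent (fun m => g m * s ^ m) N (n - j) * (s ^ j * e j)) / s ^ n|
          ≤ 4 * Ce * (1 + r * (n : ℝ)) ^ (-τ) := by
        rw [abs_div, abs_of_pos hsn, div_eq_mul_inv, mul_assoc]
        refine mul_le_mul ((Finset.abs_sum_le_sum_abs _ _).trans
          (hpart1 n (min n N) (by omega) (by omega) (by omega))) (hspow n) (by positivity)
          (by norm_num)
      rcases le_or_gt n N with hnN | hnN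
      · rw [Finset.Icc_eq_empty (by omega), Finset.sum_empty, zero_div, add_zero]
        refine hA.trans ?_
        have : 0 ≤ (1 + r * (n : ℝ)) ^ (-τ) := by positivity
        rw [hM]
        nlinarith
      · have hB := hpart2 n hn fun i hi => ih i hi (by omega)
        rw [← abs_of_pos hsn, ← abs_div] at hB
        have hrn : 1 ≤ r * (n : ℝ) := hrN.trans (by
          have : (N : ℝ) + 1 ≤ n := by exact_mod_cast hnN
          gcongr)
        have hn0 : (0 : ℝ) < n := by exact_mod_cast (by omega : 0 < n)
        -- Since τ ≥ 2 and r ≤ 1, the factor r⁻² is at most r^{-τ}; and r n ≥ 1 allows (r n)^{-τ} to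
        -- be replaced by (1 + r n)^{-τ} at the price of 2^τ.
        have hD : (r ^ 2)⁻¹ * (n : ℝ) ^ (-τ) ≤ 2 ^ τ * (1 + r * (n : ℝ)) ^ (-τ) := by
          have h2 : (r ^ 2)⁻¹ ≤ r ^ (-τ) := by
            rw [← Real.rpow_natCast, ← Real.rpow_neg hr.le]
            exact Real.rpow_le_rpow_of_exponent_ge hr hr1 (by push_cast; linarith)
          calc _ ≤ r ^ (-τ) * (n : ℝ) ^ (-τ) := by gcongr
            _ = 2 ^ τ * (2 * (r * n)) ^ (-τ) := by
                rw [Real.mul_rpow (by norm_num) (by positivity), ← mul_assoc,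
                  ← Real.rpow_add (by norm_num), Real.mul_rpow hr.le hn0.le]
                simp
            _ ≤ _ := by
                refine mul_le_mul_of_nonneg_left ?_ (by positivity)
                exact Real.rpow_le_rpow_of_nonpos (by positivity) (by linarith) (by linarith)
        calc _ ≤ _ := abs_add_le _ _
          _ ≤ 4 * Ce * (1 + r * (n : ℝ)) ^ (-τ) + C₂ * b * ((r ^ 2)⁻¹ * (n : ℝ) ^ (-τ)) := by
              rw [← mul_assoc]; exact add_le_add hA hB
          _ ≤ 4 * Ce * (1 + r * (n : ℝ)) ^ (-τ)
                + C₂ * b * (2 ^ τ * (1 + r * (n : ℝ)) ^ (-τ)) := by gcongr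
          _ = (4 * Ce + b * (C₂ * 2 ^ τ)) * (1 + r * (n : ℝ)) ^ (-τ) := by ring
          _ ≤ _ := by gcongr; rw [hM]; linarith
  intro n hn
  refine ⟨(hcrude n hn).trans (by gcongr; exact (le_max_left _ _).trans (le_max_left _ _)),
    fun hNn => ⟨?_, ?_⟩⟩
  · have h1 : f n - mainPart g e s N n / s ^ n
        = (f n * s ^ n - mainPart g e s N n) / s ^ n := by
      field_simp
    rw [h1, hsplit n, min_eq_right hNn, mainPart, add_sub_cancel_left, abs_div,
      abs_of_pos (pow_pos hs0 n)]
    refine (hpart2 n hn fun i hi => hcrude i (by omega)).trans ?_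
    gcongr
    exact (le_max_right _ _).trans (le_max_left _ _)
  · exact (Finset.abs_sum_le_sum_abs _ _).trans (hpart1 n N le_rfl hNn (hNn.trans hn))

/-! ### Near-critical recursions -/

theorem abs_one_add_pow_sub_one_le (t : ℝ) (m : ℕ) :
    |(1 + t) ^ m - 1| ≤ m * |t| * Real.exp (m * |t|) := by
  have h1 : (1 + t) ^ m - 1 = (∑ i ∈ Finset.range m, (1 + t) ^ i) * t := by
    have := geom_sum_mul (1 + t) m
    rw [← this]; ring
  rw [h1, abs_mul]
  have h2 : |∑ i ∈ Finset.range m, (1 + t) ^ i| ≤ m * Real.exp (m * |t|) := by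
    refine (Finset.abs_sum_le_sum_abs _ _).trans ?_
    have : ∀ i ∈ Finset.range m, |(1 + t) ^ i| ≤ Real.exp (m * |t|) := by
      intro i hi
      rw [Finset.mem_range] at hi
      rw [abs_pow]
      calc |1 + t| ^ i ≤ (Real.exp |t|) ^ i := by
            gcongr
            refine (abs_add_le _ _).trans ?_
            rw [abs_one, add_comm]
            exact Real.add_one_le_exp _
        _ = Real.exp (i * |t|) := by rw [Real.exp_nat_mul]
        _ ≤ _ := by
            refine Real.exp_le_exp.2 (mul_le_mul_of_nonneg_right ?_ (abs_nonneg _))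
            exact_mod_cast hi.le
    refine (Finset.sum_le_sum this).trans ?_
    rw [Finset.sum_const, Finset.card_range, nsmul_eq_mul]
  calc _ ≤ (m * Real.exp (m * |t|)) * |t| := by gcongr
    _ = _ := by ring

theorem abs_one_add_pow_sub_le (t : ℝ) (m : ℕ) :
    |(1 + t) ^ m - 1 - m * t| ≤ (m * |t|) ^ 2 * Real.exp (m * |t|) := by
  have h1 : (1 + t) ^ m - 1 - m * t = (∑ i ∈ Finset.range m, ((1 + t) ^ i - 1)) * t := by
    have := geom_sum_mul (1 + t) m
    rw [Finset.sum_sub_distrib, Finset.sum_const, Finset.card_range, nsmul_eq_mul, sub_mul]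
    rw [show (1 + t - 1) = t by ring] at this
    rw [this]; ring
  rw [h1, abs_mul]
  have h2 : |∑ i ∈ Finset.range m, ((1 + t) ^ i - 1)| ≤ m * (m * |t| * Real.exp (m * |t|)) := by
    refine (Finset.abs_sum_le_sum_abs _ _).trans ?_
    have : ∀ i ∈ Finset.range m, |(1 + t) ^ i - 1| ≤ m * |t| * Real.exp (m * |t|) := by
      intro i hi
      rw [Finset.mem_range] at hi
      refine (abs_one_add_pow_sub_one_le t i).trans ?_
      have : (i : ℝ) ≤ m := by exact_mod_cast hi.le
      gcongr
    refine (Finset.sum_le_sum this).trans ?_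
    rw [Finset.sum_const, Finset.card_range, nsmul_eq_mul]
  calc _ ≤ (m * (m * |t| * Real.exp (m * |t|))) * |t| := by gcongr
    _ = _ := by ring

/-- The kernel `g` and the source `e` at a dual variable `k` with `a = a(k)`, compared with the
kernel `g₀` and the source `e₀` at `k = 0`, up to the index `n₁`. -/
structure NearCritical (τ δ b a z : ℝ) (n₁ : ℕ) (g₀ g e₀ e : ℕ → ℝ) : Prop where
  abs_z : |z - 1| ≤ b
  g₀_one : g₀ 1 = z
  g_one : g 1 = z * (1 - a)
  e₀_zero : e₀ 0 = 1
  e_zero : e 0 = 1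
  e₀_one : e₀ 1 = 0
  e_one : e 1 = 0
  abs_g₀ : ∀ m, 2 ≤ m → m ≤ n₁ → |g₀ m| ≤ b * (m : ℝ) ^ (-τ)
  abs_g : ∀ m, 2 ≤ m → m ≤ n₁ → |g m| ≤ b * (m : ℝ) ^ (-τ)
  abs_g_sub : ∀ m, 2 ≤ m → m ≤ n₁ → |g m - g₀ m| ≤ b * a * (m : ℝ) ^ (1 - τ)
  abs_e₀ : ∀ m, 2 ≤ m → m ≤ n₁ → |e₀ m| ≤ b * (m : ℝ) ^ (-τ)
  abs_e : ∀ m, 2 ≤ m → m ≤ n₁ → |e m| ≤ b * (m : ℝ) ^ (-τ)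
  abs_e_sub : ∀ m, 2 ≤ m → m ≤ n₁ → |e m - e₀ m| ≤ b * a * (m : ℝ) ^ (1 - τ)
  crit : ∀ N, 1 ≤ N → N ≤ n₁ →
    |∑ m ∈ Finset.Icc 1 N, g₀ m - 1| ≤ b * (N : ℝ) ^ (-1 - δ)

section

variable {τ δ b a z : ℝ} {n₁ : ℕ} {g₀ g e₀ e : ℕ → ℝ}

/-- Comparing the kernel at k = 0 with itself is the case a = 0, so every statement about k also
covers the origin. -/
theorem NearCritical.zero (h : NearCritical τ δ b a z n₁ g₀ g e₀ e) :
    NearCritical τ δ b 0 z n₁ g₀ g₀ e₀ e₀ where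
  abs_z := h.abs_z
  g₀_one := h.g₀_one
  g_one := by rw [h.g₀_one]; ring
  e₀_zero := h.e₀_zero
  e_zero := h.e₀_zero
  e₀_one := h.e₀_one
  e_one := h.e₀_one
  abs_g₀ := h.abs_g₀
  abs_g := h.abs_g₀
  abs_g_sub := fun m _ _ => by simp
  abs_e₀ := h.abs_e₀
  abs_e := h.abs_e₀
  abs_e_sub := fun m _ _ => by simp
  crit := h.crit

theorem sum_rpow_le_zetaSum (hτ : 2 + δ < τ) {p : ℝ} (hp : p ≤ 1 + δ - τ) (N : ℕ) :
    ∑ m ∈ Finset.Icc 2 N, (m : ℝ) ^ p ≤ zetaSum (τ - 1 - δ) := by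
  refine le_trans (Finset.sum_le_sum fun m hm => ?_)
    (sum_rpow_neg_le (p := τ - 1 - δ) (by linarith) (Finset.Icc 2 N))
  rw [Finset.mem_Icc] at hm
  exact Real.rpow_le_rpow_of_exponent_le (by exact_mod_cast (by omega : 1 ≤ m)) (by linarith)

theorem sum_Icc_one_eq_add {N : ℕ} (hN : 1 ≤ N) (u : ℕ → ℝ) :
    ∑ m ∈ Finset.Icc 1 N, u m = u 1 + ∑ m ∈ Finset.Icc 2 N, u m := by
  rw [← Finset.insert_Icc_add_one_left_eq_Icc hN, Finset.sum_insert (by simp)]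
  rfl

theorem abs_sum_le_mul_zetaSum (hτ : 2 + δ < τ) {p c : ℝ} (hp : p ≤ 1 + δ - τ)
    (hc : 0 ≤ c) {N : ℕ} {u : ℕ → ℝ} (hu : ∀ m, 2 ≤ m → m ≤ N → |u m| ≤ c * (m : ℝ) ^ p) :
    |∑ m ∈ Finset.Icc 2 N, u m| ≤ c * zetaSum (τ - 1 - δ) := by
  refine (Finset.abs_sum_le_sum_abs _ _).trans (le_trans ?_
    (mul_le_mul_of_nonneg_left (sum_rpow_le_zetaSum hτ hp N) hc))
  rw [Finset.mul_sum]
  refine Finset.sum_le_sum fun m hm => ?_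
  rw [Finset.mem_Icc] at hm
  exact hu m hm.1 hm.2

/-- The linear part -za + z(1 - a)t comes from the term m = 1 alone. The rest is the defect from
mass 1 at k = 0, the change of the g_m with k, and their change with t, of order b/N, ba and b|t|.
The condition on N|t| keeps (1 + t)^m under control for m ≤ N. -/
theorem NearCritical.abs_polynomial_sub_le (h : NearCritical τ δ b a z n₁ g₀ g e₀ e)
    (hδ : 0 ≤ δ) (hτ : 2 + δ < τ) (hb : 0 ≤ b) (ha : 0 ≤ a) {N : ℕ} (hN : 1 ≤ N) (hNn : N ≤ n₁)
    {t : ℝ} (ht : N * |t| ≤ 3) :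
    |∑ m ∈ Finset.Icc 1 N, g m * (1 + t) ^ m - 1 + z * a - z * (1 - a) * t|
      ≤ b * (1 + Real.exp 3 * zetaSum (τ - 1 - δ)) * (1 / N + a + |t|) := by
  set Z := zetaSum (τ - 1 - δ) with hZ
  have hZ0 : 0 ≤ Z := zetaSum_nonneg _
  have hN0 : (1 : ℝ) ≤ N := by exact_mod_cast hN
  have h1 := h.crit N hN hNn
  have h1' : (N : ℝ) ^ (-1 - δ) ≤ 1 / N := by
    rw [one_div, ← Real.rpow_neg_one]
    exact Real.rpow_le_rpow_of_exponent_le hN0 (by linarith)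
  have h2 : |∑ m ∈ Finset.Icc 2 N, (g m - g₀ m)| ≤ b * a * Z :=
    abs_sum_le_mul_zetaSum hτ (by linarith) (by positivity)
      fun m h2 hm => h.abs_g_sub m h2 (hm.trans hNn)
  have h3 : |∑ m ∈ Finset.Icc 2 N, g m * ((1 + t) ^ m - 1)| ≤ b * |t| * Real.exp 3 * Z := by
    refine abs_sum_le_mul_zetaSum hτ (p := 1 - τ) (by linarith) (by positivity)
      fun m h2 hm => ?_
    have hm0 : (0 : ℝ) < m := by exact_mod_cast (by omega : 0 < m)
    have hmN : (m : ℝ) ≤ N := by exact_mod_cast hm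
    rw [abs_mul]
    calc _ ≤ (b * (m : ℝ) ^ (-τ)) * (m * |t| * Real.exp (m * |t|)) :=
          mul_le_mul (h.abs_g m h2 (hm.trans hNn)) (abs_one_add_pow_sub_one_le t m)
            (abs_nonneg _) (by positivity)
      _ ≤ (b * (m : ℝ) ^ (-τ)) * (m * |t| * Real.exp 3) := by
          gcongr
          exact (mul_le_mul_of_nonneg_right hmN (abs_nonneg _)).trans ht
      _ = b * |t| * Real.exp 3 * (m : ℝ) ^ (1 - τ) := by
          rw [sub_eq_add_neg, Real.rpow_add hm0, Real.rpow_one]; ring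
  have h4 : ∑ m ∈ Finset.Icc 1 N, g m * (1 + t) ^ m - 1 + z * a - z * (1 - a) * t
      = (∑ m ∈ Finset.Icc 1 N, g₀ m - 1) + ∑ m ∈ Finset.Icc 2 N, (g m - g₀ m)
        + ∑ m ∈ Finset.Icc 2 N, g m * ((1 + t) ^ m - 1) := by
    rw [sum_Icc_one_eq_add hN, sum_Icc_one_eq_add hN, h.g₀_one, h.g_one, Finset.sum_sub_distrib]
    simp only [mul_sub, Finset.sum_sub_distrib, mul_one]
    ring
  have he : 1 ≤ Real.exp 3 := Real.one_le_exp (by norm_num)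
  rw [h4]
  calc _ ≤ _ := abs_add_three _ _ _
    _ ≤ b * (1 / N) + b * a * Z + b * |t| * Real.exp 3 * Z := by
        refine add_le_add (add_le_add (h1.trans ?_) h2) h3
        gcongr
    _ ≤ _ := by
        have hx : 0 ≤ 1 / (N : ℝ) := by positivity
        have e1 : b * a * Z ≤ b * a * (Real.exp 3 * Z) := by
          have : Z ≤ Real.exp 3 * Z := le_mul_of_one_le_left hZ0 he
          gcongr
        have e2 : 0 ≤ b * (Real.exp 3 * Z) * (1 / N) := by positivity
        have e3 : 0 ≤ b * (a + |t|) := by positivity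
        nlinarith

/-- Everything that is needed of the solution `s` of `∑_{m ≤ N} g_m s^m = 1`. -/
structure IsRoot (δ a : ℝ) (N : ℕ) (g : ℕ → ℝ) (s : ℝ) : Prop where
  le : 1 + a / 2 - 1 / (16 * N) ≤ s
  ge : s ≤ 1 + 2 * a + 1 / N
  sum_eq : ∑ m ∈ Finset.Icc 1 N, g m * s ^ m = 1
  pow_le : ∀ j ≤ N, s ^ j ≤ Real.exp 3
  sum_le : ∑ m ∈ Finset.Icc 2 N, |g m * s ^ m| * (m : ℝ) ^ (1 + δ) ≤ 1 / 2

theorem IsRoot.pos {s : ℝ} {N : ℕ} (h : IsRoot δ a N g s) (ha : 0 ≤ a) (hN : 1 ≤ N) : 0 < s := by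
  have hN0 : (1 : ℝ) ≤ N := by exact_mod_cast hN
  have : 1 / (16 * (N : ℝ)) ≤ 1 / 16 := by
    rw [div_le_div_iff₀ (by positivity) (by norm_num)]; linarith
  linarith [h.le]

theorem IsRoot.abs_resolvent_le {s : ℝ} {N : ℕ} (h : IsRoot δ a N g s) (hδ : 0 ≤ δ) (hN : 1 ≤ N)
    (n : ℕ) : |resolvent (fun m => g m * s ^ m) N n| ≤ 3 := by
  have h1 := abs_resolvent_sub_le hδ hN h.sum_eq h.sum_le n
  have h2 := abs_le.1 (abs_sum_nat_mul_sub_one_le hδ hN h.sum_eq h.sum_le)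
  set c := ∑ m ∈ Finset.Icc 1 N, (m : ℝ) * (g m * s ^ m)
  have hc0 : 0 < c := by linarith [h2.1]
  have hcinv : c⁻¹ ≤ 2 := by
    rw [inv_le_comm₀ hc0 two_pos]; linarith [h2.1]
  have h3 : ((n : ℝ) + 1) ^ (-δ) ≤ 1 :=
    Real.rpow_le_one_of_one_le_of_nonpos (by linarith [n.cast_nonneg (α := ℝ)]) (by linarith)
  have h4 := abs_le.1 (h1.trans h3)
  have hcpos : 0 < c⁻¹ := inv_pos.2 hc0
  exact abs_le.2 ⟨by linarith, by linarith⟩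

/-- Intermediate value theorem between t = a/2 - 1/(16N) and t = 2a + 1/N. The linear part there is
below, respectively above, zero by a multiple of a + 1/N, whereas the error is only b times such a
multiple. The terms in 1/N provide the margin when a = 0, and aN ≤ 1 keeps s^N bounded. -/
theorem NearCritical.exists_root (hδ : 0 ≤ δ) (hτ : 2 + δ < τ) :
    ∃ b₀ : ℝ, 0 < b₀ ∧ ∀ (b a z : ℝ) (n₁ : ℕ) (g₀ g e₀ e : ℕ → ℝ),
      NearCritical τ δ b a z n₁ g₀ g e₀ e → 0 ≤ b → b ≤ b₀ → 0 ≤ a → a ≤ 1 / 4 →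
      ∀ N : ℕ, 1 ≤ N → N ≤ n₁ → a * N ≤ 1 → ∃ s, IsRoot δ a N g s := by
  set Z := zetaSum (τ - 1 - δ) with hZ
  have hZ0 : 0 ≤ Z := zetaSum_nonneg _
  set Y := 1 + Real.exp 3 * Z with hY
  have hY1 : 1 ≤ Y := by have : 0 ≤ Real.exp 3 * Z := by positivity
                         linarith
  refine ⟨1 / (1000 * Y), by positivity, ?_⟩
  intro b a z n₁ g₀ g e₀ e h hb hbb ha ha4 N hN hNn haN
  have hbY : b * Y ≤ 1 / 1000 := by
    rw [le_div_iff₀ (by positivity)] at hbb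
    linarith
  have hb1 : b ≤ 1 / 1000 := by nlinarith
  have hz := abs_le.1 (h.abs_z.trans hb1)
  have hN0 : (1 : ℝ) ≤ N := by exact_mod_cast hN
  set x : ℝ := 1 / N with hx
  have hx0 : 0 < x := by positivity
  have hxN : x * N = 1 := by rw [hx]; field_simp
  have hx16 : 1 / (16 * (N : ℝ)) = x / 16 := by rw [hx]; field_simp
  set Φ : ℝ → ℝ := fun s => ∑ m ∈ Finset.Icc 1 N, g m * s ^ m with hΦ
  have hcont : ContinuousOn Φ (Set.Icc (1 + (a / 2 - x / 16)) (1 + (2 * a + x))) :=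
    (continuous_finsetSum _ fun m _ => continuous_const.mul (continuous_pow m)).continuousOn
  have hlow := h.abs_polynomial_sub_le hδ hτ hb ha hN hNn (t := a / 2 - x / 16) (by
    have h1 : |a / 2 - x / 16| ≤ a + x := by
      rw [abs_le]; constructor <;> linarith
    calc (N : ℝ) * |a / 2 - x / 16| ≤ N * (a + x) := by gcongr
      _ = a * N + x * N := by ring
      _ ≤ 3 := by linarith)
  have hhigh := h.abs_polynomial_sub_le hδ hτ hb ha hN hNn (t := 2 * a + x) (by
    rw [abs_of_nonneg (by linarith)]
    calc (N : ℝ) * (2 * a + x) = 2 * (a * N) + x * N := by ring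
      _ ≤ 3 := by linarith)
  rw [← hZ, ← hY, ← hx] at hlow hhigh
  have hl : |a / 2 - x / 16| ≤ a + x := by
    rw [abs_le]; constructor <;> linarith
  have hlow' : Φ (1 + (a / 2 - x / 16)) ≤ 1 := by
    have h1 := (abs_le.1 hlow).2
    have h2 : b * Y * (x + a + |a / 2 - x / 16|) ≤ 1 / 1000 * (2 * x + 2 * a) := by
      refine mul_le_mul hbY (by linarith) (by positivity) (by norm_num)
    have h3 : (1 - a) * (a / 2 - x / 16) ≤ a / 2 - 3 / 64 * x := by nlinarith
    have h4 : z * (1 - a) * (a / 2 - x / 16) ≤ z * (a / 2 - 3 / 64 * x) := by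
      rw [mul_assoc]; exact mul_le_mul_of_nonneg_left h3 (by linarith)
    have h5 : z * (-(a / 2) - 3 / 64 * x) ≤ (999 / 1000) * (-(a / 2) - 3 / 64 * x) :=
      mul_le_mul_of_nonpos_right (by linarith) (by linarith)
    simp only [hΦ]
    nlinarith
  have hhigh' : 1 ≤ Φ (1 + (2 * a + x)) := by
    have h1 := (abs_le.1 hhigh).1
    rw [abs_of_nonneg (by linarith : 0 ≤ 2 * a + x)] at h1
    have h2 : b * Y * (x + a + (2 * a + x)) ≤ 1 / 1000 * (2 * x + 3 * a) := by
      refine mul_le_mul hbY (by linarith) (by positivity) (by norm_num)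
    have h3 : 3 / 4 * (2 * a + x) ≤ (1 - a) * (2 * a + x) := by gcongr; linarith
    have h4 : z * (3 / 4 * (2 * a + x)) ≤ z * (1 - a) * (2 * a + x) := by
      rw [mul_assoc]; exact mul_le_mul_of_nonneg_left h3 (by linarith)
    have h5 : (999 / 1000) * (a / 2 + 3 / 4 * x) ≤ z * (a / 2 + 3 / 4 * x) :=
      mul_le_mul_of_nonneg_right (by linarith) (by linarith)
    simp only [hΦ]
    nlinarith
  obtain ⟨s, hs, hs1⟩ := intermediate_value_Icc (by linarith) hcont ⟨hlow', hhigh'⟩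
  have hs0 : 0 ≤ s := by
    have : x ≤ 1 := by rw [hx, div_le_one (by linarith)]; exact hN0
    linarith [hs.1]
  have hpow : ∀ j ≤ N, s ^ j ≤ Real.exp 3 := by
    intro j hj
    have hjN : (j : ℝ) ≤ N := by exact_mod_cast hj
    calc s ^ j ≤ (Real.exp (2 * a + x)) ^ j := by
          gcongr
          linarith [hs.2, Real.add_one_le_exp (2 * a + x)]
      _ = Real.exp (j * (2 * a + x)) := by rw [Real.exp_nat_mul]
      _ ≤ Real.exp 3 := by
          refine Real.exp_le_exp.2 ?_
          calc (j : ℝ) * (2 * a + x) ≤ N * (2 * a + x) := by gcongr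
            _ = 2 * (a * N) + x * N := by ring
            _ ≤ 3 := by linarith
  refine ⟨s, by rw [hx16]; linarith [hs.1], by linarith [hs.2], hs1, hpow, ?_⟩
  calc _ ≤ ∑ m ∈ Finset.Icc 2 N, b * Real.exp 3 * (m : ℝ) ^ (1 + δ - τ) := by
        refine Finset.sum_le_sum fun m hm => ?_
        rw [Finset.mem_Icc] at hm
        have hm0 : (0 : ℝ) < m := by exact_mod_cast (by omega : 0 < m)
        rw [abs_mul, abs_of_nonneg (pow_nonneg hs0 m)]
        calc _ ≤ b * (m : ℝ) ^ (-τ) * Real.exp 3 * (m : ℝ) ^ (1 + δ) := by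
              gcongr
              · exact h.abs_g m hm.1 (hm.2.trans hNn)
              · exact hpow m hm.2
          _ = _ := by
              rw [show 1 + δ - τ = -τ + (1 + δ) by ring, Real.rpow_add hm0 (-τ) (1 + δ)]; ring
    _ ≤ b * Real.exp 3 * Z := by
        rw [← Finset.mul_sum]
        exact mul_le_mul_of_nonneg_left (sum_rpow_le_zetaSum hτ le_rfl N) (by positivity)
    _ ≤ 1 / 2 := by
        have : b * Real.exp 3 * Z ≤ b * Y := by rw [hY]; nlinarith
        linarith

end

theorem inv_pow_le_two {s : ℝ} {n : ℕ} (hn : 1 ≤ n) (hs : 1 - 1 / (16 * (n : ℝ)) ≤ s) :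
    (s ^ n)⁻¹ ≤ 2 := by
  have hn0 : (1 : ℝ) ≤ n := by exact_mod_cast hn
  have h16 : 1 / (16 * (n : ℝ)) ≤ 1 / 16 := by
    rw [div_le_div_iff₀ (by positivity) (by norm_num)]; linarith
  have hs0 : 0 < s := by linarith
  have h1 : 1 / 2 ≤ s ^ n := by
    calc (1 : ℝ) / 2 ≤ 1 + n * (s - 1) := by
          have : (n : ℝ) * (1 / (16 * n)) = 1 / 16 := by field_simp
          nlinarith
      _ ≤ (1 + (s - 1)) ^ n := one_add_mul_le_pow (by linarith) n
      _ = s ^ n := by ring_nf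
  rw [inv_le_comm₀ (by positivity) two_pos]
  linarith

/-- The truncation level `⌊1/a⌋` and its elementary properties. -/
theorem floor_inv_bounds {a : ℝ} (ha : 0 < a) (ha1 : a ≤ 1) :
    1 ≤ ⌊1 / a⌋₊ ∧ a * (⌊1 / a⌋₊ : ℝ) ≤ 1 ∧ 1 ≤ a * ((⌊1 / a⌋₊ : ℝ) + 1)
      ∧ 1 / (16 * (⌊1 / a⌋₊ : ℝ)) ≤ a / 8 ∧ 1 / (⌊1 / a⌋₊ : ℝ) ≤ 2 * a := by
  have h1 : 1 ≤ 1 / a := by rw [le_div_iff₀ ha]; linarith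
  have hN : 1 ≤ ⌊1 / a⌋₊ := Nat.le_floor (by exact_mod_cast h1)
  have hN0 : (1 : ℝ) ≤ (⌊1 / a⌋₊ : ℝ) := by exact_mod_cast hN
  have h2 : a * (⌊1 / a⌋₊ : ℝ) ≤ 1 := by
    have := Nat.floor_le (by positivity : 0 ≤ 1 / a)
    rw [le_div_iff₀ ha] at this
    linarith
  have h3 : 1 ≤ a * ((⌊1 / a⌋₊ : ℝ) + 1) := by
    have := (Nat.lt_floor_add_one (1 / a)).le
    rw [div_le_iff₀ ha] at this
    linarith
  have h4 : 1 ≤ 2 * a * (⌊1 / a⌋₊ : ℝ) := by nlinarith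
  refine ⟨hN, h2, h3, ?_, ?_⟩
  · rw [div_le_iff₀ (by positivity)]; linarith
  · rw [div_le_iff₀ (by positivity)]; linarith

theorem exp_le_one_add {x : ℝ} (h0 : 0 ≤ x) (h1 : x ≤ 1 / 2) : Real.exp x ≤ 1 + 3 / 2 * x := by
  have := (abs_le.1 (Real.abs_exp_sub_one_sub_id_le (x := x)
    (by rw [abs_of_nonneg h0]; linarith))).2
  nlinarith

set_option maxHeartbeats 1000000 in
/-- The pointwise bound on the solution of a near-critical recursion, uniformly in `a`. -/
theorem NearCritical.exists_bound {τ δ η : ℝ} (hδ : 0 ≤ δ) (hτ : 2 + δ < τ) (hη : 0 < η) :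
    ∃ C c b₀ : ℝ, 1 ≤ C ∧ 0 < c ∧ 0 < b₀ ∧ b₀ ≤ 1 ∧ ∀ (b a z : ℝ) (n₁ : ℕ) (g₀ g e₀ e f : ℕ → ℝ),
      NearCritical τ δ b a z n₁ g₀ g e₀ e → 0 ≤ b → b ≤ b₀ → 0 ≤ a → a < 2 - η →
      (∀ n, f n = ∑ m ∈ Finset.Icc 1 n, g m * f (n - m) + e n) →
      ∀ n ≤ n₁, |f n| ≤ C ∧
        |f n| ≤ C * Real.exp (-(c * n * a)) + C * b * (a ^ 2)⁻¹ * (n : ℝ) ^ (-τ) := by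
  obtain ⟨Cp, bp, hCp, hbp, hpert⟩ := exists_perturbation_bound (τ := τ) (by linarith)
  obtain ⟨br, hbr, hroot⟩ := NearCritical.exists_root hδ hτ
  set Z := zetaSum (τ - 1 - δ) with hZ
  have hZ0 : 0 ≤ Z := zetaSum_nonneg _
  set Z' := zetaSum τ with hZ'
  have hZ'0 : 0 ≤ Z' := zetaSum_nonneg _
  set q : ℝ := min (1 / 4) η with hq
  have hq0 : 0 < q := lt_min (by norm_num) hη
  have hq4 : q ≤ 1 / 4 := min_le_left _ _
  have hqη : q ≤ η := min_le_right _ _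
  set Y := 1 + Real.exp 4 * Z + Real.exp 4 * Z' with hY
  have hY1 : 1 ≤ Y := by
    have h1 : 0 ≤ Real.exp 4 * Z := by positivity
    have h2 : 0 ≤ Real.exp 4 * Z' := by positivity
    linarith
  -- 24 = 8 · 3: where the exponent is at most 1 the solution is at most 8, and e^{-1} ≥ 1/3. The
  -- second entry converts r⁻² into a⁻², the worst case being r = q with a ≤ 2. The last bound on b
  -- makes the kernel mass beyond m = 1 at most q/4.
  refine ⟨max 24 (Cp * (4 / q ^ 2)), q / 8, min (min bp br) (q / (4 * Y)),
    le_trans (by norm_num) (le_max_left _ _), by positivity,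
    lt_min (lt_min hbp hbr) (by positivity), ?_, ?_⟩
  · refine (min_le_right _ _).trans ?_
    rw [div_le_one (by positivity)]
    linarith
  intro b a z n₁ g₀ g e₀ e f h hb hbb ha haη hf n hn
  have hbp' : b ≤ bp := hbb.trans ((min_le_left _ _).trans (min_le_left _ _))
  have hbr' : b ≤ br := hbb.trans ((min_le_left _ _).trans (min_le_right _ _))
  have hbY : b * Y ≤ q / 4 := by
    have := hbb.trans (min_le_right _ _)
    rw [le_div_iff₀ (by positivity)] at this
    linarith
  have hbZ : b * (Real.exp 4 * Z) ≤ q / 4 := by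
    refine le_trans (mul_le_mul_of_nonneg_left ?_ hb) hbY
    have : 0 ≤ Real.exp 4 * Z' := by positivity
    linarith
  have hbZ' : b * (Real.exp 4 * Z') ≤ q / 4 := by
    refine le_trans (mul_le_mul_of_nonneg_left ?_ hb) hbY
    have : 0 ≤ Real.exp 4 * Z := by positivity
    linarith
  have hb4 : b ≤ q / 4 := le_trans (le_mul_of_one_le_right hb hY1) hbY
  set C := max 24 (Cp * (4 / q ^ 2)) with hC
  have hC24 : 24 ≤ C := le_max_left _ _
  have hCC : Cp * (4 / q ^ 2) ≤ C := le_max_right _ _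
  have hCCp : Cp ≤ C := by
    refine le_trans (le_mul_of_one_le_right (by linarith) ?_) hCC
    rw [one_le_div (by positivity)]
    nlinarith
  have ha2 : a ≤ 2 := by linarith
  have hexp3 : Real.exp 1 ≤ 3 := by linarith [Real.exp_one_lt_d9]
  have hext : 0 ≤ C * b * (a ^ 2)⁻¹ * (n : ℝ) ^ (-τ) := by positivity
  -- a bounded solution at small `n * a`
  have hsmall : ∀ B : ℝ, |f n| ≤ B → B ≤ 8 → q / 8 * n * a ≤ 1 →
      |f n| ≤ C ∧ |f n| ≤ C * Real.exp (-(q / 8 * n * a))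
        + C * b * (a ^ 2)⁻¹ * (n : ℝ) ^ (-τ) := by
    intro B hB hB8 hx
    refine ⟨by linarith, ?_⟩
    have h1 : Real.exp (-1) ≤ Real.exp (-(q / 8 * n * a)) := Real.exp_le_exp.2 (by linarith)
    have h2 : 1 / 3 ≤ Real.exp (-1) := by
      rw [Real.exp_neg, one_div]
      gcongr
    have h3 : 24 * (1 / 3) ≤ C * Real.exp (-(q / 8 * n * a)) :=
      mul_le_mul hC24 (h2.trans h1) (by norm_num) (by linarith)
    linarith
  rcases Nat.eq_zero_or_pos n with rfl | hn0
  · have hf0 : f 0 = 1 := by rw [hf 0, h.e_zero]; simp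
    exact hsmall 1 (by rw [hf0, abs_one]) (by norm_num) (by simp)
  have hn1 : (1 : ℝ) ≤ n := by exact_mod_cast hn0
  have hmain : ∀ (s B : ℝ) (N k : ℕ), N ≤ n₁ → 0 ≤ s → (∀ j ≤ N, s ^ j ≤ Real.exp 4) →
      (∀ n, |resolvent (fun m => g m * s ^ m) N n| ≤ B) → B ≤ 3 →
      |mainPart g e s N k| ≤ 4 := by
    intro s B N k hN hs0 hs hV hB
    have h1 := abs_mainPart_le (n := k) (by linarith : 1 < τ) hb hs0 h.e_zero h.e_one hs
      (fun m h2 hm => h.abs_e m h2 (hm.trans hN)) fun n => (hV n).trans hB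
    rw [← hZ'] at h1
    linarith
  have hge : ∀ m, 2 ≤ m → m ≤ n₁ → |g m| ≤ b * (m : ℝ) ^ (-τ) ∧ |e m| ≤ b * (m : ℝ) ^ (-τ) :=
    fun m h2 hm => ⟨h.abs_g m h2 hm, h.abs_e m h2 hm⟩
  -- the final estimate from the perturbation bound
  have hlarge : ∀ (r s : ℝ) (N : ℕ), 0 < r → r ≤ 1 → 1 ≤ N → 1 ≤ r * ((N : ℝ) + 1) →
      Real.exp (r / 4) ≤ s → s ^ N ≤ Real.exp 4 →
      (∀ n, |resolvent (fun m => g m * s ^ m) N n| ≤ 3) → N ≤ n →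
      q / 8 * a ≤ r / 4 → (r ^ 2)⁻¹ ≤ 4 / q ^ 2 * (a ^ 2)⁻¹ →
      |f n| ≤ C ∧ |f n| ≤ C * Real.exp (-(q / 8 * n * a))
        + C * b * (a ^ 2)⁻¹ * (n : ℝ) ^ (-τ) := by
    intro r s N hr hr1 hN hrN hs hsN hV hNn hqr hra
    obtain ⟨h1, h2⟩ := hpert r s b N n₁ g e f hr hr1 hN hrN hs hsN hb hbp' hf h.e_zero h.e_one
      hge hV n hn
    obtain ⟨h3, h4⟩ := h2 hNn
    constructor
    · refine h1.trans ?_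
      have : (1 + r * (n : ℝ)) ^ (-τ) ≤ 1 :=
        Real.rpow_le_one_of_one_le_of_nonpos
          (by have : 0 ≤ r * (n : ℝ) := by positivity
              linarith) (by linarith)
      calc Cp * (1 + r * (n : ℝ)) ^ (-τ) ≤ Cp * 1 := by gcongr
        _ ≤ C := by linarith
    · have hs0 : 0 < s := (Real.exp_pos _).trans_le hs
      have h5 : |mainPart g e s N n / s ^ n| ≤ C * Real.exp (-(q / 8 * n * a)) := by
        rw [abs_div, abs_of_pos (pow_pos hs0 n), div_eq_mul_inv]
        refine mul_le_mul (by linarith) ?_ (by positivity) (by linarith)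
        rw [Real.exp_neg]
        gcongr
        calc Real.exp (q / 8 * n * a) ≤ Real.exp (n * (r / 4)) := by
              refine Real.exp_le_exp.2 ?_
              nlinarith
          _ = Real.exp (r / 4) ^ n := by rw [Real.exp_nat_mul]
          _ ≤ s ^ n := by gcongr
      have h6 : Cp * b * (r ^ 2)⁻¹ * (n : ℝ) ^ (-τ) ≤ C * b * (a ^ 2)⁻¹ * (n : ℝ) ^ (-τ) := by
        refine mul_le_mul_of_nonneg_right ?_ (by positivity)
        calc Cp * b * (r ^ 2)⁻¹ ≤ Cp * b * (4 / q ^ 2 * (a ^ 2)⁻¹) := by gcongr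
          _ = (Cp * (4 / q ^ 2)) * b * (a ^ 2)⁻¹ := by ring
          _ ≤ _ := by gcongr
      have h7 : f n = mainPart g e s N n / s ^ n + (f n - mainPart g e s N n / s ^ n) := by ring
      rw [h7]
      exact (abs_add_le _ _).trans (add_le_add h5 (h3.trans h6))
  -- Three regimes. For a ≤ 1/4 and an ≤ 1 the truncation is at n itself and nothing is discarded.
  -- For a ≤ 1/4 and an > 1 it is at ⌊1/a⌋, with the root as tilt. For a > 1/4 the kernel is
  -- uniformly subcritical, and a fixed tilt e^{q/4} with the fixed level ⌊1/q⌋ is enough.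
  rcases le_or_gt a (1 / 4) with ha4 | ha4
  · rcases le_or_gt (a * n) 1 with hna | hna
    · obtain ⟨s, hs⟩ := hroot b a z n₁ g₀ g e₀ e h hb hbr' ha ha4 n hn0 hn hna
      have hs0 := hs.pos ha hn0
      have h1 := hmain s 3 n n hn hs0.le
        (fun j hj => (hs.pow_le j hj).trans (Real.exp_le_exp.2 (by norm_num)))
        (hs.abs_resolvent_le hδ hn0) le_rfl
      rw [← eq_mainPart_self hf n, abs_mul, abs_of_pos (pow_pos hs0 n)] at h1
      have h4 : 1 / 2 ≤ s ^ n := by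
        have := inv_pow_le_two (s := s) hn0 (by linarith [hs.le])
        rwa [inv_le_comm₀ (pow_pos hs0 n) two_pos, inv_eq_one_div] at this
      refine hsmall 8 ?_ le_rfl ?_
      · have := mul_le_mul_of_nonneg_left h4 (abs_nonneg (f n))
        linarith
      · have : q / 8 * n * a = q / 8 * (a * n) := by ring
        rw [this]
        nlinarith
    · have ha0 : 0 < a := by
        rcases ha.eq_or_lt with h0 | h0
        · rw [← h0] at hna; norm_num at hna
        · exact h0
      obtain ⟨hN1, hN2, hN3, hN4, hN5⟩ := floor_inv_bounds ha0 (by linarith)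
      set N := ⌊1 / a⌋₊ with hN
      have hNn : N ≤ n := by
        have : (N : ℝ) ≤ n := by
          by_contra hcon
          push Not at hcon
          have : a * n < a * N := by gcongr
          linarith
        exact_mod_cast this
      obtain ⟨s, hs⟩ := hroot b a z n₁ g₀ g e₀ e h hb hbr' ha ha4 N hN1 (hNn.trans hn) hN2
      refine hlarge a s N ha0 (by linarith) hN1 hN3 ?_ ?_ (hs.abs_resolvent_le hδ hN1) hNn ?_ ?_
      -- The root is at least 1 + a/2 - a/8, and e^{a/4} ≤ 1 + 3a/8. This fixes the constant 16 in
      -- `IsRoot`.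
      · have := exp_le_one_add (x := a / 4) (by positivity) (by linarith)
        linarith [hs.le]
      · exact (hs.pow_le N le_rfl).trans (Real.exp_le_exp.2 (by norm_num))
      · nlinarith
      · refine le_mul_of_one_le_left (by positivity) ?_
        rw [one_le_div (by positivity)]
        nlinarith
  · obtain ⟨hN1, hN2, hN3, hN4, hN5⟩ := floor_inv_bounds hq0 (by linarith)
    set N := ⌊1 / q⌋₊ with hN
    set s := Real.exp (q / 4) with hs
    have hs1 : s ≤ 1 + q / 2 := by
      have := exp_le_one_add (x := q / 4) (by positivity) (by linarith)
      linarith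
    have hs0 : 0 < s := Real.exp_pos _
    have hspow : ∀ j ≤ N, s ^ j ≤ Real.exp 4 := by
      intro j hj
      have hjN : (j : ℝ) ≤ N := by exact_mod_cast hj
      rw [hs, ← Real.exp_nat_mul]
      refine Real.exp_le_exp.2 ?_
      nlinarith
    -- The upper bound a < 2 - η enters here: together with a > 1/4 it gives |1 - a| ≤ 1 - q. The
    -- first step then has tilted mass at most (1 + q/4)(1 - q)(1 + q/2) ≤ 1 - q/4, and all later
    -- steps have mass at most q/4.
    have hV : ∀ K ≤ N, 1 ≤ K → K ≤ n₁ → ∀ n, |resolvent (fun m => g m * s ^ m) K n| ≤ 1 := by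
      intro K hKN hK1 hKn
      refine abs_resolvent_le_one ?_
      rw [sum_Icc_one_eq_add hK1]
      have h1 : |g 1 * s ^ 1| ≤ 1 - q / 4 := by
        rw [pow_one, h.g_one, abs_mul, abs_mul, abs_of_pos hs0]
        have hz : |z| ≤ 1 + q / 4 := by
          have h1 := abs_le.1 (h.abs_z.trans hb4)
          rw [abs_le]; constructor <;> linarith
        have ha' : |1 - a| ≤ 1 - q := by rw [abs_le]; constructor <;> linarith
        calc |z| * |1 - a| * s ≤ (1 + q / 4) * (1 - q) * (1 + q / 2) := by
              gcongr
              exact mul_nonneg (by linarith) (by linarith)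
          _ ≤ _ := by nlinarith [mul_pos hq0 hq0, mul_pos (mul_pos hq0 hq0) hq0]
      have h2 : ∑ m ∈ Finset.Icc 2 K, |g m * s ^ m| ≤ b * (Real.exp 4 * Z) := by
        calc _ ≤ ∑ m ∈ Finset.Icc 2 K, b * Real.exp 4 * (m : ℝ) ^ (-τ) := by
              refine Finset.sum_le_sum fun m hm => ?_
              rw [Finset.mem_Icc] at hm
              rw [abs_mul, abs_of_pos (pow_pos hs0 m)]
              calc _ ≤ b * (m : ℝ) ^ (-τ) * Real.exp 4 := by
                    gcongr
                    · exact h.abs_g m hm.1 (hm.2.trans hKn)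
                    · exact hspow m (hm.2.trans hKN)
                _ = _ := by ring
          _ ≤ b * Real.exp 4 * Z := by
              rw [← Finset.mul_sum]
              exact mul_le_mul_of_nonneg_left (sum_rpow_le_zetaSum hτ (by linarith) K)
                (by positivity)
          _ = _ := by ring
      linarith
    rcases le_or_gt n N with hnN | hnN
    · have h1 := hmain s 1 n n hn hs0.le (fun j hj => hspow j (hj.trans hnN))
        (hV n hnN hn0 hn) (by norm_num)
      rw [← eq_mainPart_self hf n, abs_mul, abs_of_pos (pow_pos hs0 n)] at h1
      have h4 : 1 ≤ s ^ n := one_le_pow₀ (Real.one_le_exp (by positivity))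
      refine hsmall 8 ?_ le_rfl ?_
      · have := mul_le_mul_of_nonneg_left h4 (abs_nonneg (f n))
        linarith
      · have : (n : ℝ) ≤ N := by exact_mod_cast hnN
        calc q / 8 * n * a ≤ q / 8 * N * 2 := by gcongr
          _ ≤ 1 := by linarith
    · refine hlarge q s N hq0 (by linarith) hN1 hN3 le_rfl (hspow N le_rfl)
        (fun k => (hV N le_rfl hN1 (hnN.le.trans hn) k).trans (by norm_num)) hnN.le ?_ ?_
      · nlinarith
      · have ha0 : 0 < a := by linarith
        rw [div_mul_eq_mul_div, inv_eq_one_div, div_le_div_iff_of_pos_right (by positivity),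
          ← div_eq_mul_inv, one_le_div (by positivity)]
        nlinarith

/-- The solution at `a` differs from the solution at `0` by at most `C n a`. -/
theorem NearCritical.exists_diff_bound {τ δ η : ℝ} (hδ : 0 ≤ δ) (hτ : 2 + δ < τ) (hη : 0 < η) :
    ∃ C b₀ : ℝ, 1 ≤ C ∧ 0 < b₀ ∧ ∀ (b a z : ℝ) (n₁ : ℕ) (g₀ g e₀ e f₀ f : ℕ → ℝ),
      NearCritical τ δ b a z n₁ g₀ g e₀ e → 0 ≤ b → b ≤ b₀ → 0 ≤ a → a < 2 - η →
      (∀ n, f n = ∑ m ∈ Finset.Icc 1 n, g m * f (n - m) + e n) →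
      (∀ n, f₀ n = ∑ m ∈ Finset.Icc 1 n, g₀ m * f₀ (n - m) + e₀ n) →
      ∀ n ≤ n₁, |f n - f₀ n| ≤ C * n * a := by
  obtain ⟨C, c, bB, hC, hc, hbB, hbB1, hbound⟩ := NearCritical.exists_bound hδ hτ hη
  obtain ⟨br, hbr, hroot⟩ := NearCritical.exists_root hδ hτ
  set Z := zetaSum (τ - 1 - δ) with hZ
  have hZ0 : 0 ≤ Z := zetaSum_nonneg _
  refine ⟨6 * Real.exp 3 * (2 * C + Z * C + 1), min bB br, ?_, lt_min hbB hbr, ?_⟩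
  · have h1 : 1 ≤ Real.exp 3 := Real.one_le_exp (by norm_num)
    have h2 : 0 ≤ Z * C := by positivity
    nlinarith
  intro b a z n₁ g₀ g e₀ e f₀ f h hb hbb ha haη hf hf₀ n hn
  have hbB' := hbb.trans (min_le_left _ _)
  have hbr' := hbb.trans (min_le_right _ _)
  have hb1 : b ≤ 1 := hbB'.trans hbB1
  rcases Nat.eq_zero_or_pos n with rfl | hn0
  · rw [hf 0, hf₀ 0, h.e_zero, h.e₀_zero]; simp
  obtain ⟨s, hs⟩ := hroot b 0 z n₁ g₀ g₀ e₀ e₀ h.zero hb hbr' le_rfl (by norm_num) n hn0 hn (by simp)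
  have hs0 := hs.pos le_rfl hn0
  -- The difference of the two solutions obeys the recursion at k = 0 with source w, and w = O(a)
  -- because f is bounded. The resolvent tilted by the root at a = 0 is bounded, and s^n is bounded
  -- above and below. The sources at 1, …, n therefore add up to O(na), the one at 0 being zero.
  set u : ℕ → ℝ := fun n => f n - f₀ n with hu
  set w : ℕ → ℝ := fun n => ∑ m ∈ Finset.Icc 1 n, (g m - g₀ m) * f (n - m) + (e n - e₀ n) with hw
  have hrec : ∀ n, u n = ∑ m ∈ Finset.Icc 1 n, g₀ m * u (n - m) + w n := by
    intro n
    simp only [hu, hw]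
    rw [hf n, hf₀ n, ← add_assoc, ← Finset.sum_add_distrib]
    have : ∑ m ∈ Finset.Icc 1 n, (g₀ m * (f (n - m) - f₀ (n - m)) + (g m - g₀ m) * f (n - m))
        = ∑ m ∈ Finset.Icc 1 n, g m * f (n - m) - ∑ m ∈ Finset.Icc 1 n, g₀ m * f₀ (n - m) := by
      rw [← Finset.sum_sub_distrib]
      exact Finset.sum_congr rfl fun m _ => by ring
    rw [this]; ring
  have hwb : ∀ j, j ≤ n → |w j| ≤ (2 * C + Z * C + 1) * a := by
    intro j hj
    rcases Nat.eq_zero_or_pos j with rfl | hj0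
    · simp [hw, h.e_zero, h.e₀_zero]; positivity
    have hfb : ∀ i, i ≤ n → |f i| ≤ C := fun i hi =>
      (hbound b a z n₁ g₀ g e₀ e f h hb hbB' ha haη hf i (hi.trans hn)).1
    have h1 : |∑ m ∈ Finset.Icc 1 j, (g m - g₀ m) * f (j - m)| ≤ 2 * C * a + Z * C * a := by
      rw [sum_Icc_one_eq_add hj0]
      have hz : |z| ≤ 2 := by
        have := abs_le.1 (h.abs_z.trans hb1)
        rw [abs_le]; constructor <;> linarith
      refine (abs_add_le _ _).trans (add_le_add ?_ ?_)
      · rw [h.g_one, h.g₀_one, abs_mul, show z * (1 - a) - z = -(z * a) by ring, abs_neg, abs_mul,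
          abs_of_nonneg ha]
        calc |z| * a * |f (j - 1)| ≤ 2 * a * C := by
              gcongr
              exact hfb _ (by omega)
          _ = _ := by ring
      · have := abs_sum_le_mul_zetaSum hτ (p := 1 - τ) (c := b * a * C) (by linarith)
          (by positivity) (N := j) (u := fun m => (g m - g₀ m) * f (j - m)) fun m h2 hm => by
            rw [abs_mul]
            calc _ ≤ b * a * (m : ℝ) ^ (1 - τ) * C :=
                  mul_le_mul (h.abs_g_sub m h2 (by omega)) (hfb _ (by omega)) (abs_nonneg _)
                    (by positivity)
              _ = _ := by ring
        refine this.trans ?_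
        rw [← hZ]
        calc b * a * C * Z ≤ 1 * a * C * Z := by gcongr
          _ = _ := by ring
    have h2 : |e j - e₀ j| ≤ a := by
      rcases Nat.lt_or_ge j 2 with hj2 | hj2
      · have : j = 1 := by omega
        subst this
        rw [h.e_one, h.e₀_one]; simpa using ha
      · refine (h.abs_e_sub j hj2 (by omega)).trans ?_
        have : (j : ℝ) ^ (1 - τ) ≤ 1 :=
          Real.rpow_le_one_of_one_le_of_nonpos (by exact_mod_cast hj0) (by linarith)
        calc b * a * (j : ℝ) ^ (1 - τ) ≤ 1 * a * 1 := by gcongr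
          _ = a := by ring
    calc |w j| ≤ _ := abs_add_le _ _
      _ ≤ (2 * C * a + Z * C * a) + a := add_le_add h1 h2
      _ = _ := by ring
  have hw0 : w 0 = 0 := by simp [hw, h.e_zero, h.e₀_zero]
  have h1 : |u n * s ^ n| ≤ n * (3 * (Real.exp 3 * ((2 * C + Z * C + 1) * a))) := by
    rw [eq_mainPart_self hrec n, mainPart, Finset.sum_range_succ', hw0]
    simp only [mul_zero, add_zero]
    refine (Finset.abs_sum_le_sum_abs _ _).trans ?_
    calc _ ≤ ∑ j ∈ Finset.range n, 3 * (Real.exp 3 * ((2 * C + Z * C + 1) * a)) := by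
          refine Finset.sum_le_sum fun j hj => ?_
          rw [Finset.mem_range] at hj
          rw [abs_mul, abs_mul, abs_of_pos (pow_pos hs0 _)]
          gcongr
          · exact hs.abs_resolvent_le hδ hn0 _
          · exact hs.pow_le _ (by omega)
          · exact hwb _ (by omega)
      _ = _ := by rw [Finset.sum_const, Finset.card_range, nsmul_eq_mul]
  have h2 : (s ^ n)⁻¹ ≤ 2 := inv_pow_le_two hn0 (by linarith [hs.le])
  have h3 : |u n| = |u n * s ^ n| * (s ^ n)⁻¹ := by
    rw [abs_mul, abs_of_pos (pow_pos hs0 n)]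
    field_simp
  change |u n| ≤ _
  rw [h3]
  calc _ ≤ (n * (3 * (Real.exp 3 * ((2 * C + Z * C + 1) * a)))) * 2 := by gcongr
    _ = _ := by ring

/-! ### Asymptotics at criticality -/

theorem sum_Icc_eq_sum_range_succ (u : ℕ → ℝ) (N : ℕ) :
    ∑ m ∈ Finset.Icc 1 N, u m = ∑ j ∈ Finset.range N, u (j + 1) := by
  induction N with
  | zero => simp
  | succ N ih => rw [Finset.sum_Icc_succ_top (by omega), ih, Finset.sum_range_succ]

section

variable {τ δ : ℝ}

theorem abs_sum_Icc_le (hτ : 2 + δ < τ) {p K : ℝ} (hp : p ≤ 1 + δ - τ) (hK : 0 ≤ K) {N : ℕ}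
    {u : ℕ → ℝ} (hu : ∀ m, 1 ≤ m → m ≤ N → |u m| ≤ K * (m : ℝ) ^ p) :
    |∑ m ∈ Finset.Icc 1 N, u m| ≤ K * zetaSum (τ - 1 - δ) := by
  refine (Finset.abs_sum_le_sum_abs _ _).trans (le_trans ?_ (mul_le_mul_of_nonneg_left
    (sum_rpow_neg_le (p := τ - 1 - δ) (by linarith) (Finset.Icc 1 N)) hK))
  rw [Finset.mul_sum]
  refine Finset.sum_le_sum fun m hm => ?_
  rw [Finset.mem_Icc] at hm
  refine (hu m hm.1 hm.2).trans (mul_le_mul_of_nonneg_left ?_ hK)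
  exact Real.rpow_le_rpow_of_exponent_le (by exact_mod_cast hm.1) (by linarith)

theorem summable_succ_of_le (hδ : 0 ≤ δ) (hτ : 2 + δ < τ) {K : ℝ} {u : ℕ → ℝ}
    (hu : ∀ m, 1 ≤ m → |u m| ≤ K * (m : ℝ) ^ (1 - τ)) : Summable fun j : ℕ => u (j + 1) := by
  have h1 : Summable fun j : ℕ => K * ((j + 1 : ℕ) : ℝ) ^ (-(τ - 1)) :=
    ((summable_nat_add_iff 1).2 (summable_rpow_neg (p := τ - 1) (by linarith))).mul_left K
  refine Summable.of_norm_bounded h1 fun j => ?_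
  rw [Real.norm_eq_abs, show -(τ - 1) = 1 - τ by ring]
  exact hu (j + 1) (by omega)

/-- The exponent splits as 1 - τ = -δ - (τ - 1 - δ): beyond N the first factor is at most N^{-δ},
and the second is summable since τ > 2 + δ. -/
theorem abs_sum_sub_tsum_le (hδ : 0 ≤ δ) (hτ : 2 + δ < τ) {K : ℝ} (hK : 0 ≤ K) {u : ℕ → ℝ}
    (hu : ∀ m, 1 ≤ m → |u m| ≤ K * (m : ℝ) ^ (1 - τ)) {N : ℕ} (hN : 1 ≤ N) :
    |∑ m ∈ Finset.Icc 1 N, u m - ∑' j : ℕ, u (j + 1)|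
      ≤ K * zetaSum (τ - 1 - δ) * (N : ℝ) ^ (-δ) := by
  have hlim := (summable_succ_of_le hδ hτ hu).hasSum.tendsto_sum_nat
  have hN0 : (0 : ℝ) < N := by exact_mod_cast hN
  have hM : ∀ M, N ≤ M → |∑ m ∈ Finset.Icc 1 N, u m - ∑ j ∈ Finset.range M, u (j + 1)|
      ≤ K * zetaSum (τ - 1 - δ) * (N : ℝ) ^ (-δ) := by
    intro M hNM
    have hsplit : ∑ m ∈ Finset.Icc 1 M, u m
        = ∑ m ∈ Finset.Icc 1 N, u m + ∑ m ∈ Finset.Icc (N + 1) M, u m := by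
      rw [← Finset.sum_union]
      · refine Finset.sum_congr ?_ fun _ _ => rfl
        ext m
        simp only [Finset.mem_union, Finset.mem_Icc]
        omega
      · rw [Finset.disjoint_left]
        intro m
        simp only [Finset.mem_Icc]
        omega
    rw [← sum_Icc_eq_sum_range_succ, hsplit, sub_add_cancel_left, abs_neg]
    refine (Finset.abs_sum_le_sum_abs _ _).trans ?_
    calc _ ≤ ∑ m ∈ Finset.Icc (N + 1) M, K * (N : ℝ) ^ (-δ) * (m : ℝ) ^ (-(τ - 1 - δ)) := by
          refine Finset.sum_le_sum fun m hm => ?_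
          rw [Finset.mem_Icc] at hm
          have hm0 : (0 : ℝ) < m := by exact_mod_cast (by omega : 0 < m)
          refine (hu m (by omega)).trans ?_
          rw [mul_assoc]
          refine mul_le_mul_of_nonneg_left ?_ hK
          rw [show 1 - τ = -δ + -(τ - 1 - δ) by ring, Real.rpow_add hm0]
          refine mul_le_mul_of_nonneg_right ?_ (by positivity)
          exact Real.rpow_le_rpow_of_nonpos hN0 (by exact_mod_cast (by omega : N ≤ m))
            (by linarith)
      _ ≤ K * (N : ℝ) ^ (-δ) * zetaSum (τ - 1 - δ) := by
          rw [← Finset.mul_sum]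
          exact mul_le_mul_of_nonneg_left (sum_rpow_neg_le (by linarith) _) (by positivity)
      _ = _ := by ring
  exact le_of_tendsto (hlim.const_sub _).abs (eventually_atTop.2 ⟨N, hM⟩)

/-- Bounds on the kernel and the source at criticality, with crude constants. -/
structure CriticalBounds (τ δ a : ℝ) (g₀ g e₀ e l : ℕ → ℝ) : Prop where
  abs_g₀ : ∀ m, 1 ≤ m → |g₀ m| ≤ 2 * (m : ℝ) ^ (-τ)
  abs_g : ∀ m, 1 ≤ m → |g m| ≤ 2 * (m : ℝ) ^ (-τ)
  abs_g_sub : ∀ m, 1 ≤ m → |g m - g₀ m| ≤ 4 * a ^ δ * (m : ℝ) ^ (δ - τ)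
  abs_taylor : ∀ m, 1 ≤ m → |g m - g₀ m - a * l m| ≤ 4 * a ^ (1 + δ) * (m : ℝ) ^ (1 + δ - τ)
  abs_l : ∀ m, 1 ≤ m → |l m| ≤ 2 * (m : ℝ) ^ (1 - τ)
  abs_e₀ : ∀ m, 1 ≤ m → |e₀ m| ≤ 2 * (m : ℝ) ^ (-τ)
  abs_e : ∀ m, 1 ≤ m → |e m| ≤ 2 * (m : ℝ) ^ (-τ)
  abs_e_sub : ∀ m, 1 ≤ m → |e m - e₀ m| ≤ 4 * a ^ δ * (m : ℝ) ^ (δ - τ)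
  e_zero : e 0 = 1
  crit : ∀ N, 1 ≤ N → |∑ m ∈ Finset.Icc 1 N, g₀ m - 1| ≤ 2 * (N : ℝ) ^ (-1 - δ)

/-- min(x, 2) ≤ 2 x^δ. It will turn a gain of a·m into (a·m)^δ, which stays summable after
multiplication by m^{1-τ}. -/
theorem abs_le_of_interpolation {y p x : ℝ} (hδ0 : 0 ≤ δ) (hδ : δ ≤ 1) (hp : 0 ≤ p) (hx : 0 ≤ x)
    (h1 : |y| ≤ p * x) (h2 : |y| ≤ 2 * p) : |y| ≤ 2 * p * x ^ δ := by
  rcases le_or_gt x 1 with hx1 | hx1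
  · have : x ≤ x ^ δ := by
      rcases hx.eq_or_lt with rfl | h0
      · positivity
      · nth_rewrite 1 [← Real.rpow_one x]
        exact Real.rpow_le_rpow_of_exponent_ge h0 hx1 hδ
    have h0 : 0 ≤ x ^ δ := by positivity
    nlinarith
  · have : 1 ≤ x ^ δ := Real.one_le_rpow hx1.le hδ0
    nlinarith

theorem le_mul_rpow {y B : ℝ} (hδ0 : 0 ≤ δ) (hδ : δ ≤ 1) (hy : 0 ≤ y) (hB : 1 ≤ B) (hyB : y ≤ B) :
    y ≤ B * y ^ δ := by
  rcases hy.eq_or_lt with rfl | h0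
  · positivity
  rcases le_or_gt y 1 with h1 | h1
  · have : y ≤ y ^ δ := by
      nth_rewrite 1 [← Real.rpow_one y]
      exact Real.rpow_le_rpow_of_exponent_ge h0 h1 hδ
    have h2 : 0 ≤ y ^ δ := by positivity
    nlinarith
  · have : 1 ≤ y ^ δ := Real.one_le_rpow h1.le hδ0
    nlinarith

section

variable {a c B E μ s : ℝ} {N : ℕ} {g₀ g e₀ e l : ℕ → ℝ}

theorem IsRoot.abs_sub_one_le (hs : IsRoot δ a N g s) (ha : 0 ≤ a) :
    |s - 1| ≤ 2 * a + 1 / N := by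
  have h1 : 1 / (16 * (N : ℝ)) ≤ 1 / N := by
    rcases Nat.eq_zero_or_pos N with rfl | h
    · simp
    · have : (0 : ℝ) < N := by exact_mod_cast h
      rw [div_le_div_iff₀ (by positivity) this]; linarith
  have h0 : 0 ≤ 1 / (N : ℝ) := by positivity
  rw [abs_le]
  constructor <;> linarith [hs.le, hs.ge]

theorem IsRoot.nat_mul_abs_le (hs : IsRoot δ a N g s) (ha : 0 ≤ a) (hN : 1 ≤ N) (haN : a * N ≤ 1)
    {m : ℕ} (hm : m ≤ N) : m * |s - 1| ≤ 3 := by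
  have hN0 : (0 : ℝ) < N := by exact_mod_cast hN
  have hmN : (m : ℝ) ≤ N := by exact_mod_cast hm
  calc (m : ℝ) * |s - 1| ≤ N * (2 * a + 1 / N) := by
        gcongr
        exact hs.abs_sub_one_le ha
    _ = 2 * (a * N) + 1 := by field_simp
    _ ≤ 3 := by linarith

theorem IsRoot.abs_pow_sub_one_le (hδ0 : 0 ≤ δ) (hδ : δ ≤ 1) (hs : IsRoot δ a N g s) (ha : 0 ≤ a)
    (hN : 1 ≤ N) (haN : a * N ≤ 1) {m : ℕ} (hm : m ≤ N) :
    |s ^ m - 1| ≤ 3 * Real.exp 3 * |s - 1| ^ δ * (m : ℝ) ^ δ := by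
  have h3 := hs.nat_mul_abs_le ha hN haN hm
  have h := abs_one_add_pow_sub_one_le (s - 1) m
  rw [add_sub_cancel] at h
  calc _ ≤ _ := h
    _ ≤ (3 * ((m : ℝ) * |s - 1|) ^ δ) * Real.exp 3 := by
        refine mul_le_mul (le_mul_rpow hδ0 hδ (by positivity) (by norm_num) h3)
          (Real.exp_le_exp.2 h3) (Real.exp_pos _).le (by positivity)
    _ = _ := by rw [Real.mul_rpow (by positivity) (by positivity)]; ring

theorem IsRoot.abs_pow_sub_le (hδ0 : 0 ≤ δ) (hδ : δ ≤ 1) (hs : IsRoot δ a N g s) (ha : 0 ≤ a)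
    (hN : 1 ≤ N) (haN : a * N ≤ 1) {m : ℕ} (hm : m ≤ N) :
    |s ^ m - 1 - m * (s - 1)| ≤ 3 * Real.exp 3 * (|s - 1| * |s - 1| ^ δ) * (m * (m : ℝ) ^ δ) := by
  have h3 := hs.nat_mul_abs_le ha hN haN hm
  have h := abs_one_add_pow_sub_le (s - 1) m
  rw [add_sub_cancel] at h
  calc _ ≤ _ := h
    _ ≤ (((m : ℝ) * |s - 1|) * (3 * ((m : ℝ) * |s - 1|) ^ δ)) * Real.exp 3 := by
        rw [pow_two]
        refine mul_le_mul (mul_le_mul_of_nonneg_left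
          (le_mul_rpow hδ0 hδ (by positivity) (by norm_num) h3) (by positivity))
          (Real.exp_le_exp.2 h3) (Real.exp_pos _).le (by positivity)
    _ = _ := by rw [Real.mul_rpow (by positivity) (by positivity)]; ring

/-- The setting of the expansions of the root and of the amplitude: `μ` dominates all errors. -/
structure RootScale (δ a μ : ℝ) (N : ℕ) (g : ℕ → ℝ) (s : ℝ) : Prop where
  a_nonneg : 0 ≤ a
  one_le : 1 ≤ N
  a_mul : a * N ≤ 1
  root : IsRoot δ a N g s
  a_le : a ≤ μ
  inv_le : 1 / N ≤ 2 * μ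
  le_two : μ ≤ 2

theorem RootScale.pos (h : RootScale δ a μ N g s) : 0 < μ := by
  have h1 : (0 : ℝ) < N := by exact_mod_cast h.one_le
  have h2 : 0 < 1 / (N : ℝ) := by positivity
  linarith [h.inv_le]

theorem RootScale.abs_sub_one_le (h : RootScale δ a μ N g s) : |s - 1| ≤ 4 * μ := by
  linarith [h.root.abs_sub_one_le h.a_nonneg, h.a_le, h.inv_le]

theorem RootScale.abs_sub_one_rpow_le (h : RootScale δ a μ N g s) (hδ0 : 0 ≤ δ) (hδ : δ ≤ 1) :
    |s - 1| ^ δ ≤ 4 * μ ^ δ := by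
  have hμ := h.pos
  calc _ ≤ (4 * μ) ^ δ := Real.rpow_le_rpow (abs_nonneg _) h.abs_sub_one_le hδ0
    _ = 4 ^ δ * μ ^ δ := Real.mul_rpow (by norm_num) hμ.le
    _ ≤ 4 * μ ^ δ := by
        gcongr
        calc (4 : ℝ) ^ δ ≤ 4 ^ (1 : ℝ) := Real.rpow_le_rpow_of_exponent_le (by norm_num) hδ
          _ = 4 := Real.rpow_one _

theorem RootScale.a_rpow_le (h : RootScale δ a μ N g s) (hδ0 : 0 ≤ δ) : a ^ δ ≤ μ ^ δ :=
  Real.rpow_le_rpow h.a_nonneg h.a_le hδ0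

theorem RootScale.nat_rpow_le (h : RootScale δ a μ N g s) (hδ0 : 0 ≤ δ) (hδ : δ ≤ 1) :
    (N : ℝ) ^ (-δ) ≤ 2 * μ ^ δ := by
  have hμ := h.pos
  have hN0 : (0 : ℝ) < N := by exact_mod_cast h.one_le
  rw [Real.rpow_neg hN0.le, ← Real.inv_rpow hN0.le, ← one_div]
  calc _ ≤ (2 * μ) ^ δ := Real.rpow_le_rpow (by positivity) h.inv_le hδ0
    _ = 2 ^ δ * μ ^ δ := Real.mul_rpow (by norm_num) hμ.le
    _ ≤ 2 * μ ^ δ := by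
        gcongr
        calc (2 : ℝ) ^ δ ≤ 2 ^ (1 : ℝ) := Real.rpow_le_rpow_of_exponent_le (by norm_num) hδ
          _ = 2 := Real.rpow_one _

theorem nat_mul_rpow {m : ℕ} (hm : 1 ≤ m) (p : ℝ) : (m : ℝ) * (m : ℝ) ^ p = (m : ℝ) ^ (1 + p) := by
  have hm0 : (0 : ℝ) < m := by exact_mod_cast hm
  rw [Real.rpow_add hm0, Real.rpow_one]

theorem rpow_mul_rpow {m : ℕ} (hm : 1 ≤ m) (p q : ℝ) :
    (m : ℝ) ^ p * (m : ℝ) ^ q = (m : ℝ) ^ (p + q) := by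
  have hm0 : (0 : ℝ) < m := by exact_mod_cast hm
  rw [Real.rpow_add hm0]

/-- Three sources of error, each of order μ^δ: cutting the sum at N, passing from k = 0 to k, and
tilting by s. -/
theorem CriticalBounds.abs_sum_mul_pow_sub_le (hδ0 : 0 ≤ δ) (hδ : δ ≤ 1) (hτ : 2 + δ < τ)
    (hc : ∑' j : ℕ, ((j : ℝ) + 1) * g₀ (j + 1) = c) (h : CriticalBounds τ δ a g₀ g e₀ e l)
    (hr : RootScale δ a μ N g s) :
    |∑ m ∈ Finset.Icc 1 N, (m : ℝ) * (g m * s ^ m) - c|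
      ≤ (8 + 24 * Real.exp 3) * zetaSum (τ - 1 - δ) * μ ^ δ := by
  set Z := zetaSum (τ - 1 - δ)
  have hZ0 : 0 ≤ Z := zetaSum_nonneg _
  have hμ := hr.pos
  have h1 : |∑ m ∈ Finset.Icc 1 N, (m : ℝ) * g₀ m - c| ≤ 2 * Z * (N : ℝ) ^ (-δ) := by
    have := abs_sum_sub_tsum_le hδ0 hτ (K := 2) (by norm_num) (u := fun m => (m : ℝ) * g₀ m)
      (fun m hm => by
        rw [abs_mul, Nat.abs_cast, sub_eq_add_neg, ← nat_mul_rpow hm]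
        nlinarith [h.abs_g₀ m hm, m.cast_nonneg (α := ℝ)]) hr.one_le
    rw [← hc]
    simpa using this
  have h2 : |∑ m ∈ Finset.Icc 1 N, (m : ℝ) * (g m - g₀ m)| ≤ 4 * a ^ δ * Z := by
    have := hr.a_nonneg
    refine abs_sum_Icc_le hτ (p := 1 + (δ - τ)) (by linarith) (by positivity) fun m hm _ => ?_
    rw [abs_mul, Nat.abs_cast, ← nat_mul_rpow hm]
    nlinarith [h.abs_g_sub m hm, m.cast_nonneg (α := ℝ)]
  have h3 : |∑ m ∈ Finset.Icc 1 N, (m : ℝ) * (g m * (s ^ m - 1))|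
      ≤ 6 * Real.exp 3 * |s - 1| ^ δ * Z := by
    refine abs_sum_Icc_le hτ (p := 1 + (-τ + δ)) (by linarith) (by positivity) fun m hm hmN => ?_
    rw [abs_mul, abs_mul, Nat.abs_cast, ← nat_mul_rpow hm, ← rpow_mul_rpow hm]
    calc (m : ℝ) * (|g m| * |s ^ m - 1|)
        ≤ m * ((2 * (m : ℝ) ^ (-τ)) * (3 * Real.exp 3 * |s - 1| ^ δ * (m : ℝ) ^ δ)) := by
          gcongr
          · exact h.abs_g m hm
          · exact hr.root.abs_pow_sub_one_le hδ0 hδ hr.a_nonneg hr.one_le hr.a_mul hmN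
      _ = _ := by ring
  have hsplit : ∑ m ∈ Finset.Icc 1 N, (m : ℝ) * (g m * s ^ m) - c
      = (∑ m ∈ Finset.Icc 1 N, (m : ℝ) * g₀ m - c) + ∑ m ∈ Finset.Icc 1 N, (m : ℝ) * (g m - g₀ m)
        + ∑ m ∈ Finset.Icc 1 N, (m : ℝ) * (g m * (s ^ m - 1)) := by
    have : ∑ m ∈ Finset.Icc 1 N, (m : ℝ) * (g m * s ^ m) = ∑ m ∈ Finset.Icc 1 N, (m : ℝ) * g₀ m
        + ∑ m ∈ Finset.Icc 1 N, (m : ℝ) * (g m - g₀ m)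
        + ∑ m ∈ Finset.Icc 1 N, (m : ℝ) * (g m * (s ^ m - 1)) := by
      rw [← Finset.sum_add_distrib, ← Finset.sum_add_distrib]
      exact Finset.sum_congr rfl fun m _ => by ring
    rw [this]; ring
  rw [hsplit]
  calc _ ≤ _ := abs_add_three _ _ _
    _ ≤ 2 * Z * (2 * μ ^ δ) + 4 * μ ^ δ * Z + 6 * Real.exp 3 * (4 * μ ^ δ) * Z := by
        refine add_le_add (add_le_add (h1.trans ?_) (h2.trans ?_)) (h3.trans ?_)
        · gcongr; exact hr.nat_rpow_le hδ0 hδ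
        · have := hr.a_rpow_le hδ0
          gcongr ?_ * _; linarith
        · gcongr; exact hr.abs_sub_one_rpow_le hδ0 hδ
    _ = _ := by ring

theorem CriticalBounds.abs_sum_source_sub_le (hδ0 : 0 ≤ δ) (hδ : δ ≤ 1) (hτ : 2 + δ < τ)
    (hE : 1 + ∑' j : ℕ, e₀ (j + 1) = E) (h : CriticalBounds τ δ a g₀ g e₀ e l)
    (hr : RootScale δ a μ N g s) :
    |∑ j ∈ Finset.range (N + 1), s ^ j * e j - E|
      ≤ (8 + 24 * Real.exp 3) * zetaSum (τ - 1 - δ) * μ ^ δ := by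
  set Z := zetaSum (τ - 1 - δ)
  have hZ0 : 0 ≤ Z := zetaSum_nonneg _
  have hμ := hr.pos
  have h1 : |∑ m ∈ Finset.Icc 1 N, e₀ m - ∑' j : ℕ, e₀ (j + 1)| ≤ 2 * Z * (N : ℝ) ^ (-δ) := by
    refine abs_sum_sub_tsum_le hδ0 hτ (K := 2) (by norm_num) (fun m hm => ?_) hr.one_le
    refine (h.abs_e₀ m hm).trans (mul_le_mul_of_nonneg_left ?_ (by norm_num))
    exact Real.rpow_le_rpow_of_exponent_le (by exact_mod_cast hm) (by linarith)
  have h2 : |∑ m ∈ Finset.Icc 1 N, (e m - e₀ m)| ≤ 4 * a ^ δ * Z := by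
    have := hr.a_nonneg
    exact abs_sum_Icc_le hτ (p := δ - τ) (by linarith) (by positivity)
      fun m hm _ => h.abs_e_sub m hm
  have h3 : |∑ m ∈ Finset.Icc 1 N, e m * (s ^ m - 1)| ≤ 6 * Real.exp 3 * |s - 1| ^ δ * Z := by
    refine abs_sum_Icc_le hτ (p := -τ + δ) (by linarith) (by positivity) fun m hm hmN => ?_
    rw [abs_mul, ← rpow_mul_rpow hm]
    calc |e m| * |s ^ m - 1|
        ≤ (2 * (m : ℝ) ^ (-τ)) * (3 * Real.exp 3 * |s - 1| ^ δ * (m : ℝ) ^ δ) := by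
          gcongr
          · exact h.abs_e m hm
          · exact hr.root.abs_pow_sub_one_le hδ0 hδ hr.a_nonneg hr.one_le hr.a_mul hmN
      _ = _ := by ring
  have hsplit : ∑ j ∈ Finset.range (N + 1), s ^ j * e j - E
      = (∑ m ∈ Finset.Icc 1 N, e₀ m - ∑' j : ℕ, e₀ (j + 1)) + ∑ m ∈ Finset.Icc 1 N, (e m - e₀ m)
        + ∑ m ∈ Finset.Icc 1 N, e m * (s ^ m - 1) := by
    have : ∑ j ∈ Finset.range N, s ^ (j + 1) * e (j + 1) = ∑ m ∈ Finset.Icc 1 N, e₀ m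
        + ∑ m ∈ Finset.Icc 1 N, (e m - e₀ m) + ∑ m ∈ Finset.Icc 1 N, e m * (s ^ m - 1) := by
      rw [← Finset.sum_add_distrib, ← Finset.sum_add_distrib,
        ← sum_Icc_eq_sum_range_succ fun m => s ^ m * e m]
      exact Finset.sum_congr rfl fun m _ => by ring
    rw [Finset.sum_range_succ', this, h.e_zero, ← hE]; ring
  rw [hsplit]
  calc _ ≤ _ := abs_add_three _ _ _
    _ ≤ 2 * Z * (2 * μ ^ δ) + 4 * μ ^ δ * Z + 6 * Real.exp 3 * (4 * μ ^ δ) * Z := by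
        refine add_le_add (add_le_add (h1.trans ?_) (h2.trans ?_)) (h3.trans ?_)
        · gcongr; exact hr.nat_rpow_le hδ0 hδ
        · have := hr.a_rpow_le hδ0
          gcongr ?_ * _; linarith
        · gcongr; exact hr.abs_sub_one_rpow_le hδ0 hδ
    _ = _ := by ring

/-- First-order expansion of ∑ g_m s^m = 1 about a = 0, s = 1: the derivative in s is c and the
derivative in a is -B. The errors are the mass defect, the Taylor remainder in a, the truncation of
the two derivatives, the mixed term and the second-order term in s; each is at most of order μ ·
μ^δ. -/
theorem CriticalBounds.abs_root_sub_le (hδ0 : 0 ≤ δ) (hδ : δ ≤ 1) (hτ : 2 + δ < τ)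
    (hc : ∑' j : ℕ, ((j : ℝ) + 1) * g₀ (j + 1) = c) (hB : -∑' j : ℕ, l (j + 1) = B)
    (h : CriticalBounds τ δ a g₀ g e₀ e l) (hr : RootScale δ a μ N g s) :
    |(s - 1) * c - a * B|
      ≤ (8 + (40 + 96 * Real.exp 3) * zetaSum (τ - 1 - δ)) * (μ * μ ^ δ) := by
  set Z := zetaSum (τ - 1 - δ)
  have hZ0 : 0 ≤ Z := zetaSum_nonneg _
  have hμ := hr.pos
  have ha := hr.a_nonneg
  have hN0 : (0 : ℝ) < N := by exact_mod_cast hr.one_le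
  set t := s - 1 with ht
  have ht4 : |t| ≤ 4 * μ := hr.abs_sub_one_le
  have htδ : |t| ^ δ ≤ 4 * μ ^ δ := hr.abs_sub_one_rpow_le hδ0 hδ
  have haδ : a ^ δ ≤ μ ^ δ := hr.a_rpow_le hδ0
  have hNδ : (N : ℝ) ^ (-δ) ≤ 2 * μ ^ δ := hr.nat_rpow_le hδ0 hδ
  have h0 : |∑ m ∈ Finset.Icc 1 N, g₀ m - 1| ≤ 8 * (μ * μ ^ δ) := by
    refine (h.crit N hr.one_le).trans ?_
    have : (N : ℝ) ^ (-1 - δ) = 1 / N * (N : ℝ) ^ (-δ) := by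
      rw [sub_eq_add_neg, Real.rpow_add hN0, Real.rpow_neg_one, one_div]
    rw [this]
    calc 2 * (1 / N * (N : ℝ) ^ (-δ)) ≤ 2 * ((2 * μ) * (2 * μ ^ δ)) := by
          gcongr
          exact hr.inv_le
      _ = _ := by ring
  have h1 : |∑ m ∈ Finset.Icc 1 N, (g m - g₀ m - a * l m)| ≤ 4 * (μ * μ ^ δ) * Z := by
    have ha1 : a ^ (1 + δ) ≤ μ * μ ^ δ := by
      rw [Real.rpow_add_of_nonneg ha zero_le_one hδ0, Real.rpow_one]
      exact mul_le_mul hr.a_le haδ (by positivity) hμ.le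
    refine abs_sum_Icc_le hτ (p := 1 + δ - τ) (by linarith) (by positivity)
      fun m hm _ => (h.abs_taylor m hm).trans ?_
    gcongr
  have h2 : |∑ m ∈ Finset.Icc 1 N, l m + B| ≤ 2 * Z * (N : ℝ) ^ (-δ) := by
    have := abs_sum_sub_tsum_le hδ0 hτ (K := 2) (by norm_num) h.abs_l hr.one_le
    rw [← hB]
    rwa [← sub_eq_add_neg]
  have h3 : |∑ m ∈ Finset.Icc 1 N, (m : ℝ) * g₀ m - c| ≤ 2 * Z * (N : ℝ) ^ (-δ) := by
    have := abs_sum_sub_tsum_le hδ0 hτ (K := 2) (by norm_num) (u := fun m => (m : ℝ) * g₀ m)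
      (fun m hm => by
        rw [abs_mul, Nat.abs_cast, sub_eq_add_neg, ← nat_mul_rpow hm]
        nlinarith [h.abs_g₀ m hm, m.cast_nonneg (α := ℝ)]) hr.one_le
    rw [← hc]
    simpa using this
  have h4 : |∑ m ∈ Finset.Icc 1 N, (m : ℝ) * (g m - g₀ m)| ≤ 4 * a ^ δ * Z := by
    refine abs_sum_Icc_le hτ (p := 1 + (δ - τ)) (by linarith) (by positivity) fun m hm _ => ?_
    rw [abs_mul, Nat.abs_cast, ← nat_mul_rpow hm]
    nlinarith [h.abs_g_sub m hm, m.cast_nonneg (α := ℝ)]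
  have h5 : |∑ m ∈ Finset.Icc 1 N, g m * (s ^ m - 1 - m * t)|
      ≤ 6 * Real.exp 3 * (|t| * |t| ^ δ) * Z := by
    refine abs_sum_Icc_le hτ (p := 1 + (-τ + δ)) (by linarith) (by positivity) fun m hm hmN => ?_
    rw [abs_mul, ← nat_mul_rpow hm, ← rpow_mul_rpow hm]
    calc |g m| * |s ^ m - 1 - m * t|
        ≤ (2 * (m : ℝ) ^ (-τ)) * (3 * Real.exp 3 * (|t| * |t| ^ δ) * (m * (m : ℝ) ^ δ)) := by
          gcongr
          · exact h.abs_g m hm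
          · exact hr.root.abs_pow_sub_le hδ0 hδ ha hr.one_le hr.a_mul hmN
      _ = _ := by ring
  have hsplit : t * c - a * B = -((∑ m ∈ Finset.Icc 1 N, g₀ m - 1)
      + ∑ m ∈ Finset.Icc 1 N, (g m - g₀ m - a * l m) + a * (∑ m ∈ Finset.Icc 1 N, l m + B)
      + t * (∑ m ∈ Finset.Icc 1 N, (m : ℝ) * g₀ m - c)
      + t * ∑ m ∈ Finset.Icc 1 N, (m : ℝ) * (g m - g₀ m)
      + ∑ m ∈ Finset.Icc 1 N, g m * (s ^ m - 1 - m * t)) := by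
    have hroot := hr.root.sum_eq
    have : ∑ m ∈ Finset.Icc 1 N, g m * s ^ m = ∑ m ∈ Finset.Icc 1 N, g₀ m
        + ∑ m ∈ Finset.Icc 1 N, (g m - g₀ m - a * l m) + a * ∑ m ∈ Finset.Icc 1 N, l m
        + t * ∑ m ∈ Finset.Icc 1 N, (m : ℝ) * g₀ m
        + t * ∑ m ∈ Finset.Icc 1 N, (m : ℝ) * (g m - g₀ m)
        + ∑ m ∈ Finset.Icc 1 N, g m * (s ^ m - 1 - m * t) := by
      rw [Finset.mul_sum, Finset.mul_sum, Finset.mul_sum]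
      simp only [← Finset.sum_add_distrib]
      exact Finset.sum_congr rfl fun m _ => by ring
    rw [hroot] at this
    linear_combination -this
  have hA : |a * (∑ m ∈ Finset.Icc 1 N, l m + B)| ≤ 4 * Z * (μ * μ ^ δ) := by
    rw [abs_mul, abs_of_nonneg ha]
    calc _ ≤ μ * (2 * Z * (2 * μ ^ δ)) := by
          refine mul_le_mul hr.a_le (h2.trans ?_) (abs_nonneg _) hμ.le
          gcongr
      _ = _ := by ring
  have hB' : |t * (∑ m ∈ Finset.Icc 1 N, (m : ℝ) * g₀ m - c)| ≤ 16 * Z * (μ * μ ^ δ) := by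
    rw [abs_mul]
    calc _ ≤ (4 * μ) * (2 * Z * (2 * μ ^ δ)) := by
          refine mul_le_mul ht4 (h3.trans ?_) (abs_nonneg _) (by positivity)
          gcongr
      _ = _ := by ring
  have hC' : |t * ∑ m ∈ Finset.Icc 1 N, (m : ℝ) * (g m - g₀ m)| ≤ 16 * Z * (μ * μ ^ δ) := by
    rw [abs_mul]
    calc _ ≤ (4 * μ) * (4 * μ ^ δ * Z) := by
          refine mul_le_mul ht4 (h4.trans ?_) (abs_nonneg _) (by positivity)
          gcongr
      _ = _ := by ring
  have hD' : 6 * Real.exp 3 * (|t| * |t| ^ δ) * Z ≤ 96 * Real.exp 3 * Z * (μ * μ ^ δ) := by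
    calc _ ≤ 6 * Real.exp 3 * ((4 * μ) * (4 * μ ^ δ)) * Z := by gcongr
      _ = _ := by ring
  rw [hsplit, abs_neg]
  have k0 := abs_le.1 h0
  have k1 := abs_le.1 h1
  have k2 := abs_le.1 hA
  have k3 := abs_le.1 hB'
  have k4 := abs_le.1 hC'
  have k5 := abs_le.1 (h5.trans hD')
  rw [abs_le]
  constructor
  · linarith [k0.1, k1.1, k2.1, k3.1, k4.1, k5.1]
  · linarith [k0.2, k1.2, k2.2, k3.2, k4.2, k5.2]

end

end

theorem abs_exp_neg_sub_exp_neg_le {x y M : ℝ} (hx : Real.exp (-x) ≤ M) (hy : Real.exp (-y) ≤ M) :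
    |Real.exp (-x) - Real.exp (-y)| ≤ M * |x - y| := by
  have key : ∀ u w : ℝ, u ≤ w → Real.exp (-u) ≤ M →
      |Real.exp (-u) - Real.exp (-w)| ≤ M * |u - w| := by
    intro u w h hM
    have h1 : Real.exp (-w) ≤ Real.exp (-u) := Real.exp_le_exp.2 (by linarith)
    rw [abs_of_nonneg (by linarith), abs_of_nonpos (by linarith)]
    have h2 : Real.exp (-w) = Real.exp (-u) * Real.exp (u - w) := by
      rw [← Real.exp_add]; ring_nf
    have h3 := Real.add_one_le_exp (u - w)
    have h4 := Real.exp_pos (-u)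
    rw [h2]
    nlinarith
  rcases le_total x y with h | h
  · exact key x y h hx
  · rw [abs_sub_comm, abs_sub_comm x]
    exact key y x h hy

theorem abs_log_sub_le {s : ℝ} (hs : 1 / 2 ≤ s) : |Real.log s - (s - 1)| ≤ 2 * (s - 1) ^ 2 := by
  have hs0 : 0 < s := by linarith
  have h1 := Real.log_le_sub_one_of_pos hs0
  have h2 := Real.one_sub_inv_le_log_of_pos hs0
  have h3 : 1 - s⁻¹ = (s - 1) - (s - 1) ^ 2 * s⁻¹ := by field_simp; ring
  have h4 : s⁻¹ ≤ 2 := by rw [inv_le_comm₀ hs0 two_pos]; linarith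
  have h5 : (s - 1) ^ 2 * s⁻¹ ≤ (s - 1) ^ 2 * 2 := by gcongr
  rw [abs_le]
  constructor <;> nlinarith [sq_nonneg (s - 1)]

section

variable {τ δ a c B E μ s b z : ℝ} {N n : ℕ} {g₀ g e₀ e f l : ℕ → ℝ}

/-- A δ-moment of the source compensates for the renewal rate being (n - j + 1)^{-δ} rather than
n^{-δ} when the source acts at time j. -/
theorem CriticalBounds.sum_weighted_source_le (hδ0 : 0 ≤ δ) (hδ : δ ≤ 1) (hτ : 2 + δ < τ)
    (h : CriticalBounds τ δ a g₀ g e₀ e l) (hr : RootScale δ a μ N g s) :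
    ∑ j ∈ Finset.range (N + 1), ((j : ℝ) + 1) ^ δ * |s ^ j * e j|
      ≤ 1 + 4 * Real.exp 3 * zetaSum (τ - 1 - δ) := by
  have hs0 := hr.root.pos hr.a_nonneg hr.one_le
  rw [Finset.sum_range_succ', h.e_zero, add_comm]
  refine add_le_add (by simp) ?_
  rw [← sum_Icc_eq_sum_range_succ fun m => ((m : ℝ) + 1) ^ δ * |s ^ m * e m|]
  refine (le_abs_self _).trans (abs_sum_Icc_le hτ (p := δ + -τ) (by linarith) (by positivity)
    fun m hm hmN => ?_)
  have hm1 : (1 : ℝ) ≤ m := by exact_mod_cast hm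
  rw [abs_mul, abs_abs, abs_mul, abs_of_pos (pow_pos hs0 m), abs_of_nonneg (by positivity),
    ← rpow_mul_rpow hm]
  have h1 : ((m : ℝ) + 1) ^ δ ≤ 2 * (m : ℝ) ^ δ := by
    calc ((m : ℝ) + 1) ^ δ ≤ (2 * (m : ℝ)) ^ δ :=
          Real.rpow_le_rpow (by positivity) (by linarith) hδ0
      _ = 2 ^ δ * (m : ℝ) ^ δ := Real.mul_rpow (by norm_num) (by positivity)
      _ ≤ 2 * (m : ℝ) ^ δ := by
          gcongr
          calc (2 : ℝ) ^ δ ≤ 2 ^ (1 : ℝ) := Real.rpow_le_rpow_of_exponent_le (by norm_num) hδ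
            _ = 2 := Real.rpow_one _
  calc ((m : ℝ) + 1) ^ δ * (s ^ m * |e m|)
      ≤ (2 * (m : ℝ) ^ δ) * (Real.exp 3 * (2 * (m : ℝ) ^ (-τ))) := by
        gcongr
        · exact hr.root.pow_le m hmN
        · exact h.abs_e m hm
    _ = _ := by ring

/-- By the renewal theorem the resolvent may be replaced by the inverse mean of the tilted kernel.
The mean and the total source are then replaced by their limits c and E. -/
theorem CriticalBounds.abs_mainPart_sub_le (hδ0 : 0 ≤ δ) (hδ : δ ≤ 1) (hτ : 2 + δ < τ)
    (hc : ∑' j : ℕ, ((j : ℝ) + 1) * g₀ (j + 1) = c) (hE : 1 + ∑' j : ℕ, e₀ (j + 1) = E)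
    (hc2 : 1 / 2 ≤ c) (h : CriticalBounds τ δ a g₀ g e₀ e l) (hr : RootScale δ a μ N g s)
    (hNn : N ≤ n) (hnμ : 1 / n ≤ μ) :
    |mainPart g e s N n - E / c| ≤ (1 + 4 * Real.exp 3 * zetaSum (τ - 1 - δ)
      + (2 + 4 * |E|) * ((8 + 24 * Real.exp 3) * zetaSum (τ - 1 - δ))) * μ ^ δ := by
  set Z := zetaSum (τ - 1 - δ)
  have hZ0 : 0 ≤ Z := zetaSum_nonneg _
  set K := (8 + 24 * Real.exp 3) * Z
  have hK0 : 0 ≤ K := by positivity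
  have hμ := hr.pos
  have hn0 : (0 : ℝ) < n := by exact_mod_cast hr.one_le.trans hNn
  set V := resolvent (fun m => g m * s ^ m) N with hV
  set cN := ∑ m ∈ Finset.Icc 1 N, (m : ℝ) * (g m * s ^ m) with hcN
  set εN := ∑ j ∈ Finset.range (N + 1), s ^ j * e j with hεN
  have hcN1 := abs_le.1 (abs_sum_nat_mul_sub_one_le hδ0 hr.one_le hr.root.sum_eq hr.root.sum_le)
  have hcN2 : 1 / 2 ≤ cN := by linarith [hcN1.1]
  have h1 : |mainPart g e s N n - cN⁻¹ * εN| ≤ (1 + 4 * Real.exp 3 * Z) * μ ^ δ := by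
    have hsub : mainPart g e s N n - cN⁻¹ * εN
        = ∑ j ∈ Finset.range (N + 1), (V (n - j) - cN⁻¹) * (s ^ j * e j) := by
      rw [mainPart, hεN, Finset.mul_sum, ← Finset.sum_sub_distrib]
      exact Finset.sum_congr rfl fun j _ => by ring
    rw [hsub]
    refine (Finset.abs_sum_le_sum_abs _ _).trans ?_
    have hterm : ∀ j ∈ Finset.range (N + 1), |(V (n - j) - cN⁻¹) * (s ^ j * e j)|
        ≤ μ ^ δ * (((j : ℝ) + 1) ^ δ * |s ^ j * e j|) := by
      intro j hj
      rw [Finset.mem_range] at hj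
      rw [abs_mul, ← mul_assoc]
      refine mul_le_mul_of_nonneg_right ?_ (abs_nonneg _)
      refine (abs_resolvent_sub_le hδ0 hr.one_le hr.root.sum_eq hr.root.sum_le (n - j)).trans ?_
      have h2 := succ_rpow_le_mul hδ0 (show j ≤ n by omega)
      have h3 : (((n - j : ℕ) : ℝ) + 1) ^ (-δ) ≤ ((n : ℝ) + 1) ^ (-δ) * ((j : ℝ) + 1) ^ δ := by
        rw [Real.rpow_neg (by positivity), Real.rpow_neg (by positivity), inv_eq_one_div,
          inv_mul_eq_div, div_le_div_iff₀ (by positivity) (by positivity)]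
        linarith
      refine h3.trans (mul_le_mul_of_nonneg_right ?_ (by positivity))
      rw [Real.rpow_neg (by positivity), ← Real.inv_rpow (by positivity)]
      refine Real.rpow_le_rpow (by positivity) (le_trans ?_ hnμ) hδ0
      rw [← one_div]
      exact one_div_le_one_div_of_le hn0 (by linarith)
    refine (Finset.sum_le_sum hterm).trans ?_
    rw [← Finset.mul_sum, mul_comm]
    exact mul_le_mul_of_nonneg_right (h.sum_weighted_source_le hδ0 hδ hτ hr) (by positivity)
  have h2 := h.abs_sum_mul_pow_sub_le hδ0 hδ hτ hc hr
  have h3 := h.abs_sum_source_sub_le hδ0 hδ hτ hE hr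
  have h4 : |cN⁻¹ * εN - E / c| ≤ (2 + 4 * |E|) * K * μ ^ δ := by
    have hsub : cN⁻¹ * εN - E / c = cN⁻¹ * (εN - E) - E * (cN⁻¹ * c⁻¹) * (cN - c) := by
      have : cN ≠ 0 := by linarith
      have : c ≠ 0 := by linarith
      field_simp
      ring
    have hi1 : |cN⁻¹| ≤ 2 := by
      rw [abs_of_pos (inv_pos.2 (by linarith)), inv_le_comm₀ (by linarith) two_pos]; linarith
    have hi2 : |c⁻¹| ≤ 2 := by
      rw [abs_of_pos (inv_pos.2 (by linarith)), inv_le_comm₀ (by linarith) two_pos]; linarith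
    rw [hsub]
    calc _ ≤ _ := abs_sub _ _
      _ = |cN⁻¹| * |εN - E| + |E| * (|cN⁻¹| * |c⁻¹|) * |cN - c| := by
          simp only [abs_mul]
      _ ≤ 2 * (K * μ ^ δ) + |E| * (2 * 2) * (K * μ ^ δ) := by
          gcongr
      _ = _ := by ring
  calc _ = |(mainPart g e s N n - cN⁻¹ * εN) + (cN⁻¹ * εN - E / c)| := by ring_nf
    _ ≤ _ := abs_add_le _ _
    _ ≤ _ := add_le_add h1 h4
    _ = _ := by ring

/-- The root expansion gives n log s = n a B/c + O(n μ^{1+δ}). Since nμ = 1 + na, this error is (1 +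
na)^{1+δ} n^{-δ}; half of the exponential e^{-na/4} absorbs the polynomial, and e^{-na/8} survives.
-/
theorem CriticalBounds.exists_mainPart_bound (hδ0 : 0 ≤ δ) (hδ : δ ≤ 1) (hτ : 2 + δ < τ)
    (hc : ∑' j : ℕ, ((j : ℝ) + 1) * g₀ (j + 1) = c) (hE : 1 + ∑' j : ℕ, e₀ (j + 1) = E)
    (hB : -∑' j : ℕ, l (j + 1) = B) (hc2 : 1 / 2 ≤ c) (hBc : 1 / 2 ≤ B / c) :
    ∃ C : ℝ, 0 < C ∧ ∀ (a μ s : ℝ) (N n : ℕ) (g e : ℕ → ℝ), CriticalBounds τ δ a g₀ g e₀ e l →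
      RootScale δ a μ N g s → N ≤ n → μ = a + 1 / n → (s ^ n)⁻¹ ≤ 4 * Real.exp (-(n * a / 4)) →
      |mainPart g e s N n / s ^ n - E / c * Real.exp (-(n * (B / c) * a))|
        ≤ C * (n : ℝ) ^ (-δ) * Real.exp (-(n * a / 8)) := by
  obtain ⟨Ce, hCe0, hCe⟩ := exists_exp_neg_le_rpow (c := 1 / 8) (by norm_num) (1 + δ)
  set Z := zetaSum (τ - 1 - δ) with hZ
  have hZ0 : 0 ≤ Z := zetaSum_nonneg _
  set K₁ := 1 + 4 * Real.exp 3 * Z + (2 + 4 * |E|) * ((8 + 24 * Real.exp 3) * Z) with hK₁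
  have hK₁0 : 0 < K₁ := by positivity
  set K₂ := 8 + (40 + 96 * Real.exp 3) * Z with hK₂
  have hK₂0 : 0 < K₂ := by positivity
  set K₃ := 64 + 2 * K₂ with hK₃
  refine ⟨4 * (K₁ + |E / c| * K₃) * Ce, by positivity, ?_⟩
  intro a μ s N n g e h hr hNn hμn hsn
  have hμ := hr.pos
  have ha := hr.a_nonneg
  have hN1 := hr.one_le
  have hn0 : (0 : ℝ) < n := by exact_mod_cast hN1.trans hNn
  have hs0 := hr.root.pos ha hN1
  have hnμ : 1 / (n : ℝ) ≤ μ := by linarith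
  have hP := h.abs_mainPart_sub_le hδ0 hδ hτ hc hE hc2 hr hNn hnμ
  have hR := h.abs_root_sub_le hδ0 hδ hτ hc hB hr
  rw [← hZ, ← hK₁] at hP
  rw [← hZ, ← hK₂] at hR
  have hs2 : 1 / 2 ≤ s := by
    have hN0 : (1 : ℝ) ≤ N := by exact_mod_cast hN1
    have : 1 / (16 * (N : ℝ)) ≤ 1 / 16 := by
      rw [div_le_div_iff₀ (by positivity) (by norm_num)]; linarith
    linarith [hr.root.le]
  have hlog : |Real.log s - B / c * a| ≤ K₃ * (μ * μ ^ δ) := by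
    have h1 := abs_log_sub_le hs2
    have h2 : 2 * (s - 1) ^ 2 ≤ 64 * (μ * μ ^ δ) := by
      have h3 : (s - 1) ^ 2 ≤ (4 * μ) ^ 2 := by
        rw [← sq_abs]
        exact pow_le_pow_left₀ (abs_nonneg _) hr.abs_sub_one_le 2
      have h4 := le_mul_rpow hδ0 hδ hμ.le one_le_two hr.le_two
      nlinarith
    have h3 : |(s - 1) - B / c * a| ≤ 2 * K₂ * (μ * μ ^ δ) := by
      have h4 : (s - 1) - B / c * a = ((s - 1) * c - a * B) / c := by
        have : c ≠ 0 := by linarith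
        field_simp
      rw [h4, abs_div, abs_of_pos (by linarith : 0 < c), div_le_iff₀ (by linarith)]
      have h5 : 0 ≤ K₂ * (μ * μ ^ δ) := by positivity
      nlinarith
    calc _ = |(Real.log s - (s - 1)) + ((s - 1) - B / c * a)| := by ring_nf
      _ ≤ _ := abs_add_le _ _
      _ ≤ 64 * (μ * μ ^ δ) + 2 * K₂ * (μ * μ ^ δ) := add_le_add (h1.trans h2) h3
      _ = _ := by rw [hK₃]; ring
  have hsexp : (s ^ n)⁻¹ = Real.exp (-(n * Real.log s)) := by
    rw [Real.exp_neg, Real.exp_nat_mul, Real.exp_log hs0]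
  have hdiff : |(s ^ n)⁻¹ - Real.exp (-(n * (B / c) * a))|
      ≤ 4 * Real.exp (-(n * a / 4)) * (n * (K₃ * (μ * μ ^ δ))) := by
    rw [hsexp]
    refine (abs_exp_neg_sub_exp_neg_le (M := 4 * Real.exp (-(n * a / 4))) ?_ ?_).trans ?_
    · rw [← hsexp]; exact hsn
    · calc Real.exp (-(n * (B / c) * a)) ≤ Real.exp (-(n * a / 4)) := by
            refine Real.exp_le_exp.2 ?_
            have : n * a * (1 / 4) ≤ n * a * (B / c) :=
              mul_le_mul_of_nonneg_left (by linarith) (by positivity)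
            linarith
        _ ≤ _ := by linarith [Real.exp_pos (-(n * a / 4))]
    · refine mul_le_mul_of_nonneg_left ?_ (by positivity)
      rw [mul_assoc, ← mul_sub, abs_mul, Nat.abs_cast]
      gcongr
  have hx : (n : ℝ) * μ = 1 + n * a := by
    rw [hμn, mul_add, mul_one_div_cancel hn0.ne']; ring
  have hxμ : (n : ℝ) * (μ * μ ^ δ) = (1 + n * a) ^ (1 + δ) * (n : ℝ) ^ (-δ) := by
    rw [← hx, Real.mul_rpow hn0.le hμ.le, Real.rpow_add hn0, Real.rpow_add hμ, Real.rpow_one,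
      Real.rpow_one, Real.rpow_neg hn0.le]
    field_simp
  have hexp : Real.exp (-(n * a / 4)) * ((1 + n * a) ^ (1 + δ) * (n : ℝ) ^ (-δ))
      ≤ Ce * (n : ℝ) ^ (-δ) * Real.exp (-(n * a / 8)) := by
    have h1 := hCe (n * a) (by positivity)
    have h2 : Real.exp (-(n * a / 4)) = Real.exp (-(n * a / 8)) * Real.exp (-(1 / 8 * (n * a))) := by
      rw [← Real.exp_add]; ring_nf
    have h3 : Real.exp (-(1 / 8 * (n * a))) * (1 + n * a) ^ (1 + δ) ≤ Ce := by
      calc _ ≤ Ce * (1 + n * a) ^ (-(1 + δ)) * (1 + n * a) ^ (1 + δ) := by gcongr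
        _ = Ce := by
            rw [mul_assoc, ← Real.rpow_add (by positivity)]; simp
    rw [h2]
    calc _ = (Real.exp (-(1 / 8 * (n * a))) * (1 + n * a) ^ (1 + δ))
          * ((n : ℝ) ^ (-δ) * Real.exp (-(n * a / 8))) := by ring
      _ ≤ Ce * ((n : ℝ) ^ (-δ) * Real.exp (-(n * a / 8))) := by gcongr
      _ = _ := by ring
  have hμδ : μ ^ δ ≤ n * (μ * μ ^ δ) := by
    rw [← mul_assoc, hx]
    refine le_mul_of_one_le_left (by positivity) ?_
    have : 0 ≤ n * a := by positivity
    linarith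
  have hsplit : mainPart g e s N n / s ^ n - E / c * Real.exp (-(n * (B / c) * a))
      = (mainPart g e s N n - E / c) * (s ^ n)⁻¹
        + E / c * ((s ^ n)⁻¹ - Real.exp (-(n * (B / c) * a))) := by
    rw [div_eq_mul_inv]; ring
  rw [hsplit]
  calc _ ≤ _ := abs_add_le _ _
    _ = |mainPart g e s N n - E / c| * (s ^ n)⁻¹
        + |E / c| * |(s ^ n)⁻¹ - Real.exp (-(n * (B / c) * a))| := by
        rw [abs_mul, abs_mul, abs_of_pos (inv_pos.2 (pow_pos hs0 n))]
    _ ≤ K₁ * (n * (μ * μ ^ δ)) * (4 * Real.exp (-(n * a / 4)))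
        + |E / c| * (4 * Real.exp (-(n * a / 4)) * (n * (K₃ * (μ * μ ^ δ)))) := by
        gcongr
        exact hP.trans (by gcongr)
    _ = 4 * (K₁ + |E / c| * K₃) * (Real.exp (-(n * a / 4)) * (n * (μ * μ ^ δ))) := by ring
    _ ≤ 4 * (K₁ + |E / c| * K₃) * (Ce * (n : ℝ) ^ (-δ) * Real.exp (-(n * a / 8))) := by
        rw [hxμ]
        gcongr
    _ = _ := by ring

/-- The solution of a critical recursion is `A e^{-n v a}` up to a relative error `n^{-δ}` and the
contribution `a^{-2} n^{-τ}` of a single long step. -/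
theorem NearCritical.exists_asymptotics (hδ0 : 0 ≤ δ) (hδ : δ ≤ 1) (hτ : 2 + δ < τ) :
    ∃ b₀ : ℝ, 0 < b₀ ∧ ∀ (b z c B E : ℝ) (g₀ e₀ l : ℕ → ℝ), 0 ≤ b → b ≤ b₀ →
      ∑' j : ℕ, ((j : ℝ) + 1) * g₀ (j + 1) = c → 1 + ∑' j : ℕ, e₀ (j + 1) = E →
      -∑' j : ℕ, l (j + 1) = B → 1 / 2 ≤ c → 1 / 2 ≤ B / c →
      ∃ C : ℝ, 0 < C ∧ ∀ (a : ℝ) (g e f : ℕ → ℝ),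
        (∀ n₁, NearCritical τ δ b a z n₁ g₀ g e₀ e) → CriticalBounds τ δ a g₀ g e₀ e l →
        0 ≤ a → a ≤ 1 / 4 → (∀ n, f n = ∑ m ∈ Finset.Icc 1 n, g m * f (n - m) + e n) →
        ∀ n : ℕ, 1 ≤ n → |f n - E / c * Real.exp (-(n * (B / c) * a))|
          ≤ C * (n : ℝ) ^ (-δ) * Real.exp (-(n * a / 8)) + C * (a ^ 2)⁻¹ * (n : ℝ) ^ (-τ) := by
  obtain ⟨Cp, bp, hCp, hbp, hpert⟩ := exists_perturbation_bound (τ := τ) (by linarith)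
  obtain ⟨br, hbr, hroot⟩ := NearCritical.exists_root hδ0 hτ
  refine ⟨min bp br, lt_min hbp hbr, ?_⟩
  intro b z c B E g₀ e₀ l hb hbb hc hE hB hc2 hBc
  obtain ⟨Cm, hCm0, hCm⟩ := CriticalBounds.exists_mainPart_bound hδ0 hδ hτ hc hE hB hc2 hBc
  refine ⟨max Cm (Cp * b), lt_max_of_lt_left hCm0, ?_⟩
  intro a g e f hnc hcb ha ha4 hf n hn
  have hn1 : (1 : ℝ) ≤ n := by exact_mod_cast hn
  have h := hnc n
  set C := max Cm (Cp * b) with hC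
  have hC1 : Cm ≤ C := le_max_left _ _
  have hC2 : Cp * b ≤ C := le_max_right _ _
  have hinv : 1 / (n : ℝ) ≤ 1 := by rw [div_le_one (by linarith)]; exact hn1
  have hinv0 : 0 < 1 / (n : ℝ) := by positivity
  have hfin : ∀ s N, RootScale δ a (a + 1 / n) N g s → N ≤ n →
      (s ^ n)⁻¹ ≤ 4 * Real.exp (-(n * a / 4)) →
      |f n - mainPart g e s N n / s ^ n| ≤ C * (a ^ 2)⁻¹ * (n : ℝ) ^ (-τ) →
      |f n - E / c * Real.exp (-(n * (B / c) * a))|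
          ≤ C * (n : ℝ) ^ (-δ) * Real.exp (-(n * a / 8)) + C * (a ^ 2)⁻¹ * (n : ℝ) ^ (-τ) := by
    intro s N hr hNn hs hpart
    have h1 := hCm a (a + 1 / n) s N n g e hcb hr hNn rfl hs
    calc _ = |(mainPart g e s N n / s ^ n - E / c * Real.exp (-(n * (B / c) * a)))
          + (f n - mainPart g e s N n / s ^ n)| := by ring_nf
      _ ≤ _ := abs_add_le _ _
      _ ≤ _ := add_le_add (h1.trans (by gcongr)) hpart
  -- As in the pointwise bound: for an ≤ 1 the truncation is at n and the main part is exact,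
  -- otherwise it is at ⌊1/a⌋ and the long step costs a⁻² n^{-τ}. At a = 0 the last term is zero by
  -- the convention 0⁻¹ = 0, so the case an ≤ 1 has to be exact.
  rcases le_or_gt (a * n) 1 with hna | hna
  · obtain ⟨s, hs⟩ := hroot b a z n g₀ g e₀ e h hb (hbb.trans (min_le_right _ _)) ha ha4 n hn
      le_rfl hna
    have hs0 := hs.pos ha hn
    refine hfin s n ⟨ha, hn, hna, hs, by linarith, by linarith, by linarith⟩ le_rfl ?_ ?_
    · have h1 : (s ^ n)⁻¹ ≤ 2 := inv_pow_le_two hn (by linarith [hs.le])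
      have h2 : -(n * a / 4) + 1 ≤ Real.exp (-(n * a / 4)) := Real.add_one_le_exp _
      have h3 : (n : ℝ) * a ≤ 1 := by linarith
      linarith
    · rw [← eq_mainPart_self hf n, mul_div_cancel_right₀ _ (pow_pos hs0 n).ne', sub_self, abs_zero]
      have : 0 < C := hCm0.trans_le hC1
      positivity
  · have ha0 : 0 < a := by
      rcases ha.eq_or_lt with h0 | h0
      · rw [← h0] at hna; norm_num at hna
      · exact h0
    obtain ⟨hN1, hN2, hN3, hN4, hN5⟩ := floor_inv_bounds ha0 (by linarith)
    set N := ⌊1 / a⌋₊ with hN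
    have hNn : N ≤ n := by
      have : (N : ℝ) ≤ n := by
        by_contra hcon
        push Not at hcon
        have : a * n < a * N := by gcongr
        linarith
      exact_mod_cast this
    obtain ⟨s, hs⟩ := hroot b a z n g₀ g e₀ e h hb (hbb.trans (min_le_right _ _)) ha ha4 N hN1
      hNn hN2
    have hs0 := hs.pos ha hN1
    have hsa : Real.exp (a / 4) ≤ s := by
      have := exp_le_one_add (x := a / 4) (by positivity) (by linarith)
      linarith [hs.le]
    refine hfin s N ⟨ha, hN1, hN2, hs, by linarith, by linarith, by linarith⟩ hNn ?_ ?_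
    · have h1 : (s ^ n)⁻¹ ≤ Real.exp (-(n * a / 4)) := by
        rw [Real.exp_neg]
        gcongr
        calc Real.exp (n * a / 4) = Real.exp (a / 4) ^ n := by
              rw [← Real.exp_nat_mul]; ring_nf
          _ ≤ s ^ n := by gcongr
      linarith [Real.exp_pos (-(n * a / 4))]
    · have h1 := ((hpert a s b N n g e f ha0 (by linarith) hN1 hN3 hsa
        ((hs.pow_le N le_rfl).trans (Real.exp_le_exp.2 (by norm_num))) hb
        (hbb.trans (min_le_left _ _)) hf h.e_zero h.e_one
        (fun m h2 hm => ⟨h.abs_g m h2 hm, h.abs_e m h2 hm⟩)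
        (hs.abs_resolvent_le hδ0 hN1) n le_rfl).2 hNn).1
      refine h1.trans ?_
      gcongr

end

/-! ### Fourier analysis on the dual cube -/

theorem dualMeasure_eq_pi (d : ℕ) :
    dualMeasure d = ENNReal.ofReal (((2 * Real.pi) ^ d)⁻¹)
      • Measure.pi fun _ : Fin d => volume.restrict (Set.Icc (-Real.pi) Real.pi) := by
  rw [dualMeasure, dualCube, ← Set.pi_univ_Icc, volume_pi, Measure.restrict_pi_pi]

theorem measurableSet_dualCube (d : ℕ) : MeasurableSet (dualCube d) := measurableSet_Icc

theorem ae_mem_dualCube (d : ℕ) : ∀ᵐ k ∂(dualMeasure d), k ∈ dualCube d :=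
  Measure.ae_smul_measure (ae_restrict_mem (measurableSet_dualCube d)) _

instance isProbabilityMeasure_dualMeasure (d : ℕ) : IsProbabilityMeasure (dualMeasure d) := by
  constructor
  have hpi := Real.pi_pos
  rw [dualMeasure_eq_pi, Measure.smul_apply, Measure.pi_univ]
  simp only [Measure.restrict_apply_univ, Real.volume_Icc, Finset.prod_const, Finset.card_univ,
    Fintype.card_fin, smul_eq_mul]
  rw [← ENNReal.ofReal_pow (by linarith), ← ENNReal.ofReal_mul (by positivity),
    show Real.pi - -Real.pi = 2 * Real.pi by ring, inv_mul_cancel₀ (by positivity),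
    ENNReal.ofReal_one]

theorem integral_dualMeasure_prod {𝕜 : Type*} [RCLike 𝕜] (d : ℕ) (F : Fin d → ℝ → 𝕜) :
    ∫ k, ∏ i, F i (k i) ∂(dualMeasure d)
      = (((2 * Real.pi) ^ d)⁻¹ : ℝ) • ∏ i, ∫ t in Set.Icc (-Real.pi) Real.pi, F i t := by
  have hpi := Real.pi_pos
  rw [dualMeasure_eq_pi, integral_smul_measure, ENNReal.toReal_ofReal (by positivity),
    integral_fintype_prod_eq_prod]

theorem integrable_dualMeasure_prod {𝕜 : Type*} [RCLike 𝕜] {d : ℕ} {F : Fin d → ℝ → 𝕜}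
    (hF : ∀ i, IntegrableOn (F i) (Set.Icc (-Real.pi) Real.pi)) :
    Integrable (fun k : Fin d → ℝ => ∏ i, F i (k i)) (dualMeasure d) := by
  rw [dualMeasure_eq_pi]
  exact (Integrable.fintype_prod hF).smul_measure ENNReal.ofReal_ne_top

theorem exp_dot_eq_prod {d : ℕ} (k : Fin d → ℝ) (x : Fin d → ℤ) :
    Complex.exp (Complex.I * (dot k x : ℂ))
      = ∏ i, Complex.exp (Complex.I * ((k i : ℂ) * (x i : ℂ))) := by
  rw [← Complex.exp_sum, ← Finset.mul_sum, dot]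
  push_cast
  rfl

theorem continuous_dot {d : ℕ} (x : Fin d → ℤ) : Continuous fun k : Fin d → ℝ => dot k x := by
  unfold dot
  fun_prop

theorem integral_exp_int (n : ℤ) :
    ∫ t in Set.Icc (-Real.pi) Real.pi, Complex.exp (Complex.I * ((t : ℂ) * (n : ℂ)))
      = if n = 0 then (2 * Real.pi : ℂ) else 0 := by
  have hpi := Real.pi_pos
  rw [integral_Icc_eq_integral_Ioc, ← intervalIntegral.integral_of_le (by linarith)]
  split_ifs with h
  · subst h
    simp
    ring
  · have hc : Complex.I * (n : ℂ) ≠ 0 := mul_ne_zero Complex.I_ne_zero (by exact_mod_cast h)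
    have h1 : ∀ t : ℝ, Complex.exp (Complex.I * ((t : ℂ) * (n : ℂ)))
        = Complex.exp (Complex.I * (n : ℂ) * t) := fun t => by ring_nf
    simp only [h1]
    rw [integral_exp_mul_complex hc]
    have h2 : Complex.exp (Complex.I * (n : ℂ) * (Real.pi : ℝ))
        = Complex.exp (Complex.I * (n : ℂ) * ((-Real.pi : ℝ) : ℂ)) := by
      rw [Complex.exp_eq_exp_iff_exists_int]
      exact ⟨n, by push_cast; ring⟩
    rw [h2, sub_self, zero_div]

theorem integral_exp_dot {d : ℕ} (x : Fin d → ℤ) :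
    ∫ k, Complex.exp (Complex.I * (dot k x : ℂ)) ∂(dualMeasure d) = if x = 0 then 1 else 0 := by
  have hpi := Real.pi_pos
  simp only [exp_dot_eq_prod]
  rw [integral_dualMeasure_prod d fun i t => Complex.exp (Complex.I * ((t : ℂ) * (x i : ℂ)))]
  simp only [integral_exp_int]
  split_ifs with h
  · subst h
    simp
  · obtain ⟨i, hi⟩ : ∃ i, x i ≠ 0 := by
      by_contra hcon
      push Not at hcon
      exact h (funext hcon)
    rw [Finset.prod_eq_zero (Finset.mem_univ i) (by simp [hi]), smul_zero]

theorem norm_exp_I_mul_real (t : ℝ) : ‖Complex.exp (Complex.I * (t : ℂ))‖ = 1 := by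
  rw [mul_comm]; exact Complex.norm_exp_ofReal_mul_I t

theorem norm_exp_neg_I_mul_real (t : ℝ) : ‖Complex.exp (-(Complex.I * (t : ℂ)))‖ = 1 := by
  have := norm_exp_I_mul_real (-t)
  rwa [Complex.ofReal_neg, mul_neg] at this

section

variable {d : ℕ} {D : (Fin d → ℤ) → ℝ}

theorem summable_fourier_terms (hD : Summable D) (h0 : ∀ x, 0 ≤ D x) (k : Fin d → ℝ) :
    Summable fun x => (D x : ℂ) * Complex.exp (Complex.I * (dot k x : ℂ)) := by
  refine Summable.of_norm (hD.congr fun x => ?_)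
  rw [norm_mul, norm_exp_I_mul_real, mul_one, Complex.norm_real, Real.norm_of_nonneg (h0 x)]

theorem continuous_fourier (hD : Summable D) (h0 : ∀ x, 0 ≤ D x) : Continuous (fourier D) := by
  refine continuous_tsum (u := D) (fun x => ?_) hD fun x k => ?_
  · have := continuous_dot x
    fun_prop
  · rw [norm_mul, norm_exp_I_mul_real, mul_one, Complex.norm_real, Real.norm_of_nonneg (h0 x)]

theorem continuous_hatD (hD : Summable D) (h0 : ∀ x, 0 ≤ D x) : Continuous (hatD D) :=
  Complex.continuous_re.comp (continuous_fourier hD h0)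

theorem norm_fourier_le (hD : HasSum D 1) (h0 : ∀ x, 0 ≤ D x) (k : Fin d → ℝ) :
    ‖fourier D k‖ ≤ 1 := by
  refine tsum_of_norm_bounded hD fun x => ?_
  rw [norm_mul, norm_exp_I_mul_real, mul_one, Complex.norm_real, Real.norm_of_nonneg (h0 x)]

theorem abs_hatD_le (hD : HasSum D 1) (h0 : ∀ x, 0 ≤ D x) (k : Fin d → ℝ) : |hatD D k| ≤ 1 :=
  (Complex.abs_re_le_norm _).trans (norm_fourier_le hD h0 k)

theorem hasSum_hatD (hD : Summable D) (h0 : ∀ x, 0 ≤ D x) (k : Fin d → ℝ) :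
    HasSum (fun x => D x * Real.cos (dot k x)) (hatD D k) := by
  have := Complex.hasSum_re (summable_fourier_terms hD h0 k).hasSum
  refine this.congr_fun fun x => ?_
  rw [Complex.re_ofReal_mul, mul_comm Complex.I, Complex.exp_ofReal_mul_I_re]

theorem integral_exp_neg_mul_fourier (hD : Summable D) (h0 : ∀ x, 0 ≤ D x) (x : Fin d → ℤ) :
    ∫ k, Complex.exp (-(Complex.I * (dot k x : ℂ))) * fourier D k ∂(dualMeasure d) = D x := by
  have hterm : ∀ (y : Fin d → ℤ) (k : Fin d → ℝ), Complex.exp (-(Complex.I * (dot k x : ℂ)))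
      * ((D y : ℂ) * Complex.exp (Complex.I * (dot k y : ℂ)))
      = (D y : ℂ) * Complex.exp (Complex.I * (dot k (y - x) : ℂ)) := by
    intro y k
    have : dot k (y - x) = dot k y - dot k x := by
      simp [dot, mul_sub, Finset.sum_sub_distrib]
    rw [this, mul_left_comm, ← Complex.exp_add]
    push_cast
    ring_nf
  have hcont : ∀ w : Fin d → ℤ, Continuous fun k : Fin d → ℝ =>
      Complex.exp (Complex.I * (dot k w : ℂ)) := fun w => by
    have := continuous_dot w
    fun_prop
  have h1 := hasSum_integral_of_summable_integral_norm (μ := dualMeasure d)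
    (F := fun y k => Complex.exp (-(Complex.I * (dot k x : ℂ)))
      * ((D y : ℂ) * Complex.exp (Complex.I * (dot k y : ℂ)))) (fun y => ?_) ?_
  · simp only [tsum_mul_left] at h1
    change HasSum _ (∫ k, Complex.exp (-(Complex.I * (dot k x : ℂ))) * fourier D k ∂_) at h1
    refine h1.unique ?_
    have h2 : ∀ y, ∫ k, Complex.exp (-(Complex.I * (dot k x : ℂ)))
        * ((D y : ℂ) * Complex.exp (Complex.I * (dot k y : ℂ))) ∂(dualMeasure d)
        = if y = x then (D x : ℂ) else 0 := by
      intro y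
      simp only [hterm]
      rw [integral_const_mul, integral_exp_dot]
      by_cases h : y = x
      · subst h; simp
      · simp [h, sub_eq_zero]
    simp only [h2]
    exact hasSum_ite_eq x _
  · simp only [hterm]
    refine Integrable.const_mul (Integrable.of_bound (C := 1) (hcont _).aestronglyMeasurable
      (ae_of_all _ fun k => (norm_exp_I_mul_real _).le)) _
  · refine hD.congr fun y => ?_
    simp only [norm_mul, norm_exp_I_mul_real, norm_exp_neg_I_mul_real, one_mul, mul_one,
      Complex.norm_real, Real.norm_of_nonneg (h0 y)]
    simp

/-- Parseval: the integral of |D̂|² is ∑ D(x)², which is at most sup D times the total mass 1. -/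
theorem integral_hatD_sq_le (hD : HasSum D 1) (h0 : ∀ x, 0 ≤ D x) {B : ℝ} (hB : ∀ x, D x ≤ B) :
    ∫ k, hatD D k ^ 2 ∂(dualMeasure d) ≤ B := by
  have hcF := continuous_fourier hD.summable h0
  have hsq : HasSum (fun x => (D x : ℂ) * D x)
      (∫ k, fourier D k * (starRingEnd ℂ) (fourier D k) ∂(dualMeasure d)) := by
    have h1 := hasSum_integral_of_summable_integral_norm (μ := dualMeasure d)
      (F := fun x k => ((D x : ℂ) * Complex.exp (Complex.I * (dot k x : ℂ)))
        * (starRingEnd ℂ) (fourier D k)) (fun x => ?_) ?_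
    · simp only [tsum_mul_right] at h1
      change HasSum _ (∫ k, fourier D k * (starRingEnd ℂ) (fourier D k) ∂_) at h1
      refine h1.congr_fun fun x => ?_
      have h2 : ∀ k, ((D x : ℂ) * Complex.exp (Complex.I * (dot k x : ℂ)))
          * (starRingEnd ℂ) (fourier D k) = (D x : ℂ) * (starRingEnd ℂ)
            (Complex.exp (-(Complex.I * (dot k x : ℂ))) * fourier D k) := by
        intro k
        rw [map_mul, ← Complex.exp_conj]
        simp
        ring
      simp only [h2]
      rw [integral_const_mul, integral_conj, integral_exp_neg_mul_fourier hD.summable h0,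
        Complex.conj_ofReal]
    · refine Integrable.of_bound (C := D x) ?_ (ae_of_all _ fun k => ?_)
      · have h3 := continuous_dot x
        have h4 : Continuous fun k => (starRingEnd ℂ) (fourier D k) :=
          Complex.continuous_conj.comp hcF
        exact Continuous.aestronglyMeasurable (by fun_prop)
      · rw [norm_mul, norm_mul, norm_exp_I_mul_real, mul_one, Complex.norm_real,
          Real.norm_of_nonneg (h0 x), RCLike.norm_conj]
        exact mul_le_of_le_one_right (h0 x) (norm_fourier_le hD h0 k)
    · refine Summable.of_nonneg_of_le (fun x => integral_nonneg fun k => norm_nonneg _)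
        (fun x => ?_) hD.summable
      refine (integral_mono_of_nonneg (ae_of_all _ fun k => norm_nonneg _)
        (integrable_const (D x)) (ae_of_all _ fun k => ?_)).trans (by simp)
      simp only
      rw [norm_mul, norm_mul, norm_exp_I_mul_real, mul_one, Complex.norm_real,
          Real.norm_of_nonneg (h0 x), RCLike.norm_conj]
      exact mul_le_of_le_one_right (h0 x) (norm_fourier_le hD h0 k)
  have hre : HasSum (fun x => D x * D x) (∫ k, ‖fourier D k‖ ^ 2 ∂(dualMeasure d)) := by
    have h1 : ∫ k, fourier D k * (starRingEnd ℂ) (fourier D k) ∂(dualMeasure d)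
        = ((∫ k, ‖fourier D k‖ ^ 2 ∂(dualMeasure d) : ℝ) : ℂ) := by
      rw [← integral_complex_ofReal]
      refine integral_congr_ae (ae_of_all _ fun k => ?_)
      simp only
      rw [Complex.mul_conj, Complex.normSq_eq_norm_sq]
    rw [h1] at hsq
    exact_mod_cast hsq
  have hle : ∫ k, hatD D k ^ 2 ∂(dualMeasure d) ≤ ∫ k, ‖fourier D k‖ ^ 2 ∂(dualMeasure d) := by
    refine integral_mono_of_nonneg (ae_of_all _ fun k => by positivity) ?_ (ae_of_all _ fun k => ?_)
    · refine Integrable.of_bound (C := 1) (by fun_prop) (ae_of_all _ fun k => ?_)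
      rw [norm_pow, norm_norm]
      exact pow_le_one₀ (norm_nonneg _) (norm_fourier_le hD h0 k)
    · simp only
      rw [← sq_abs]
      exact pow_le_pow_left₀ (abs_nonneg _) (Complex.abs_re_le_norm _) 2
  refine hle.trans ?_
  have h2 : HasSum (fun x => B * D x) (B * 1) := hD.mul_left B
  rw [mul_one] at h2
  exact hasSum_le (fun x => mul_le_mul_of_nonneg_right (hB x) (h0 x)) hre h2

theorem integrable_hatD_sq (hD : HasSum D 1) (h0 : ∀ x, 0 ≤ D x) :
    Integrable (fun k => hatD D k ^ 2) (dualMeasure d) := by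
  have := continuous_hatD hD.summable h0
  refine Integrable.of_bound (C := 1) (by fun_prop) (ae_of_all _ fun k => ?_)
  rw [norm_pow, Real.norm_eq_abs]
  exact pow_le_one₀ (abs_nonneg _) (abs_hatD_le hD h0 k)

end

/-! ### Norms and integrals on the dual cube -/

section

variable {d : ℕ}

theorem sqNorm_nonneg (x : Fin d → ℝ) : 0 ≤ sqNorm x := Finset.sum_nonneg fun _ _ => sq_nonneg _

theorem norm_sq_le_sqNorm (x : Fin d → ℝ) : ‖x‖ ^ 2 ≤ sqNorm x := by
  have h : ‖x‖ ≤ Real.sqrt (sqNorm x) := by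
    refine (pi_norm_le_iff_of_nonneg (Real.sqrt_nonneg _)).2 fun i => ?_
    rw [Real.norm_eq_abs]
    refine Real.abs_le_sqrt ?_
    exact Finset.single_le_sum (f := fun i => x i ^ 2) (fun i _ => sq_nonneg _) (Finset.mem_univ i)
  calc ‖x‖ ^ 2 ≤ Real.sqrt (sqNorm x) ^ 2 := pow_le_pow_left₀ (norm_nonneg _) h 2
    _ = _ := Real.sq_sqrt (sqNorm_nonneg x)

theorem sqNorm_le_norm_sq (x : Fin d → ℝ) : sqNorm x ≤ d * ‖x‖ ^ 2 := by
  calc sqNorm x ≤ ∑ _i : Fin d, ‖x‖ ^ 2 := by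
        refine Finset.sum_le_sum fun i _ => ?_
        rw [← sq_abs]
        exact pow_le_pow_left₀ (abs_nonneg _) (norm_le_pi_norm x i) 2
    _ = _ := by simp

theorem mem_dualCube_iff {k : Fin d → ℝ} : k ∈ dualCube d ↔ ∀ i, |k i| ≤ Real.pi := by
  simp only [dualCube, Set.mem_Icc, Pi.le_def, abs_le]
  exact ⟨fun h i => ⟨h.1 i, h.2 i⟩, fun h => ⟨fun i => (h i).1, fun i => (h i).2⟩⟩

theorem zero_mem_dualCube : (0 : Fin d → ℝ) ∈ dualCube d :=
  mem_dualCube_iff.2 fun i => by simpa using Real.pi_pos.le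

theorem norm_le_of_mem_dualCube {k : Fin d → ℝ} (hk : k ∈ dualCube d) : ‖k‖ ≤ Real.pi :=
  (pi_norm_le_iff_of_nonneg Real.pi_pos.le).2 fun i => mem_dualCube_iff.1 hk i

theorem ae_forall_ne_zero : ∀ᵐ k ∂(dualMeasure d), ∀ i, k i ≠ 0 := by
  rw [dualMeasure_eq_pi]
  refine Measure.ae_smul_measure (ae_all_iff.2 fun i => ?_) _
  exact compl_mem_ae_iff.2 (Measure.pi_hyperplane _ i 0)

/-- A negative power of the norm is bounded by a product over the coordinates. -/
theorem norm_rpow_neg_le_prod (hd : 0 < d) {q : ℝ} (hq : 0 ≤ q) {k : Fin d → ℝ}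
    (hk : ∀ i, k i ≠ 0) : ‖k‖ ^ (-q) ≤ ∏ i, |k i| ^ (-(q / d)) := by
  have hd0 : (0 : ℝ) < d := by exact_mod_cast hd
  calc ‖k‖ ^ (-q) = ∏ _i : Fin d, ‖k‖ ^ (-(q / d)) := by
        rw [Finset.prod_const, Finset.card_univ, Fintype.card_fin, ← Real.rpow_natCast,
          ← Real.rpow_mul (norm_nonneg _)]
        congr 1
        field_simp
    _ ≤ _ := by
        refine Finset.prod_le_prod (fun i _ => by positivity) fun i _ => ?_
        exact Real.rpow_le_rpow_of_nonpos (abs_pos.2 (hk i)) (norm_le_pi_norm k i)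
          (by have : 0 ≤ q / d := by positivity
              linarith)

theorem inv_sqNorm_sq_le_prod (hd : 0 < d) {k : Fin d → ℝ} (hk : ∀ i, k i ≠ 0) :
    (sqNorm k ^ 2)⁻¹ ≤ ∏ i, |k i| ^ (-(4 / d : ℝ)) := by
  have hk0 : k ≠ 0 := fun h => hk ⟨0, hd⟩ (by rw [h]; rfl)
  have hn : 0 < ‖k‖ := norm_pos_iff.2 hk0
  refine le_trans ?_ (norm_rpow_neg_le_prod hd (q := 4) (by norm_num) hk)
  rw [Real.rpow_neg hn.le]
  have h1 : ‖k‖ ^ (4 : ℝ) = (‖k‖ ^ 2) ^ 2 := by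
    rw [← pow_mul]; norm_cast
  rw [h1]
  gcongr
  exact norm_sq_le_sqNorm k

theorem integrableOn_abs_rpow {p : ℝ} (hp : p < 1) (r : ℝ) :
    IntegrableOn (fun t : ℝ => |t| ^ (-p)) (Set.Icc (-r) r) := by
  rcases le_or_gt r 0 with hr | hr
  · rcases hr.eq_or_lt with rfl | hr
    · simp
    · rw [Set.Icc_eq_empty (by linarith)]; simp
  have h1 : IntegrableOn (fun t : ℝ => |t| ^ (-p)) (Set.Icc 0 r) := by
    rw [integrableOn_Icc_iff_integrableOn_Ioc]
    have := (intervalIntegral.intervalIntegrable_rpow' (a := 0) (b := r) (r := -p) (by linarith)).1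
    refine this.congr_fun (fun t ht => ?_) measurableSet_Ioc
    simp only
    rw [abs_of_pos ht.1]
  have h2 : IntegrableOn (fun t : ℝ => |t| ^ (-p)) (Set.Icc (-r) 0) := by
    have h3 := h1.comp_neg
    simpa using h3
  have := h2.union h1
  rwa [Set.Icc_union_Icc_eq_Icc (by linarith) hr.le] at this

theorem setIntegral_abs_rpow {p r : ℝ} (hp : p < 1) (hr : 0 < r) :
    ∫ t in Set.Icc (-r) r, |t| ^ (-p) = 2 * (r ^ (1 - p) / (1 - p)) := by
  rw [integral_Icc_eq_integral_Ioc, ← intervalIntegral.integral_of_le (by linarith)]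
  have hI : ∀ a b, -r ≤ a → a ≤ b → b ≤ r →
      IntervalIntegrable (fun t : ℝ => |t| ^ (-p)) volume a b := by
    intro a b ha hab hb
    rw [intervalIntegrable_iff_integrableOn_Icc_of_le hab]
    exact (integrableOn_abs_rpow hp r).mono_set (Set.Icc_subset_Icc ha hb)
  rw [← intervalIntegral.integral_add_adjacent_intervals (hI (-r) 0 le_rfl (by linarith) hr.le)
    (hI 0 r (by linarith) hr.le le_rfl)]
  have h1 : ∫ t in (0 : ℝ)..r, |t| ^ (-p) = r ^ (1 - p) / (1 - p) := by
    have : ∫ t in (0 : ℝ)..r, |t| ^ (-p) = ∫ t in (0 : ℝ)..r, t ^ (-p) := by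
      refine intervalIntegral.integral_congr fun t ht => ?_
      rw [Set.uIcc_of_le hr.le] at ht
      rw [abs_of_nonneg ht.1]
    rw [this, integral_rpow (Or.inl (by linarith)), Real.zero_rpow (by linarith), sub_zero,
      show -p + 1 = 1 - p by ring]
  have h2 : ∫ t in (-r)..(0 : ℝ), |t| ^ (-p) = r ^ (1 - p) / (1 - p) := by
    rw [← h1]
    have := intervalIntegral.integral_comp_neg (a := -r) (b := 0) (fun t : ℝ => |t| ^ (-p))
    simp only [abs_neg, neg_neg, neg_zero] at this
    exact this
  rw [h1, h2]; ring

theorem exp_sqNorm_eq_prod (c : ℝ) (k : Fin d → ℝ) :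
    Real.exp (-(c * sqNorm k)) = ∏ i, Real.exp (-c * k i ^ 2) := by
  rw [← Real.exp_sum, ← Finset.mul_sum, sqNorm, neg_mul]

theorem integrable_exp_sqNorm {c : ℝ} (hc : 0 < c) :
    Integrable (fun k : Fin d → ℝ => Real.exp (-(c * sqNorm k))) := by
  simp only [exp_sqNorm_eq_prod]
  exact Integrable.fintype_prod (f := fun _ t => Real.exp (-c * t ^ 2))
    fun _ => integrable_exp_neg_mul_sq hc

theorem integrable_dual_of_integrable {F : (Fin d → ℝ) → ℝ} (hF : Integrable F) :
    Integrable F (dualMeasure d) :=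
  hF.restrict.smul_measure ENNReal.ofReal_ne_top

theorem integral_dual_le_of_integrable {F : (Fin d → ℝ) → ℝ} (hF : Integrable F)
    (h0 : ∀ k, 0 ≤ F k) :
    ∫ k, F k ∂(dualMeasure d) ≤ ((2 * Real.pi) ^ d)⁻¹ * ∫ k, F k := by
  have hpi := Real.pi_pos
  rw [dualMeasure, integral_smul_measure, ENNReal.toReal_ofReal (by positivity), smul_eq_mul]
  refine mul_le_mul_of_nonneg_left ?_ (by positivity)
  exact setIntegral_le_integral hF (ae_of_all _ h0)

theorem integral_exp_sqNorm {c : ℝ} (hc : 0 < c) :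
    ∫ k : Fin d → ℝ, Real.exp (-(c * sqNorm k)) = Real.pi ^ ((d : ℝ) / 2) * c ^ (-(d : ℝ) / 2) := by
  simp only [exp_sqNorm_eq_prod]
  rw [integral_fintype_prod_volume_eq_prod (fun (_ : Fin d) (t : ℝ) => Real.exp (-c * t ^ 2))]
  simp only [integral_gaussian, Finset.prod_const, Finset.card_univ, Fintype.card_fin]
  rw [Real.sqrt_eq_rpow, ← Real.rpow_natCast, ← Real.rpow_mul (by positivity), div_eq_mul_inv,
    Real.mul_rpow Real.pi_pos.le (by positivity), Real.inv_rpow hc.le, ← Real.rpow_neg hc.le]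
  congr 2 <;> ring

end

/-! ### Consequences of the assumption on the step distribution -/

section

variable {d : ℕ} {ε C c₁ c₂ η L : ℝ} {D : (Fin d → ℤ) → ℝ} {f e : ℕ → (Fin d → ℝ) → ℝ → ℝ}

namespace AssumptionD

theorem hatD_zero (h : AssumptionD d ε C c₁ c₂ η L D f e) : hatD D 0 = 1 := by
  refine (hasSum_hatD h.normalised.summable h.nonneg 0).unique ?_
  have : ∀ x : Fin d → ℤ, dot (0 : Fin d → ℝ) x = 0 := fun x => by simp [dot]
  simpa only [this, Real.cos_zero, mul_one] using h.normalised

theorem aFun_zero (h : AssumptionD d ε C c₁ c₂ η L D f e) : aFun D 0 = 0 := by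
  rw [aFun, h.hatD_zero, sub_self]

theorem aFun_nonneg (h : AssumptionD d ε C c₁ c₂ η L D f e) (k : Fin d → ℝ) : 0 ≤ aFun D k := by
  have := (abs_le.1 (abs_hatD_le h.normalised h.nonneg k)).2
  rw [aFun]; linarith

theorem hatD_sq_le (h : AssumptionD d ε C c₁ c₂ η L D f e) (k : Fin d → ℝ) : hatD D k ^ 2 ≤ 1 := by
  rw [← sq_abs]
  exact pow_le_one₀ (abs_nonneg _) (abs_hatD_le h.normalised h.nonneg k)

theorem aFun_le_two (h : AssumptionD d ε C c₁ c₂ η L D f e) (k : Fin d → ℝ) : aFun D k ≤ 2 := by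
  have := (abs_le.1 (abs_hatD_le h.normalised h.nonneg k)).1
  rw [aFun]; linarith

theorem mul_sqNorm_le_aFun (h : AssumptionD d ε C c₁ c₂ η L D f e) (hd : 0 < d) (hη : 0 < η)
    {k : Fin d → ℝ} (hk : k ∈ dualCube d) :
    min (c₁ * L ^ 2) (η / (d * Real.pi ^ 2)) * sqNorm k ≤ aFun D k := by
  have hd0 : (0 : ℝ) < d := by exact_mod_cast hd
  have hpi := Real.pi_pos
  rcases le_total ‖k‖ L⁻¹ with h1 | h1
  · exact (mul_le_mul_of_nonneg_right (min_le_left _ _) (sqNorm_nonneg k)).trans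
      (h.a_lower k hk h1)
  · refine le_trans (mul_le_mul_of_nonneg_right (min_le_right _ _) (sqNorm_nonneg k)) ?_
    refine le_trans ?_ (h.a_away k hk h1).le
    have h2 := sqNorm_le_norm_sq k
    have h3 : ‖k‖ ^ 2 ≤ Real.pi ^ 2 :=
      pow_le_pow_left₀ (norm_nonneg _) (norm_le_of_mem_dualCube hk) 2
    have h4 : sqNorm k ≤ d * Real.pi ^ 2 := h2.trans (by gcongr)
    calc η / (d * Real.pi ^ 2) * sqNorm k ≤ η / (d * Real.pi ^ 2) * (d * Real.pi ^ 2) := by gcongr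
      _ = η := by field_simp

theorem f_one_eq (h : AssumptionD d ε C c₁ c₂ η L D f e) {k : Fin d → ℝ} (hk : k ∈ dualCube d)
    {z : ℝ} (hz : 0 < z) : f 1 k z = z * hatD D k := by
  have := congrArg Complex.re (h.f_one k hk z hz)
  rwa [Complex.ofReal_re, Complex.re_ofReal_mul] at this

theorem g_one_eq {g : ℕ → (Fin d → ℝ) → ℝ → ℝ} (h : AssumptionD d ε C c₁ c₂ η L D f e)
    (hr : Recursion d f g e) {k : Fin d → ℝ} (hk : k ∈ dualCube d) {z : ℝ} (hz : 0 < z) :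
    g 1 k z = z * hatD D k := by
  have h1 := hr.succ 0 k hk z hz
  rw [zero_add, h.e_one k hk z hz, h.f_one_eq hk hz] at h1
  simpa [hr.zero k hk z hz] using h1.symm

end AssumptionD

/-- The integral of `∏ |kᵢ|^(-4/d)` over the cube `‖k‖ ≤ r`. -/
theorem integral_indicator_prod (hd : 4 < d) {r : ℝ} (hr : 0 < r) (hr' : r ≤ Real.pi) :
    Integrable (fun k : Fin d → ℝ => ∏ i, (Set.Icc (-r) r).indicator
      (fun t => |t| ^ (-(4 / d : ℝ))) (k i)) (dualMeasure d) ∧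
    ∫ k : Fin d → ℝ, ∏ i, (Set.Icc (-r) r).indicator (fun t => |t| ^ (-(4 / d : ℝ))) (k i)
      ∂(dualMeasure d)
      = ((2 * Real.pi) ^ d)⁻¹ * ((2 / (1 - 4 / d)) ^ d * r ^ ((d : ℝ) - 4)) := by
  have hd0 : (4 : ℝ) < d := by exact_mod_cast hd
  have hp : (4 : ℝ) / d < 1 := by rw [div_lt_one (by linarith)]; exact hd0
  have hsub : Set.Icc (-r) r ⊆ Set.Icc (-Real.pi) Real.pi :=
    Set.Icc_subset_Icc (by linarith) hr'
  constructor
  · refine integrable_dualMeasure_prod (F := fun _ => (Set.Icc (-r) r).indicator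
      (fun t => |t| ^ (-(4 / d : ℝ)))) fun i => ?_
    exact (((integrableOn_abs_rpow hp r).integrable_indicator measurableSet_Icc).integrableOn)
  · rw [integral_dualMeasure_prod d fun _ => (Set.Icc (-r) r).indicator
      (fun t => |t| ^ (-(4 / d : ℝ)))]
    have h1 : ∫ t in Set.Icc (-Real.pi) Real.pi, (Set.Icc (-r) r).indicator
        (fun t => |t| ^ (-(4 / d : ℝ))) t = 2 * (r ^ (1 - 4 / d : ℝ) / (1 - 4 / d)) := by
      rw [setIntegral_indicator measurableSet_Icc, Set.inter_eq_right.2 hsub,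
        setIntegral_abs_rpow hp hr]
    simp only [h1, Finset.prod_const, Finset.card_univ, Fintype.card_fin, smul_eq_mul]
    congr 1
    rw [show 2 * (r ^ (1 - 4 / d : ℝ) / (1 - 4 / d)) = 2 / (1 - 4 / d) * r ^ (1 - 4 / d : ℝ) by
      ring, mul_pow, ← Real.rpow_natCast (r ^ _), ← Real.rpow_mul hr.le]
    congr 2
    field_simp

/-- Every piece produces the factor L^{-d}. For ‖k‖ ≤ 1/L, the Gaussian with variance of order
1/(nL²) integrates to L^{-d} n^{-d/2}, and a^{-2} ≤ const · L^{-4}|k|^{-4} integrates over the cube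
of side 2/L to L^{-4} · L^{-(d-4)}; convergence requires d > 4. For larger k, a > η makes the bound
on F uniform, and the weight D̂² integrates to at most C L^{-d}. -/
theorem exists_eLpNorm_bound (hd : 4 < d) (C : ℝ) {c₁ η C₁ c : ℝ} (hc₁ : 0 < c₁) (hη : 0 < η)
    (hC₁ : 0 ≤ C₁) (hc : 0 < c) :
    ∃ K : ℝ, ∀ (ε c₂ L : ℝ) (D : (Fin d → ℤ) → ℝ) (f e : ℕ → (Fin d → ℝ) → ℝ → ℝ),
      AssumptionD d ε C c₁ c₂ η L D f e → 1 ≤ L → ∀ (F : (Fin d → ℝ) → ℝ) (n : ℕ) (b : ℝ),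
      1 ≤ n → 0 ≤ b → b ≤ 1 →
      (∀ k ∈ dualCube d, |F k| ≤ C₁ * Real.exp (-(c * n * aFun D k))
        + C₁ * b * (aFun D k ^ 2)⁻¹ * (n : ℝ) ^ (-((d : ℝ) / 2))) →
      eLpNorm (fun k => hatD D k ^ 2 * F k) 1 (dualMeasure d)
        ≤ ENNReal.ofReal (K * beta d L * (n : ℝ) ^ (-(d : ℝ) / 2)) := by
  have hpi := Real.pi_pos
  have hd0 : (4 : ℝ) < d := by exact_mod_cast hd
  obtain ⟨C₂, hC₂, hexp⟩ := exists_exp_neg_le_rpow (mul_pos hc hη) ((d : ℝ) / 2)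
  set K₁ := ((2 * Real.pi) ^ d)⁻¹ * (Real.pi ^ ((d : ℝ) / 2) * (c * c₁) ^ (-(d : ℝ) / 2)) with hK₁
  set K₂ := (c₁ ^ 2)⁻¹ * (((2 * Real.pi) ^ d)⁻¹ * (2 / (1 - 4 / d : ℝ)) ^ d) with hK₂
  refine ⟨C₁ * (K₁ + C₂ * |C|) + C₁ * (K₂ + (η ^ 2)⁻¹ * |C|), ?_⟩
  intro ε c₂ L D f e h hL F n b hn hb hb1 hF
  have hL0 : 0 < L := by linarith
  have hn0 : (0 : ℝ) < n := by exact_mod_cast hn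
  have hLpi : L⁻¹ ≤ Real.pi := (inv_le_one_of_one_le₀ hL).trans (by linarith [Real.pi_gt_three])
  set φ : (Fin d → ℝ) → ℝ := fun k => ∏ i, (Set.Icc (-L⁻¹) L⁻¹).indicator
      (fun t => |t| ^ (-(4 / d : ℝ))) (k i) with hφ
  have hφ0 : ∀ k, 0 ≤ φ k := fun k => Finset.prod_nonneg fun i _ =>
    Set.indicator_nonneg (fun t _ => by positivity) _
  obtain ⟨hφi, hφI⟩ := integral_indicator_prod hd (inv_pos.2 hL0) hLpi
  set N := (n : ℝ) ^ (-(d : ℝ) / 2) with hN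
  have hN0 : 0 ≤ N := by positivity
  have hNd : (n : ℝ) ^ (-((d : ℝ) / 2)) = N := by rw [hN, neg_div]
  have hβ : 0 ≤ beta d L := by unfold beta; positivity
  set G : (Fin d → ℝ) → ℝ := fun k =>
    C₁ * (Real.exp (-((c * n * (c₁ * L ^ 2)) * sqNorm k)) + C₂ * N * hatD D k ^ 2)
      + C₁ * N * (((c₁ * L ^ 2) ^ 2)⁻¹ * φ k + (η ^ 2)⁻¹ * hatD D k ^ 2) with hG
  have hcn : 0 < c * n * (c₁ * L ^ 2) := by positivity
  have hgi := integrable_dual_of_integrable (integrable_exp_sqNorm (d := d) hcn)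
  have hDi := integrable_hatD_sq h.normalised h.nonneg
  have hG1i : Integrable (fun k : Fin d → ℝ =>
      Real.exp (-((c * n * (c₁ * L ^ 2)) * sqNorm k)) + C₂ * N * hatD D k ^ 2) (dualMeasure d) :=
    hgi.add (hDi.const_mul _)
  have hG2i : Integrable (fun k : Fin d → ℝ =>
      ((c₁ * L ^ 2) ^ 2)⁻¹ * φ k + (η ^ 2)⁻¹ * hatD D k ^ 2) (dualMeasure d) :=
    (hφi.const_mul _).add (hDi.const_mul _)
  have hGi : Integrable G (dualMeasure d) := (hG1i.const_mul _).add (hG2i.const_mul _)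
  have hpt : ∀ᵐ k ∂(dualMeasure d), |hatD D k ^ 2 * F k| ≤ G k := by
    filter_upwards [ae_mem_dualCube d, ae_forall_ne_zero (d := d)] with k hk hk0
    have hD0 : 0 ≤ hatD D k ^ 2 := sq_nonneg _
    have hD1 := h.hatD_sq_le k
    have hane := h.aFun_nonneg k
    have h1 : |hatD D k ^ 2 * F k| ≤ hatD D k ^ 2 * (C₁ * Real.exp (-(c * n * aFun D k))
        + C₁ * N * (aFun D k ^ 2)⁻¹) := by
      rw [abs_mul, abs_of_nonneg hD0]
      refine mul_le_mul_of_nonneg_left ((hF k hk).trans ?_) hD0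
      rw [hNd]
      have : C₁ * b * (aFun D k ^ 2)⁻¹ * N ≤ C₁ * 1 * (aFun D k ^ 2)⁻¹ * N := by gcongr
      linarith
    refine h1.trans ?_
    have hE0 : 0 ≤ Real.exp (-((c * n * (c₁ * L ^ 2)) * sqNorm k)) := (Real.exp_pos _).le
    rcases le_or_gt ‖k‖ L⁻¹ with hkL | hkL
    · have ha := h.a_lower k hk hkL
      have hs : 0 < sqNorm k := lt_of_lt_of_le
        (by have : 0 < ‖k‖ := norm_pos_iff.2 fun hz => hk0 ⟨0, by omega⟩ (by rw [hz]; rfl)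
            positivity) (norm_sq_le_sqNorm k)
      have hφk : φ k = ∏ i, |k i| ^ (-(4 / d : ℝ)) := by
        refine Finset.prod_congr rfl fun i _ => ?_
        rw [Set.indicator_of_mem]
        exact abs_le.1 ((norm_le_pi_norm k i).trans hkL)
      have h2 : Real.exp (-(c * n * aFun D k))
          ≤ Real.exp (-((c * n * (c₁ * L ^ 2)) * sqNorm k)) := by
        refine Real.exp_le_exp.2 (neg_le_neg ?_)
        calc c * n * (c₁ * L ^ 2) * sqNorm k = c * n * (c₁ * L ^ 2 * sqNorm k) := by ring
          _ ≤ _ := by gcongr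
      have h3 : (aFun D k ^ 2)⁻¹ ≤ ((c₁ * L ^ 2) ^ 2)⁻¹ * φ k := by
        calc (aFun D k ^ 2)⁻¹ ≤ ((c₁ * L ^ 2 * sqNorm k) ^ 2)⁻¹ := by gcongr
          _ = ((c₁ * L ^ 2) ^ 2)⁻¹ * (sqNorm k ^ 2)⁻¹ := by rw [mul_pow, mul_inv]
          _ ≤ _ := by
            rw [hφk]
            gcongr
            exact inv_sqNorm_sq_le_prod (by omega) hk0
      calc hatD D k ^ 2 * (C₁ * Real.exp (-(c * n * aFun D k)) + C₁ * N * (aFun D k ^ 2)⁻¹)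
          ≤ 1 * (C₁ * Real.exp (-((c * n * (c₁ * L ^ 2)) * sqNorm k))
            + C₁ * N * (((c₁ * L ^ 2) ^ 2)⁻¹ * φ k)) := by gcongr
        _ ≤ G k := by
            rw [hG, one_mul]
            simp only
            gcongr
            · exact le_add_of_nonneg_right (by positivity)
            · exact le_add_of_nonneg_right (by positivity)
    · have ha := (h.a_away k hk hkL.le).le
      have h2 : Real.exp (-(c * n * aFun D k)) ≤ C₂ * N := by
        calc Real.exp (-(c * n * aFun D k)) ≤ Real.exp (-(c * η * n)) := by
              refine Real.exp_le_exp.2 (neg_le_neg ?_)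
              calc c * η * n = c * n * η := by ring
                _ ≤ _ := by gcongr
          _ ≤ C₂ * (1 + n) ^ (-((d : ℝ) / 2)) := hexp n hn0.le
          _ ≤ C₂ * N := by
              rw [← hNd]
              refine mul_le_mul_of_nonneg_left ?_ hC₂.le
              exact Real.rpow_le_rpow_of_nonpos hn0 (by linarith) (by linarith)
      have h3 : (aFun D k ^ 2)⁻¹ ≤ (η ^ 2)⁻¹ := by gcongr
      calc hatD D k ^ 2 * (C₁ * Real.exp (-(c * n * aFun D k)) + C₁ * N * (aFun D k ^ 2)⁻¹)
          ≤ hatD D k ^ 2 * (C₁ * (C₂ * N) + C₁ * N * (η ^ 2)⁻¹) := by gcongr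
        _ = C₁ * (0 + C₂ * N * hatD D k ^ 2)
            + C₁ * N * (((c₁ * L ^ 2) ^ 2)⁻¹ * 0 + (η ^ 2)⁻¹ * hatD D k ^ 2) := by ring
        _ ≤ G k := by
            rw [hG]
            simp only
            gcongr
            exact hφ0 k
  have hG0 : 0 ≤ᵐ[dualMeasure d] G := by
    filter_upwards [hpt] with k hk using (abs_nonneg _).trans hk
  have hcalc : ∫ k, G k ∂(dualMeasure d)
      ≤ (C₁ * (K₁ + C₂ * |C|) + C₁ * (K₂ + (η ^ 2)⁻¹ * |C|)) * beta d L * N := by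
    have hDI : ∫ k, hatD D k ^ 2 ∂(dualMeasure d) ≤ |C| * beta d L :=
      (integral_hatD_sq_le h.normalised h.nonneg h.sup_le).trans
        (mul_le_mul_of_nonneg_right (le_abs_self C) hβ)
    have hgI : ∫ k : Fin d → ℝ, Real.exp (-((c * n * (c₁ * L ^ 2)) * sqNorm k)) ∂(dualMeasure d)
        ≤ K₁ * beta d L * N := by
      refine (integral_dual_le_of_integrable (integrable_exp_sqNorm (d := d) hcn)
        fun k => (Real.exp_pos _).le).trans (le_of_eq ?_)
      rw [integral_exp_sqNorm hcn, show c * n * (c₁ * L ^ 2) = (c * c₁) * (n * L ^ 2) by ring,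
        Real.mul_rpow (by positivity) (by positivity), Real.mul_rpow hn0.le (by positivity)]
      have : (L ^ 2) ^ (-(d : ℝ) / 2) = beta d L := by
        rw [beta, ← Real.rpow_natCast L 2, ← Real.rpow_mul hL0.le, ← Real.rpow_natCast L d,
          ← Real.rpow_neg hL0.le]
        congr 1
        push_cast; ring
      rw [this]; ring
    have hφI' : ((c₁ * L ^ 2) ^ 2)⁻¹ * ∫ k, φ k ∂(dualMeasure d) = K₂ * beta d L := by
      rw [hφI, Real.inv_rpow hL0.le, Real.rpow_sub hL0, Real.rpow_natCast,
        show L ^ (4 : ℝ) = L ^ 4 by norm_cast, beta, hK₂]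
      field_simp
    have hsum : ∫ k, G k ∂(dualMeasure d)
        = C₁ * (∫ k : Fin d → ℝ, Real.exp (-((c * n * (c₁ * L ^ 2)) * sqNorm k)) ∂(dualMeasure d)
            + C₂ * N * ∫ k, hatD D k ^ 2 ∂(dualMeasure d))
          + C₁ * N * (((c₁ * L ^ 2) ^ 2)⁻¹ * ∫ k, φ k ∂(dualMeasure d)
            + (η ^ 2)⁻¹ * ∫ k, hatD D k ^ 2 ∂(dualMeasure d)) := by
      rw [hG, integral_add (hG1i.const_mul _) (hG2i.const_mul _), integral_const_mul,
        integral_const_mul, integral_add hgi (hDi.const_mul _),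
        integral_add (hφi.const_mul _) (hDi.const_mul _), integral_const_mul, integral_const_mul,
        integral_const_mul]
    rw [hsum, hφI']
    calc _ ≤ C₁ * (K₁ * beta d L * N + C₂ * N * (|C| * beta d L))
          + C₁ * N * (K₂ * beta d L + (η ^ 2)⁻¹ * (|C| * beta d L)) := by gcongr
      _ = _ := by ring
  rw [eLpNorm_one_eq_lintegral_enorm]
  calc ∫⁻ k, ‖hatD D k ^ 2 * F k‖ₑ ∂(dualMeasure d)
      ≤ ∫⁻ k, ENNReal.ofReal (G k) ∂(dualMeasure d) := by
        refine lintegral_mono_ae ?_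
        filter_upwards [hpt] with k hk
        rw [← ofReal_norm, Real.norm_eq_abs]
        exact ENNReal.ofReal_le_ofReal hk
    _ = ENNReal.ofReal (∫ k, G k ∂(dualMeasure d)) :=
        (ofReal_integral_eq_lintegral_ofReal hGi hG0).symm
    _ ≤ _ := ENNReal.ofReal_le_ofReal hcalc

end

/-! ### Second derivatives at the origin -/

/-- The quadratic bound forces h'(0) = 0, after which l'Hôpital's rule needs only the existence of
the second derivative at 0. -/
theorem tendsto_sub_div_sq {h : ℝ → ℝ} (hd : ∀ᶠ t in 𝓝 (0 : ℝ), DifferentiableAt ℝ h t)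
    (hd2 : DifferentiableAt ℝ (deriv h) 0) {M : ℝ}
    (hM : ∀ᶠ t in 𝓝 (0 : ℝ), |h t - h 0| ≤ M * t ^ 2) :
    Tendsto (fun t => (h t - h 0) / t ^ 2) (𝓝[≠] 0) (𝓝 (deriv (deriv h) 0 / 2)) := by
  have hd0 : DifferentiableAt ℝ h 0 := hd.self_of_nhds
  have hderiv : deriv h 0 = 0 := by
    have h1 := hd0.hasDerivAt.tendsto_slope
    refine tendsto_nhds_unique h1 (squeeze_zero_norm' (a := fun t => M * |t|) ?_ ?_)
    · filter_upwards [hM.filter_mono nhdsWithin_le_nhds, self_mem_nhdsWithin] with t ht ht0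
      have ht0' : t ≠ 0 := ht0
      have : 0 < |t| := abs_pos.2 ht0'
      rw [slope_def_field, sub_zero, Real.norm_eq_abs, abs_div, div_le_iff₀ this]
      calc |h t - h 0| ≤ M * t ^ 2 := ht
        _ = M * |t| * |t| := by rw [mul_assoc, abs_mul_abs_self, sq]
    · have : Tendsto (fun t : ℝ => M * |t|) (𝓝 0) (𝓝 (M * |0|)) := by
        apply Continuous.tendsto; fun_prop
      rw [abs_zero, mul_zero] at this
      exact this.mono_left nhdsWithin_le_nhds
  refine HasDerivAt.lhopital_zero_nhdsNE (f' := deriv h) (g' := fun t => 2 * t) ?_ ?_ ?_ ?_ ?_ ?_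
  · filter_upwards [hd.filter_mono nhdsWithin_le_nhds] with t ht
    exact ht.hasDerivAt.sub_const _
  · refine Eventually.of_forall fun t => ?_
    simpa using hasDerivAt_pow 2 t
  · filter_upwards [self_mem_nhdsWithin] with t ht
    exact mul_ne_zero two_ne_zero ht
  · have : Tendsto (fun t => h t - h 0) (𝓝 0) (𝓝 (h 0 - h 0)) := hd0.continuousAt.tendsto.sub_const _
    rw [sub_self] at this
    exact this.mono_left nhdsWithin_le_nhds
  · have : Tendsto (fun t : ℝ => t ^ 2) (𝓝 0) (𝓝 (0 ^ 2)) := by apply Continuous.tendsto; fun_prop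
    rw [zero_pow two_ne_zero] at this
    exact this.mono_left nhdsWithin_le_nhds
  · have h1 := hd2.hasDerivAt.tendsto_slope
    refine (h1.div_const 2).congr fun t => ?_
    rw [slope_def_field, hderiv, sub_zero, sub_zero, div_div, mul_comm t 2]

theorem onAxis_zero {d : ℕ} (h : (Fin d → ℝ) → ℝ) (i : Fin d) : onAxis h i 0 = h 0 := by
  simp [onAxis]

theorem sqNorm_single {d : ℕ} (i : Fin d) (t : ℝ) : sqNorm (Pi.single i t) = t ^ 2 := by
  unfold sqNorm
  rw [Finset.sum_eq_single i]
  · simp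
  · intro j _ hj; simp [hj]
  · simp

theorem eventually_mem_dualCube (d : ℕ) : ∀ᶠ k in 𝓝 (0 : Fin d → ℝ), k ∈ dualCube d := by
  filter_upwards [Metric.ball_mem_nhds (0 : Fin d → ℝ) Real.pi_pos] with k hk
  rw [mem_ball_zero_iff] at hk
  exact mem_dualCube_iff.2 fun i => (norm_le_pi_norm k i).trans hk.le

theorem eventually_single {d : ℕ} {P : (Fin d → ℝ) → Prop} (h : ∀ᶠ k in 𝓝 (0 : Fin d → ℝ), P k)
    (i : Fin d) : ∀ᶠ t in 𝓝 (0 : ℝ), P (Pi.single i t) := by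
  have : Tendsto (fun t : ℝ => (Pi.single i t : Fin d → ℝ)) (𝓝 0) (𝓝 0) := by
    have := (continuous_single (A := fun _ : Fin d => ℝ) i).tendsto (0 : ℝ)
    rwa [Pi.single_zero] at this
  exact this.eventually h

theorem HasSecondPartials.congr {d : ℕ} {h q : (Fin d → ℝ) → ℝ} (hh : HasSecondPartials h)
    (hq : ∀ k ∈ dualCube d, q k = h k) : HasSecondPartials q := by
  intro i
  have he : onAxis q i =ᶠ[𝓝 0] onAxis h i := eventually_single
    ((eventually_mem_dualCube d).mono hq) i
  refine ⟨?_, he.deriv.differentiableAt_iff.2 (hh i).2⟩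
  filter_upwards [he.eventuallyEq_nhds, (hh i).1] with t ht ht'
  exact ht.differentiableAt_iff.2 ht'

theorem lap0_eq_mul {d : ℕ} {h q : (Fin d → ℝ) → ℝ} {z : ℝ} (hh : HasSecondPartials h)
    (hq : ∀ k ∈ dualCube d, q k = z * h k) : lap0 q = z * lap0 h := by
  rw [lap0, lap0, Finset.mul_sum]
  refine Finset.sum_congr rfl fun i _ => ?_
  have he : onAxis q i =ᶠ[𝓝 0] fun t => z * onAxis h i t := eventually_single
    ((eventually_mem_dualCube d).mono hq) i
  rw [he.deriv.deriv_eq]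
  have : deriv (fun t => z * onAxis h i t) =ᶠ[𝓝 0] fun t => z * deriv (onAxis h i) t := by
    filter_upwards [(hh i).1] with t ht
    exact deriv_const_mul _ ht
  rw [this.deriv_eq, deriv_const_mul _ (hh i).2]

namespace AssumptionD

variable {d : ℕ} {ε C c₁ c₂ η L : ℝ} {D : (Fin d → ℤ) → ℝ} {f e : ℕ → (Fin d → ℝ) → ℝ → ℝ}

theorem hasSecondPartials_hatD (h : AssumptionD d ε C c₁ c₂ η L D f e)
    (h1 : HasSecondPartials fun k => f 1 k 1) : HasSecondPartials (hatD D) :=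
  h1.congr fun k hk => by rw [h.f_one_eq hk one_pos, one_mul]

theorem eventually_aFun_le (h : AssumptionD d ε C c₁ c₂ η L D f e) (hL : 1 ≤ L) :
    ∀ᶠ k in 𝓝 (0 : Fin d → ℝ), aFun D k ≤ c₂ * L ^ 2 * sqNorm k := by
  filter_upwards [eventually_mem_dualCube d,
    Metric.ball_mem_nhds (0 : Fin d → ℝ) (inv_pos.2 (by linarith : 0 < L))] with k hk hk'
  rw [mem_ball_zero_iff] at hk'
  exact h.a_upper k hk hk'.le

theorem eventually_le_aFun (h : AssumptionD d ε C c₁ c₂ η L D f e) (hL : 1 ≤ L) :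
    ∀ᶠ k in 𝓝 (0 : Fin d → ℝ), c₁ * L ^ 2 * sqNorm k ≤ aFun D k := by
  filter_upwards [eventually_mem_dualCube d,
    Metric.ball_mem_nhds (0 : Fin d → ℝ) (inv_pos.2 (by linarith : 0 < L))] with k hk hk'
  rw [mem_ball_zero_iff] at hk'
  exact h.a_lower k hk hk'.le

theorem tendsto_aFun_div_sq (h : AssumptionD d ε C c₁ c₂ η L D f e) (hL : 1 ≤ L)
    (h1 : HasSecondPartials fun k => f 1 k 1) (i : Fin d) :
    Tendsto (fun t => aFun D (Pi.single i t) / t ^ 2) (𝓝[≠] 0)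
      (𝓝 (-deriv (deriv (onAxis (hatD D) i)) 0 / 2)) := by
  have h2 := h.hasSecondPartials_hatD h1 i
  have key := tendsto_sub_div_sq h2.1 h2.2 (M := c₂ * L ^ 2) ?_
  · rw [neg_div]
    refine key.neg.congr fun t => ?_
    rw [onAxis_zero, h.hatD_zero, aFun, onAxis]
    ring
  · filter_upwards [eventually_single (h.eventually_aFun_le hL) i] with t ht
    rw [sqNorm_single] at ht
    rw [onAxis_zero, h.hatD_zero, onAxis, abs_sub_comm]
    have := h.aFun_nonneg (Pi.single i t)
    rw [aFun] at this ht
    rwa [abs_of_nonneg this]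

theorem le_sigmaSq (h : AssumptionD d ε C c₁ c₂ η L D f e) (hL : 1 ≤ L)
    (h1 : HasSecondPartials fun k => f 1 k 1) : 2 * d * (c₁ * L ^ 2) ≤ sigmaSq D := by
  have key : ∀ i : Fin d, 2 * (c₁ * L ^ 2) ≤ -deriv (deriv (onAxis (hatD D) i)) 0 := by
    intro i
    have := ge_of_tendsto (h.tendsto_aFun_div_sq hL h1 i) (b := c₁ * L ^ 2) ?_
    · linarith
    · filter_upwards [(eventually_single (h.eventually_le_aFun hL) i).filter_mono
        nhdsWithin_le_nhds, self_mem_nhdsWithin] with t ht ht0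
      have ht0' : t ≠ 0 := ht0
      rw [sqNorm_single] at ht
      rw [le_div_iff₀ (by positivity)]
      exact ht
  rw [sigmaSq, lap0, ← Finset.sum_neg_distrib]
  calc 2 * d * (c₁ * L ^ 2) = ∑ _i : Fin d, 2 * (c₁ * L ^ 2) := by simp; ring
    _ ≤ _ := Finset.sum_le_sum fun i _ => key i

theorem sigmaSq_pos (h : AssumptionD d ε C c₁ c₂ η L D f e) (hd : 0 < d) (hc₁ : 0 < c₁)
    (hL : 1 ≤ L) (h1 : HasSecondPartials fun k => f 1 k 1) : 0 < sigmaSq D := by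
  have hd0 : (0 : ℝ) < d := by exact_mod_cast hd
  have hL0 : 0 < L := by linarith
  exact lt_of_lt_of_le (by positivity) (h.le_sigmaSq hL h1)

/-- Along each axis the second derivative is the limit of 2(q(k) - q(0))/k², and the same limit for
a(k) sums to σ². A bound by n a(k) on the increment of f_n therefore controls its Laplacian, with no
recursion for derivatives. -/
theorem abs_lap0_le (h : AssumptionD d ε C c₁ c₂ η L D f e) (hL : 1 ≤ L)
    (h1 : HasSecondPartials fun k => f 1 k 1) {q : (Fin d → ℝ) → ℝ} (hq : HasSecondPartials q)
    {M : ℝ} (hM0 : 0 ≤ M) (hM : ∀ k ∈ dualCube d, |q k - q 0| ≤ M * aFun D k) :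
    |lap0 q| ≤ M * sigmaSq D := by
  have key : ∀ i : Fin d, |deriv (deriv (onAxis q i)) 0|
      ≤ M * -deriv (deriv (onAxis (hatD D) i)) 0 := by
    intro i
    have hev := eventually_single ((eventually_mem_dualCube d).mono hM) i
    have ht := tendsto_sub_div_sq (hq i).1 (hq i).2 (M := M * (c₂ * L ^ 2)) (by
      filter_upwards [hev, eventually_single (h.eventually_aFun_le hL) i] with t ht1 ht2
      rw [onAxis_zero, onAxis]
      rw [sqNorm_single] at ht2
      calc _ ≤ _ := ht1
        _ ≤ M * (c₂ * L ^ 2 * t ^ 2) := by gcongr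
        _ = _ := by ring)
    have := le_of_tendsto_of_tendsto ht.abs ((h.tendsto_aFun_div_sq hL h1 i).const_mul M) (by
      filter_upwards [hev.filter_mono nhdsWithin_le_nhds] with t ht1
      rw [onAxis_zero, onAxis, abs_div, abs_of_nonneg (sq_nonneg t), ← mul_div_assoc]
      gcongr)
    rw [abs_div, abs_two] at this
    linarith
  calc |lap0 q| ≤ ∑ i, |deriv (deriv (onAxis q i)) 0| := Finset.abs_sum_le_sum_abs _ _
    _ ≤ ∑ i, M * -deriv (deriv (onAxis (hatD D) i)) 0 := Finset.sum_le_sum fun i _ => key i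
    _ = _ := by rw [← Finset.mul_sum, Finset.sum_neg_distrib, sigmaSq, lap0]

end AssumptionD

/-! ### The expansion of `a(k)` at the origin -/

/-- The Taylor remainder gives θ⁴ for |θ| ≤ 1, and θ² is trivial beyond. The intermediate power
|θ|^{2+2δ} is the one matched by the available moment of D. -/
theorem abs_one_sub_cos_sub_le {δ : ℝ} (hδ : 0 ≤ δ) (hδ1 : δ ≤ 1) (θ : ℝ) :
    |1 - Real.cos θ - θ ^ 2 / 2| ≤ (θ ^ 2) ^ (1 + δ) := by
  rcases le_or_gt |θ| 1 with h | h
  · have h1 := Real.cos_bound h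
    have h2 : θ ^ 2 ≤ 1 := by rw [← sq_abs]; exact pow_le_one₀ (abs_nonneg _) h
    calc |1 - Real.cos θ - θ ^ 2 / 2| = |Real.cos θ - (1 - θ ^ 2 / 2)| := by
          rw [← abs_neg]; ring_nf
      _ ≤ |θ| ^ 4 * (5 / 96) := h1
      _ ≤ |θ| ^ 4 := by nlinarith [pow_nonneg (abs_nonneg θ) 4]
      _ = (θ ^ 2) ^ (2 : ℝ) := by
          rw [show |θ| ^ 4 = (|θ| ^ 2) ^ 2 by ring, sq_abs]; norm_cast
      _ ≤ _ := by
          rcases (sq_nonneg θ).eq_or_lt with h0 | h0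
          · rw [← h0, Real.zero_rpow (by norm_num), Real.zero_rpow (by linarith)]
          · exact Real.rpow_le_rpow_of_exponent_ge h0 h2 (by linarith)
  · have h2 : 1 ≤ θ ^ 2 := by rw [← sq_abs]; exact one_le_pow₀ h.le
    have h3 := Real.one_sub_sq_div_two_le_cos (x := θ)
    have h4 := Real.cos_le_one θ
    calc |1 - Real.cos θ - θ ^ 2 / 2| ≤ θ ^ 2 := abs_le.2 ⟨by linarith, by linarith⟩
      _ = (θ ^ 2) ^ (1 : ℝ) := (Real.rpow_one _).symm
      _ ≤ _ := Real.rpow_le_rpow_of_exponent_le h2 (by linarith)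

theorem dot_sq_le {d : ℕ} (k : Fin d → ℝ) (x : Fin d → ℤ) :
    dot k x ^ 2 ≤ sqNorm k * sqNorm (toReal x) :=
  Finset.sum_mul_sq_le_sq_mul_sq _ _ _

/-- The squared norm of a lattice point is an integer, hence either 0 or at least 1. -/
theorem sqNorm_toReal_rpow_le {d : ℕ} (x : Fin d → ℤ) {p q : ℝ} (hp : 0 < p) (hpq : p ≤ q) :
    sqNorm (toReal x) ^ p ≤ sqNorm (toReal x) ^ q := by
  have hint : sqNorm (toReal x) = ((∑ i, x i ^ 2 : ℤ) : ℝ) := by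
    simp [sqNorm, toReal]
  rcases (Finset.sum_nonneg fun i _ => sq_nonneg (x i) : 0 ≤ ∑ i, x i ^ 2).eq_or_lt with h | h
  · rw [hint, ← h, Int.cast_zero, Real.zero_rpow hp.ne', Real.zero_rpow (by linarith)]
  · refine Real.rpow_le_rpow_of_exponent_le ?_ hpq
    rw [hint]; exact_mod_cast h

/-- The quadratic form `∑ₓ D(x) (k·x)²`. -/
noncomputable def quadForm {d : ℕ} (D : (Fin d → ℤ) → ℝ) (k : Fin d → ℝ) : ℝ :=
  ∑' x, D x * dot k x ^ 2

theorem dot_smul {d : ℕ} (t : ℝ) (k : Fin d → ℝ) (x : Fin d → ℤ) :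
    dot (t • k) x = t * dot k x := by
  simp only [dot, Pi.smul_apply, smul_eq_mul, Finset.mul_sum, mul_assoc]

theorem quadForm_smul {d : ℕ} (D : (Fin d → ℤ) → ℝ) (t : ℝ) (k : Fin d → ℝ) :
    quadForm D (t • k) = t ^ 2 * quadForm D k := by
  rw [quadForm, quadForm, ← tsum_mul_left]
  refine tsum_congr fun x => ?_
  rw [dot_smul]; ring

theorem sqNorm_smul {d : ℕ} (t : ℝ) (k : Fin d → ℝ) : sqNorm (t • k) = t ^ 2 * sqNorm k := by
  simp only [sqNorm, Pi.smul_apply, smul_eq_mul, Finset.mul_sum, mul_pow]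

namespace AssumptionD

variable {d : ℕ} {ε C c₁ c₂ η L : ℝ} {D : (Fin d → ℤ) → ℝ} {f e : ℕ → (Fin d → ℝ) → ℝ → ℝ}

theorem summable_moment (h : AssumptionD d ε C c₁ c₂ η L D f e) {p : ℝ} (hp : 0 < p)
    (hpε : p ≤ 1 + ε) : Summable fun x : Fin d → ℤ => D x * sqNorm (toReal x) ^ p := by
  refine Summable.of_nonneg_of_le (fun x => mul_nonneg (h.nonneg x)
    (Real.rpow_nonneg (sqNorm_nonneg _) _)) (fun x => ?_) h.moment
  rw [mul_comm]
  refine mul_le_mul_of_nonneg_right ?_ (h.nonneg x)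
  refine (sqNorm_toReal_rpow_le x hp hpε).trans (le_of_eq ?_)
  rw [Real.sqrt_eq_rpow, ← Real.rpow_mul (sqNorm_nonneg _)]
  congr 1; ring

theorem summable_dot_sq (h : AssumptionD d ε C c₁ c₂ η L D f e) (hε : 0 ≤ ε) (k : Fin d → ℝ) :
    Summable fun x => D x * dot k x ^ 2 := by
  refine Summable.of_nonneg_of_le (fun x => mul_nonneg (h.nonneg x) (sq_nonneg _)) (fun x => ?_)
    ((h.summable_moment one_pos (by linarith)).mul_left (sqNorm k))
  rw [Real.rpow_one, mul_left_comm]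
  exact mul_le_mul_of_nonneg_left (dot_sq_le k x) (h.nonneg x)

theorem exists_abs_aFun_sub_quadForm_le (h : AssumptionD d ε C c₁ c₂ η L D f e) {δ : ℝ}
    (hδ : 0 ≤ δ) (hδ1 : δ ≤ 1) (hδε : δ ≤ ε) :
    ∃ M : ℝ, 0 ≤ M ∧ ∀ k, |aFun D k - quadForm D k / 2| ≤ M * sqNorm k ^ (1 + δ) := by
  have hs := h.summable_moment (p := 1 + δ) (by linarith) (by linarith)
  refine ⟨∑' x, D x * sqNorm (toReal x) ^ (1 + δ), tsum_nonneg fun x => mul_nonneg (h.nonneg x)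
    (Real.rpow_nonneg (sqNorm_nonneg _) _), fun k => ?_⟩
  have h1 : HasSum (fun x => D x * (1 - Real.cos (dot k x) - dot k x ^ 2 / 2))
      (aFun D k - quadForm D k / 2) := by
    have h2 := (h.normalised.sub (hasSum_hatD h.normalised.summable h.nonneg k)).sub
      ((h.summable_dot_sq (by linarith) k).hasSum.div_const 2)
    refine h2.congr_fun fun x => ?_
    ring
  have h3 := tsum_of_norm_bounded (hs.hasSum.mul_right (sqNorm k ^ (1 + δ)))
    (f := fun x => D x * (1 - Real.cos (dot k x) - dot k x ^ 2 / 2)) fun x => ?_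
  · rwa [h1.tsum_eq] at h3
  · rw [norm_mul, Real.norm_of_nonneg (h.nonneg x), mul_assoc]
    refine mul_le_mul_of_nonneg_left ?_ (h.nonneg x)
    refine (abs_one_sub_cos_sub_le hδ hδ1 _).trans ?_
    rw [← Real.mul_rpow (sqNorm_nonneg _) (sqNorm_nonneg _), mul_comm]
    exact Real.rpow_le_rpow (sq_nonneg _) (dot_sq_le k x) (by linarith)

theorem tendsto_aFun_smul_div_sq (h : AssumptionD d ε C c₁ c₂ η L D f e) {δ : ℝ}
    (hδ : 0 < δ) (hδ1 : δ ≤ 1) (hδε : δ ≤ ε) (k : Fin d → ℝ) :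
    Tendsto (fun t : ℝ => aFun D (t • k) / t ^ 2) (𝓝[≠] 0) (𝓝 (quadForm D k / 2)) := by
  obtain ⟨M, hM0, hM⟩ := h.exists_abs_aFun_sub_quadForm_le hδ.le hδ1 hδε
  rw [tendsto_iff_norm_sub_tendsto_zero]
  refine squeeze_zero' (g := fun t => M * sqNorm k ^ (1 + δ) * (t ^ 2) ^ δ)
    (Eventually.of_forall fun t => norm_nonneg _) ?_ ?_
  · filter_upwards [self_mem_nhdsWithin] with t ht
    have ht0 : t ≠ 0 := ht
    have ht2 : 0 < t ^ 2 := by positivity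
    have h1 := hM (t • k)
    rw [quadForm_smul, sqNorm_smul, Real.mul_rpow ht2.le (sqNorm_nonneg _),
      Real.rpow_add ht2, Real.rpow_one] at h1
    rw [Real.norm_eq_abs, show aFun D (t • k) / t ^ 2 - quadForm D k / 2
      = (aFun D (t • k) - t ^ 2 * quadForm D k / 2) / t ^ 2 by field_simp, abs_div,
      abs_of_pos ht2, div_le_iff₀ ht2]
    refine h1.trans (le_of_eq ?_)
    ring
  · have : ContinuousAt (fun t : ℝ => M * sqNorm k ^ (1 + δ) * (t ^ 2) ^ δ) 0 := by
      refine ContinuousAt.mul continuousAt_const ?_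
      exact ((continuous_pow 2).continuousAt).rpow_const (Or.inr hδ.le)
    have := this.tendsto
    simp only [ne_eq, OfNat.ofNat_ne_zero, not_false_eq_true, zero_pow, Real.zero_rpow hδ.ne',
      mul_zero] at this
    exact this.mono_left nhdsWithin_le_nhds

theorem eventually_smul {P : (Fin d → ℝ) → Prop} (h : ∀ᶠ k in 𝓝 (0 : Fin d → ℝ), P k)
    (k : Fin d → ℝ) : ∀ᶠ t in 𝓝[≠] (0 : ℝ), P (t • k) := by
  have : Tendsto (fun t : ℝ => t • k) (𝓝 0) (𝓝 0) := by
    have h1 : Continuous fun t : ℝ => t • k := by fun_prop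
    have := h1.tendsto 0
    rwa [zero_smul] at this
  exact (this.eventually h).filter_mono nhdsWithin_le_nhds

/-- The quadratic form is the limit of 2a(tk)/t², so it inherits the symmetries of D̂ near the
origin; symmetry of D itself is never invoked. -/
theorem quadForm_eq_of_symm (h : AssumptionD d ε C c₁ c₂ η L D f e) {δ : ℝ}
    (hδ : 0 < δ) (hδ1 : δ ≤ 1) (hδε : δ ≤ ε) {k k' : Fin d → ℝ}
    (hk : ∀ᶠ t in 𝓝[≠] (0 : ℝ), hatD D (t • k) = hatD D (t • k')) :
    quadForm D k = quadForm D k' := by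
  have h1 := h.tendsto_aFun_smul_div_sq hδ hδ1 hδε k
  have h2 := h.tendsto_aFun_smul_div_sq hδ hδ1 hδε k'
  have := tendsto_nhds_unique (h1.congr' (by
    filter_upwards [hk] with t ht
    rw [aFun, ht, ← aFun])) h2
  linarith

/-- The symmetry is that of f₁(·;1), which equals D̂ on the dual cube. -/
theorem latticeSymmetric_hatD (h : AssumptionD d ε C c₁ c₂ η L D f e)
    (hs : LatticeSymmetric fun k => f 1 k 1) : LatticeSymmetric (hatD D) := by
  have h1 : ∀ k ∈ dualCube d, f 1 k 1 = hatD D k := fun k hk => by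
    rw [h.f_one_eq hk one_pos, one_mul]
  refine ⟨fun k hk i => ?_, fun k hk τ => ?_⟩
  · have hk' : Function.update k i (-k i) ∈ dualCube d := by
      rw [mem_dualCube_iff] at hk ⊢
      intro j
      by_cases hj : j = i
      · subst hj; simpa using hk j
      · simpa [hj] using hk j
    rw [← h1 _ hk, ← h1 _ hk']
    exact hs.1 k hk i
  · have hk' : (fun i => k (τ i)) ∈ dualCube d := by
      rw [mem_dualCube_iff] at hk ⊢
      exact fun j => hk _
    rw [← h1 _ hk, ← h1 _ hk']
    exact hs.2 k hk τ

theorem quadForm_update (h : AssumptionD d ε C c₁ c₂ η L D f e)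
    (hs : LatticeSymmetric fun k => f 1 k 1) {δ : ℝ}
    (hδ : 0 < δ) (hδ1 : δ ≤ 1) (hδε : δ ≤ ε) (k : Fin d → ℝ) (i : Fin d) :
    quadForm D (Function.update k i (-k i)) = quadForm D k := by
  refine h.quadForm_eq_of_symm hδ hδ1 hδε ?_
  filter_upwards [eventually_smul (eventually_mem_dualCube d) k] with t ht
  have h1 := (h.latticeSymmetric_hatD hs).1 _ ht i
  rw [← h1]
  congr 1
  ext j
  by_cases hj : j = i
  · subst hj; simp
  · simp [hj]

theorem quadForm_perm (h : AssumptionD d ε C c₁ c₂ η L D f e)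
    (hs : LatticeSymmetric fun k => f 1 k 1) {δ : ℝ}
    (hδ : 0 < δ) (hδ1 : δ ≤ 1) (hδε : δ ≤ ε) (k : Fin d → ℝ) (τ : Equiv.Perm (Fin d)) :
    quadForm D (fun i => k (τ i)) = quadForm D k := by
  refine h.quadForm_eq_of_symm hδ hδ1 hδε ?_
  filter_upwards [eventually_smul (eventually_mem_dualCube d) k] with t ht
  exact (h.latticeSymmetric_hatD hs).2 _ ht τ

end AssumptionD

theorem dot_single {d : ℕ} (i : Fin d) (t : ℝ) (x : Fin d → ℤ) :
    dot (Pi.single i t) x = t * x i := by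
  unfold dot
  rw [Finset.sum_eq_single i]
  · simp
  · intro j _ hj; simp [hj]
  · simp

theorem dot_add {d : ℕ} (k k' : Fin d → ℝ) (x : Fin d → ℤ) :
    dot (k + k') x = dot k x + dot k' x := by
  simp [dot, add_mul, Finset.sum_add_distrib]

namespace AssumptionD

variable {d : ℕ} {ε C c₁ c₂ η L : ℝ} {D : (Fin d → ℤ) → ℝ} {f e : ℕ → (Fin d → ℝ) → ℝ → ℝ}

theorem summable_coord_mul (h : AssumptionD d ε C c₁ c₂ η L D f e) (hε : 0 ≤ ε) (i j : Fin d) :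
    Summable fun x : Fin d → ℤ => D x * ((x i : ℝ) * x j) := by
  have h1 := h.summable_dot_sq hε (Pi.single i 1)
  have h2 := h.summable_dot_sq hε (Pi.single j 1)
  have h3 := h.summable_dot_sq hε (Pi.single i 1 + Pi.single j 1)
  refine (((h3.sub h1).sub h2).div_const 2).congr fun x => ?_
  rw [dot_add, dot_single, dot_single]
  ring

/-- The covariance form is isotropic. -/
theorem quadForm_eq (h : AssumptionD d ε C c₁ c₂ η L D f e)
    (hs : LatticeSymmetric fun k => f 1 k 1) {δ : ℝ}
    (hδ : 0 < δ) (hδ1 : δ ≤ 1) (hδε : δ ≤ ε) (i₀ : Fin d) (k : Fin d → ℝ) :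
    quadForm D k = quadForm D (Pi.single i₀ 1) * sqNorm k := by
  have hε : 0 ≤ ε := by linarith
  set q : Fin d → Fin d → ℝ := fun i j => ∑' x : Fin d → ℤ, D x * ((x i : ℝ) * x j) with hq
  have hq1 : ∀ i, quadForm D (Pi.single i 1) = q i i := by
    intro i
    refine tsum_congr fun x => ?_
    rw [dot_single]; ring
  have hq2 : ∀ i j s, quadForm D (Pi.single i 1 + Pi.single j s)
      = q i i + s ^ 2 * q j j + 2 * s * q i j := by
    intro i j s
    rw [hq]
    simp only
    rw [← tsum_mul_left, ← tsum_mul_left, ← Summable.tsum_add (h.summable_coord_mul hε i i)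
      ((h.summable_coord_mul hε j j).mul_left _), ← Summable.tsum_add
      ((h.summable_coord_mul hε i i).add ((h.summable_coord_mul hε j j).mul_left _))
      ((h.summable_coord_mul hε i j).mul_left _)]
    refine tsum_congr fun x => ?_
    rw [dot_add, dot_single, dot_single]; ring
  have hdiag : ∀ i, q i i = q i₀ i₀ := by
    intro i
    rw [← hq1, ← hq1, ← h.quadForm_perm hs hδ hδ1 hδε _ (Equiv.swap i₀ i)]
    congr 1
    ext j
    by_cases hj : j = i₀
    · subst hj; simp
    · have : Equiv.swap i₀ i j ≠ i := by
        rw [Ne, Equiv.swap_apply_eq_iff, Equiv.swap_apply_right]; exact hj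
      simp [hj, this]
  -- Reflection of the coordinate j changes the sign of the cross term and leaves the diagonal terms
  -- alone.
  have hoff : ∀ i j, i ≠ j → q i j = 0 := by
    intro i j hij
    have h1 := h.quadForm_update hs hδ hδ1 hδε (Pi.single i 1 + Pi.single j 1) j
    have h2 : Function.update (Pi.single i 1 + Pi.single j 1 : Fin d → ℝ) j
        (-(Pi.single i 1 + Pi.single j 1 : Fin d → ℝ) j) = Pi.single i 1 + Pi.single j (-1) := by
      ext l
      by_cases hl : l = j
      · subst hl; simp [hij.symm]
      · simp [hl]
    rw [h2, hq2, hq2] at h1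
    linarith
  have hexpand : quadForm D k = ∑ i, ∑ j, k i * k j * q i j := by
    have : ∀ x : Fin d → ℤ, D x * dot k x ^ 2
        = ∑ i, ∑ j, k i * k j * (D x * ((x i : ℝ) * x j)) := by
      intro x
      rw [sq, dot, Finset.sum_mul_sum, Finset.mul_sum]
      refine Finset.sum_congr rfl fun i _ => ?_
      rw [Finset.mul_sum]
      refine Finset.sum_congr rfl fun j _ => ?_
      ring
    rw [quadForm, tsum_congr this, Summable.tsum_finsetSum fun i _ => summable_sum fun j _ =>
      (h.summable_coord_mul hε i j).mul_left _]
    refine Finset.sum_congr rfl fun i _ => ?_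
    rw [Summable.tsum_finsetSum fun j _ => (h.summable_coord_mul hε i j).mul_left _]
    refine Finset.sum_congr rfl fun j _ => ?_
    rw [tsum_mul_left]
  rw [hexpand, hq1, sqNorm, Finset.mul_sum]
  refine Finset.sum_congr rfl fun i _ => ?_
  rw [Finset.sum_eq_single i, hdiag]
  · ring
  · intro j _ hj
    rw [hoff i j hj.symm, mul_zero]
  · simp

/-- Isotropy leaves a single constant in the quadratic form, and the trace identifies it as σ²/d. -/
theorem exists_aFun_expansion (h : AssumptionD d ε C c₁ c₂ η L D f e) (hd : 0 < d) (hL : 1 ≤ L)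
    (hs : LatticeSymmetric fun k => f 1 k 1) (h1 : HasSecondPartials fun k => f 1 k 1) {δ : ℝ}
    (hδ : 0 < δ) (hδ1 : δ ≤ 1) (hδε : δ ≤ ε) :
    ∃ M : ℝ, 0 ≤ M ∧ ∀ k,
      |aFun D k - sigmaSq D / (2 * d) * sqNorm k| ≤ M * sqNorm k ^ (1 + δ) := by
  have hd0 : (0 : ℝ) < d := by exact_mod_cast hd
  obtain ⟨M, hM0, hM⟩ := h.exists_abs_aFun_sub_quadForm_le hδ.le hδ1 hδε
  refine ⟨M, hM0, fun k => ?_⟩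
  have key : ∀ i : Fin d, -deriv (deriv (onAxis (hatD D) i)) 0
      = quadForm D (Pi.single ⟨0, hd⟩ 1) := by
    intro i
    have h2 := h.tendsto_aFun_div_sq hL h1 i
    have h3 := h.tendsto_aFun_smul_div_sq hδ hδ1 hδε (Pi.single i 1)
    rw [h.quadForm_eq hs hδ hδ1 hδε ⟨0, hd⟩ (Pi.single i 1), sqNorm_single, one_pow, mul_one] at h3
    have h4 := tendsto_nhds_unique h2 (h3.congr fun t => by
      rw [← Pi.single_smul, smul_eq_mul, mul_one])
    linarith
  have hσ : sigmaSq D = d * quadForm D (Pi.single ⟨0, hd⟩ 1) := by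
    rw [sigmaSq, lap0, ← Finset.sum_neg_distrib, Finset.sum_congr rfl fun i _ => key i]
    simp
  have h5 := hM k
  rw [h.quadForm_eq hs hδ hδ1 hδε ⟨0, hd⟩ k] at h5
  rwa [hσ, show d * quadForm D (Pi.single ⟨0, hd⟩ 1) / (2 * d) * sqNorm k
    = quadForm D (Pi.single ⟨0, hd⟩ 1) * sqNorm k / 2 by field_simp]

end AssumptionD

/-! ### Tails of the zeta series -/

/-- `∑_{m > n} m^{-p}`. -/
noncomputable def tailSum (p : ℝ) (n : ℕ) : ℝ := ∑' j : ℕ, ((j + (n + 1) : ℕ) : ℝ) ^ (-p)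

theorem summable_tail {p : ℝ} (hp : 1 < p) (n : ℕ) :
    Summable fun j : ℕ => ((j + (n + 1) : ℕ) : ℝ) ^ (-p) :=
  (summable_nat_add_iff (n + 1)).2 (summable_rpow_neg hp)

theorem tailSum_eq {p : ℝ} (hp : 1 < p) (n : ℕ) :
    tailSum p n = ((n + 1 : ℕ) : ℝ) ^ (-p) + tailSum p (n + 1) := by
  rw [tailSum, (summable_tail hp n).tsum_eq_zero_add, zero_add]
  congr 1
  refine tsum_congr fun j => ?_
  rw [show j + 1 + (n + 1) = j + (n + 1 + 1) by ring]

theorem tailSum_nonneg (p : ℝ) (n : ℕ) : 0 ≤ tailSum p n := tsum_nonneg fun _ => by positivity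

/-- Strict positivity gives the intervals around z_n positive length, without which the conditional
assumptions could not be applied to them. -/
theorem tailSum_pos {p : ℝ} (hp : 1 < p) (n : ℕ) : 0 < tailSum p n := by
  rw [tailSum_eq hp]
  have := tailSum_nonneg p (n + 1)
  positivity

theorem tailSum_succ_le {p : ℝ} (hp : 1 < p) (n : ℕ) : tailSum p (n + 1) ≤ tailSum p n := by
  rw [tailSum_eq hp n]
  have : (0 : ℝ) ≤ ((n + 1 : ℕ) : ℝ) ^ (-p) := by positivity
  linarith

theorem tailSum_le {τ δ : ℝ} (hδ : 0 ≤ δ) (hτ : 2 + δ < τ) (n : ℕ) :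
    tailSum τ n ≤ ((n + 1 : ℕ) : ℝ) ^ (-1 - δ) * zetaSum (τ - 1 - δ) := by
  have hs := summable_tail (p := τ - 1 - δ) (by linarith) n
  have h1 : ∑' j : ℕ, ((j + (n + 1) : ℕ) : ℝ) ^ (-(τ - 1 - δ)) ≤ zetaSum (τ - 1 - δ) :=
    tsum_comp_le_tsum_of_inj (summable_rpow_neg (p := τ - 1 - δ) (by linarith))
      (fun _ => by positivity) (add_left_injective (n + 1))
  calc tailSum τ n ≤ ∑' j : ℕ, ((n + 1 : ℕ) : ℝ) ^ (-1 - δ)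
          * ((j + (n + 1) : ℕ) : ℝ) ^ (-(τ - 1 - δ)) := by
        refine Summable.tsum_le_tsum (fun j => ?_) (summable_tail (by linarith) n)
          (hs.mul_left _)
        have hj : (0 : ℝ) < ((j + (n + 1) : ℕ) : ℝ) := by positivity
        rw [show -τ = (-1 - δ) + -(τ - 1 - δ) by ring, Real.rpow_add hj]
        refine mul_le_mul_of_nonneg_right ?_ (by positivity)
        refine Real.rpow_le_rpow_of_nonpos (by positivity) ?_ (by linarith)
        exact_mod_cast Nat.le_add_left _ _
    _ ≤ _ := by
        rw [tsum_mul_left]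
        gcongr

theorem tendsto_tailSum {τ δ : ℝ} (hδ : 0 ≤ δ) (hτ : 2 + δ < τ) :
    Tendsto (tailSum τ) atTop (𝓝 0) := by
  have h1 : Tendsto (fun n : ℕ => ((n + 1 : ℕ) : ℝ) ^ (-(1 + δ)) * zetaSum (τ - 1 - δ)) atTop
      (𝓝 (0 * zetaSum (τ - 1 - δ))) := by
    refine Tendsto.mul_const _ ?_
    exact (tendsto_rpow_neg_atTop (by linarith : 0 < 1 + δ)).comp
      (tendsto_natCast_atTop_atTop.comp (tendsto_add_atTop_nat 1))
  rw [zero_mul] at h1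
  refine squeeze_zero (fun n => tailSum_nonneg _ n) (fun n => ?_) h1
  rw [neg_add, ← sub_eq_add_neg]
  exact tailSum_le hδ hτ n

/-! ### The intervals on which the bounds are propagated -/

/-- The sequence `eₘ` with the convention `e₀ = 1`. -/
noncomputable def eHat {d : ℕ} (e : ℕ → (Fin d → ℝ) → ℝ → ℝ) (k : Fin d → ℝ) (z : ℝ) (m : ℕ) : ℝ :=
  if m = 0 then 1 else e m k z

theorem eHat_of_pos {d : ℕ} (e : ℕ → (Fin d → ℝ) → ℝ → ℝ) (k : Fin d → ℝ) (z : ℝ) {m : ℕ}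
    (hm : 1 ≤ m) : eHat e k z m = e m k z := if_neg (by omega)

theorem Recursion.eq_sum_add_eHat {d : ℕ} {f g e : ℕ → (Fin d → ℝ) → ℝ → ℝ}
    (h : Recursion d f g e) {k : Fin d → ℝ} (hk : k ∈ dualCube d) {z : ℝ} (hz : 0 < z) (n : ℕ) :
    f n k z = ∑ m ∈ Finset.Icc 1 n, g m k z * f (n - m) k z + eHat e k z n := by
  rcases n with _ | n
  · simp [eHat, h.zero k hk z hz]
  · rw [eHat_of_pos e k z (by omega)]
    exact h.succ n k hk z hz

/-- The bounds on the kernels `gₘ`, `eₘ` at one value of `z`, with a small constant `q`. -/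
structure KernelBounds (d : ℕ) (δ q : ℝ) (D : (Fin d → ℤ) → ℝ)
    (g e : ℕ → (Fin d → ℝ) → ℝ → ℝ) (m : ℕ) (z : ℝ) : Prop where
  abs_g : ∀ k ∈ dualCube d, |g m k z| ≤ q * (m : ℝ) ^ (-((d : ℝ) / 2))
  abs_e : ∀ k ∈ dualCube d, |e m k z| ≤ q * (m : ℝ) ^ (-((d : ℝ) / 2))
  abs_e_sub : ∀ k ∈ dualCube d,
    |e m k z - e m 0 z| ≤ q * aFun D k * (m : ℝ) ^ (1 - (d : ℝ) / 2)
  abs_lap : |(sigmaSq D)⁻¹ * lap0 fun k => g m k z| ≤ q * (m : ℝ) ^ (1 - (d : ℝ) / 2)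
  differentiableAt : DifferentiableAt ℝ (fun w => g m 0 w) z
  abs_deriv : |deriv (fun w => g m 0 w) z| ≤ q * (m : ℝ) ^ (1 - (d : ℝ) / 2)
  abs_g_sub : ∀ k ∈ dualCube d,
    |g m k z - g m 0 z| ≤ 2 * q * aFun D k * (m : ℝ) ^ (1 - (d : ℝ) / 2)
  abs_taylor : ∀ k ∈ dualCube d,
    |g m k z - g m 0 z - aFun D k * ((sigmaSq D)⁻¹ * lap0 fun k => g m k z)|
      ≤ q * aFun D k ^ (1 + δ) * (m : ℝ) ^ (1 + δ - (d : ℝ) / 2)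

section

variable {d : ℕ} {ε C c₁ c₂ η α L δ : ℝ} {D : (Fin d → ℤ) → ℝ} {Ce Cg L₁ : ℝ → ℝ}
  {f g e : ℕ → (Fin d → ℝ) → ℝ → ℝ}

/-- The remainder bound is used at ε' = 0 and ε' = δ. The first, with the Laplacian term added back,
yields the increment bound and its factor 2; the second is the Taylor bound. -/
theorem kernelBounds_of_assumptions (hE : AssumptionE d α Ce L₁ L D f e)
    (hG : AssumptionG d ε α Cg L₁ L D f g) (hL : 0 < L) (hσ : 0 < sigmaSq D)
    (ha : ∀ k, 0 ≤ aFun D k) (hδ : 0 ≤ δ) (hδε : δ ≤ ε) {K Q : ℝ} (hK : 1 < K) (hLK : L₁ K ≤ L)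
    (hCe : Ce K ≤ Q) (hCg : Cg K ≤ Q) {s t : ℝ} (hst : s < t)
    (hsub : Set.Icc s t ⊆ Set.Icc (1 - α) (1 + α)) {n : ℕ}
    (hf : ∀ z ∈ Set.Icc s t, ∀ m, 1 ≤ m → m ≤ n → FBounds d L D f K m z) :
    ∀ z ∈ Set.Icc s t, ∀ m, 2 ≤ m → m ≤ n + 1 →
      KernelBounds d δ (Q * beta d L) D g e m z := by
  intro z hz m hm hmn
  have hβ : 0 < beta d L := by unfold beta; positivity
  have e1 : -(d : ℝ) / 2 = -((d : ℝ) / 2) := neg_div _ _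
  have e2 : -((d : ℝ) - 2) / 2 = 1 - (d : ℝ) / 2 := by ring
  have e3 : -((d : ℝ) - 2 - 2 * δ) / 2 = 1 + δ - (d : ℝ) / 2 := by ring
  have e4 : -((d : ℝ) - 2 - 2 * 0) / 2 = 1 - (d : ℝ) / 2 := by ring
  obtain ⟨h1, h2, h3, h4, h5, h6⟩ := hG K hK hLK s t hst hsub n hf z hz m hm hmn
  have hE' := fun k hk => hE K hK hLK s t hst hsub n hf z hz k hk m hm hmn
  rw [e1] at h1
  rw [e2] at h3 h5
  have hlap : |(sigmaSq D)⁻¹ * lap0 fun k => g m k z|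
      ≤ Q * beta d L * (m : ℝ) ^ (1 - (d : ℝ) / 2) := by
    rw [abs_mul, abs_of_pos (inv_pos.2 hσ), inv_mul_le_iff₀ hσ]
    refine h3.trans ?_
    calc Cg K * sigmaSq D * beta d L * (m : ℝ) ^ (1 - (d : ℝ) / 2)
        ≤ Q * sigmaSq D * beta d L * (m : ℝ) ^ (1 - (d : ℝ) / 2) := by gcongr
      _ = _ := by ring
  refine ⟨fun k hk => (h1 k hk).trans ?_, fun k hk => ?_, fun k hk => ?_, hlap, h4,
    h5.trans ?_, fun k hk => ?_, fun k hk => ?_⟩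
  · gcongr
  · have := (hE' k hk).1
    rw [e1] at this
    refine this.trans ?_
    gcongr
  · have := (hE' k hk).2
    rw [e2] at this
    refine this.trans ?_
    have hak := ha k
    calc Ce K * aFun D k * beta d L * (m : ℝ) ^ (1 - (d : ℝ) / 2)
        ≤ Q * aFun D k * beta d L * (m : ℝ) ^ (1 - (d : ℝ) / 2) := by gcongr
      _ = _ := by ring
  · gcongr
  · have := h6 k hk 0 ⟨le_rfl, hδ.trans hδε⟩
    have hak := ha k
    rw [e4, add_zero, Real.rpow_one, mul_assoc] at this
    have h7 : |aFun D k * ((sigmaSq D)⁻¹ * lap0 fun k => g m k z)|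
        ≤ aFun D k * (Q * beta d L * (m : ℝ) ^ (1 - (d : ℝ) / 2)) := by
      rw [abs_mul, abs_of_nonneg hak]
      gcongr
    have h8 : Cg K * beta d L * aFun D k * (m : ℝ) ^ (1 - (d : ℝ) / 2)
        ≤ Q * beta d L * aFun D k * (m : ℝ) ^ (1 - (d : ℝ) / 2) := by gcongr
    have h9 := abs_add_le (g m k z - g m 0 z - aFun D k * ((sigmaSq D)⁻¹ * lap0 fun k => g m k z))
      (aFun D k * ((sigmaSq D)⁻¹ * lap0 fun k => g m k z))
    rw [sub_add_cancel] at h9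
    rw [mul_assoc] at this
    have h10 := mul_assoc (Cg K * beta d L) (aFun D k) ((m : ℝ) ^ (1 - (d : ℝ) / 2))
    linarith
  · have := h6 k hk δ ⟨hδ, hδε⟩
    have hak := ha k
    rw [e3, mul_assoc (aFun D k)] at this
    refine this.trans ?_
    gcongr

/-- The interval `[zₙ - wₙ, zₙ + wₙ]` with `wₙ = 2q ∑_{m>n} m^{-d/2}`. -/
noncomputable def critInterval (g : ℕ → (Fin d → ℝ) → ℝ → ℝ) (q : ℝ) (n : ℕ) : Set ℝ :=
  Set.Icc (zSeq g n - 2 * q * tailSum ((d : ℝ) / 2) n) (zSeq g n + 2 * q * tailSum ((d : ℝ) / 2) n)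

theorem mem_critInterval {q : ℝ} {n : ℕ} {z : ℝ} :
    z ∈ critInterval g q n ↔ |z - zSeq g n| ≤ 2 * q * tailSum ((d : ℝ) / 2) n := by
  rw [critInterval, Set.mem_Icc, abs_le]
  constructor <;> rintro ⟨h1, h2⟩ <;> constructor <;> linarith

theorem zSeq_mem_critInterval {q : ℝ} (hq : 0 ≤ q) (n : ℕ) : zSeq g n ∈ critInterval g q n := by
  rw [mem_critInterval, sub_self, abs_zero]
  have := tailSum_nonneg ((d : ℝ) / 2) n
  positivity

/-- The half-width shrinks by exactly 2q(n + 1)^{-d/2}, the displacement allowed for the centre. -/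
theorem critInterval_succ_subset {q : ℝ} (hd : (1 : ℝ) < d / 2) {n : ℕ}
    (h : |zSeq g (n + 1) - zSeq g n| ≤ 2 * q * ((n + 1 : ℕ) : ℝ) ^ (-((d : ℝ) / 2))) :
    critInterval g q (n + 1) ⊆ critInterval g q n := by
  intro z hz
  rw [mem_critInterval] at hz ⊢
  rw [tailSum_eq hd n]
  have := abs_sub_le z (zSeq g (n + 1)) (zSeq g n)
  linarith

theorem critInterval_subset {q : ℝ} (hd : (1 : ℝ) < d / 2) {n : ℕ}
    (h : ∀ j < n, |zSeq g (j + 1) - zSeq g j| ≤ 2 * q * ((j + 1 : ℕ) : ℝ) ^ (-((d : ℝ) / 2)))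
    {j : ℕ} (hj : j ≤ n) : critInterval g q n ⊆ critInterval g q j := by
  induction n with
  | zero => rw [Nat.le_zero.1 hj]
  | succ n ih =>
    rcases Nat.lt_or_ge n j with h1 | h1
    · rw [show j = n + 1 by omega]
    · exact (critInterval_succ_subset hd (h n (by omega))).trans
        (ih (fun i hi => h i (by omega)) h1)

/-- Mean value theorem: the z-derivatives are summable with a small sum, so the map iterated in the
definition of z_n is a contraction. -/
theorem abs_sum_g_sub_le (hδ : 0 ≤ δ) (hτ : 2 + δ < (d : ℝ) / 2) {q : ℝ} (hq : 0 ≤ q) {j N : ℕ}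
    (hN : N ≤ j + 1)
    (hk : ∀ z ∈ critInterval g q j, ∀ m, 2 ≤ m → m ≤ j + 1 → KernelBounds d δ q D g e m z)
    {z z' : ℝ} (hz : z ∈ critInterval g q j) (hz' : z' ∈ critInterval g q j) :
    |∑ m ∈ Finset.Icc 2 N, (g m 0 z - g m 0 z')|
      ≤ q * zetaSum ((d : ℝ) / 2 - 1 - δ) * |z - z'| := by
  have h1 : ∀ m, 2 ≤ m → m ≤ N →
      |g m 0 z - g m 0 z'| ≤ q * |z - z'| * (m : ℝ) ^ (1 - (d : ℝ) / 2) := by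
    intro m hm hmN
    have := (convex_Icc _ _).norm_image_sub_le_of_norm_deriv_le (f := fun w => g m 0 w)
      (s := critInterval g q j) (fun w hw => (hk w hw m hm (by omega)).differentiableAt)
      (fun w hw => (hk w hw m hm (by omega)).abs_deriv) hz' hz
    refine this.trans (le_of_eq ?_)
    rw [Real.norm_eq_abs]; ring
  refine (abs_sum_le_mul_zetaSum (δ := δ) hτ (by linarith) (by positivity) h1).trans (le_of_eq ?_)
  ring

/-- Consecutive steps differ by the contracted previous step and one new term g_{n+2}. Each
contributes at most q(n + 2)^{-d/2}; the factor 2^{d/2} in the smallness condition pays for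
comparing n + 1 with n + 2. -/
theorem abs_zSeq_succ_sub_le (hδ : 0 ≤ δ) (hτ : 2 + δ < (d : ℝ) / 2) {q : ℝ} (hq : 0 ≤ q)
    (hqZ : q * zetaSum ((d : ℝ) / 2 - 1 - δ) * 2 ^ ((d : ℝ) / 2) ≤ 1 / 2) {n : ℕ}
    (hk : ∀ j ≤ n, ∀ z ∈ critInterval g q j, ∀ m, 2 ≤ m → m ≤ j + 1 →
      KernelBounds d δ q D g e m z)
    (hprev : ∀ j < n, |zSeq g (j + 1) - zSeq g j| ≤ 2 * q * ((j + 1 : ℕ) : ℝ) ^ (-((d : ℝ) / 2))) :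
    |zSeq g (n + 1) - zSeq g n| ≤ 2 * q * ((n + 1 : ℕ) : ℝ) ^ (-((d : ℝ) / 2)) := by
  rcases n with _ | n
  · have : zSeq g (0 + 1) - zSeq g 0 = 0 := by simp [zSeq]
    rw [this, abs_zero]; positivity
  have hmem := zSeq_mem_critInterval (g := g) hq
  have hsub := critInterval_succ_subset (by linarith) (hprev n (by omega))
  have h1 := (hk (n + 1) le_rfl _ (hmem _) (n + 2) (by omega) (by omega)).abs_g 0 zero_mem_dualCube
  have h2 := abs_sum_g_sub_le hδ hτ hq le_rfl (hk n (by omega)) (hsub (hmem (n + 1))) (hmem n)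
  have heq : zSeq g (n + 1 + 1) - zSeq g (n + 1)
      = -(∑ m ∈ Finset.Icc 2 (n + 1), (g m 0 (zSeq g (n + 1)) - g m 0 (zSeq g n)))
        - g (n + 2) 0 (zSeq g (n + 1)) := by
    rw [Finset.sum_sub_distrib]
    have e1 : zSeq g (n + 1 + 1) = 1 - ∑ m ∈ Finset.Icc 2 (n + 2), g m 0 (zSeq g (n + 1)) := rfl
    have e2 : zSeq g (n + 1) = 1 - ∑ m ∈ Finset.Icc 2 (n + 1), g m 0 (zSeq g n) := rfl
    rw [e1, Finset.sum_Icc_succ_top (by omega)]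
    linear_combination -e2
  rw [heq]
  have h3 := hprev n (by omega)
  set Z := zetaSum ((d : ℝ) / 2 - 1 - δ)
  have hZ0 : 0 ≤ Z := zetaSum_nonneg _
  have h4 : ((n + 1 : ℕ) : ℝ) ^ (-((d : ℝ) / 2))
      ≤ 2 ^ ((d : ℝ) / 2) * ((n + 2 : ℕ) : ℝ) ^ (-((d : ℝ) / 2)) := by
    have : ((n + 2 : ℕ) : ℝ) ≤ 2 * ((n + 1 : ℕ) : ℝ) := by push_cast; linarith
    have h5 := Real.rpow_le_rpow_of_nonpos (by positivity) this
      (by linarith : -((d : ℝ) / 2) ≤ 0)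
    rw [Real.mul_rpow (by norm_num) (by positivity), Real.rpow_neg (by norm_num : (0 : ℝ) ≤ 2),
      inv_mul_le_iff₀ (by positivity)] at h5
    exact h5
  have hr : (0 : ℝ) ≤ ((n + 2 : ℕ) : ℝ) ^ (-((d : ℝ) / 2)) := by positivity
  calc _ ≤ |∑ m ∈ Finset.Icc 2 (n + 1), (g m 0 (zSeq g (n + 1)) - g m 0 (zSeq g n))|
        + |g (n + 2) 0 (zSeq g (n + 1))| := by
          rw [← abs_neg (∑ m ∈ Finset.Icc 2 (n + 1), _)]; exact abs_sub _ _
    _ ≤ q * Z * (2 * q * (2 ^ ((d : ℝ) / 2) * ((n + 2 : ℕ) : ℝ) ^ (-((d : ℝ) / 2))))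
        + q * ((n + 2 : ℕ) : ℝ) ^ (-((d : ℝ) / 2)) := by
          refine add_le_add (h2.trans ?_) h1
          gcongr
          exact h3.trans (by gcongr)
    _ = (q * Z * 2 ^ ((d : ℝ) / 2)) * (2 * (q * ((n + 2 : ℕ) : ℝ) ^ (-((d : ℝ) / 2))))
        + q * ((n + 2 : ℕ) : ℝ) ^ (-((d : ℝ) / 2)) := by ring
    _ ≤ 1 / 2 * (2 * (q * ((n + 2 : ℕ) : ℝ) ^ (-((d : ℝ) / 2))))
        + q * ((n + 2 : ℕ) : ℝ) ^ (-((d : ℝ) / 2)) := by gcongr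
    _ = _ := by
        show _ = 2 * q * ((n + 2 : ℕ) : ℝ) ^ (-((d : ℝ) / 2))
        ring

/-- The delicate point is the mass defect at level N. By definition z_N plus the terms g_m(0;
z_{N-1}), 2 ≤ m ≤ N, equals 1, so the defect at z comes from |z - z_N| and |z - z_{N-1}|. It is at
most 4q times a tail of the zeta series, hence O(q N^{-1-δ}). -/
theorem nearCritical_of_kernelBounds (hD : AssumptionD d ε C c₁ c₂ η L D f e)
    (hr : Recursion d f g e) (hδ : 0 ≤ δ) (hτ : 2 + δ < (d : ℝ) / 2) {q : ℝ} (hq : 0 ≤ q)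
    (hqZ : q * zetaSum ((d : ℝ) / 2 - 1 - δ) ≤ 1) {n : ℕ}
    (hk : ∀ j < n, ∀ z ∈ critInterval g q j, ∀ m, 2 ≤ m → m ≤ j + 1 →
      KernelBounds d δ q D g e m z)
    (hz : ∀ j < n, |zSeq g (j + 1) - zSeq g j| ≤ 2 * q * ((j + 1 : ℕ) : ℝ) ^ (-((d : ℝ) / 2)))
    {z : ℝ} (hzI : z ∈ critInterval g q n) (hz0 : 0 < z) {k : Fin d → ℝ} (hkd : k ∈ dualCube d) :
    NearCritical ((d : ℝ) / 2) δ (q * (4 * zetaSum ((d : ℝ) / 2 - 1 - δ) + 2)) (aFun D k) z n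
      (fun m => g m 0 z) (fun m => g m k z) (eHat e 0 z) (eHat e k z) := by
  set Z := zetaSum ((d : ℝ) / 2 - 1 - δ) with hZ
  have hZ0 : 0 ≤ Z := zetaSum_nonneg _
  have hsub : ∀ j ≤ n, z ∈ critInterval g q j := fun j hj =>
    critInterval_subset (by linarith) hz hj hzI
  have hK : ∀ m, 2 ≤ m → m ≤ n → KernelBounds d δ q D g e m z := fun m hm hmn =>
    hk (m - 1) (by omega) z (hsub _ (by omega)) m hm (by omega)
  have hqb : q ≤ q * (4 * Z + 2) := by nlinarith
  have hqb2 : 2 * q ≤ q * (4 * Z + 2) := by nlinarith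
  have h0 : (0 : Fin d → ℝ) ∈ dualCube d := zero_mem_dualCube
  have ha := hD.aFun_nonneg k
  refine ⟨?_, ?_, ?_, rfl, rfl, ?_, ?_, ?_, ?_, ?_, ?_, ?_, ?_, ?_⟩
  · have h1 := mem_critInterval.1 (hsub 0 (by omega))
    have h2 := tailSum_le hδ hτ 0
    rw [zero_add, Nat.cast_one, Real.one_rpow, one_mul] at h2
    have h3 : zSeq g 0 = 1 := rfl
    rw [h3] at h1
    refine h1.trans ?_
    nlinarith
  · simp only [hD.g_one_eq hr h0 hz0, hD.hatD_zero, mul_one]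
  · simp only [hD.g_one_eq hr hkd hz0, aFun, sub_sub_cancel]
  · rw [eHat_of_pos _ _ _ le_rfl, hD.e_one 0 h0 z hz0]
  · rw [eHat_of_pos _ _ _ le_rfl, hD.e_one k hkd z hz0]
  · exact fun m hm hmn => ((hK m hm hmn).abs_g 0 h0).trans (by gcongr)
  · exact fun m hm hmn => ((hK m hm hmn).abs_g k hkd).trans (by gcongr)
  · exact fun m hm hmn => ((hK m hm hmn).abs_g_sub k hkd).trans (by gcongr)
  · intro m hm hmn
    rw [eHat_of_pos _ _ _ (by omega)]
    exact ((hK m hm hmn).abs_e 0 h0).trans (by gcongr)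
  · intro m hm hmn
    rw [eHat_of_pos _ _ _ (by omega)]
    exact ((hK m hm hmn).abs_e k hkd).trans (by gcongr)
  · intro m hm hmn
    rw [eHat_of_pos _ _ _ (by omega), eHat_of_pos _ _ _ (by omega)]
    exact ((hK m hm hmn).abs_e_sub k hkd).trans (by gcongr)
  · intro N hN hNn
    obtain ⟨N, rfl⟩ : ∃ N', N = N' + 1 := ⟨N - 1, by omega⟩
    have h1 := mem_critInterval.1 (hsub (N + 1) hNn)
    have hN1 := hsub N (by omega)
    have h2 := mem_critInterval.1 hN1
    have h3 := abs_sum_g_sub_le hδ hτ hq le_rfl (hk N (by omega)) hN1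
      (zSeq_mem_critInterval hq N)
    have heq : ∑ m ∈ Finset.Icc 1 (N + 1), g m 0 z - 1
        = (z - zSeq g (N + 1))
          + ∑ m ∈ Finset.Icc 2 (N + 1), (g m 0 z - g m 0 (zSeq g N)) := by
      rw [sum_Icc_one_eq_add hN, hD.g_one_eq hr h0 hz0, hD.hatD_zero, Finset.sum_sub_distrib]
      have e2 : zSeq g (N + 1) = 1 - ∑ m ∈ Finset.Icc 2 (N + 1), g m 0 (zSeq g N) := rfl
      linear_combination e2
    rw [heq]
    set T := tailSum ((d : ℝ) / 2) N with hT
    have hT0 : 0 ≤ T := tailSum_nonneg _ _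
    calc _ ≤ 2 * q * tailSum ((d : ℝ) / 2) (N + 1) + q * Z * (2 * q * T) := by
          refine (abs_add_le _ _).trans (add_le_add h1 (h3.trans ?_))
          gcongr
      _ ≤ 2 * q * T + 1 * (2 * q * T) := by
          gcongr
          exact tailSum_succ_le (by linarith) N
      _ = 4 * q * T := by ring
      _ ≤ 4 * q * (((N + 1 : ℕ) : ℝ) ^ (-1 - δ) * Z) := by
          gcongr
          exact tailSum_le hδ hτ N
      _ = (4 * q * Z) * ((N + 1 : ℕ) : ℝ) ^ (-1 - δ) := by ring
      _ ≤ _ := by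
          refine mul_le_mul_of_nonneg_right ?_ (by positivity)
          nlinarith

end

/-! ### Convergence to the critical point -/

theorem exists_beta_le {d : ℕ} (hd : 1 ≤ d) {x : ℝ} (hx : 0 < x) :
    ∃ L₀ : ℝ, 1 ≤ L₀ ∧ ∀ L, L₀ ≤ L → beta d L ≤ x := by
  refine ⟨max 1 x⁻¹, le_max_left _ _, fun L hL => ?_⟩
  have h1 : 1 ≤ L := (le_max_left _ _).trans hL
  have h2 : x⁻¹ ≤ L ^ d := ((le_max_right _ _).trans hL).trans (le_self_pow₀ h1 (by omega))
  rw [beta]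
  exact inv_le_of_inv_le₀ hx h2

section

variable {d : ℕ} {δ : ℝ}

/-- K is determined by d, δ, C, c₁ and η before C_e(K), C_g(K) and L are considered, so the
bootstrap is not circular. The three bounds come from the L¹ estimate, the uniform bound at k = 0,
and the increment bound O(m a(k)) respectively. -/
theorem exists_fBounds_constant (hd : 4 < d) (hδ : 0 ≤ δ) (hτ : 2 + δ < (d : ℝ) / 2) (C : ℝ)
    {c₁ η : ℝ} (hc₁ : 0 < c₁) (hη : 0 < η) :
    ∃ K b₀ : ℝ, 1 < K ∧ 0 < b₀ ∧ ∀ (ε c₂ L : ℝ) (D : (Fin d → ℤ) → ℝ)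
      (f g e : ℕ → (Fin d → ℝ) → ℝ → ℝ), AssumptionD d ε C c₁ c₂ η L D f e → 1 ≤ L →
      Recursion d f g e → AssumptionS d f g e → ∀ (z b : ℝ) (n : ℕ), 0 < z → 0 ≤ b → b ≤ b₀ →
      (∀ k ∈ dualCube d, NearCritical ((d : ℝ) / 2) δ b (aFun D k) z n
        (fun m => g m 0 z) (fun m => g m k z) (eHat e 0 z) (eHat e k z)) →
      ∀ m, 1 ≤ m → m ≤ n → FBounds d L D f K m z := by
  obtain ⟨C₁, c, b₁, hC₁, hc, hb₁, hb₁1, hbound⟩ := NearCritical.exists_bound hδ hτ hη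
  obtain ⟨C₂, b₂, hC₂, hb₂, hdiff⟩ := NearCritical.exists_diff_bound hδ hτ hη
  obtain ⟨K₃, hK₃⟩ := exists_eLpNorm_bound hd C hc₁ hη (by linarith : 0 ≤ C₁) hc
  set K := max (max C₁ C₂) (max K₃ 2) with hK
  have hKC₁ : C₁ ≤ K := (le_max_left _ _).trans (le_max_left _ _)
  have hKC₂ : C₂ ≤ K := (le_max_right _ _).trans (le_max_left _ _)
  have hKK₃ : K₃ ≤ K := (le_max_left _ _).trans (le_max_right _ _)
  have hK2 : 2 ≤ K := (le_max_right _ _).trans (le_max_right _ _)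
  refine ⟨K, min b₁ b₂, by linarith, lt_min hb₁ hb₂, ?_⟩
  intro ε c₂ L D f g e hD hL hr hS z b n hz hb hbb hnc m hm hmn
  have h0 : (0 : Fin d → ℝ) ∈ dualCube d := zero_mem_dualCube
  have hβ : 0 ≤ beta d L := by unfold beta; positivity
  have hσ := hD.sigmaSq_pos (by omega) hc₁ hL (hS.diff 1 le_rfl 1 one_pos)
  have hrec := fun k hk => hr.eq_sum_add_eHat (k := k) hk hz
  have hb1 : ∀ k ∈ dualCube d, _ := fun k hk => hbound b (aFun D k) z n _ _ _ _
    (fun m => f m k z) (hnc k hk) hb (hbb.trans (min_le_left _ _)) (hD.aFun_nonneg k)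
    (hD.a_lt k hk) (hrec k hk) m hmn
  have hd1 : ∀ k ∈ dualCube d, |f m k z - f m 0 z| ≤ C₂ * m * aFun D k := fun k hk =>
    hdiff b (aFun D k) z n _ _ _ _ (fun m => f m 0 z) (fun m => f m k z) (hnc k hk) hb
      (hbb.trans (min_le_right _ _)) (hD.aFun_nonneg k) (hD.a_lt k hk) (hrec k hk) (hrec 0 h0) m hmn
  refine ⟨?_, (hb1 0 h0).1.trans hKC₁, ?_⟩
  · refine (hK₃ ε c₂ L D f e hD hL (fun k => f m k z) m b hm hb
      ((hbb.trans (min_le_left _ _)).trans hb₁1) fun k hk => (hb1 k hk).2).trans ?_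
    refine ENNReal.ofReal_le_ofReal ?_
    gcongr
  · refine (hD.abs_lap0_le hL (hS.diff 1 le_rfl 1 one_pos) (hS.diff m hm z hz)
      (M := C₂ * m) (by positivity) hd1).trans ?_
    calc C₂ * m * sigmaSq D = C₂ * sigmaSq D * m := by ring
      _ ≤ _ := by gcongr

/-- One induction step: bounds on f_m for m ≤ n on the n-th interval give kernel bounds for m ≤ n +
1 there; these nest the next interval inside it; on that interval the recursion is near-critical up
to n + 1, which returns the bounds on f_m for m ≤ n + 1 with the same K. -/
theorem exists_critical_point (hd : 4 < d) (hδ : 0 ≤ δ) (hτ : 2 + δ < (d : ℝ) / 2)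
    {ε C c₁ c₂ η α : ℝ} (hδε : δ ≤ ε) (hc₁ : 0 < c₁) (hη : 0 < η) (hα : α ∈ Set.Ioo (0 : ℝ) 1)
    (Ce Cg L₁ : ℝ → ℝ) {b₀ : ℝ} (hb₀ : 0 < b₀) :
    ∃ L₀ : ℝ, 1 ≤ L₀ ∧ ∀ L : ℝ, L₀ ≤ L →
      ∀ (D : (Fin d → ℤ) → ℝ) (f g e : ℕ → (Fin d → ℝ) → ℝ → ℝ),
        Recursion d f g e → AssumptionS d f g e → AssumptionD d ε C c₁ c₂ η L D f e →
        AssumptionE d α Ce L₁ L D f e → AssumptionG d ε α Cg L₁ L D f g →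
        ∃ zc q b : ℝ, 0 < zc ∧ 0 ≤ q ∧ q ≤ b ∧ b ≤ b₀ ∧ Tendsto (zSeq g) atTop (𝓝 zc) ∧
          (∀ m, 2 ≤ m → KernelBounds d δ q D g e m zc) ∧
          ∀ n, ∀ k ∈ dualCube d, NearCritical ((d : ℝ) / 2) δ b (aFun D k) zc n
            (fun m => g m 0 zc) (fun m => g m k zc) (eHat e 0 zc) (eHat e k zc) := by
  obtain ⟨K, b₁, hK, hb₁, hfb⟩ := exists_fBounds_constant hd hδ hτ C hc₁ hη
  set Q := max (max (Ce K) (Cg K)) 1 with hQ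
  have hQe : Ce K ≤ Q := (le_max_left _ _).trans (le_max_left _ _)
  have hQg : Cg K ≤ Q := (le_max_right _ _).trans (le_max_left _ _)
  have hQ1 : 1 ≤ Q := le_max_right _ _
  set Z := zetaSum ((d : ℝ) / 2 - 1 - δ) with hZ
  have hZ0 : 0 ≤ Z := zetaSum_nonneg _
  -- 4Z + 2 is the loss in passing from kernel bounds to near-criticality, and 2Z · 2^{d/2} is what
  -- the contraction of the z_n requires. Taking qW ≤ x meets both and also keeps the intervals
  -- inside [1 - α, 1 + α].
  set W := 4 * Z + 2 + 2 * Z * 2 ^ ((d : ℝ) / 2) with hW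
  have hp2 : (1 : ℝ) ≤ 2 ^ ((d : ℝ) / 2) := Real.one_le_rpow (by norm_num) (by linarith)
  have hZp : 0 ≤ Z * 2 ^ ((d : ℝ) / 2) := by positivity
  have hW0 : 0 < W := by linarith
  set x := min (min b₀ b₁) (min α 1) with hx
  have hx0 : 0 < x := lt_min (lt_min hb₀ hb₁) (lt_min hα.1 one_pos)
  obtain ⟨L₂, hL₂, hβL⟩ := exists_beta_le (d := d) (by omega) (x := x / (Q * W)) (by positivity)
  refine ⟨max L₂ (L₁ K), hL₂.trans (le_max_left _ _), ?_⟩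
  intro L hL D f g e hr hS hD hE hG
  have hL1 : 1 ≤ L := hL₂.trans ((le_max_left _ _).trans hL)
  have hLK : L₁ K ≤ L := (le_max_right _ _).trans hL
  have hL0 : 0 < L := by linarith
  have hβ : 0 < beta d L := by unfold beta; positivity
  have hσ := hD.sigmaSq_pos (by omega) hc₁ hL1 (hS.diff 1 le_rfl 1 one_pos)
  set q := Q * beta d L with hq
  have hq0 : 0 < q := by positivity
  have hqW : q * W ≤ x := by
    have := hβL L ((le_max_left _ _).trans hL)
    rw [le_div_iff₀ (by positivity)] at this
    linarith
  have hqb : q * (4 * Z + 2) ≤ x := by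
    have : q * (4 * Z + 2) ≤ q * W := by gcongr; linarith
    linarith
  have hx1 : x ≤ 1 := (min_le_right _ _).trans (min_le_right _ _)
  have hxα : x ≤ α := (min_le_right _ _).trans (min_le_left _ _)
  have hxb₀ : x ≤ b₀ := (min_le_left _ _).trans (min_le_left _ _)
  have hxb₁ : x ≤ b₁ := (min_le_left _ _).trans (min_le_right _ _)
  have hqZ : q * Z ≤ 1 := by nlinarith
  have hqZ2 : q * Z * 2 ^ ((d : ℝ) / 2) ≤ 1 / 2 := by
    have h1 : q * W = q * (4 * Z + 2) + 2 * (q * Z * 2 ^ ((d : ℝ) / 2)) := by rw [hW]; ring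
    have h2 : 0 ≤ q * (4 * Z + 2) := by positivity
    linarith
  have hI0 : critInterval g q 0 ⊆ Set.Icc (1 - α) (1 + α) := by
    intro z hz
    rw [mem_critInterval] at hz
    have h2 := tailSum_le hδ hτ 0
    rw [zero_add, Nat.cast_one, Real.one_rpow, one_mul] at h2
    have h3 : zSeq g 0 = 1 := rfl
    rw [h3] at hz
    have h4 : 2 * q * tailSum ((d : ℝ) / 2) 0 ≤ α := by nlinarith
    have := abs_le.1 (hz.trans h4)
    constructor <;> linarith [this.1, this.2]
  have hd1 : (1 : ℝ) < d / 2 := by linarith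
  have hkern : ∀ n, (∀ j < n, |zSeq g (j + 1) - zSeq g j|
        ≤ 2 * q * ((j + 1 : ℕ) : ℝ) ^ (-((d : ℝ) / 2))) →
      (∀ z ∈ critInterval g q n, ∀ m, 1 ≤ m → m ≤ n → FBounds d L D f K m z) →
      ∀ z ∈ critInterval g q n, ∀ m, 2 ≤ m → m ≤ n + 1 → KernelBounds d δ q D g e m z := by
    intro n hA hB
    have hT := tailSum_pos hd1 n
    refine kernelBounds_of_assumptions hE hG hL0 hσ hD.aFun_nonneg hδ hδε hK hLK hQe hQg ?_
      ((critInterval_subset hd1 hA (Nat.zero_le n)).trans hI0) hB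
    have : 0 < 2 * q * tailSum ((d : ℝ) / 2) n := by positivity
    linarith
  have hind : ∀ n, (∀ j < n, |zSeq g (j + 1) - zSeq g j|
        ≤ 2 * q * ((j + 1 : ℕ) : ℝ) ^ (-((d : ℝ) / 2))) ∧
      (∀ j ≤ n, ∀ z ∈ critInterval g q j, ∀ m, 1 ≤ m → m ≤ j → FBounds d L D f K m z) := by
    intro n
    induction n with
    | zero => exact ⟨fun j hj => by omega, fun j hj z _ m hm hmj => by omega⟩
    | succ n ih =>
      obtain ⟨hA, hB⟩ := ih
      have hk : ∀ j ≤ n, ∀ z ∈ critInterval g q j, ∀ m, 2 ≤ m → m ≤ j + 1 →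
          KernelBounds d δ q D g e m z := fun j hj =>
        hkern j (fun i hi => hA i (by omega)) (hB j hj)
      have hA' : ∀ j < n + 1, |zSeq g (j + 1) - zSeq g j|
          ≤ 2 * q * ((j + 1 : ℕ) : ℝ) ^ (-((d : ℝ) / 2)) := by
        intro j hj
        rcases Nat.lt_or_ge j n with h | h
        · exact hA j h
        · rw [show j = n by omega]
          exact abs_zSeq_succ_sub_le hδ hτ hq0.le hqZ2 hk hA
      refine ⟨hA', fun j hj z hz m hm hmj => ?_⟩
      rcases Nat.lt_or_ge n j with h | h
      · obtain rfl : j = n + 1 := by omega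
        have hz0 : 0 < z := by
          have := (hI0 (critInterval_subset hd1 hA' (Nat.zero_le _) hz)).1
          linarith [hα.2]
        refine hfb ε c₂ L D f g e hD hL1 hr hS z _ (n + 1) hz0 (by positivity)
          (hqb.trans hxb₁) (fun k hkd => ?_) m hm hmj
        exact nearCritical_of_kernelBounds hD hr hδ hτ hq0.le hqZ (fun i hi => hk i (by omega))
          hA' hz hz0 hkd
      · exact hB j h z hz m hm hmj
  have hA : ∀ j, |zSeq g (j + 1) - zSeq g j| ≤ 2 * q * ((j + 1 : ℕ) : ℝ) ^ (-((d : ℝ) / 2)) :=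
    fun j => (hind (j + 1)).1 j (by omega)
  have hk : ∀ n, ∀ z ∈ critInterval g q n, ∀ m, 2 ≤ m → m ≤ n + 1 →
      KernelBounds d δ q D g e m z := fun n =>
    hkern n (fun j _ => hA j) ((hind n).2 n le_rfl)
  have hmem : ∀ n N, N ≤ n → zSeq g n ∈ critInterval g q N := fun n N h =>
    critInterval_subset hd1 (fun j _ => hA j) h (zSeq_mem_critInterval hq0.le n)
  have hcauchy : CauchySeq (zSeq g) := by
    refine cauchySeq_of_le_tendsto_0 (fun n => 4 * q * tailSum ((d : ℝ) / 2) n)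
      (fun n m N hn hm => ?_) ?_
    · have h1 := mem_critInterval.1 (hmem n N hn)
      have h2 := mem_critInterval.1 (hmem m N hm)
      rw [Real.dist_eq]
      have := abs_sub_le (zSeq g n) (zSeq g N) (zSeq g m)
      rw [abs_sub_comm (zSeq g N)] at this
      linarith
    · have := (tendsto_tailSum hδ hτ).const_mul (4 * q)
      rwa [mul_zero] at this
  obtain ⟨zc, hzc⟩ := cauchySeq_tendsto_of_complete hcauchy
  have hzcI : ∀ n, zc ∈ critInterval g q n := fun n =>
    isClosed_Icc.mem_of_tendsto hzc (eventually_atTop.2 ⟨n, fun m hm => hmem m n hm⟩)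
  have hzc0 : 0 < zc := by
    have := (hI0 (hzcI 0)).1
    linarith [hα.2]
  refine ⟨zc, q, q * (4 * Z + 2), hzc0, hq0.le, by nlinarith, hqb.trans hxb₀, hzc, fun m hm => ?_,
    fun n k hkd => ?_⟩
  · exact hk (m - 1) zc (hzcI _) m hm (by omega)
  · exact nearCritical_of_kernelBounds hD hr hδ hτ hq0.le hqZ (fun j _ => hk j) (fun j _ => hA j)
      (hzcI n) hzc0 hkd

end

/-! ### The critical point, the amplitude and the diffusion constant -/

theorem summable_and_abs_tsum_sub_le {τ δ : ℝ} (hδ : 0 ≤ δ) (hτ : 2 + δ < τ) {b : ℝ} (hb : 0 ≤ b)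
    {u : ℕ → ℝ} (hu : ∀ m, 2 ≤ m → |u m| ≤ b * (m : ℝ) ^ (1 - τ)) :
    Summable (fun j : ℕ => u (j + 1)) ∧
      |∑' j : ℕ, u (j + 1) - u 1| ≤ b * zetaSum (τ - 1 - δ) := by
  have hs : Summable fun j : ℕ => u (j + 1) := by
    refine summable_succ_of_le hδ hτ (K := max b |u 1|) fun m hm => ?_
    rcases hm.eq_or_lt with rfl | hm
    · simp
    · exact (hu m hm).trans (by gcongr; exact le_max_left _ _)
  refine ⟨hs, ?_⟩
  have h1 := (hs.hasSum.tendsto_sum_nat.sub_const (u 1)).abs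
  refine le_of_tendsto h1 (eventually_atTop.2 ⟨1, fun N hN => ?_⟩)
  rw [← sum_Icc_eq_sum_range_succ, sum_Icc_one_eq_add hN, add_sub_cancel_left]
  exact abs_sum_le_mul_zetaSum hτ (by linarith) hb fun m hm _ => hu m hm

section

variable {d : ℕ} {δ ε C c₁ c₂ η L : ℝ} {D : (Fin d → ℤ) → ℝ} {f g e : ℕ → (Fin d → ℝ) → ℝ → ℝ}

/-- `σ^{-2} ∇² gₘ(0; z)`. -/
noncomputable def lapRatio (D : (Fin d → ℤ) → ℝ) (g : ℕ → (Fin d → ℝ) → ℝ → ℝ) (z : ℝ) (m : ℕ) :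
    ℝ := (sigmaSq D)⁻¹ * lap0 fun k => g m k z

theorem lapRatio_one (hD : AssumptionD d ε C c₁ c₂ η L D f e) (hr : Recursion d f g e)
    (h1 : HasSecondPartials fun k => f 1 k 1) (hσ : 0 < sigmaSq D) {z : ℝ} (hz : 0 < z) :
    lapRatio D g z 1 = -z := by
  rw [lapRatio, lap0_eq_mul (hD.hasSecondPartials_hatD h1) (z := z)
    fun k hk => hD.g_one_eq hr hk hz]
  have : lap0 (hatD D) = -sigmaSq D := by rw [sigmaSq, neg_neg]
  rw [this]
  field_simp

theorem criticalBounds_of_kernelBounds (hD : AssumptionD d ε C c₁ c₂ η L D f e)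
    (hr : Recursion d f g e) (h1 : HasSecondPartials fun k => f 1 k 1) (hσ : 0 < sigmaSq D)
    (hδ : 0 ≤ δ) (hδ1 : δ ≤ 1) {z q b : ℝ} (hz : 0 < z) (hq : 0 ≤ q) (hqb : q ≤ b) (hb1 : b ≤ 1)
    (hK : ∀ m, 2 ≤ m → KernelBounds d δ q D g e m z) {k : Fin d → ℝ} (hk : k ∈ dualCube d)
    (hnc : ∀ n, NearCritical ((d : ℝ) / 2) δ b (aFun D k) z n
      (fun m => g m 0 z) (fun m => g m k z) (eHat e 0 z) (eHat e k z)) :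
    CriticalBounds ((d : ℝ) / 2) δ (aFun D k) (fun m => g m 0 z) (fun m => g m k z)
      (eHat e 0 z) (eHat e k z) (lapRatio D g z) := by
  have ha := hD.aFun_nonneg k
  have ha2 := hD.aFun_le_two k
  have hb : 0 ≤ b := hq.trans hqb
  have hz2 : z ≤ 2 := by linarith [(abs_le.1 (hnc 0).abs_z).2]
  have haδ : 0 ≤ aFun D k ^ δ := by positivity
  have haδ' := le_mul_rpow hδ hδ1 ha one_le_two ha2
  have h4 : 0 ≤ aFun D k ^ (1 + δ) := by positivity
  have hinterp : ∀ (y : ℝ) (m : ℕ), 2 ≤ m → |y| ≤ b * aFun D k * (m : ℝ) ^ (1 - (d : ℝ) / 2) →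
      |y| ≤ 2 * (b * (m : ℝ) ^ (-((d : ℝ) / 2))) →
      |y| ≤ 4 * aFun D k ^ δ * (m : ℝ) ^ (δ - (d : ℝ) / 2) := by
    intro y m hm hy1 hy2
    have hm0 : (0 : ℝ) < m := by positivity
    have h3 : b * aFun D k * (m : ℝ) ^ (1 - (d : ℝ) / 2)
        = b * (m : ℝ) ^ (-((d : ℝ) / 2)) * (aFun D k * m) := by
      rw [sub_eq_add_neg, Real.rpow_add hm0, Real.rpow_one]; ring
    rw [h3] at hy1
    refine (abs_le_of_interpolation hδ hδ1 (by positivity) (by positivity) hy1 hy2).trans ?_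
    rw [Real.mul_rpow ha hm0.le, sub_eq_add_neg, Real.rpow_add hm0]
    calc 2 * (b * (m : ℝ) ^ (-((d : ℝ) / 2))) * (aFun D k ^ δ * (m : ℝ) ^ δ)
        ≤ 4 * (1 * (m : ℝ) ^ (-((d : ℝ) / 2))) * (aFun D k ^ δ * (m : ℝ) ^ δ) := by
          gcongr; norm_num
      _ = _ := by ring
  have hsub2 : ∀ x y t : ℝ, |x| ≤ t → |y| ≤ t → |x - y| ≤ 2 * t := fun x y t hx hy => by
    have := abs_sub x y
    linarith
  have hcase : ∀ {P : ℕ → Prop}, P 1 → (∀ m, 2 ≤ m → P m) → ∀ m, 1 ≤ m → P m := by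
    intro P hP1 hP m hm
    rcases hm.eq_or_lt with rfl | hm
    · exact hP1
    · exact hP m hm
  have h := fun m => hnc m
  have hle : ∀ {x p : ℝ} {m : ℕ}, x ≤ b * (m : ℝ) ^ p → x ≤ 2 * (m : ℝ) ^ p := fun hx =>
    hx.trans (by gcongr; linarith)
  have hg1 := (h 1).g_one
  have hg01 := (h 1).g₀_one
  refine ⟨hcase ?_ fun m hm => hle ((h m).abs_g₀ m hm le_rfl),
    hcase ?_ fun m hm => hle ((h m).abs_g m hm le_rfl),
    hcase ?_ fun m hm => hinterp _ m hm ((h m).abs_g_sub m hm le_rfl)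
      (hsub2 _ _ _ ((h m).abs_g m hm le_rfl) ((h m).abs_g₀ m hm le_rfl)),
    hcase ?_ fun m hm => ((hK m hm).abs_taylor k hk).trans ?_,
    hcase ?_ fun m hm => ((hK m hm).abs_lap).trans ?_,
    hcase ?_ fun m hm => hle ((h m).abs_e₀ m hm le_rfl),
    hcase ?_ fun m hm => hle ((h m).abs_e m hm le_rfl),
    hcase ?_ fun m hm => hinterp _ m hm ((h m).abs_e_sub m hm le_rfl)
      (hsub2 _ _ _ ((h m).abs_e m hm le_rfl) ((h m).abs_e₀ m hm le_rfl)),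
    rfl, fun N hN => hle ((h N).crit N hN le_rfl)⟩
  · rw [hg01, Nat.cast_one, Real.one_rpow, abs_of_pos hz]; linarith
  · rw [hg1, Nat.cast_one, Real.one_rpow, abs_mul, abs_of_pos hz]
    have : |1 - aFun D k| ≤ 1 := abs_le.2 ⟨by linarith, by linarith⟩
    nlinarith [abs_nonneg (1 - aFun D k)]
  · rw [hg1, hg01, Nat.cast_one, Real.one_rpow, mul_one,
      show z * (1 - aFun D k) - z = -(z * aFun D k) by ring, abs_neg,
      abs_of_nonneg (by positivity)]
    nlinarith
  -- The term m = 1 is exactly affine in a(k): g₁ = z(1 - a), with Laplacian ratio -z, so its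
  -- remainder vanishes.
  · rw [hg1, hg01, lapRatio_one hD hr h1 hσ hz, Nat.cast_one, Real.one_rpow, mul_one,
      show z * (1 - aFun D k) - z - aFun D k * -z = 0 by ring, abs_zero]
    positivity
  · gcongr; linarith
  · rw [lapRatio_one hD hr h1 hσ hz, Nat.cast_one, Real.one_rpow, abs_neg, abs_of_pos hz]; linarith
  · gcongr; linarith
  · rw [(h 1).e₀_one, abs_zero]; positivity
  · rw [(h 1).e_one, abs_zero]; positivity
  · rw [(h 1).e₀_one, (h 1).e_one, sub_zero, abs_zero]; positivity

/-- The leading contributions to c, B and E are z, z and 1, and everything else is at most bZ. With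
|z - 1| ≤ b all three lie within 1/16 of 1, which gives positivity of A and v. Letting N → ∞ in the
mass defect gives ∑ g_m = 1. -/
theorem isCritical_of_kernelBounds (hD : AssumptionD d ε C c₁ c₂ η L D f e)
    (hr : Recursion d f g e) (h1 : HasSecondPartials fun k => f 1 k 1) (hσ : 0 < sigmaSq D)
    (hδ : 0 ≤ δ) (hτ : 2 + δ < (d : ℝ) / 2) {z q b : ℝ} (hz : 0 < z) (hq : 0 ≤ q) (hqb : q ≤ b)
    (hbZ : b * (1 + zetaSum ((d : ℝ) / 2 - 1 - δ)) ≤ 1 / 16)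
    (hlim : Tendsto (zSeq g) atTop (𝓝 z))
    (hK : ∀ m, 2 ≤ m → KernelBounds d δ q D g e m z)
    (hnc : ∀ n, NearCritical ((d : ℝ) / 2) δ b 0 z n
      (fun m => g m 0 z) (fun m => g m 0 z) (eHat e 0 z) (eHat e 0 z)) :
    ∃ c B E : ℝ, ∑' j : ℕ, ((j : ℝ) + 1) * g (j + 1) 0 z = c ∧
      1 + ∑' j : ℕ, eHat e 0 z (j + 1) = E ∧ -∑' j : ℕ, lapRatio D g z (j + 1) = B ∧
      1 / 2 ≤ c ∧ 1 / 2 ≤ B / c ∧ IsCritical D g e z (E / c) (B / c) := by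
  set Z := zetaSum ((d : ℝ) / 2 - 1 - δ) with hZ
  have hZ0 : 0 ≤ Z := zetaSum_nonneg _
  have hb : 0 ≤ b := hq.trans hqb
  have hz1 := abs_le.1 (hnc 0).abs_z
  have h0 : (0 : Fin d → ℝ) ∈ dualCube d := zero_mem_dualCube
  have hpow : ∀ m : ℕ, 2 ≤ m → (m : ℝ) ^ (-((d : ℝ) / 2)) ≤ (m : ℝ) ^ (1 - (d : ℝ) / 2) :=
    fun m hm => Real.rpow_le_rpow_of_exponent_le (by exact_mod_cast (by omega : 1 ≤ m)) (by linarith)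
  obtain ⟨hgs, -⟩ := summable_and_abs_tsum_sub_le (u := fun m => g m 0 z) hδ hτ hb fun m hm =>
    ((hnc m).abs_g₀ m hm le_rfl).trans (mul_le_mul_of_nonneg_left (hpow m hm) hb)
  obtain ⟨hcs, hcb⟩ := summable_and_abs_tsum_sub_le (u := fun m => (m : ℝ) * g m 0 z) hδ hτ hb
    fun m hm => by
      have hm0 : (0 : ℝ) < m := by positivity
      rw [abs_mul, abs_of_pos hm0, sub_eq_add_neg, Real.rpow_add hm0, Real.rpow_one,
        mul_left_comm]
      exact mul_le_mul_of_nonneg_left ((hnc m).abs_g₀ m hm le_rfl) hm0.le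
  obtain ⟨hes, heb⟩ := summable_and_abs_tsum_sub_le (u := eHat e 0 z) hδ hτ hb fun m hm =>
    ((hnc m).abs_e₀ m hm le_rfl).trans (mul_le_mul_of_nonneg_left (hpow m hm) hb)
  obtain ⟨hls, hlb⟩ := summable_and_abs_tsum_sub_le (u := lapRatio D g z) hδ hτ hb fun m hm =>
    (hK m hm).abs_lap.trans (by gcongr)
  have hg1 : g 1 0 z = z := (hnc 1).g₀_one
  simp only [Nat.cast_add, Nat.cast_one, hg1, one_mul] at hcb hcs
  rw [(hnc 1).e₀_one, sub_zero] at heb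
  rw [lapRatio_one hD hr h1 hσ hz] at hlb
  refine ⟨_, _, _, rfl, rfl, rfl, ?_⟩
  set c := ∑' j : ℕ, ((j : ℝ) + 1) * g (j + 1) 0 z with hc
  set B := -∑' j : ℕ, lapRatio D g z (j + 1) with hB
  set E := 1 + ∑' j : ℕ, eHat e 0 z (j + 1) with hE
  have hcb' := abs_le.1 hcb
  have heb' := abs_le.1 heb
  have hlb' := abs_le.1 hlb
  have hbZ' : b + b * Z ≤ 1 / 16 := by linarith
  have hbZ0 : 0 ≤ b * Z := by positivity
  have hc0 : 15 / 16 ≤ c := by linarith [hcb'.1]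
  have hc0' : c ≤ 17 / 16 := by linarith [hcb'.2]
  have hB0 : 15 / 16 ≤ B := by linarith [hlb'.2]
  have hE0 : 15 / 16 ≤ E := by linarith [heb'.1]
  have hcpos : 0 < c := by linarith
  have hBc : 1 / 2 ≤ B / c := by rw [le_div_iff₀ hcpos]; linarith
  have heq : ∀ j : ℕ, eHat e 0 z (j + 1) = e (j + 1) 0 z := fun j =>
    eHat_of_pos _ _ _ (by omega)
  have hlap : ∀ j : ℕ, lap0 (fun k => g (j + 1) k z) = sigmaSq D * lapRatio D g z (j + 1) := by
    intro j
    rw [lapRatio]; field_simp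
  refine ⟨by linarith, hBc, hz, by positivity, by linarith, hlim, ?_, hcs, ?_, ?_, ?_, ?_⟩
  · have h2 := hgs.hasSum.tendsto_sum_nat
    have h3 : Tendsto (fun N : ℕ => ∑ j ∈ Finset.range N, g (j + 1) 0 z) atTop (𝓝 1) := by
      rw [tendsto_iff_norm_sub_tendsto_zero]
      have h4 : Tendsto (fun N : ℕ => b * (N : ℝ) ^ (-(1 + δ))) atTop (𝓝 (b * 0)) :=
        ((tendsto_rpow_neg_atTop (by linarith : 0 < 1 + δ)).comp
          tendsto_natCast_atTop_atTop).const_mul b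
      rw [mul_zero] at h4
      refine squeeze_zero' (Eventually.of_forall fun _ => norm_nonneg _)
        (eventually_atTop.2 ⟨1, fun N hN => ?_⟩) h4
      rw [← sum_Icc_eq_sum_range_succ (fun m => g m 0 z), neg_add, ← sub_eq_add_neg]
      exact (hnc N).crit N hN le_rfl
    have h5 := hgs.hasSum
    rwa [tendsto_nhds_unique h2 h3] at h5
  · exact hes.congr heq
  · exact (hls.mul_left (sigmaSq D)).congr fun j => (hlap j).symm
  · rw [hE, tsum_congr heq]
  · rw [tsum_congr hlap, tsum_mul_left, ← mul_neg, ← hB, mul_div_mul_left _ _ hσ.ne']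

end

/-! ### Asymptotics of f_n(k; z_c), uniform in k -/

section

variable {d : ℕ} {δ : ℝ}

theorem exists_rpow_mul_exp_neg_le {p c : ℝ} (hp : 0 ≤ p) (hc : 0 < c) :
    ∃ C : ℝ, 0 < C ∧ ∀ x : ℝ, 0 ≤ x → x ^ p * Real.exp (-(c * x)) ≤ C := by
  obtain ⟨C, hC, h⟩ := exists_exp_neg_le_rpow hc p
  refine ⟨C, hC, fun x hx => ?_⟩
  calc x ^ p * Real.exp (-(c * x)) ≤ (1 + x) ^ p * (C * (1 + x) ^ (-p)) :=
        mul_le_mul (Real.rpow_le_rpow hx (by linarith) hp) (h x hx) (Real.exp_pos _).le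
          (by positivity)
    _ = C := by
        rw [Real.rpow_neg (by positivity)]
        field_simp

/-- Comparison of `e^{-nva}` with a Gaussian when `a` is close to a quadratic form. -/
theorem exists_exp_sub_exp_bound {v κ c₀ M : ℝ} (hδ : 0 ≤ δ) (hv : 0 < v) (hκ : 0 < κ)
    (hc₀ : 0 < c₀) (hM : 0 ≤ M) :
    ∃ C c : ℝ, 0 < C ∧ 0 < c ∧ ∀ (n : ℕ) (a s : ℝ), 1 ≤ n → 0 ≤ s → c₀ * s ≤ a →
      |a - κ * s| ≤ M * s ^ (1 + δ) →
      |Real.exp (-(n * v * a)) - Real.exp (-(n * (v * κ) * s))|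
        ≤ C * (n : ℝ) ^ (-δ) * Real.exp (-(c * n * s)) := by
  set c := v * min c₀ κ / 2 with hc
  have hm : 0 < min c₀ κ := lt_min hc₀ hκ
  have hc0 : 0 < c := by positivity
  obtain ⟨C, hC, hexp⟩ := exists_rpow_mul_exp_neg_le (p := 1 + δ) (by linarith) hc0
  refine ⟨v * M * C + 1, c, by positivity, hc0, ?_⟩
  intro n a s hn hs has hMa
  have hn0 : (0 : ℝ) < n := by exact_mod_cast hn
  have hx : 0 ≤ n * s := by positivity
  -- The exponential is bounded by a product of two equal factors: one absorbs (ns)^{1+δ}, the other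
  -- remains in the final bound.
  have h1 : ∀ y, min c₀ κ * s ≤ y →
      Real.exp (-(n * v * y)) ≤ Real.exp (-(c * (n * s))) * Real.exp (-(c * (n * s))) := by
    intro y hy
    rw [← Real.exp_add]
    refine Real.exp_le_exp.2 ?_
    have : n * v * (min c₀ κ * s) ≤ n * v * y := by gcongr
    have h2 : n * v * (min c₀ κ * s) = 2 * (c * (n * s)) := by rw [hc]; ring
    linarith
  have h2 := h1 a (le_trans (by gcongr; exact min_le_left _ _) has)
  have h3 := h1 (κ * s) (by gcongr; exact min_le_right _ _)
  have h4 := abs_exp_neg_sub_exp_neg_le h2 h3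
  rw [show n * (v * κ) * s = n * v * (κ * s) by ring]
  refine h4.trans ?_
  have h5 : |n * v * a - n * v * (κ * s)| ≤ n * v * (M * s ^ (1 + δ)) := by
    rw [← mul_sub, abs_mul, abs_of_pos (by positivity)]
    gcongr
  have h6 : n * s ^ (1 + δ) = (n : ℝ) ^ (-δ) * (n * s) ^ (1 + δ) := by
    rw [Real.mul_rpow hn0.le hs, ← mul_assoc, ← Real.rpow_add hn0]
    simp
  have h7 := hexp (n * s) hx
  rw [mul_assoc c]
  calc _ ≤ Real.exp (-(c * (n * s))) * Real.exp (-(c * (n * s))) * (n * v * (M * s ^ (1 + δ))) := by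
        gcongr
    _ = v * M * ((n : ℝ) ^ (-δ) * ((n * s) ^ (1 + δ) * Real.exp (-(c * (n * s)))))
          * Real.exp (-(c * (n * s))) := by
        rw [← mul_assoc ((n : ℝ) ^ (-δ)), ← h6]; ring
    _ ≤ v * M * ((n : ℝ) ^ (-δ) * C) * Real.exp (-(c * (n * s))) := by gcongr
    _ = v * M * C * (n : ℝ) ^ (-δ) * Real.exp (-(c * (n * s))) := by ring
    _ ≤ _ := by gcongr; linarith

set_option maxHeartbeats 1000000 in
/-- The asymptotics of `fₙ(k; z_c)`, uniformly in `k`. -/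
theorem exists_critical_asymptotics (hd : 4 < d) (hδ : 0 < δ) (hδ1 : δ ≤ 1)
    (hτ : 2 + δ < (d : ℝ) / 2) {ε C c₁ c₂ η α : ℝ} (hδε : δ ≤ ε) (hc₁ : 0 < c₁) (hη : 0 < η)
    (hα : α ∈ Set.Ioo (0 : ℝ) 1) (Ce Cg L₁ : ℝ → ℝ) :
    ∃ L₀ : ℝ, 1 ≤ L₀ ∧ ∀ L : ℝ, L₀ ≤ L →
      ∀ (D : (Fin d → ℤ) → ℝ) (f g e : ℕ → (Fin d → ℝ) → ℝ → ℝ),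
        Recursion d f g e → AssumptionS d f g e → AssumptionD d ε C c₁ c₂ η L D f e →
        AssumptionE d α Ce L₁ L D f e → AssumptionG d ε α Cg L₁ L D f g →
        ∃ zc A v : ℝ, IsCritical D g e zc A v ∧ 0 < sigmaSq D ∧
          ∃ M c : ℝ, 0 < M ∧ 0 < c ∧ ∀ n : ℕ, 1 ≤ n → ∀ k ∈ dualCube d,
            |f n k zc - A * Real.exp (-(n * (v * (sigmaSq D / (2 * d))) * sqNorm k))|
              ≤ M * (n : ℝ) ^ (-δ) * Real.exp (-(c * n * sqNorm k))
                + M * (sqNorm k ^ 2)⁻¹ * (n : ℝ) ^ (-((d : ℝ) / 2)) := by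
  obtain ⟨C₁, c₃, b₁, hC₁, hc₃, hb₁, hb₁1, hbound⟩ := NearCritical.exists_bound hδ.le hτ hη
  obtain ⟨b₂, hb₂, hasymp⟩ := NearCritical.exists_asymptotics hδ.le hδ1 hτ
  set Z := zetaSum ((d : ℝ) / 2 - 1 - δ) with hZ
  have hZ0 : 0 ≤ Z := zetaSum_nonneg _
  obtain ⟨L₀, hL₀, hcrit⟩ := exists_critical_point (ε := ε) (C := C) (c₂ := c₂) hd hδ.le hτ hδε hc₁
    hη hα Ce Cg L₁ (b₀ := min (min b₁ b₂) (1 / (16 * (1 + Z))))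
    (lt_min (lt_min hb₁ hb₂) (by positivity))
  refine ⟨L₀, hL₀, ?_⟩
  intro L hL D f g e hr hS hD hE hG
  obtain ⟨zc, q, b, hzc, hq, hqb, hbb, hlim, hK, hnc⟩ := hcrit L hL D f g e hr hS hD hE hG
  have hL1 : 1 ≤ L := hL₀.trans hL
  have hb0 : 0 ≤ b := hq.trans hqb
  have hbb₁ : b ≤ b₁ := hbb.trans ((min_le_left _ _).trans (min_le_left _ _))
  have hbb₂ : b ≤ b₂ := hbb.trans ((min_le_left _ _).trans (min_le_right _ _))
  have hb1 : b ≤ 1 := hbb₁.trans hb₁1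
  have hbZ : b * (1 + Z) ≤ 1 / 16 := by
    have := hbb.trans (min_le_right _ _)
    rw [le_div_iff₀ (by positivity)] at this
    linarith
  have hdiff1 := hS.diff 1 le_rfl 1 one_pos
  have hσ := hD.sigmaSq_pos (by omega) hc₁ hL1 hdiff1
  have h0 : (0 : Fin d → ℝ) ∈ dualCube d := zero_mem_dualCube
  obtain ⟨c, B, E, hc, hE', hB, hc2, hBc, hIC⟩ := isCritical_of_kernelBounds hD hr hdiff1 hσ hδ.le hτ
    hzc hq hqb hbZ hlim hK fun n => (hnc n 0 h0).zero
  refine ⟨zc, E / c, B / c, hIC, hσ, ?_⟩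
  set A := E / c with hA
  set v := B / c with hv
  have hv0 : 0 < v := hIC.v_pos
  have hA0 : 0 < A := hIC.A_pos
  have hd0 : (0 : ℝ) < d := by exact_mod_cast (by omega : 0 < d)
  obtain ⟨C₂, hC₂, hf⟩ := hasymp b zc c B E (fun m => g m 0 zc) _ _ hb0 hbb₂ hc hE' hB hc2 hBc
  obtain ⟨M, hM0, hM⟩ := hD.exists_aFun_expansion (by omega) hL1 (hS.symm_f 1 le_rfl 1 one_pos)
    hdiff1 hδ hδ1 hδε
  set c₀ := min (c₁ * L ^ 2) (η / (d * Real.pi ^ 2)) with hc₀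
  have hpi := Real.pi_pos
  have hc₀0 : 0 < c₀ := lt_min (by positivity) (by positivity)
  have hac : ∀ k ∈ dualCube d, c₀ * sqNorm k ≤ aFun D k := fun k hk =>
    hD.mul_sqNorm_le_aFun (by omega) hη hk
  obtain ⟨C₃, c₄, hC₃, hc₄, hcomp⟩ := exists_exp_sub_exp_bound (δ := δ) hδ.le hv0
    (κ := sigmaSq D / (2 * d)) (by positivity) hc₀0 hM0
  set r := min c₃ (min v (1 / 4)) with hr'
  have hr0 : 0 < r := lt_min hc₃ (lt_min hv0 (by norm_num))
  have hrc₃ : r ≤ c₃ := min_le_left _ _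
  have hrv : r ≤ v := (min_le_right _ _).trans (min_le_left _ _)
  have hr4 : r ≤ 1 / 4 := (min_le_right _ _).trans (min_le_right _ _)
  obtain ⟨C₄, hC₄, hexp⟩ := exists_exp_neg_le_rpow (c := r / 8) (by positivity) δ
  set X := C₂ + (C₁ + A) * C₄ with hX
  have hX0 : 0 < X := by positivity
  set Y := C₂ + C₁ with hY
  have hY0 : 0 < Y := by positivity
  have hmain : ∀ n : ℕ, 1 ≤ n → ∀ k ∈ dualCube d,
      |f n k zc - A * Real.exp (-(n * v * aFun D k))|
        ≤ X * (n : ℝ) ^ (-δ) * Real.exp (-(r / 2 * n * aFun D k))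
          + Y * (aFun D k ^ 2)⁻¹ * (n : ℝ) ^ (-((d : ℝ) / 2)) := by
    intro n hn k hk
    have hn0 : (0 : ℝ) < n := by exact_mod_cast hn
    have ha := hD.aFun_nonneg k
    have hrec := hr.eq_sum_add_eHat (k := k) hk hzc
    -- For a > 1/4 no expansion is needed: apart from the long-step term, f_n and A e^{-nva} are
    -- each exponentially small in n, hence below n^{-δ} e^{-rna/2} up to a constant.
    rcases le_or_gt (aFun D k) (1 / 4) with h4 | h4
    · refine (hf (aFun D k) (fun m => g m k zc) (eHat e k zc) (fun m => f m k zc)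
        (fun n => hnc n k hk) (criticalBounds_of_kernelBounds hD hr hdiff1 hσ hδ.le hδ1 hzc hq hqb
          hb1 hK hk fun n => hnc n k hk) ha h4 hrec n hn).trans ?_
      have h5 : Real.exp (-(n * aFun D k / 8)) ≤ Real.exp (-(r / 2 * n * aFun D k)) := by
        refine Real.exp_le_exp.2 (neg_le_neg ?_)
        have : 0 ≤ n * aFun D k := by positivity
        nlinarith
      have hX2 : C₂ ≤ X := by rw [hX]; exact le_add_of_nonneg_right (by positivity)
      gcongr
      linarith
    · have h5 := (hbound b (aFun D k) zc n _ _ _ _ (fun m => f m k zc) (hnc n k hk) hb0 hbb₁ ha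
        (hD.a_lt k hk) hrec n le_rfl).2
      have h6 : ∀ s, r ≤ s → Real.exp (-(s * n * aFun D k))
          ≤ C₄ * (n : ℝ) ^ (-δ) * Real.exp (-(r / 2 * n * aFun D k)) := by
        intro s hs
        have h7 : Real.exp (-(r / 8 * n)) ≤ C₄ * (n : ℝ) ^ (-δ) := by
          refine (hexp n hn0.le).trans (mul_le_mul_of_nonneg_left ?_ hC₄.le)
          exact Real.rpow_le_rpow_of_nonpos hn0 (by linarith) (by linarith)
        calc Real.exp (-(s * n * aFun D k))
            ≤ Real.exp (-(r / 8 * n)) * Real.exp (-(r / 2 * n * aFun D k)) := by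
              rw [← Real.exp_add]
              refine Real.exp_le_exp.2 ?_
              have h8 : r * (n * aFun D k) ≤ s * (n * aFun D k) := by gcongr
              have h9 : r * n * (1 / 4) ≤ r * n * aFun D k := by gcongr
              linarith
          _ ≤ _ := by gcongr
      have h7 := h6 c₃ hrc₃
      have h8 := h6 v hrv
      rw [mul_comm v] at h8
      calc _ ≤ |f n k zc| + |A * Real.exp (-(n * v * aFun D k))| := abs_sub _ _
        _ = |f n k zc| + A * Real.exp (-(n * v * aFun D k)) := by
            rw [abs_of_pos (by positivity : 0 < A * Real.exp (-(n * v * aFun D k)))]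
        _ ≤ (C₁ * (C₄ * (n : ℝ) ^ (-δ) * Real.exp (-(r / 2 * n * aFun D k)))
            + C₁ * 1 * (aFun D k ^ 2)⁻¹ * (n : ℝ) ^ (-((d : ℝ) / 2)))
            + A * (C₄ * (n : ℝ) ^ (-δ) * Real.exp (-(r / 2 * n * aFun D k))) := by
              refine add_le_add (h5.trans ?_) (by gcongr)
              gcongr
        _ = ((C₁ + A) * C₄) * (n : ℝ) ^ (-δ) * Real.exp (-(r / 2 * n * aFun D k))
            + C₁ * (aFun D k ^ 2)⁻¹ * (n : ℝ) ^ (-((d : ℝ) / 2)) := by ring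
        _ ≤ _ := by
            gcongr
            · linarith
            · linarith
  set cc := min (r / 2 * c₀) c₄ with hcc
  refine ⟨X + A * C₃ + Y * (c₀ ^ 2)⁻¹, cc, by positivity, lt_min (by positivity) hc₄, ?_⟩
  intro n hn k hk
  have hn0 : (0 : ℝ) < n := by exact_mod_cast hn
  have hs := sqNorm_nonneg k
  have ha := hac k hk
  have h1 := hmain n hn k hk
  have h2 := hcomp n (aFun D k) (sqNorm k) hn hs ha (hM k)
  have h3 : Real.exp (-(r / 2 * n * aFun D k)) ≤ Real.exp (-(cc * n * sqNorm k)) := by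
    refine Real.exp_le_exp.2 (neg_le_neg ?_)
    calc cc * n * sqNorm k ≤ (r / 2 * c₀) * n * sqNorm k := by gcongr; exact min_le_left _ _
      _ = r / 2 * n * (c₀ * sqNorm k) := by ring
      _ ≤ _ := by gcongr
  have h4 : Real.exp (-(c₄ * n * sqNorm k)) ≤ Real.exp (-(cc * n * sqNorm k)) := by
    refine Real.exp_le_exp.2 (neg_le_neg ?_)
    gcongr
    exact min_le_right _ _
  have h5 : (aFun D k ^ 2)⁻¹ ≤ (c₀ ^ 2)⁻¹ * (sqNorm k ^ 2)⁻¹ := by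
    -- At k = 0 both sides are 0 by the convention 0⁻¹ = 0, so the estimate there has no long-step
    -- term.
    rcases hs.eq_or_lt with h | h
    · have hk0 : k = 0 := by
        have := norm_sq_le_sqNorm k
        rw [← h] at this
        exact norm_eq_zero.1 (pow_eq_zero_iff two_ne_zero |>.1 (le_antisymm this (sq_nonneg _)))
      rw [hk0, hD.aFun_zero]
      simp [sqNorm]
    · rw [← mul_inv, ← mul_pow]
      gcongr
  calc _ ≤ |f n k zc - A * Real.exp (-(n * v * aFun D k))|
        + |A * (Real.exp (-(n * v * aFun D k))
          - Real.exp (-(n * (v * (sigmaSq D / (2 * d))) * sqNorm k)))| := by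
          refine le_trans (le_of_eq ?_) (abs_add_le _ _)
          congr 1; ring
    _ ≤ (X * (n : ℝ) ^ (-δ) * Real.exp (-(cc * n * sqNorm k))
          + Y * ((c₀ ^ 2)⁻¹ * (sqNorm k ^ 2)⁻¹) * (n : ℝ) ^ (-((d : ℝ) / 2)))
        + A * (C₃ * (n : ℝ) ^ (-δ) * Real.exp (-(cc * n * sqNorm k))) := by
          rw [abs_mul, abs_of_pos hA0]
          refine add_le_add (h1.trans ?_) ?_
          · gcongr
          · refine mul_le_mul_of_nonneg_left (h2.trans ?_) hA0.le
            gcongr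
    _ = (X + A * C₃) * (n : ℝ) ^ (-δ) * Real.exp (-(cc * n * sqNorm k))
        + (Y * (c₀ ^ 2)⁻¹) * (sqNorm k ^ 2)⁻¹ * (n : ℝ) ^ (-((d : ℝ) / 2)) := by ring
    _ ≤ _ := by
        have hA3 : 0 ≤ X + A * C₃ := by positivity
        have hYc : 0 ≤ Y * (c₀ ^ 2)⁻¹ := by positivity
        refine add_le_add (mul_le_mul_of_nonneg_right (mul_le_mul_of_nonneg_right ?_ ?_) ?_)
          (mul_le_mul_of_nonneg_right (mul_le_mul_of_nonneg_right ?_ ?_) ?_)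
        · linarith
        · positivity
        · positivity
        · linarith
        · positivity
        · positivity

end

/-! ### Averages over lattice cubes and the Dirichlet kernel -/

theorem sum_Icc_int_eq_sum_range {M : Type*} [AddCommMonoid M] (a : ℤ) (N : ℕ) (F : ℤ → M) :
    ∑ j ∈ Finset.Icc (a - N) (a + N), F j = ∑ i ∈ Finset.range (2 * N + 1), F (a - N + i) := by
  rw [Int.Icc_eq_finset_map, Finset.sum_map,
    show (a + (N : ℤ) + 1 - (a - N)).toNat = 2 * N + 1 by omega]
  rfl

/-- Geometric series of ratio w = e^{-it}: the numerator is at most 2, and |w - 1| = 2|sin(t/2)| ≥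
2|t|/π on |t| ≤ π. -/
theorem norm_sum_exp_le {t : ℝ} (ht : |t| ≤ Real.pi) (ht0 : t ≠ 0) (a : ℤ) (N : ℕ) :
    ‖∑ j ∈ Finset.Icc (a - N) (a + N), Complex.exp (-(Complex.I * ((t : ℂ) * (j : ℂ))))‖
      ≤ Real.pi / |t| := by
  have hpi := Real.pi_pos
  have hta : 0 < |t| := abs_pos.2 ht0
  set w := Complex.exp (Complex.I * ((-t : ℝ) : ℂ)) with hw
  have hterm : ∀ i : ℕ, Complex.exp (-(Complex.I * ((t : ℂ) * ((a - N + i : ℤ) : ℂ))))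
      = Complex.exp (-(Complex.I * ((t * (a - N : ℤ) : ℝ) : ℂ))) * w ^ i := by
    intro i
    rw [hw, ← Complex.exp_nat_mul, ← Complex.exp_add]
    congr 1
    push_cast
    ring
  rw [sum_Icc_int_eq_sum_range a N fun j => Complex.exp (-(Complex.I * ((t : ℂ) * (j : ℂ))))]
  simp only [hterm]
  rw [← Finset.mul_sum, norm_mul, norm_exp_neg_I_mul_real, one_mul]
  have h1 : ‖∑ i ∈ Finset.range (2 * N + 1), w ^ i‖ * ‖w - 1‖ ≤ 2 := by
    rw [← norm_mul, geom_sum_mul]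
    refine (norm_sub_le _ _).trans ?_
    rw [norm_pow, hw, norm_exp_I_mul_real, one_pow, norm_one]
    norm_num
  have h2 : 2 / Real.pi * |t| ≤ ‖w - 1‖ := by
    rw [hw, Complex.norm_exp_I_mul_ofReal_sub_one, norm_mul, Real.norm_eq_abs, Real.norm_eq_abs,
      abs_two, neg_div, Real.sin_neg, abs_neg]
    have := Real.mul_abs_le_abs_sin (x := t / 2) (by rw [abs_div, abs_two]; linarith)
    rw [abs_div, abs_two] at this
    linarith
  have h3 : ‖∑ i ∈ Finset.range (2 * N + 1), w ^ i‖ * (2 / Real.pi * |t|) ≤ 2 :=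
    (mul_le_mul_of_nonneg_left h2 (norm_nonneg _)).trans h1
  rw [le_div_iff₀ hta]
  have h4 : ‖∑ i ∈ Finset.range (2 * N + 1), w ^ i‖ * (2 / Real.pi * |t|)
      = ‖∑ i ∈ Finset.range (2 * N + 1), w ^ i‖ * |t| * 2 / Real.pi := by ring
  rw [h4, div_le_iff₀ hpi] at h3
  linarith

section

variable {d : ℕ}

theorem latticeCube_toFinset (x : Fin d → ℤ) {R : ℝ} (hR : 0 ≤ R) :
    (latticeCube_finite x R).toFinset
      = Fintype.piFinset fun i => Finset.Icc (x i - ⌊R⌋₊) (x i + ⌊R⌋₊) := by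
  ext y
  rw [Set.Finite.mem_toFinset, Fintype.mem_piFinset, latticeCube, Set.mem_ofPred_eq,
    pi_norm_le_iff_of_nonneg hR]
  refine forall_congr' fun i => ?_
  have h1 : (toReal x - toReal y) i = ((x i - y i : ℤ) : ℝ) := by simp [toReal]
  rw [h1, Real.norm_eq_abs, ← Int.cast_abs, ← Nat.cast_natAbs, ← Nat.le_floor_iff hR,
    Finset.mem_Icc]
  omega

theorem natFloor_bounds {R : ℝ} (hR : 0 ≤ R) : 2 * (⌊R⌋₊ : ℝ) + 1 ≤ 2 * R + 1 := by
  linarith [Nat.floor_le hR]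

theorem card_latticeCube (x : Fin d → ℤ) {R : ℝ} (hR : 0 ≤ R) :
    ((latticeCube_finite x R).toFinset.card : ℝ) = (2 * (⌊R⌋₊ : ℝ) + 1) ^ d := by
  rw [latticeCube_toFinset x hR, Fintype.card_piFinset]
  have : ∀ i, (Finset.Icc (x i - (⌊R⌋₊ : ℤ)) (x i + ⌊R⌋₊)).card = 2 * ⌊R⌋₊ + 1 := by
    intro i
    rw [Int.card_Icc]; omega
  simp [this]

theorem card_latticeCube_le (x : Fin d → ℤ) {R : ℝ} (hR : 0 ≤ R) :
    ((latticeCube_finite x R).toFinset.card : ℝ) ≤ (2 * R + 1) ^ d := by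
  rw [card_latticeCube x hR]
  exact pow_le_pow_left₀ (by positivity) (natFloor_bounds hR) d

/-- The normalised Dirichlet kernel of a lattice cube. -/
noncomputable def cubeKernel (x : Fin d → ℤ) (R : ℝ) (k : Fin d → ℝ) : ℂ :=
  (((2 * R + 1) ^ d : ℝ) : ℂ)⁻¹
    * ∑ y ∈ (latticeCube_finite x R).toFinset, Complex.exp (-(Complex.I * (dot k y : ℂ)))

theorem continuous_cubeKernel (x : Fin d → ℤ) (R : ℝ) : Continuous (cubeKernel x R) := by
  unfold cubeKernel
  refine continuous_const.mul (continuous_finsetSum _ fun y _ => ?_)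
  have := continuous_dot (d := d) y
  fun_prop

theorem norm_cubeAverage_weight {R : ℝ} (hR : 0 ≤ R) :
    ‖((((2 * R + 1) ^ d : ℝ) : ℂ)⁻¹)‖ = ((2 * R + 1) ^ d)⁻¹ := by
  rw [norm_inv, Complex.norm_real, Real.norm_of_nonneg (by positivity)]

theorem norm_average_le (x : Fin d → ℤ) {R : ℝ} (hR : 0 ≤ R) {F : (Fin d → ℤ) → ℂ} {B : ℝ}
    (hB : 0 ≤ B) (hF : ∀ y, ‖F y‖ ≤ B) :
    ‖(((2 * R + 1) ^ d : ℝ) : ℂ)⁻¹ * ∑ y ∈ (latticeCube_finite x R).toFinset, F y‖ ≤ B := by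
  rw [norm_mul, norm_cubeAverage_weight hR, inv_mul_le_iff₀ (by positivity)]
  refine (norm_sum_le_of_le _ fun y _ => hF y).trans ?_
  rw [Finset.sum_const, nsmul_eq_mul]
  exact mul_le_mul_of_nonneg_right (card_latticeCube_le x hR) hB

theorem norm_cubeKernel_le_one (x : Fin d → ℤ) {R : ℝ} (hR : 0 ≤ R) (k : Fin d → ℝ) :
    ‖cubeKernel x R k‖ ≤ 1 :=
  norm_average_le x hR zero_le_one fun _ => (norm_exp_neg_I_mul_real _).le

/-- The kernel factorises over the coordinates. Each factor is at most min(1, u) with u =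
π/(R|k_i|), hence at most u^{κ/d}. Spreading the power κ evenly over the coordinates keeps each
singularity mild. -/
theorem norm_cubeKernel_le (hd : 0 < d) (x : Fin d → ℤ) {R κ : ℝ} (hR : 1 ≤ R) (hκ : 0 ≤ κ)
    (hκd : κ ≤ d) {k : Fin d → ℝ} (hk : k ∈ dualCube d) (hk0 : ∀ i, k i ≠ 0) :
    ‖cubeKernel x R k‖ ≤ Real.pi ^ κ * R ^ (-κ) * ∏ i, |k i| ^ (-(κ / d)) := by
  have hpi := Real.pi_pos
  have hR0 : 0 < R := by linarith
  have hd0 : (0 : ℝ) < d := by exact_mod_cast hd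
  set θ := κ / d with hθ
  have hθ0 : 0 ≤ θ := by positivity
  have hθ1 : θ ≤ 1 := by rw [hθ, div_le_one hd0]; exact hκd
  set S : Fin d → ℂ := fun i => ∑ j ∈ Finset.Icc (x i - (⌊R⌋₊ : ℤ)) (x i + ⌊R⌋₊),
    Complex.exp (-(Complex.I * ((k i : ℂ) * (j : ℂ)))) with hS
  have hprod : ∑ y ∈ (latticeCube_finite x R).toFinset, Complex.exp (-(Complex.I * (dot k y : ℂ)))
      = ∏ i, S i := by
    rw [latticeCube_toFinset x hR0.le, hS, Finset.prod_univ_sum]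
    refine Finset.sum_congr rfl fun y _ => ?_
    rw [← Complex.exp_sum, Finset.sum_neg_distrib, ← Finset.mul_sum, dot]
    push_cast
    rfl
  have hfac : ∀ i, ‖S i‖ / (2 * R + 1) ≤ Real.pi ^ θ * R ^ (-θ) * |k i| ^ (-θ) := by
    intro i
    have hki : 0 < |k i| := abs_pos.2 (hk0 i)
    set u := Real.pi / (R * |k i|) with hu
    have hu0 : 0 < u := by positivity
    have h1 : ‖S i‖ / (2 * R + 1) ≤ 1 := by
      rw [div_le_one (by positivity)]
      refine le_trans (norm_sum_le_of_le _ (n := fun _ => 1) fun j _ => ?_) ?_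
      · have := norm_exp_neg_I_mul_real (k i * j)
        push_cast at this
        exact this.le
      · rw [Finset.sum_const, nsmul_eq_mul, mul_one, Int.card_Icc,
          show (x i + (⌊R⌋₊ : ℤ) + 1 - (x i - ⌊R⌋₊)).toNat = 2 * ⌊R⌋₊ + 1 by omega]
        push_cast
        exact natFloor_bounds hR0.le
    have h2 : ‖S i‖ / (2 * R + 1) ≤ u := by
      calc ‖S i‖ / (2 * R + 1) ≤ (Real.pi / |k i|) / R := by
            gcongr
            · exact norm_sum_exp_le (mem_dualCube_iff.1 hk i) (hk0 i) (x i) _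
            · linarith
        _ = u := by rw [hu]; field_simp
    have h3 : ‖S i‖ / (2 * R + 1) ≤ u ^ θ := by
      rcases le_or_gt 1 u with h | h
      · exact h1.trans (Real.one_le_rpow h hθ0)
      · refine h2.trans ?_
        nth_rewrite 1 [← Real.rpow_one u]
        exact Real.rpow_le_rpow_of_exponent_ge hu0 h.le hθ1
    refine h3.trans (le_of_eq ?_)
    rw [hu, Real.div_rpow hpi.le (by positivity), Real.mul_rpow hR0.le (abs_nonneg _),
      Real.rpow_neg hR0.le, Real.rpow_neg (abs_nonneg _)]
    field_simp
  rw [cubeKernel, hprod, norm_mul, norm_cubeAverage_weight hR0.le, norm_prod]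
  calc ((2 * R + 1) ^ d)⁻¹ * ∏ i, ‖S i‖ = ∏ i, ‖S i‖ / (2 * R + 1) := by
        rw [Finset.prod_div_distrib, Finset.prod_const, Finset.card_univ, Fintype.card_fin,
          div_eq_inv_mul]
    _ ≤ ∏ i, Real.pi ^ θ * R ^ (-θ) * |k i| ^ (-θ) :=
        Finset.prod_le_prod (fun i _ => by positivity) fun i _ => hfac i
    _ = _ := by
        rw [Finset.prod_mul_distrib, Finset.prod_const, Finset.card_univ, Fintype.card_fin, mul_pow,
          ← Real.rpow_natCast, ← Real.rpow_natCast, ← Real.rpow_mul hpi.le,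
          ← Real.rpow_mul hR0.le]
        congr 3
        · rw [hθ]; field_simp
        · rw [hθ]; field_simp

/-! ### Gaussian integrals -/

theorem integral_exp_mul_gaussian {b : ℝ} (hb : 0 < b) (y : Fin d → ℤ) :
    ∫ k : Fin d → ℝ, Complex.exp (-(Complex.I * (dot k y : ℂ)))
        * ((Real.exp (-(b * sqNorm k)) : ℝ) : ℂ)
      = (((Real.pi / b) ^ ((d : ℝ) / 2) * Real.exp (-(sqNorm (toReal y) / (4 * b))) : ℝ) : ℂ) := by
  have hpi := Real.pi_pos
  have h1 : ∀ k : Fin d → ℝ, Complex.exp (-(Complex.I * (dot k y : ℂ)))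
        * ((Real.exp (-(b * sqNorm k)) : ℝ) : ℂ)
      = ∏ i, Complex.exp (Complex.I * (-(y i : ℂ)) * (k i : ℂ))
        * Complex.exp (-(b : ℂ) * (k i : ℂ) ^ 2) := by
    intro k
    rw [Finset.prod_mul_distrib, ← Complex.exp_sum, ← Complex.exp_sum, Complex.ofReal_exp]
    congr 2
    · rw [dot]
      push_cast
      rw [Finset.mul_sum, ← Finset.sum_neg_distrib]
      exact Finset.sum_congr rfl fun i _ => by ring
    · rw [sqNorm]
      push_cast
      rw [Finset.mul_sum, ← Finset.sum_neg_distrib]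
      exact Finset.sum_congr rfl fun i _ => by ring
  simp only [h1]
  rw [integral_fintype_prod_volume_eq_prod (fun (i : Fin d) (t : ℝ) =>
    Complex.exp (Complex.I * (-(y i : ℂ)) * (t : ℂ)) * Complex.exp (-(b : ℂ) * (t : ℂ) ^ 2))]
  have h2 : ∀ i : Fin d, ∫ t : ℝ, Complex.exp (Complex.I * (-(y i : ℂ)) * (t : ℂ))
        * Complex.exp (-(b : ℂ) * (t : ℂ) ^ 2)
      = (((Real.pi / b) ^ (1 / 2 : ℝ) * Real.exp (-((y i : ℝ) ^ 2 / (4 * b))) : ℝ) : ℂ) := by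
    intro i
    rw [fourierIntegral_gaussian (by simpa using hb)]
    push_cast
    rw [Complex.ofReal_cpow (by positivity)]
    push_cast
    congr 2
    ring
  simp only [h2]
  rw [← Complex.ofReal_prod]
  congr 1
  rw [Finset.prod_mul_distrib, Finset.prod_const, Finset.card_univ, Fintype.card_fin,
    ← Real.rpow_natCast, ← Real.rpow_mul (by positivity), ← Real.exp_sum]
  congr 2
  · ring
  · rw [Finset.sum_neg_distrib, ← Finset.sum_div]
    rfl

theorem integrable_exp_mul_gaussian {b : ℝ} (hb : 0 < b) (y : Fin d → ℤ) :
    Integrable fun k : Fin d → ℝ => Complex.exp (-(Complex.I * (dot k y : ℂ)))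
        * ((Real.exp (-(b * sqNorm k)) : ℝ) : ℂ) := by
  have h1 := (integrable_exp_sqNorm (d := d) hb).ofReal (𝕜 := ℂ)
  refine h1.mono ?_ (ae_of_all _ fun k => ?_)
  · have := continuous_dot (d := d) y
    refine AEStronglyMeasurable.mul ?_ h1.1
    exact Continuous.aestronglyMeasurable (by fun_prop)
  · rw [norm_mul, norm_exp_neg_I_mul_real, one_mul]
    rfl

/-- The part of the Gaussian integral outside the dual cube. -/
theorem norm_integral_dual_gaussian_sub_le {b : ℝ} (hb : 0 < b) (y : Fin d → ℤ) :
    ‖∫ k, Complex.exp (-(Complex.I * (dot k y : ℂ))) * ((Real.exp (-(b * sqNorm k)) : ℝ) : ℂ)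
        ∂(dualMeasure d)
      - ((((2 * Real.pi) ^ d)⁻¹ * ((Real.pi / b) ^ ((d : ℝ) / 2)
        * Real.exp (-(sqNorm (toReal y) / (4 * b)))) : ℝ) : ℂ)‖
      ≤ Real.pi ^ ((d : ℝ) / 2) * (b / 2) ^ (-(d : ℝ) / 2) * Real.exp (-(b / 2)) := by
  have hpi := Real.pi_pos
  have hi := integrable_exp_mul_gaussian hb y
  rw [Complex.ofReal_mul, ← integral_exp_mul_gaussian hb y, dualMeasure, integral_smul_measure,
    ENNReal.toReal_ofReal (by positivity), ← integral_add_compl (measurableSet_dualCube d) hi,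
    ← Complex.real_smul, smul_add, sub_add_cancel_left, norm_neg, norm_smul]
  have h1 : ‖((2 * Real.pi) ^ d)⁻¹‖ ≤ 1 := by
    rw [Real.norm_of_nonneg (by positivity)]
    exact inv_le_one_of_one_le₀ (one_le_pow₀ (by linarith [Real.pi_gt_three]))
  refine (mul_le_of_le_one_left (norm_nonneg _) h1).trans ?_
  -- Half of the exponent is spent on k² ≥ 1 outside the dual cube, the other half on convergence of
  -- the integral.
  have hg := integrable_exp_sqNorm (d := d) (c := b / 2) (by positivity)
  have h2 : ‖∫ k in (dualCube d)ᶜ, Complex.exp (-(Complex.I * (dot k y : ℂ)))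
      * ((Real.exp (-(b * sqNorm k)) : ℝ) : ℂ)‖
      ≤ ∫ k : Fin d → ℝ in (dualCube d)ᶜ, Real.exp (-(b / 2)) * Real.exp (-(b / 2 * sqNorm k)) := by
    refine norm_integral_le_of_norm_le (hg.const_mul _).integrableOn ?_
    filter_upwards [ae_restrict_mem (measurableSet_dualCube d).compl] with k hk
    rw [norm_mul, norm_exp_neg_I_mul_real, one_mul, Complex.norm_real, Real.norm_of_nonneg
      (Real.exp_pos _).le, ← Real.exp_add]
    refine Real.exp_le_exp.2 ?_
    have h3 : 1 ≤ sqNorm k := by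
      rw [Set.mem_compl_iff, mem_dualCube_iff] at hk
      push Not at hk
      obtain ⟨i, hi⟩ := hk
      have h4 : 1 ≤ ‖k‖ := by
        have := norm_le_pi_norm k i
        rw [Real.norm_eq_abs] at this
        linarith [Real.pi_gt_three]
      exact (one_le_pow₀ h4).trans (norm_sq_le_sqNorm k)
    nlinarith
  refine h2.trans ?_
  rw [integral_const_mul]
  have h5 : ∫ k : Fin d → ℝ in (dualCube d)ᶜ, Real.exp (-(b / 2 * sqNorm k))
      ≤ ∫ k : Fin d → ℝ, Real.exp (-(b / 2 * sqNorm k)) :=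
    setIntegral_le_integral hg (ae_of_all _ fun k => (Real.exp_pos _).le)
  rw [integral_exp_sqNorm (by positivity)] at h5
  calc _ ≤ Real.exp (-(b / 2)) * (Real.pi ^ ((d : ℝ) / 2) * (b / 2) ^ (-(d : ℝ) / 2)) := by gcongr
    _ = _ := by ring

end

/-! ### Comparison of the averages with Gaussian averages -/

section

variable {d : ℕ}

/-- The Gaussian density `A (d/(2πnvσ²))^{d/2} e^{-d x²/(2nvσ²)}`. -/
noncomputable def gaussWeight (d n : ℕ) (A v σsq : ℝ) (x : Fin d → ℝ) : ℝ :=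
  prefactor d n A v σsq * Real.exp (-(d * sqNorm x / (2 * (v * σsq * n))))

theorem gaussWeight_eq (hd : 0 < d) {n : ℕ} (hn : 1 ≤ n) {A v σsq : ℝ} (hv : 0 < v)
    (hσ : 0 < σsq) (x : Fin d → ℝ) :
    gaussWeight d n A v σsq x = A * (((2 * Real.pi) ^ d)⁻¹
      * ((Real.pi / (n * (v * (σsq / (2 * d))))) ^ ((d : ℝ) / 2)
        * Real.exp (-(sqNorm x / (4 * (n * (v * (σsq / (2 * d))))))))) := by
  have hpi := Real.pi_pos
  have hd0 : (0 : ℝ) < d := by exact_mod_cast hd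
  have hn0 : (0 : ℝ) < n := by exact_mod_cast hn
  rw [gaussWeight, prefactor]
  have h1 : ((2 * Real.pi) ^ d)⁻¹ = (((2 * Real.pi) ^ 2)⁻¹) ^ ((d : ℝ) / 2) := by
    rw [← Real.rpow_natCast (2 * Real.pi) 2, ← Real.rpow_neg (by positivity),
      ← Real.rpow_mul (by positivity), ← Real.rpow_natCast (2 * Real.pi) d,
      ← Real.rpow_neg (by positivity)]
    congr 1
    push_cast; ring
  rw [h1, ← mul_assoc (_ ^ ((d : ℝ) / 2)), ← Real.mul_rpow (by positivity) (by positivity),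
    ← mul_assoc A]
  congr 3
  · field_simp
  · field_simp
    ring

theorem integrable_prod_abs_rpow (hd : 0 < d) {p : ℝ} (hp : p < d) :
    Integrable (fun k : Fin d → ℝ => ∏ i, |k i| ^ (-(p / d))) (dualMeasure d) := by
  have hd0 : (0 : ℝ) < d := by exact_mod_cast hd
  refine integrable_dualMeasure_prod (F := fun _ t => |t| ^ (-(p / d))) fun i => ?_
  exact integrableOn_abs_rpow (by rw [div_lt_one hd0]; exact hp) _

/-- The integral of `(k²)⁻²` against the Dirichlet kernel decays like `R^{-κ}`. -/
theorem exists_integral_cubeKernel_bound (hd : 4 < d) {κ : ℝ} (hκ : 0 ≤ κ) (hκ1 : κ < 1) :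
    ∃ C : ℝ, 0 ≤ C ∧ ∀ (x : Fin d → ℤ) (R : ℝ), 1 ≤ R →
      Integrable (fun k => ‖cubeKernel x R k‖ * (sqNorm k ^ 2)⁻¹) (dualMeasure d) ∧
      ∫ k, ‖cubeKernel x R k‖ * (sqNorm k ^ 2)⁻¹ ∂(dualMeasure d) ≤ C * R ^ (-κ) := by
  have hpi := Real.pi_pos
  have hd5 : (5 : ℝ) ≤ d := by exact_mod_cast hd
  -- The combined singularity has order 4 + κ, which is below d because d ≥ 5 and κ < 1.
  have hi := integrable_prod_abs_rpow (d := d) (by omega) (p := 4 + κ) (by linarith)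
  have hC0 : 0 ≤ ∫ k : Fin d → ℝ, ∏ i, |k i| ^ (-((4 + κ) / d)) ∂(dualMeasure d) :=
    integral_nonneg fun k => Finset.prod_nonneg fun i _ => by positivity
  refine ⟨Real.pi ^ κ * ∫ k : Fin d → ℝ, ∏ i, |k i| ^ (-((4 + κ) / d)) ∂(dualMeasure d),
    by positivity, fun x R hR => ?_⟩
  have hpt : ∀ᵐ k ∂(dualMeasure d), ‖‖cubeKernel x R k‖ * (sqNorm k ^ 2)⁻¹‖
      ≤ Real.pi ^ κ * R ^ (-κ) * ∏ i, |k i| ^ (-((4 + κ) / d)) := by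
    filter_upwards [ae_mem_dualCube d, ae_forall_ne_zero (d := d)] with k hk hk0
    rw [Real.norm_of_nonneg (by positivity)]
    have h1 := norm_cubeKernel_le (by omega) x hR hκ (by linarith) hk hk0
    have h2 := inv_sqNorm_sq_le_prod (by omega) hk0
    calc _ ≤ (Real.pi ^ κ * R ^ (-κ) * ∏ i, |k i| ^ (-(κ / d))) * ∏ i, |k i| ^ (-(4 / d : ℝ)) :=
          mul_le_mul h1 h2 (by positivity)
            (mul_nonneg (by positivity) (Finset.prod_nonneg fun i _ => by positivity))
      _ = _ := by
          rw [mul_assoc, ← Finset.prod_mul_distrib]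
          congr 1
          refine Finset.prod_congr rfl fun i _ => ?_
          rw [← Real.rpow_add (abs_pos.2 (hk0 i))]
          congr 1; ring
  have hint := Integrable.mono' (hi.const_mul (Real.pi ^ κ * R ^ (-κ))) (by
    have h1 : AEStronglyMeasurable (fun k => ‖cubeKernel x R k‖) (dualMeasure d) :=
      (continuous_cubeKernel x R).norm.aestronglyMeasurable
    have h2 : Measurable fun k : Fin d → ℝ => (sqNorm k ^ 2)⁻¹ := by
      unfold sqNorm; fun_prop
    exact h1.mul h2.aestronglyMeasurable) hpt
  refine ⟨hint, ?_⟩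
  calc _ ≤ ∫ k : Fin d → ℝ, Real.pi ^ κ * R ^ (-κ) * ∏ i, |k i| ^ (-((4 + κ) / d))
          ∂(dualMeasure d) := by
        refine integral_mono_ae hint (hi.const_mul _) ?_
        filter_upwards [hpt] with k hk using (le_abs_self _).trans hk
    _ = _ := by rw [integral_const_mul]; ring

theorem integrable_exp_mul {h : (Fin d → ℝ) → ℂ} (hh : Integrable h (dualMeasure d))
    (y : Fin d → ℤ) :
    Integrable (fun k => Complex.exp (-(Complex.I * (dot k y : ℂ))) * h k) (dualMeasure d) := by
  refine hh.mono ?_ (ae_of_all _ fun k => ?_)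
  · have := continuous_dot (d := d) y
    exact AEStronglyMeasurable.mul (Continuous.aestronglyMeasurable (by fun_prop)) hh.1
  · rw [norm_mul, norm_exp_neg_I_mul_real, one_mul]

theorem average_integral_eq {h : (Fin d → ℝ) → ℂ} (hh : Integrable h (dualMeasure d))
    (x : Fin d → ℤ) (R : ℝ) :
    (((2 * R + 1) ^ d : ℝ) : ℂ)⁻¹ * ∑ y ∈ (latticeCube_finite x R).toFinset,
        ∫ k, Complex.exp (-(Complex.I * (dot k y : ℂ))) * h k ∂(dualMeasure d)
      = ∫ k, cubeKernel x R k * h k ∂(dualMeasure d) := by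
  rw [← integral_finsetSum _ fun y _ => integrable_exp_mul hh y, ← integral_const_mul]
  refine integral_congr_ae (ae_of_all _ fun k => ?_)
  simp only [cubeKernel]
  rw [← Finset.sum_mul]; ring

/-- The reason for averaging: the error |k|^{-4} n^{-d/2} alone integrates to the order of the main
term, but against the Dirichlet kernel it gains R^{-κ}. The other error scales like a Gaussian, so
there the bound 1 on the kernel suffices and n^{-δ} is gained. The part of the Gaussian outside the
dual cube is exponentially small. -/
theorem exists_cubeAverage_bound (hd : 4 < d) {δ κ A v σsq M c z : ℝ} (hδ : 0 ≤ δ) (hκ : 0 ≤ κ)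
    (hκ1 : κ < 1) (hA : 0 < A) (hv : 0 < v) (hσ : 0 < σsq) (hM : 0 < M) (hc : 0 < c)
    {f : ℕ → (Fin d → ℝ) → ℝ → ℝ}
    (hmeas : ∀ n, 1 ≤ n → AEMeasurable (fun k => f n k z) (volume.restrict (dualCube d)))
    (hf : ∀ n : ℕ, 1 ≤ n → ∀ k ∈ dualCube d,
      |f n k z - A * Real.exp (-(n * (v * (σsq / (2 * d))) * sqNorm k))|
        ≤ M * (n : ℝ) ^ (-δ) * Real.exp (-(c * n * sqNorm k))
          + M * (sqNorm k ^ 2)⁻¹ * (n : ℝ) ^ (-((d : ℝ) / 2))) :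
    ∃ C : ℝ, 0 ≤ C ∧ ∀ n : ℕ, 1 ≤ n → ∀ R : ℝ, 1 ≤ R → ∀ x : Fin d → ℤ,
      ‖cubeAverage f n z R x - (((2 * R + 1) ^ d : ℝ) : ℂ)⁻¹
          * ∑ y ∈ (latticeCube_finite x R).toFinset,
            ((gaussWeight d n A v σsq (toReal y) : ℝ) : ℂ)‖
        ≤ C * (n : ℝ) ^ (-((d : ℝ) / 2)) * ((n : ℝ) ^ (-δ) + R ^ (-κ)) := by
  have hpi := Real.pi_pos
  have hd0 : (0 : ℝ) < d := by exact_mod_cast (by omega : 0 < d)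
  obtain ⟨C₁, hC₁, hker⟩ := exists_integral_cubeKernel_bound hd hκ hκ1
  set lam := v * (σsq / (2 * d)) with hlam
  have hlam0 : 0 < lam := by positivity
  obtain ⟨C₂, hC₂, hexp⟩ := exists_exp_neg_le_rpow (c := lam / 2) (by positivity) δ
  set C₃ := Real.pi ^ ((d : ℝ) / 2) * c ^ (-(d : ℝ) / 2) with hC₃
  set C₄ := A * (Real.pi ^ ((d : ℝ) / 2) * (lam / 2) ^ (-(d : ℝ) / 2)) * C₂ with hC₄
  refine ⟨C₄ + M * C₃ + M * C₁, by positivity, fun n hn R hR x => ?_⟩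
  have hR0 : 0 ≤ R := by linarith
  have hn0 : (0 : ℝ) < n := by exact_mod_cast hn
  set N := (n : ℝ) ^ (-((d : ℝ) / 2)) with hN
  have hN' : (n : ℝ) ^ (-(d : ℝ) / 2) = N := by rw [hN, neg_div]
  set G : (Fin d → ℝ) → ℝ := fun k => A * Real.exp (-(n * lam * sqNorm k)) with hG
  have hnl : 0 < n * lam := by positivity
  have hGi : Integrable (fun k => (G k : ℂ)) (dualMeasure d) :=
    (integrable_dual_of_integrable ((integrable_exp_sqNorm hnl).const_mul A)).ofReal
  set r : (Fin d → ℝ) → ℂ := fun k => ((f n k z - G k : ℝ) : ℂ) with hr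
  have hcn : 0 < c * n := by positivity
  have hei := integrable_dual_of_integrable (integrable_exp_sqNorm (d := d) hcn)
  have hfm : AEMeasurable (fun k => f n k z) (dualMeasure d) :=
    (hmeas n hn).smul_measure _
  have hrm : AEStronglyMeasurable r (dualMeasure d) := by
    have h1 : AEStronglyMeasurable (fun k => (f n k z : ℂ) - (G k : ℂ)) (dualMeasure d) :=
      (Complex.measurable_ofReal.comp_aemeasurable hfm).aestronglyMeasurable.sub hGi.1
    refine h1.congr (ae_of_all _ fun k => ?_)
    simp [hr]
  have hrb : ∀ᵐ k ∂(dualMeasure d), ‖r k‖ ≤ M * (n : ℝ) ^ (-δ) * Real.exp (-(c * n * sqNorm k))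
      + M * N * (sqNorm k ^ 2)⁻¹ := by
    filter_upwards [ae_mem_dualCube d] with k hk
    rw [hr, Complex.norm_real, Real.norm_eq_abs]
    refine (hf n hn k hk).trans (le_of_eq ?_)
    ring
  have hinv : Integrable (fun k : Fin d → ℝ => (sqNorm k ^ 2)⁻¹) (dualMeasure d) := by
    refine Integrable.mono' (integrable_prod_abs_rpow (d := d) (by omega) (p := 4)
      (by exact_mod_cast hd)) ?_ ?_
    · have h2 : Measurable fun k : Fin d → ℝ => (sqNorm k ^ 2)⁻¹ := by
        unfold sqNorm; fun_prop
      exact h2.aestronglyMeasurable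
    · filter_upwards [ae_forall_ne_zero (d := d)] with k hk0
      rw [Real.norm_of_nonneg (by positivity)]
      exact inv_sqNorm_sq_le_prod (by omega) hk0
  have hri : Integrable r (dualMeasure d) :=
    Integrable.mono' ((hei.const_mul _).add (hinv.const_mul _)) hrm hrb
  have hpn : ∀ y, pn f n y z
      = ∫ k, Complex.exp (-(Complex.I * (dot k y : ℂ))) * (G k : ℂ) ∂(dualMeasure d)
        + ∫ k, Complex.exp (-(Complex.I * (dot k y : ℂ))) * r k ∂(dualMeasure d) := by
    intro y
    rw [← integral_add (integrable_exp_mul hGi y) (integrable_exp_mul hri y), pn]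
    refine integral_congr_ae (ae_of_all _ fun k => ?_)
    simp only [hr]
    push_cast
    ring
  have hgauss : ∀ y : Fin d → ℤ,
      ‖∫ k, Complex.exp (-(Complex.I * (dot k y : ℂ))) * (G k : ℂ) ∂(dualMeasure d)
        - ((gaussWeight d n A v σsq (toReal y) : ℝ) : ℂ)‖ ≤ C₄ * N * (n : ℝ) ^ (-δ) := by
    intro y
    have h1 := norm_integral_dual_gaussian_sub_le hnl y
    have h2 : ∫ k, Complex.exp (-(Complex.I * (dot k y : ℂ))) * (G k : ℂ) ∂(dualMeasure d)
        = (A : ℂ) * ∫ k, Complex.exp (-(Complex.I * (dot k y : ℂ)))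
          * ((Real.exp (-(n * lam * sqNorm k)) : ℝ) : ℂ) ∂(dualMeasure d) := by
      rw [← integral_const_mul]
      refine integral_congr_ae (ae_of_all _ fun k => ?_)
      simp only [hG]
      push_cast
      ring
    rw [gaussWeight_eq (by omega) hn hv hσ, h2, Complex.ofReal_mul, ← mul_sub, norm_mul,
      Complex.norm_real, Real.norm_of_nonneg hA.le]
    have h3 : (n * lam / 2) ^ (-(d : ℝ) / 2) = N * (lam / 2) ^ (-(d : ℝ) / 2) := by
      rw [mul_div_assoc, Real.mul_rpow hn0.le (by positivity), hN']
    have h4 : Real.exp (-(n * lam / 2)) ≤ C₂ * (n : ℝ) ^ (-δ) := by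
      have := hexp n hn0.le
      rw [show lam / 2 * (n : ℝ) = n * lam / 2 by ring] at this
      refine this.trans (mul_le_mul_of_nonneg_left ?_ hC₂.le)
      exact Real.rpow_le_rpow_of_nonpos hn0 (by linarith) (by linarith)
    rw [h3] at h1
    calc _ ≤ A * (Real.pi ^ ((d : ℝ) / 2) * (N * (lam / 2) ^ (-(d : ℝ) / 2))
          * Real.exp (-(n * lam / 2))) := by gcongr
      _ ≤ A * (Real.pi ^ ((d : ℝ) / 2) * (N * (lam / 2) ^ (-(d : ℝ) / 2))
          * (C₂ * (n : ℝ) ^ (-δ))) := by gcongr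
      _ = _ := by rw [hC₄]; ring
  have hrest : ‖∫ k, cubeKernel x R k * r k ∂(dualMeasure d)‖
      ≤ M * C₃ * N * (n : ℝ) ^ (-δ) + M * C₁ * N * R ^ (-κ) := by
    obtain ⟨hki, hkI⟩ := hker x R hR
    have h1 : ‖∫ k, cubeKernel x R k * r k ∂(dualMeasure d)‖
        ≤ ∫ k, (M * (n : ℝ) ^ (-δ) * Real.exp (-(c * n * sqNorm k))
          + M * N * (‖cubeKernel x R k‖ * (sqNorm k ^ 2)⁻¹)) ∂(dualMeasure d) := by
      refine norm_integral_le_of_norm_le ((hei.const_mul _).add (hki.const_mul _)) ?_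
      filter_upwards [hrb] with k hk
      rw [norm_mul]
      have h2 := norm_cubeKernel_le_one x hR0 k
      calc ‖cubeKernel x R k‖ * ‖r k‖ ≤ ‖cubeKernel x R k‖ * (M * (n : ℝ) ^ (-δ)
            * Real.exp (-(c * n * sqNorm k)) + M * N * (sqNorm k ^ 2)⁻¹) := by gcongr
        _ = ‖cubeKernel x R k‖ * (M * (n : ℝ) ^ (-δ) * Real.exp (-(c * n * sqNorm k)))
            + M * N * (‖cubeKernel x R k‖ * (sqNorm k ^ 2)⁻¹) := by ring
        _ ≤ _ := by
            refine add_le_add ?_ le_rfl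
            exact mul_le_of_le_one_left (by positivity) h2
    rw [integral_add (hei.const_mul _) (hki.const_mul _), integral_const_mul,
      integral_const_mul] at h1
    have h5 : ∫ k : Fin d → ℝ, Real.exp (-(c * n * sqNorm k)) ∂(dualMeasure d) ≤ C₃ * N := by
      refine (integral_dual_le_of_integrable (integrable_exp_sqNorm (d := d) hcn)
        fun k => (Real.exp_pos _).le).trans ?_
      rw [integral_exp_sqNorm hcn, Real.mul_rpow hc.le hn0.le, hN', ← mul_assoc (Real.pi ^ _), ← hC₃]
      refine mul_le_of_le_one_left (by positivity) ?_
      exact inv_le_one_of_one_le₀ (one_le_pow₀ (by linarith [Real.pi_gt_three]))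
    refine h1.trans ?_
    calc _ ≤ M * (n : ℝ) ^ (-δ) * (C₃ * N) + M * N * (C₁ * R ^ (-κ)) := by gcongr
      _ = _ := by ring
  have hsplit : cubeAverage f n z R x - (((2 * R + 1) ^ d : ℝ) : ℂ)⁻¹
          * ∑ y ∈ (latticeCube_finite x R).toFinset,
            ((gaussWeight d n A v σsq (toReal y) : ℝ) : ℂ)
      = (((2 * R + 1) ^ d : ℝ) : ℂ)⁻¹ * ∑ y ∈ (latticeCube_finite x R).toFinset,
          (∫ k, Complex.exp (-(Complex.I * (dot k y : ℂ))) * (G k : ℂ) ∂(dualMeasure d)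
            - ((gaussWeight d n A v σsq (toReal y) : ℝ) : ℂ))
        + ∫ k, cubeKernel x R k * r k ∂(dualMeasure d) := by
    rw [← average_integral_eq hri x R, cubeAverage, Finset.sum_sub_distrib,
      Finset.sum_congr rfl fun y _ => hpn y, Finset.sum_add_distrib]
    ring
  rw [hsplit]
  refine (norm_add_le _ _).trans ((add_le_add (norm_average_le x hR0 (by positivity) hgauss)
    hrest).trans ?_)
  have e1 : 0 ≤ C₄ := by positivity
  have e2 : 0 ≤ C₃ := by positivity
  have p1 : 0 ≤ (C₄ + M * C₃) * N * R ^ (-κ) := by positivity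
  have p2 : 0 ≤ M * C₁ * N * (n : ℝ) ^ (-δ) := by positivity
  linarith

end

/-! ### Regularity of the one-dimensional Gaussian -/

theorem hasDerivAt_gauss (b t : ℝ) :
    HasDerivAt (fun t => Real.exp (-(b * t ^ 2))) (-(2 * b * t) * Real.exp (-(b * t ^ 2))) t := by
  have h1 : HasDerivAt (fun t : ℝ => -(b * t ^ 2)) (-(2 * b * t)) t := by
    have := ((hasDerivAt_pow 2 t).const_mul b).neg
    refine this.congr_deriv ?_
    norm_num
    ring
  exact h1.exp.congr_deriv (by ring)

theorem hasDerivAt_deriv_gauss (b t : ℝ) :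
    HasDerivAt (fun t => -(2 * b * t) * Real.exp (-(b * t ^ 2)))
      ((4 * b * (b * t ^ 2) - 2 * b) * Real.exp (-(b * t ^ 2))) t := by
  have h1 : HasDerivAt (fun t : ℝ => -(2 * b * t)) (-(2 * b)) t := by
    exact ((hasDerivAt_id t).const_mul (2 * b)).neg.congr_deriv (by ring)
  exact (h1.mul (hasDerivAt_gauss b t)).congr_deriv (by ring)

theorem abs_gauss_sub_le {b : ℝ} (hb : 0 ≤ b) (s t : ℝ) :
    |Real.exp (-(b * s ^ 2)) - Real.exp (-(b * t ^ 2))| ≤ 2 * Real.sqrt b * |s - t| := by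
  refine convex_univ.norm_image_sub_le_of_norm_hasDerivWithin_le
    (f := fun t => Real.exp (-(b * t ^ 2)))
    (fun x _ => (hasDerivAt_gauss b x).hasDerivWithinAt) (fun x _ => ?_) (Set.mem_univ t)
    (Set.mem_univ s)
  set w := Real.sqrt b * |x| with hw
  have hw2 : b * x ^ 2 = w ^ 2 := by rw [hw, mul_pow, Real.sq_sqrt hb, sq_abs]
  have hw0 : 0 ≤ w := by positivity
  have h2 : w * Real.exp (-(w ^ 2)) ≤ 1 := by
    have h3 := Real.add_one_le_exp (w ^ 2)
    rw [Real.exp_neg, ← div_eq_mul_inv, div_le_one (Real.exp_pos _)]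
    nlinarith [sq_nonneg (w - 1)]
  rw [norm_mul, Real.norm_eq_abs, Real.norm_of_nonneg (Real.exp_pos _).le, abs_neg, abs_mul,
    abs_of_nonneg (by positivity : 0 ≤ 2 * b), hw2]
  have h3 : 2 * b * |x| = 2 * Real.sqrt b * w := by
    rw [hw]
    nth_rewrite 1 [← Real.mul_self_sqrt hb]
    ring
  rw [h3, mul_assoc]
  exact mul_le_of_le_one_right (by positivity) h2

theorem abs_deriv_gauss_sub_le {b : ℝ} (hb : 0 ≤ b) (s t : ℝ) :
    |-(2 * b * s) * Real.exp (-(b * s ^ 2)) - -(2 * b * t) * Real.exp (-(b * t ^ 2))|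
      ≤ 6 * b * |s - t| := by
  refine convex_univ.norm_image_sub_le_of_norm_hasDerivWithin_le
    (f := fun t => -(2 * b * t) * Real.exp (-(b * t ^ 2)))
    (fun x _ => (hasDerivAt_deriv_gauss b x).hasDerivWithinAt) (fun x _ => ?_) (Set.mem_univ t)
    (Set.mem_univ s)
  set w := b * x ^ 2 with hw
  have hw0 : 0 ≤ w := by positivity
  have h2 : w * Real.exp (-w) ≤ 1 := by
    have h3 := Real.add_one_le_exp w
    rw [Real.exp_neg, ← div_eq_mul_inv, div_le_one (Real.exp_pos _)]
    linarith
  have h3 : Real.exp (-w) ≤ 1 := Real.exp_le_one_iff.2 (by linarith)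
  have h4 := Real.exp_pos (-w)
  rw [Real.norm_eq_abs, sub_mul, mul_assoc (4 * b)]
  refine (abs_sub _ _).trans ?_
  rw [abs_of_nonneg (by positivity), abs_of_nonneg (by positivity)]
  nlinarith

theorem abs_gauss_second_difference_le {b : ℝ} (hb : 0 ≤ b) (p h : ℝ) :
    |Real.exp (-(b * (p + h) ^ 2)) + Real.exp (-(b * (p - h) ^ 2))
      - 2 * Real.exp (-(b * p ^ 2))| ≤ 12 * b * h ^ 2 := by
  have key := (convex_Icc (-|h|) |h|).norm_image_sub_le_of_norm_hasDerivWithin_le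
    (f := fun u => Real.exp (-(b * (p + u) ^ 2)) + Real.exp (-(b * (p - u) ^ 2)))
    (f' := fun u => -(2 * b * (p + u)) * Real.exp (-(b * (p + u) ^ 2))
      - -(2 * b * (p - u)) * Real.exp (-(b * (p - u) ^ 2))) (C := 12 * b * |h|) (x := 0) (y := h)
    (fun u _ => ?_) (fun u hu => ?_) ⟨by simp, by simp⟩ ⟨neg_abs_le h, le_abs_self h⟩
  · simp only [add_zero, sub_zero, Real.norm_eq_abs, ← two_mul] at key
    refine key.trans (le_of_eq ?_)
    rw [mul_assoc, abs_mul_abs_self, sq]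
  · have h1 : HasDerivAt (fun u : ℝ => p + u) 1 u := (hasDerivAt_id u).const_add p
    have h2 : HasDerivAt (fun u : ℝ => p - u) (-1) u := (hasDerivAt_id u).const_sub p
    have h3 := (hasDerivAt_gauss b (p + u)).comp u h1
    have h4 := (hasDerivAt_gauss b (p - u)).comp u h2
    exact ((h3.add h4).congr_deriv (by ring)).hasDerivWithinAt
  · rw [Real.norm_eq_abs]
    refine (abs_deriv_gauss_sub_le hb _ _).trans ?_
    rw [show p + u - (p - u) = 2 * u by ring, abs_mul, abs_two]
    have h5 : |u| ≤ |h| := abs_le.2 hu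
    nlinarith

/-- Averaging the sum with its reflection about y cancels the first-order variation and leaves
second differences of size bN². This is what makes the cube-averaging error R²/n rather than R/√n.
-/
theorem abs_sum_gauss_sub_le {b : ℝ} (hb : 0 ≤ b) (y : ℤ) (N : ℕ) :
    |∑ j ∈ Finset.Icc (y - N) (y + N), Real.exp (-(b * (j : ℝ) ^ 2))
      - (2 * N + 1) * Real.exp (-(b * (y : ℝ) ^ 2))| ≤ (2 * N + 1) * (6 * b * (N : ℝ) ^ 2) := by
  rw [sum_Icc_int_eq_sum_range y N fun j => Real.exp (-(b * (j : ℝ) ^ 2))]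
  set S := ∑ i ∈ Finset.range (2 * N + 1), Real.exp (-(b * ((y - N + i : ℤ) : ℝ) ^ 2)) with hS
  have hrefl : S = ∑ i ∈ Finset.range (2 * N + 1), Real.exp (-(b * ((y : ℝ) + (N - i)) ^ 2)) := by
    rw [hS, ← Finset.sum_range_reflect]
    refine Finset.sum_congr rfl fun i hi => ?_
    rw [Finset.mem_range] at hi
    have : ((y - N + (2 * N + 1 - 1 - i : ℕ) : ℤ) : ℝ) = (y : ℝ) + (N - i) := by
      rw [show 2 * N + 1 - 1 - i = 2 * N - i by omega]
      push_cast [Nat.cast_sub (by omega : i ≤ 2 * N)]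
      ring
    rw [this]
  have hself : S = ∑ i ∈ Finset.range (2 * N + 1), Real.exp (-(b * ((y : ℝ) - (N - i)) ^ 2)) := by
    refine Finset.sum_congr rfl fun i _ => ?_
    congr 4
    push_cast; ring
  have h2 : 2 * (S - (2 * N + 1) * Real.exp (-(b * (y : ℝ) ^ 2)))
      = ∑ i ∈ Finset.range (2 * N + 1), (Real.exp (-(b * ((y : ℝ) + (N - i)) ^ 2))
        + Real.exp (-(b * ((y : ℝ) - (N - i)) ^ 2)) - 2 * Real.exp (-(b * (y : ℝ) ^ 2))) := by
    rw [Finset.sum_sub_distrib, Finset.sum_add_distrib, ← hrefl, ← hself, Finset.sum_const,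
      Finset.card_range, nsmul_eq_mul]
    push_cast
    ring
  have h3 : |2 * (S - (2 * N + 1) * Real.exp (-(b * (y : ℝ) ^ 2)))|
      ≤ (2 * N + 1) * (12 * b * (N : ℝ) ^ 2) := by
    rw [h2]
    refine (Finset.abs_sum_le_sum_abs _ _).trans ?_
    refine (Finset.sum_le_card_nsmul _ _ (12 * b * (N : ℝ) ^ 2) fun i hi => ?_).trans
      (le_of_eq ?_)
    · refine (abs_gauss_second_difference_le hb _ _).trans ?_
      have h4 : |(N : ℝ) - i| ≤ N := by
        rw [Finset.mem_range] at hi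
        have : (i : ℝ) ≤ 2 * N := by exact_mod_cast (by omega : i ≤ 2 * N)
        exact abs_le.2 ⟨by linarith, by linarith [(Nat.cast_nonneg i : (0 : ℝ) ≤ i)]⟩
      have h5 : ((N : ℝ) - i) ^ 2 ≤ (N : ℝ) ^ 2 := by
        rw [← sq_abs]; exact pow_le_pow_left₀ (abs_nonneg _) h4 2
      gcongr
    · rw [Finset.card_range, nsmul_eq_mul]; push_cast; ring
  rw [abs_mul, abs_two] at h3
  linarith

theorem abs_ratio_sub_one_le {R : ℝ} (hR : 1 ≤ R) :
    |(2 * (⌊R⌋₊ : ℝ) + 1) / (2 * R + 1) - 1| ≤ 1 / R := by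
  have h1 := Nat.floor_le (by linarith : 0 ≤ R)
  have h2 := Nat.lt_floor_add_one R
  have h3 : (2 * (⌊R⌋₊ : ℝ) + 1) / (2 * R + 1) - 1 = -(2 * (R - ⌊R⌋₊) / (2 * R + 1)) := by
    field_simp; ring
  rw [h3, abs_neg, abs_of_nonneg (div_nonneg (by linarith) (by linarith)),
    div_le_div_iff₀ (by linarith) (by linarith)]
  nlinarith

theorem abs_average_gauss_sub_le {b R X : ℝ} (hb : 0 ≤ b) (hR : 1 ≤ R) (y : ℤ) :
    |(∑ j ∈ Finset.Icc (y - (⌊R⌋₊ : ℤ)) (y + ⌊R⌋₊), Real.exp (-(b * (j : ℝ) ^ 2))) / (2 * R + 1)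
      - Real.exp (-(b * X ^ 2))| ≤ 6 * b * R ^ 2 + 1 / R + 2 * Real.sqrt b * |X - y| := by
  set N := ⌊R⌋₊ with hN
  have hN0 : (0 : ℝ) ≤ N := Nat.cast_nonneg _
  have hNR : (N : ℝ) ≤ R := Nat.floor_le (by linarith)
  have h1 := abs_sum_gauss_sub_le hb y N
  have h2 := abs_gauss_sub_le hb (y : ℝ) X
  have h3 := abs_ratio_sub_one_le hR
  set S := ∑ j ∈ Finset.Icc (y - (N : ℤ)) (y + N), Real.exp (-(b * (j : ℝ) ^ 2)) with hS
  set E := Real.exp (-(b * (y : ℝ) ^ 2)) with hE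
  have hE1 : E ≤ 1 := Real.exp_le_one_iff.2 (by have := mul_nonneg hb (sq_nonneg (y : ℝ)); linarith)
  have hE0 : 0 < E := Real.exp_pos _
  have hR1 : 0 < 2 * R + 1 := by linarith
  have h4 : |(S - (2 * N + 1) * E) / (2 * R + 1)| ≤ 6 * b * R ^ 2 := by
    rw [abs_div, abs_of_pos hR1, div_le_iff₀ hR1]
    refine h1.trans ?_
    calc (2 * (N : ℝ) + 1) * (6 * b * (N : ℝ) ^ 2) ≤ (2 * R + 1) * (6 * b * R ^ 2) := by gcongr
      _ = _ := by ring
  have h5 : |((2 * (N : ℝ) + 1) / (2 * R + 1) - 1) * E| ≤ 1 / R := by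
    rw [abs_mul, abs_of_pos hE0]
    exact (mul_le_of_le_one_right (abs_nonneg _) hE1).trans h3
  have h6 : S / (2 * R + 1) - Real.exp (-(b * X ^ 2))
      = (S - (2 * N + 1) * E) / (2 * R + 1) + ((2 * (N : ℝ) + 1) / (2 * R + 1) - 1) * E
        + (E - Real.exp (-(b * X ^ 2))) := by
    field_simp
    ring
  rw [h6, abs_sub_comm X]
  exact (abs_add_le _ _).trans (add_le_add ((abs_add_le _ _).trans (add_le_add h4 h5)) h2)

theorem abs_prod_sub_prod_le {ι : Type*} (s : Finset ι) {a b : ι → ℝ} (ha0 : ∀ i, 0 ≤ a i)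
    (ha1 : ∀ i, a i ≤ 1) (hb0 : ∀ i, 0 ≤ b i) (hb1 : ∀ i, b i ≤ 1) :
    |∏ i ∈ s, a i - ∏ i ∈ s, b i| ≤ ∑ i ∈ s, |a i - b i| := by
  classical
  induction s using Finset.induction_on with
  | empty => simp
  | insert i s hi ih =>
    rw [Finset.prod_insert hi, Finset.prod_insert hi, Finset.sum_insert hi,
      show a i * ∏ j ∈ s, a j - b i * ∏ j ∈ s, b j
        = (a i - b i) * ∏ j ∈ s, a j + b i * (∏ j ∈ s, a j - ∏ j ∈ s, b j) by ring]
    refine (abs_add_le _ _).trans (add_le_add ?_ ?_)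
    · rw [abs_mul, abs_of_nonneg (Finset.prod_nonneg fun j _ => ha0 j)]
      exact mul_le_of_le_one_right (abs_nonneg _)
        (Finset.prod_le_one (fun j _ => ha0 j) fun j _ => ha1 j)
    · rw [abs_mul, abs_of_nonneg (hb0 i)]
      exact (mul_le_of_le_one_left (abs_nonneg _) (hb1 i)).trans ih

/-! ### Averages of Gaussians over lattice cubes -/

section

variable {d : ℕ}

/-- Comparison with coordinatewise rounding; any bound independent of x is sufficient, so the
constant is crude. -/
theorem IsClosest.abs_sub_le {x : Fin d → ℝ} {y : Fin d → ℤ} (h : IsClosest x y) (i : Fin d) :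
    |x i - y i| ≤ d := by
  have hd1 : (1 : ℝ) ≤ d := by exact_mod_cast (by have := i.2; omega : 1 ≤ d)
  have h1 := h fun j => round (x j)
  have h2 : sqNorm (x - toReal fun j => round (x j)) ≤ d := by
    calc sqNorm (x - toReal fun j => round (x j)) ≤ ∑ _j : Fin d, (1 : ℝ) := by
          refine Finset.sum_le_sum fun j _ => ?_
          have h3 := abs_sub_round (x j)
          have h4 : |x j - round (x j)| ≤ 1 := by linarith
          calc ((x - toReal fun j => round (x j)) j) ^ 2 = |x j - round (x j)| ^ 2 := by
                rw [sq_abs]; rfl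
            _ ≤ 1 := pow_le_one₀ (abs_nonneg _) h4
      _ = d := by simp
  have h5 : (x i - y i) ^ 2 ≤ sqNorm (x - toReal y) :=
    Finset.single_le_sum (f := fun j => (x - toReal y) j ^ 2) (fun j _ => sq_nonneg _)
      (Finset.mem_univ i)
  refine abs_le_of_sq_le_sq ?_ (by linarith)
  nlinarith

theorem sum_gauss_eq_prod (y : Fin d → ℤ) {R : ℝ} (hR : 0 ≤ R) (b : ℝ) :
    ∑ w ∈ (latticeCube_finite y R).toFinset, Real.exp (-(b * sqNorm (toReal w)))
      = ∏ i, ∑ j ∈ Finset.Icc (y i - (⌊R⌋₊ : ℤ)) (y i + ⌊R⌋₊), Real.exp (-(b * (j : ℝ) ^ 2)) := by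
  rw [latticeCube_toFinset y hR, Finset.prod_univ_sum]
  refine Finset.sum_congr rfl fun w _ => ?_
  rw [exp_sqNorm_eq_prod]
  refine Finset.prod_congr rfl fun i _ => ?_
  rw [neg_mul]; rfl

theorem sum_exp_gauss_le (y : ℤ) {R b : ℝ} (hR : 0 ≤ R) (hb : 0 ≤ b) :
    (∑ j ∈ Finset.Icc (y - (⌊R⌋₊ : ℤ)) (y + ⌊R⌋₊), Real.exp (-(b * (j : ℝ) ^ 2))) / (2 * R + 1)
      ≤ 1 := by
  rw [div_le_one (by linarith)]
  refine (Finset.sum_le_card_nsmul _ _ 1 fun j _ => ?_).trans ?_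
  · exact Real.exp_le_one_iff.2 (by have := mul_nonneg hb (sq_nonneg (j : ℝ)); linarith)
  · rw [Int.card_Icc, show (y + (⌊R⌋₊ : ℤ) + 1 - (y - ⌊R⌋₊)).toNat = 2 * ⌊R⌋₊ + 1 by omega,
      nsmul_eq_mul, mul_one]
    push_cast
    exact natFloor_bounds hR

/-- The average of a Gaussian over a lattice cube, with error of second order in the radius. -/
theorem abs_average_gaussian_sub_le {b R : ℝ} (hb : 0 ≤ b) (hR : 1 ≤ R) {X : Fin d → ℝ}
    {y : Fin d → ℤ} (hy : IsClosest X y) :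
    |((2 * R + 1) ^ d)⁻¹ * ∑ w ∈ (latticeCube_finite y R).toFinset,
        Real.exp (-(b * sqNorm (toReal w))) - Real.exp (-(b * sqNorm X))|
      ≤ d * (6 * b * R ^ 2 + 1 / R + 2 * Real.sqrt b * d) := by
  have hR0 : 0 ≤ R := by linarith
  rw [sum_gauss_eq_prod y hR0, exp_sqNorm_eq_prod]
  have h1 : ((2 * R + 1) ^ d)⁻¹ * ∏ i, ∑ j ∈ Finset.Icc (y i - (⌊R⌋₊ : ℤ)) (y i + ⌊R⌋₊),
        Real.exp (-(b * (j : ℝ) ^ 2))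
      = ∏ i, (∑ j ∈ Finset.Icc (y i - (⌊R⌋₊ : ℤ)) (y i + ⌊R⌋₊),
        Real.exp (-(b * (j : ℝ) ^ 2))) / (2 * R + 1) := by
    rw [Finset.prod_div_distrib, Finset.prod_const, Finset.card_univ, Fintype.card_fin,
      div_eq_inv_mul]
  rw [h1]
  refine (abs_prod_sub_prod_le _ (fun i => div_nonneg (Finset.sum_nonneg fun _ _ =>
    (Real.exp_pos _).le) (by linarith)) (fun i => sum_exp_gauss_le (y i) hR0 hb)
    (fun i => (Real.exp_pos _).le) fun i => Real.exp_le_one_iff.2 ?_).trans ?_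
  · have := mul_nonneg hb (sq_nonneg (X i)); linarith
  · refine (Finset.sum_le_card_nsmul _ _ (6 * b * R ^ 2 + 1 / R + 2 * Real.sqrt b * d)
      fun i _ => ?_).trans (le_of_eq ?_)
    · rw [neg_mul]
      refine (abs_average_gauss_sub_le hb hR (y i) (X := X i)).trans ?_
      gcongr
      exact hy.abs_sub_le i
    · rw [Finset.card_univ, Fintype.card_fin, nsmul_eq_mul]

end

/-! ### The local limit theorem for averages -/

section

variable {d : ℕ}

theorem abs_apply_le_sqrt_sqNorm (X : Fin d → ℝ) (i : Fin d) : |X i| ≤ Real.sqrt (sqNorm X) :=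
  Real.abs_le_sqrt (Finset.single_le_sum (f := fun i => X i ^ 2) (fun _ _ => sq_nonneg _)
    (Finset.mem_univ i))

/-- The average of a Gaussian over a lattice cube, with a relative error. -/
theorem abs_average_gaussian_sub_le_mul {b R : ℝ} (hb : 0 ≤ b) (hR : 1 ≤ R) {X : Fin d → ℝ}
    {y : Fin d → ℤ} (hy : IsClosest X y) {r : ℝ}
    (hr : r = b * (d * (2 * Real.sqrt (sqNorm X) * ((1 + d) * R) + ((1 + d) * R) ^ 2)))
    (hr1 : r ≤ 1) :
    |((2 * R + 1) ^ d)⁻¹ * ∑ w ∈ (latticeCube_finite y R).toFinset,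
        Real.exp (-(b * sqNorm (toReal w))) - Real.exp (-(b * sqNorm X))|
      ≤ Real.exp (-(b * sqNorm X)) * (2 * r + d * (1 / R)) := by
  have hR0 : 0 ≤ R := by linarith
  set E := Real.exp (-(b * sqNorm X)) with hE
  have hE0 : 0 < E := Real.exp_pos _
  set T := (latticeCube_finite y R).toFinset with hT
  have hr0 : 0 ≤ r := by rw [hr]; positivity
  have hterm : ∀ w ∈ T, |Real.exp (-(b * sqNorm (toReal w))) - E| ≤ E * (2 * r) := by
    intro w hw
    rw [hT, Set.Finite.mem_toFinset] at hw
    -- Distance from the centre of the cube plus the rounding error d, which is at most dR as R ≥ 1.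
    have hu : ∀ i, |(w i : ℝ) - X i| ≤ (1 + d) * R := by
      intro i
      have h1 : |(y i : ℝ) - w i| ≤ R := (norm_le_pi_norm (toReal y - toReal w) i).trans hw
      have h2 := hy.abs_sub_le i
      have h3 := abs_sub_le (w i : ℝ) (y i) (X i)
      rw [abs_sub_comm (w i : ℝ) (y i), abs_sub_comm (y i : ℝ) (X i)] at h3
      have hd0 : (0 : ℝ) ≤ d := Nat.cast_nonneg d
      nlinarith
    have h1 : |sqNorm (toReal w) - sqNorm X|
        ≤ d * (2 * Real.sqrt (sqNorm X) * ((1 + d) * R) + ((1 + d) * R) ^ 2) := by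
      rw [sqNorm, sqNorm, ← Finset.sum_sub_distrib, ← sqNorm]
      refine (Finset.abs_sum_le_sum_abs _ _).trans ?_
      refine (Finset.sum_le_card_nsmul _ _ (2 * Real.sqrt (sqNorm X) * ((1 + d) * R)
        + ((1 + d) * R) ^ 2) fun i _ => ?_).trans (le_of_eq ?_)
      · have h2 : toReal w i ^ 2 - X i ^ 2
            = 2 * X i * ((w i : ℝ) - X i) + ((w i : ℝ) - X i) ^ 2 := by
          simp only [toReal]; ring
        rw [h2]
        refine (abs_add_le _ _).trans ?_
        rw [abs_mul, abs_mul, abs_two, abs_pow]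
        have h3 := abs_apply_le_sqrt_sqNorm X i
        have h4 := hu i
        gcongr
      · rw [Finset.card_univ, Fintype.card_fin, nsmul_eq_mul]
    set θ := -(b * (sqNorm (toReal w) - sqNorm X)) with hθ
    have h2 : |θ| ≤ r := by
      rw [hθ, abs_neg, abs_mul, abs_of_nonneg hb, hr]
      gcongr
    have h3 : Real.exp (-(b * sqNorm (toReal w))) - E = E * (Real.exp θ - 1) := by
      rw [mul_sub, mul_one, hE, ← Real.exp_add, hθ]
      congr 2; ring
    rw [h3, abs_mul, abs_of_pos hE0]
    refine mul_le_mul_of_nonneg_left ?_ hE0.le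
    exact (Real.abs_exp_sub_one_le (h2.trans hr1)).trans (by gcongr)
  have hcard := card_latticeCube y hR0
  have hcard' := card_latticeCube_le y hR0
  rw [← hT] at hcard hcard'
  have hRd : 0 < (2 * R + 1) ^ d := by positivity
  set ρ := (2 * (⌊R⌋₊ : ℝ) + 1) / (2 * R + 1) with hρ
  have hρ1 : ρ ≤ 1 := (div_le_one (by positivity)).2 (natFloor_bounds hR0)
  have hρ0 : 0 ≤ ρ := by positivity
  have h1 : |((2 * R + 1) ^ d)⁻¹ * ∑ w ∈ T, (Real.exp (-(b * sqNorm (toReal w))) - E)|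
      ≤ E * (2 * r) := by
    rw [abs_mul, abs_of_pos (inv_pos.2 hRd), inv_mul_le_iff₀ hRd]
    refine (Finset.abs_sum_le_sum_abs _ _).trans ?_
    refine (Finset.sum_le_card_nsmul _ _ _ hterm).trans ?_
    rw [nsmul_eq_mul]
    gcongr
  have h2 : |ρ ^ d - 1| ≤ d * (1 / R) := by
    have h3 := abs_prod_sub_prod_le (Finset.univ : Finset (Fin d)) (a := fun _ => ρ)
      (b := fun _ => 1) (fun _ => hρ0) (fun _ => hρ1) (fun _ => zero_le_one) fun _ => le_rfl
    simp only [Finset.prod_const, Finset.sum_const, Finset.card_univ, Fintype.card_fin, one_pow,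
      nsmul_eq_mul] at h3
    refine h3.trans ?_
    gcongr
    exact abs_ratio_sub_one_le hR
  have h3 : ((2 * R + 1) ^ d)⁻¹ * ∑ w ∈ T, Real.exp (-(b * sqNorm (toReal w))) - E
      = ((2 * R + 1) ^ d)⁻¹ * ∑ w ∈ T, (Real.exp (-(b * sqNorm (toReal w))) - E)
        + E * (ρ ^ d - 1) := by
    rw [Finset.sum_sub_distrib, Finset.sum_const, nsmul_eq_mul, hcard, hρ, div_pow]
    field_simp
    ring
  rw [h3, mul_add]
  refine (abs_add_le _ _).trans (add_le_add h1 ?_)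
  rw [abs_mul, abs_of_pos hE0]
  gcongr

theorem prefactor_eq {n : ℕ} (hn : 1 ≤ n) {A v σsq : ℝ} (hv : 0 < v) (hσ : 0 < σsq) :
    prefactor d n A v σsq
      = A * ((d : ℝ) / (2 * Real.pi * v * σsq)) ^ ((d : ℝ) / 2) * (n : ℝ) ^ (-((d : ℝ) / 2)) := by
  have hpi := Real.pi_pos
  have hn0 : (0 : ℝ) < n := by exact_mod_cast hn
  rw [prefactor, Real.rpow_neg hn0.le, ← Real.inv_rpow hn0.le, mul_assoc A,
    ← Real.mul_rpow (by positivity) (by positivity)]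
  congr 2
  field_simp

theorem gaussian_exponent_eq {P : ℝ} (hP : 0 < P) (x : Fin d → ℝ) :
    Real.exp (-(d / (2 * P) * sqNorm (Real.sqrt P • x))) = Real.exp (-(d : ℝ) * sqNorm x / 2) := by
  rw [sqNorm_smul, Real.sq_sqrt hP.le]
  congr 1
  field_simp

theorem gaussWeight_average_eq (n : ℕ) (A v σsq R : ℝ) (y : Fin d → ℤ) :
    (((2 * R + 1) ^ d : ℝ) : ℂ)⁻¹ * ∑ w ∈ (latticeCube_finite y R).toFinset,
        ((gaussWeight d n A v σsq (toReal w) : ℝ) : ℂ)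
      = ((prefactor d n A v σsq * (((2 * R + 1) ^ d)⁻¹ * ∑ w ∈ (latticeCube_finite y R).toFinset,
        Real.exp (-(d / (2 * (v * σsq * n)) * sqNorm (toReal w)))) : ℝ) : ℂ) := by
  rw [← Complex.ofReal_sum, ← Complex.ofReal_inv, ← Complex.ofReal_mul]
  congr 1
  simp only [gaussWeight]
  rw [← Finset.mul_sum, mul_left_comm]
  congr 2
  refine Finset.sum_congr rfl fun w _ => ?_
  congr 2
  ring

/-- The error bound `‖avg - W‖ ≤ (Fourier error) + (Gaussian averaging error)`. -/
theorem norm_cubeAverage_sub_le {f : ℕ → (Fin d → ℝ) → ℝ → ℝ} {n : ℕ} {A v σsq z R W B S : ℝ}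
    {y : Fin d → ℤ} (hp : 0 ≤ prefactor d n A v σsq)
    (h1 : ‖cubeAverage f n z R y - (((2 * R + 1) ^ d : ℝ) : ℂ)⁻¹
          * ∑ w ∈ (latticeCube_finite y R).toFinset,
            ((gaussWeight d n A v σsq (toReal w) : ℝ) : ℂ)‖ ≤ B)
    (h2 : |((2 * R + 1) ^ d)⁻¹ * ∑ w ∈ (latticeCube_finite y R).toFinset,
        Real.exp (-(d / (2 * (v * σsq * n)) * sqNorm (toReal w))) - W| ≤ S) :
    ‖cubeAverage f n z R y - ((prefactor d n A v σsq * W : ℝ) : ℂ)‖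
      ≤ B + prefactor d n A v σsq * S := by
  rw [gaussWeight_average_eq] at h1
  refine (norm_sub_le_norm_sub_add_norm_sub _ _ _).trans (add_le_add h1 ?_)
  rw [← Complex.ofReal_sub, Complex.norm_real, Real.norm_eq_abs, ← mul_sub, abs_mul,
    abs_of_nonneg hp]
  gcongr

variable {f : ℕ → (Fin d → ℝ) → ℝ → ℝ} {A v σsq z δ : ℝ}

theorem exists_error_bound (hd : 0 < d) (hA : 0 < A) (hv : 0 < v) (hσ : 0 < σsq) {κ C : ℝ}
    (hκ1 : κ < 1) (hC : 0 ≤ C)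
    (h : ∀ n : ℕ, 1 ≤ n → ∀ R : ℝ, 1 ≤ R → ∀ y : Fin d → ℤ,
      ‖cubeAverage f n z R y - (((2 * R + 1) ^ d : ℝ) : ℂ)⁻¹
          * ∑ w ∈ (latticeCube_finite y R).toFinset,
            ((gaussWeight d n A v σsq (toReal w) : ℝ) : ℂ)‖
        ≤ C * (n : ℝ) ^ (-((d : ℝ) / 2)) * ((n : ℝ) ^ (-δ) + R ^ (-κ))) :
    ∃ M : ℝ, 0 ≤ M ∧ ∀ n : ℕ, 1 ≤ n → ∀ R : ℝ, 1 ≤ R → ∀ x : Fin d → ℝ, ∀ y : Fin d → ℤ,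
      IsClosest (Real.sqrt (v * σsq * n) • x) y →
      ‖cubeAverage f n z R y
          - ((prefactor d n A v σsq * Real.exp (-(d : ℝ) * sqNorm x / 2) : ℝ) : ℂ)‖
        ≤ prefactor d n A v σsq * (M * (R ^ (-κ) + (n : ℝ) ^ (-δ) + R ^ 2 / n)) := by
  have hpi := Real.pi_pos
  have hd0 : (0 : ℝ) < d := by exact_mod_cast hd
  set p₀ := A * ((d : ℝ) / (2 * Real.pi * v * σsq)) ^ ((d : ℝ) / 2) with hp₀
  have hp₀0 : 0 < p₀ := by positivity
  set b₀ := (d : ℝ) / (2 * (v * σsq)) with hb₀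
  have hb₀0 : 0 < b₀ := by positivity
  refine ⟨C / p₀ + d * (6 * b₀ + 1 + 2 * Real.sqrt b₀ * d), by positivity, ?_⟩
  intro n hn R hR x y hy
  have hn0 : (0 : ℝ) < n := by exact_mod_cast hn
  have hR0 : 0 < R := by linarith
  have hP : 0 < v * σsq * n := by positivity
  have hpre := prefactor_eq (d := d) hn (A := A) hv hσ
  rw [← hp₀] at hpre
  have hpos : 0 < prefactor d n A v σsq := by rw [hpre]; positivity
  have h2 := abs_average_gaussian_sub_le (b := d / (2 * (v * σsq * n))) (by positivity) hR hy
  rw [gaussian_exponent_eq hP] at h2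
  refine (norm_cubeAverage_sub_le hpos.le (h n hn R hR y) h2).trans ?_
  have hb : (d : ℝ) / (2 * (v * σsq * n)) = b₀ / n := by rw [hb₀]; field_simp
  rw [hb]
  have hRκ : 1 / R ≤ R ^ (-κ) := by
    rw [one_div, ← Real.rpow_neg_one]
    exact Real.rpow_le_rpow_of_exponent_le hR (by linarith)
  have hRκ0 : 0 < R ^ (-κ) := by positivity
  -- The rounding error of order n^{-1/2} needs no term of its own: for R ≤ √n it is at most 1/R ≤
  -- R^{-κ}, and for R ≥ √n the term R²/n is at least 1.
  have hsqrt : Real.sqrt (b₀ / n) ≤ Real.sqrt b₀ * (R ^ (-κ) + R ^ 2 / n) := by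
    rw [Real.sqrt_div hb₀0.le, div_eq_mul_inv]
    refine mul_le_mul_of_nonneg_left ?_ (Real.sqrt_nonneg _)
    have hsn : 0 < Real.sqrt n := Real.sqrt_pos.2 hn0
    have h3 : 0 ≤ R ^ 2 / n := by positivity
    rcases le_total R (Real.sqrt n) with h4 | h4
    · have : (Real.sqrt n)⁻¹ ≤ 1 / R := by
        rw [one_div]; exact inv_anti₀ hR0 h4
      linarith
    · have h5 : 1 ≤ R ^ 2 / n := by
        rw [le_div_iff₀ hn0, one_mul]
        calc (n : ℝ) = Real.sqrt n ^ 2 := (Real.sq_sqrt hn0.le).symm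
          _ ≤ R ^ 2 := by gcongr
      have h6 : (Real.sqrt n)⁻¹ ≤ 1 := inv_le_one_of_one_le₀
        (Real.one_le_sqrt.2 (by exact_mod_cast hn))
      linarith
  have hCn : C * (n : ℝ) ^ (-((d : ℝ) / 2)) = prefactor d n A v σsq * (C / p₀) := by
    rw [hpre]; field_simp
  rw [hCn, mul_assoc, ← mul_add]
  refine mul_le_mul_of_nonneg_left ?_ hpos.le
  set a₁ := R ^ (-κ)
  set a₂ := (n : ℝ) ^ (-δ)
  have ha₂ : 0 ≤ a₂ := by positivity
  have ha₃ : 0 ≤ R ^ 2 / n := by positivity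
  have hCp : 0 ≤ C / p₀ := by positivity
  have hs0 : 0 ≤ Real.sqrt b₀ := Real.sqrt_nonneg _
  calc C / p₀ * (a₂ + a₁) + d * (6 * (b₀ / n) * R ^ 2 + 1 / R + 2 * Real.sqrt (b₀ / n) * d)
      ≤ C / p₀ * (a₁ + a₂ + R ^ 2 / n) + d * (6 * b₀ * (a₁ + a₂ + R ^ 2 / n)
        + (a₁ + a₂ + R ^ 2 / n) + 2 * (Real.sqrt b₀ * (a₁ + a₂ + R ^ 2 / n)) * d) := by
        have e1 : a₂ + a₁ ≤ a₁ + a₂ + R ^ 2 / n := by linarith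
        have e2 : 6 * (b₀ / n) * R ^ 2 ≤ 6 * b₀ * (a₁ + a₂ + R ^ 2 / n) := by
          rw [show 6 * (b₀ / n) * R ^ 2 = 6 * b₀ * (R ^ 2 / n) by ring]
          gcongr; linarith
        have e3 : 1 / R ≤ a₁ + a₂ + R ^ 2 / n := by linarith
        have e4 : Real.sqrt (b₀ / n) ≤ Real.sqrt b₀ * (a₁ + a₂ + R ^ 2 / n) := by
          refine hsqrt.trans (mul_le_mul_of_nonneg_left ?_ hs0)
          linarith
        gcongr
    _ = _ := by ring

/-- A ratio requires errors relative to the factor e^{-dx²/2}. With μ = min(1/4, δ), the logarithmic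
condition on x makes this factor at least R^{-μ}, while n^{-δ} + R^{-1/2} ≤ 2R^{-2μ} once R ≤ √n;
the quotient is O(R^{-μ}). The lattice average of the Gaussian is handled by a bound that is already
relative. -/
theorem tendsto_cubeAverage_div (hd : 0 < d) (hA : 0 < A) (hv : 0 < v) (hσ : 0 < σsq)
    (hδ : 0 < δ) {C : ℝ} (hC : 0 ≤ C)
    (h : ∀ n : ℕ, 1 ≤ n → ∀ R : ℝ, 1 ≤ R → ∀ y : Fin d → ℤ,
      ‖cubeAverage f n z R y - (((2 * R + 1) ^ d : ℝ) : ℂ)⁻¹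
          * ∑ w ∈ (latticeCube_finite y R).toFinset,
            ((gaussWeight d n A v σsq (toReal w) : ℝ) : ℂ)‖
        ≤ C * (n : ℝ) ^ (-((d : ℝ) / 2)) * ((n : ℝ) ^ (-δ) + R ^ (-(1 / 2) : ℝ)))
    {R : ℕ → ℝ} (hR : Tendsto R atTop atTop) (hRo : R =o[atTop] fun n : ℕ => Real.sqrt n)
    {x : ℕ → Fin d → ℝ}
    (hx : ∀ᶠ n in atTop, sqNorm (x n) ≤ 2 * min (1 / 4) δ / d * Real.log (R n))
    (hxo : (fun n => R n * Real.sqrt (sqNorm (x n))) =o[atTop] fun n : ℕ => Real.sqrt n)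
    {y : ℕ → Fin d → ℤ} (hy : ∀ n : ℕ, IsClosest (Real.sqrt (v * σsq * n) • x n) (y n)) :
    Tendsto (fun n : ℕ => cubeAverage f n z (R n) (y n) /
        ((prefactor d n A v σsq * Real.exp (-(d : ℝ) * sqNorm (x n) / 2) : ℝ) : ℂ))
      atTop (𝓝 1) := by
  have hpi := Real.pi_pos
  have hd0 : (0 : ℝ) < d := by exact_mod_cast hd
  set μ := min (1 / 4) δ with hμ
  have hμ0 : 0 < μ := lt_min (by norm_num) hδ
  have hμ4 : μ ≤ 1 / 4 := min_le_left _ _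
  have hμδ : μ ≤ δ := min_le_right _ _
  set p₀ := A * ((d : ℝ) / (2 * Real.pi * v * σsq)) ^ ((d : ℝ) / 2) with hp₀
  have hp₀0 : 0 < p₀ := by positivity
  set S := Real.sqrt (v * σsq) with hS
  have hS0 : 0 < S := Real.sqrt_pos.2 (by positivity)
  have hS2 : S ^ 2 = v * σsq := Real.sq_sqrt (by positivity)
  set K₁ := (d : ℝ) ^ 2 * (1 + d) / S with hK₁
  set K₂ := (d : ℝ) ^ 2 * (1 + d) ^ 2 / (2 * S ^ 2) with hK₂
  set r : ℕ → ℝ := fun n => K₁ * (R n * Real.sqrt (sqNorm (x n)) / Real.sqrt n)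
    + K₂ * (R n / Real.sqrt n) ^ 2 with hr
  have hrlim : Tendsto r atTop (𝓝 0) := by
    have h1 := (hxo.tendsto_div_nhds_zero.const_mul K₁).add
      ((hRo.tendsto_div_nhds_zero.pow 2).const_mul K₂)
    simpa using h1
  have hRn : Tendsto (fun n => 1 / R n) atTop (𝓝 0) := by
    exact (tendsto_inv_atTop_zero.comp hR).congr fun n => (one_div _).symm
  have hRμ : Tendsto (fun n => R n ^ (-μ)) atTop (𝓝 0) :=
    (tendsto_rpow_neg_atTop hμ0).comp hR
  have hRle : ∀ᶠ n : ℕ in atTop, R n ≤ Real.sqrt n := by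
    filter_upwards [hRo.bound one_pos] with n hn
    rw [one_mul, Real.norm_eq_abs, Real.norm_of_nonneg (Real.sqrt_nonneg _)] at hn
    exact (le_abs_self _).trans hn
  rw [tendsto_iff_norm_sub_tendsto_zero]
  refine squeeze_zero' (g := fun n => 2 * (C / p₀) * R n ^ (-μ) + (2 * r n + d * (1 / R n)))
    (Eventually.of_forall fun _ => norm_nonneg _) ?_ ?_
  · filter_upwards [hRle, hR.eventually_ge_atTop 1, hx, eventually_ge_atTop 1,
      hrlim.eventually_le_const zero_lt_one] with n hRn1 hR1 hxn hn hrn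
    have hn0 : (0 : ℝ) < n := by exact_mod_cast hn
    have hR0 : 0 < R n := by linarith
    have hP : 0 < v * σsq * n := by positivity
    have hsn : 0 < Real.sqrt n := Real.sqrt_pos.2 hn0
    have hsn2 : Real.sqrt n ^ 2 = n := Real.sq_sqrt hn0.le
    have hpre := prefactor_eq (d := d) hn (A := A) hv hσ
    rw [← hp₀] at hpre
    have hpos : 0 < prefactor d n A v σsq := by rw [hpre]; positivity
    set E := Real.exp (-(d : ℝ) * sqNorm (x n) / 2) with hE
    have hE0 : 0 < E := Real.exp_pos _
    have hreq : r n = d / (2 * (v * σsq * n)) * (d * (2 * Real.sqrt (sqNorm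
        (Real.sqrt (v * σsq * n) • x n)) * ((1 + d) * R n) + ((1 + d) * R n) ^ 2)) := by
      rw [sqNorm_smul, Real.sqrt_mul (sq_nonneg _), Real.sqrt_sq (Real.sqrt_nonneg _),
        Real.sqrt_mul (by positivity), ← hS, hr, hK₁, hK₂, ← hS2]
      obtain ⟨q, hq⟩ : ∃ q, q = Real.sqrt n := ⟨_, rfl⟩
      have hnq : (n : ℝ) = q ^ 2 := by rw [hq, hsn2]
      have hq0 : 0 < q := by rw [hq]; exact hsn
      simp only [← hq]
      rw [hnq]
      field_simp
    have h2 := abs_average_gaussian_sub_le_mul (b := d / (2 * (v * σsq * n))) (by positivity) hR1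
      (hy n) hreq hrn
    rw [gaussian_exponent_eq hP] at h2
    have h3 := norm_cubeAverage_sub_le hpos.le (h n hn (R n) hR1 (y n)) h2
    rw [← hE] at h3
    have hW : 0 < prefactor d n A v σsq * E := by positivity
    have hWne : ((prefactor d n A v σsq * E : ℝ) : ℂ) ≠ 0 := by exact_mod_cast hW.ne'
    rw [div_sub_one hWne, norm_div, Complex.norm_real, Real.norm_of_nonneg hW.le,
      div_le_iff₀ hW]
    refine h3.trans ?_
    have hER : 1 ≤ E * R n ^ μ := by
      rw [hE, Real.rpow_def_of_pos hR0, ← Real.exp_add]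
      refine Real.one_le_exp ?_
      have : (d : ℝ) * sqNorm (x n) / 2 ≤ d * (2 * μ / d * Real.log (R n)) / 2 := by gcongr
      have h4 : (d : ℝ) * (2 * μ / d * Real.log (R n)) / 2 = Real.log (R n) * μ := by
        field_simp
      linarith
    have hnδ : (n : ℝ) ^ (-δ) ≤ R n ^ (-(2 * μ)) := by
      calc (n : ℝ) ^ (-δ) ≤ (R n ^ 2) ^ (-δ) := by
            refine Real.rpow_le_rpow_of_nonpos (by positivity) ?_ (by linarith)
            rw [← hsn2]; gcongr
        _ = R n ^ (-(2 * δ)) := by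
            rw [← Real.rpow_natCast, ← Real.rpow_mul hR0.le]; congr 1; push_cast; ring
        _ ≤ _ := Real.rpow_le_rpow_of_exponent_le hR1 (by linarith)
    have hRh : R n ^ (-(1 / 2) : ℝ) ≤ R n ^ (-(2 * μ)) :=
      Real.rpow_le_rpow_of_exponent_le hR1 (by linarith)
    have hsplit : R n ^ (-(2 * μ)) = R n ^ (-μ) * R n ^ (-μ) := by
      rw [← Real.rpow_add hR0]; congr 1; ring
    have hER' : R n ^ (-μ) ≤ E := by
      rw [Real.rpow_neg hR0.le, inv_le_iff_one_le_mul₀ (by positivity)]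
      exact hER
    have h5 : (n : ℝ) ^ (-δ) + R n ^ (-(1 / 2) : ℝ) ≤ 2 * (R n ^ (-μ) * E) := by
      have : R n ^ (-μ) * R n ^ (-μ) ≤ R n ^ (-μ) * E := by gcongr
      linarith
    have hCn : C * (n : ℝ) ^ (-((d : ℝ) / 2)) = prefactor d n A v σsq * (C / p₀) := by
      rw [hpre]; field_simp
    rw [hCn]
    calc _ ≤ prefactor d n A v σsq * (C / p₀) * (2 * (R n ^ (-μ) * E))
          + prefactor d n A v σsq * (E * (2 * r n + d * (1 / R n))) := by
          gcongr
      _ = _ := by ring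
  · have := (hRμ.const_mul (2 * (C / p₀))).add ((hrlim.const_mul 2).add (hRn.const_mul (d : ℝ)))
    simpa using this

end

end LaceLCLT

/-! ### The local central limit theorem and its error bound -/

open LaceLCLT in
theorem theorem1p3 (d : ℕ) (hd : 4 < d)
    -- the exponents in the error terms
    (δ γ ρ : ℝ) (hδ : 0 < δ) (hρ : 0 < ρ) (hρ' : 0 < ((d : ℝ) - 4) / 2 - ρ)
    (hργ : ((d : ℝ) - 4) / 2 - ρ < γ) (hγδ : γ + δ < min 1 (((d : ℝ) - 4) / 2))
    -- the constants in the assumptions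
    (ε C c₁ c₂ η α : ℝ) (hε : δ < ε) (hc₁ : 0 < c₁) (hc₂ : 0 < c₂) (hη : 0 < η)
    (hα : α ∈ Set.Ioo (0 : ℝ) 1) (Ce Cg L₁ : ℝ → ℝ) :
    ∃ L₀ : ℝ, 1 ≤ L₀ ∧ ∃ c : ℝ, 0 < c ∧ ∀ L : ℝ, L₀ ≤ L →
      ∀ (D : (Fin d → ℤ) → ℝ) (f g e : ℕ → (Fin d → ℝ) → ℝ → ℝ),
        Recursion d f g e → AssumptionS d f g e → AssumptionD d ε C c₁ c₂ η L D f e →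
        AssumptionE d α Ce L₁ L D f e → AssumptionG d ε α Cg L₁ L D f g →
        ∃ zc A v : ℝ, IsCritical D g e zc A v ∧
          -- the local central limit theorem
          (∀ R : ℕ → ℝ, Tendsto R atTop atTop →
            R =o[atTop] (fun n : ℕ => Real.sqrt n) →
            ∀ x : ℕ → Fin d → ℝ, (∀ᶠ n in atTop, sqNorm (x n) ≤ c * Real.log (R n)) →
            (fun n => R n * Real.sqrt (sqNorm (x n))) =o[atTop] (fun n : ℕ => Real.sqrt n) →
            ∀ y : ℕ → Fin d → ℤ,
              (∀ n : ℕ, IsClosest (Real.sqrt (v * sigmaSq D * n) • x n) (y n)) →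
              Tendsto (fun n : ℕ => cubeAverage f n zc (R n) (y n) /
                  ((prefactor d n A v (sigmaSq D) * Real.exp (-(d : ℝ) * sqNorm (x n) / 2) : ℝ) : ℂ))
                atTop (𝓝 1)) ∧
          -- the explicit error bound
          (∀ κ γ' : ℝ, 0 < κ → κ < 1 → κ < (d : ℝ) - 4 - 2 * ρ → 0 < γ' → γ' < γ →
            ∃ M : ℝ, ∀ n : ℕ, 1 ≤ n → ∀ R : ℝ, 1 ≤ R → ∀ x : Fin d → ℝ, ∀ y : Fin d → ℤ,
              IsClosest (Real.sqrt (v * sigmaSq D * n) • x) y →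
              ‖cubeAverage f n zc R y
                  - ((prefactor d n A v (sigmaSq D)
                      * Real.exp (-(d : ℝ) * sqNorm x / 2) : ℝ) : ℂ)‖
                ≤ prefactor d n A v (sigmaSq D) * (M * (R ^ (-κ) + (n : ℝ) ^ (-γ')
                    + (n : ℝ) ^ (-δ) + R ^ 2 / n))) := by
  have hd0 : (0 : ℝ) < d := by exact_mod_cast (by omega : 0 < d)
  have hmin1 := min_le_left (1 : ℝ) (((d : ℝ) - 4) / 2)
  have hmin2 := min_le_right (1 : ℝ) (((d : ℝ) - 4) / 2)
  have hδ1 : δ ≤ 1 := by linarith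
  have hτ : 2 + δ < (d : ℝ) / 2 := by linarith
  have hμ : 0 < min (1 / 4) δ := lt_min (by norm_num) hδ
  obtain ⟨L₀, hL₀, hmain⟩ := exists_critical_asymptotics (C := C) (c₂ := c₂) hd hδ hδ1 hτ hε.le
    hc₁ hη hα Ce Cg L₁
  -- This constant keeps e^{-dx²/2} at least R^{-min(1/4, δ)}, which still dominates the Fourier
  -- error.
  refine ⟨L₀, hL₀, 2 * min (1 / 4) δ / d, by positivity, ?_⟩
  intro L hL D f g e hr hS hD hE hG
  obtain ⟨zc, A, v, hcrit, hσ, M, c, hM, hc, hf⟩ := hmain L hL D f g e hr hS hD hE hG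
  have hmeas := fun n hn => hS.meas n hn zc hcrit.zc_pos
  refine ⟨zc, A, v, hcrit, ?_, ?_⟩
  · intro R hR hRo x hx hxo y hy
    -- κ = 1/2 is chosen as 2 · (1/4), twice the largest power of R that the Gaussian factor may
    -- lose.
    obtain ⟨B, hB, hbound⟩ := exists_cubeAverage_bound hd hδ.le (κ := 1 / 2) (by norm_num)
      (by norm_num) hcrit.A_pos hcrit.v_pos hσ hM hc hmeas hf
    exact tendsto_cubeAverage_div (by omega) hcrit.A_pos hcrit.v_pos hσ hδ hB hbound hR hRo hx
      hxo hy
  · intro κ γ' hκ hκ1 _ _ _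
    obtain ⟨B, hB, hbound⟩ := exists_cubeAverage_bound hd hδ.le hκ.le hκ1 hcrit.A_pos hcrit.v_pos
      hσ hM hc hmeas hf
    obtain ⟨M', hM', herr⟩ := exists_error_bound (by omega) hcrit.A_pos hcrit.v_pos hσ hκ1 hB
      hbound
    refine ⟨M', fun n hn R hR x y hy => (herr n hn R hR x y hy).trans ?_⟩
    have hpi := Real.pi_pos
    have hA := hcrit.A_pos
    have hv := hcrit.v_pos
    have hp : 0 ≤ prefactor d n A v (sigmaSq D) := by unfold prefactor; positivity
    -- The error obtained consists of R^{-κ}, n^{-δ} and R²/n; the term n^{-γ'} is a nonnegative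
    -- addition.
    have hγ : (0 : ℝ) ≤ (n : ℝ) ^ (-γ') := by positivity
    gcongr
    linarith
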